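/- **Setting.** Let $d\ge1$, $\gamma>0$, $T\in(0,\infty)$, and let $\Gamma\subset\mathbb R^d$ have non-zero perimeter (the perimeter of a Lebesgue measurable set is the total variation over $\mathbb R^d$ of its indicator function). Write $\partial_*E$ for the measure theoretic boundary of $E$ (the points where neither $E$ nor $\mathbb R^d\setminus E$ has density zero), $\mathcal H^{d-1}$ for the Hausdorff measure normalized to agree with surface area, and $a^\pm=\max(\pm a,0)$. *Paths and equilibria.* Let $\mathcal Y$ be the set of $1$-Lipschitz $y:[0,\infty)\to\mathbb R^d$ with $\theta:=\inf\{t\ge0:y_t\in\overline\Gamma\}<\infty$ and $y_t=y_\theta$ for $t\ge\theta$, with the metric $\|y-\hat y\|_\infty+|\theta-\hat\theta|$. Let $(\kappa,\mathbb Q,L)\in\mathcal E_T$ mean: $\kappa\in(0,\infty)$; $\mathbb Q$ is a Borel probability measure on $\mathcal Y\times[0,\infty)=\{(y,\beta)\}$; $L:\mathbb R^d\to\mathbb R\setminus\{0\}$ is upper semicontinuous and locally integrable; $\mathbb Q$ minimizes $\mathbb E^{\hat{\mathbb Q}}\big[\int_0^\theta L^+(y_t)\,dt\big]$ over all $\hat{\mathbb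 Q}$ with $\hat{\mathbb Q}\circ y_0^{-1}=\mathbb Q\circ y_0^{-1}$; $\mathbb Q$-a.s. $\int_0^\theta L^+(y_t)\,dt\le T$ and $\beta\le\theta$; $\mathbb Q$-a.s. on $\{\beta=\theta\}$, $y_\theta\in\partial_*\Gamma$; and for all $\phi\in C_c^\infty(\mathbb R^d)$, $$\kappa\,\mathbb E^{\mathbb Q}\Big[\int_0^\beta\phi(y_t)L^+(y_t)\,dt\Big]=\int_{\mathbb R^d}\phi\,(1+\gamma L)\,dx,\qquad \mathbb E^{\mathbb Q}\Big[\int_0^\beta\phi(y_t)L^-(y_t)\,dt\Big]=0,$$ the second expectation being absolutely convergent. For $t\ge0$ put $\iota(t):=\inf\{r\in[0,\theta]:\int_r^\theta L^+(y_z)\,dz<t\}$ (with $\inf\emptyset=\infty$), $\overline{\mathbb Q}_t(dx):=\mathbb E^{\mathbb Q}\big[\int_{\iota(t)}^{\beta\vee\iota(t)}\mathbf 1_{\{y_r\in dx\}}\,dr\big]$, $D_t:=\Gamma\cup\operatorname{supp}\overline{\mathbb Q}_t$ and $w^{\mathbb Q,L}(x):=\inf\{t\ge0:x\in D_t\}\in[0,\infty]$.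 For $u:\mathbb R^d\to\mathbb R$ the excess energy loss is the signed measure $$\mathbf e(dx):=\kappa\,\mathbb Q(y_0\in dx,\theta=0)+\mathbf 1_{\{w^{\mathbb Q,L}<\infty\}\setminus\overline\Gamma}(x)\big(\kappa\,\mathbb Q(y_0\in dx)-\kappa\,\mathbb Q(y_\beta\in dx)-(1+u(x))\,dx\big).$$ **Proposition 2.1.** Let $V_0,w:\mathbb R^d\to[0,\infty)$ and $u:\mathbb R^d\to\mathbb R$ be measurable. Assume: (i) $\{0<w<T\}$ is open, $w\in C^1(\{0<w<T\})\cap C(\overline{\{0<w<T\}})$, $\{w=0\}=\overline\Gamma$, $\int_{\{0<w<T\}}|u|\,dx<\infty$, $V_0$ is bounded, $\nabla w\neq0$ on $\{0<w<T\}$ with $1/|\nabla w|$ bounded there, and $|\nabla w|$ is bounded on every bounded subset of $\{0<w<T\}$. (ii) For every $t\in(0,T)$, $\Gamma$ and $\{w<t\}$ have finite perimeter, $\partial\Gamma=\partial_*\Gamma$ and $\partial\{w<t\}=\partial_*\{w<t\}$. Moreover $\operatorname{Leb}(\partial\{w<T\})=0$. (iii) For every $t\in(0,T)$ and every compactly supported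 Lipschitz function $\phi$ on $\overline{\{0<w<t\}}$, $$\int_{\{0<w<t\}}-\phi\,(u+1)+\nabla\phi\cdot\Big(\frac{\nabla w}{|\nabla w|^2}+\gamma\frac{\nabla w}{|\nabla w|}\Big)dx=\int_{\partial\{w<t\}}\phi\Big(\frac1{|\nabla w|}+\gamma\Big)d\mathcal H^{d-1}-\int_{\partial\Gamma}\phi\,(V_0+\gamma)\,d\mathcal H^{d-1},$$ the integral over $\partial\{w<t\}$ being taken over the part of this set in $\{0<w<T\}$, where $\nabla w$ is defined. (iv) For every $z\in\partial\Gamma\cup\{0<w<T\}$ there is a unique continuous curve $Y^z$ on $[0,\tau(T)]$, lying in $\{0<w<T\}$ at almost every time, with $Y^z_r=z+\int_0^r\frac{\nabla w}{|\nabla w|}(Y^z_s)\,ds$, where $\tau(t):=\inf\{r\ge0:w(Y^z_r)\ge t\}$ (and $0<\tau(T)<\infty$ is attained). Moreover, the map $\mathbf Y(t,z):=Y^z_{\tau(t)}$ is a continuous bijection from $[0,T)\times\partial\Gamma$ onto $\partial\Gamma\cup\{0<w<T\}$ whose inverse is locally Lipschitz. Then there exists $(\kappa,\mathbb Q,L)\in\mathcal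 E_T$ such that (1) $w=w^{\mathbb Q,L}$ on $\overline{\{w<T\}}$; (2) $1+u$ is integrable on $\{w^{\mathbb Q,L}<\infty\}\setminus\overline\Gamma$ (so that $\mathbf e$ is a finite signed measure), $\mathbf e\ge0$, and for every $t\in(0,T)$ the set $\{w^{\mathbb Q,L}\le t\}$ is Borel and $\mathbf e(\{w^{\mathbb Q,L}\le t\})=0$; (3) $\kappa\,\mathbb Q(y_\theta\in dx,\beta=\theta)=(V_0(x)+\gamma)\,\mathbf 1_{\partial\Gamma}(x)\,\mathcal H^{d-1}(dx)$. -/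

import Mathlib

open Set Filter Topology MeasureTheory
open scoped NNReal ENNReal ContDiff

noncomputable section

namespace Cascade

/-! ### Sets of finite perimeter -/

/-- The Euclidean space `ℝᵈ`. -/
abbrev Sp (d : ℕ) : Type := EuclideanSpace ℝ (Fin d)

/-- The divergence `∑ᵢ ∂ᵢ φᵢ` of a vector field. -/
def divergence {d : ℕ} (φ : Sp d → Sp d) (x : Sp d) : ℝ :=
  ∑ i : Fin d, fderiv ℝ φ x (EuclideanSpace.single i 1) i

/-- The perimeter of `E`, i.e. the total variation over `ℝᵈ` of its indicator function. -/
def perimeter {d : ℕ} (E : Set (Sp d)) : ℝ≥0∞ :=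
  ⨆ (φ : Sp d → Sp d)
    (_ : ContDiff ℝ 1 φ ∧ HasCompactSupport φ ∧ ∀ x, ‖φ x‖ ≤ 1),
    ENNReal.ofReal (∫ x in E, divergence φ x)

/-- A (Lebesgue measurable) set of finite perimeter in `ℝᵈ`. -/
def HasFinitePerimeter {d : ℕ} (E : Set (Sp d)) : Prop :=
  NullMeasurableSet E volume ∧ perimeter E < ⊤

/-- The measure theoretic boundary: neither `E` nor its complement has density zero at `x`. -/
def essBoundary {d : ℕ} (E : Set (Sp d)) : Set (Sp d) :=
  {x | 0 < limsup (fun r : ℝ =>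
          volume (Metric.closedBall x r ∩ E) / ENNReal.ofReal (r ^ d)) (𝓝[>] 0) ∧
       0 < limsup (fun r : ℝ =>
          volume (Metric.closedBall x r \ E) / ENNReal.ofReal (r ^ d)) (𝓝[>] 0)}

/-! ### The space of paths -/

/-- Paths `y : [0,∞) → ℝᵈ` of speed at most one which hit the closure of `Γ` in finite time and
stay forever at the point where they first hit it. -/
structure Path {d : ℕ} (Γ : Set (Sp d)) where
  /-- the position as a function of time -/
  toFun : ℝ≥0 → Sp d
  lipschitz : LipschitzWith 1 toFun
  hits : ∃ t, toFun t ∈ closure Γ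
  stopped : ∀ t, sInf {s | toFun s ∈ closure Γ} ≤ t →
    toFun t = toFun (sInf {s | toFun s ∈ closure Γ})

namespace Path

variable {d : ℕ} {Γ : Set (Sp d)}

/-- The hitting time `θ` of the closure of `Γ`. -/
def hit (y : Path Γ) : ℝ≥0 := sInf {s | y.toFun s ∈ closure Γ}

/-- The position `y_r` at a real time `r ≥ 0` (and `y_0` for negative `r`). -/
def pos (y : Path Γ) (r : ℝ) : Sp d := y.toFun r.toNNReal

theorem dist_toFun_le (y : Path Γ) (t : ℝ≥0) : dist (y.toFun t) (y.toFun 0) ≤ y.hit := by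
  have key : ∀ s : ℝ≥0, s ≤ y.hit → dist (y.toFun s) (y.toFun 0) ≤ y.hit := by
    intro s hs
    have h := y.lipschitz.dist_le_mul s 0
    have h2 : dist s (0 : ℝ≥0) = (s : ℝ) := by simp [NNReal.dist_eq]
    rw [h2] at h
    have h3 : (s : ℝ) ≤ y.hit := by exact_mod_cast hs
    simp only [NNReal.coe_one, one_mul] at h
    linarith
  rcases le_total t y.hit with h | h
  · exact key t h
  · have h2 : y.toFun t = y.toFun y.hit := y.stopped t h
    rw [h2]
    exact key _ le_rfl

theorem bddAbove_dist (y z : Path Γ) :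
    BddAbove (range fun t : ℝ≥0 => dist (y.toFun t) (z.toFun t)) := by
  refine ⟨y.hit + dist (y.toFun 0) (z.toFun 0) + z.hit, ?_⟩
  rintro _ ⟨t, rfl⟩
  have h1 := y.dist_toFun_le t
  have h2 := z.dist_toFun_le t
  rw [dist_comm] at h2
  have h3 := dist_triangle4 (y.toFun t) (y.toFun 0) (z.toFun 0) (z.toFun t)
  dsimp only
  linarith

/-- The metric `‖y - z‖_∞ + |θ(y) - θ(z)|`. -/
instance : MetricSpace (Path Γ) where
  dist y z := (⨆ t : ℝ≥0, dist (y.toFun t) (z.toFun t)) + dist y.hit z.hit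
  dist_self y := by simp
  dist_comm y z := by simp only [dist_comm]
  dist_triangle x y z := by
    have h1 : (⨆ t : ℝ≥0, dist (x.toFun t) (z.toFun t)) ≤
        (⨆ t : ℝ≥0, dist (x.toFun t) (y.toFun t)) + ⨆ t : ℝ≥0, dist (y.toFun t) (z.toFun t) := by
      refine ciSup_le fun t => (dist_triangle _ (y.toFun t) _).trans ?_
      exact add_le_add (le_ciSup (bddAbove_dist x y) t) (le_ciSup (bddAbove_dist y z) t)
    have h2 := dist_triangle x.hit y.hit z.hit
    linarith
  eq_of_dist_eq_zero := by
    intro y z h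
    have h0 : 0 ≤ ⨆ t : ℝ≥0, dist (y.toFun t) (z.toFun t) := Real.iSup_nonneg fun t => dist_nonneg
    have h1 : (⨆ t : ℝ≥0, dist (y.toFun t) (z.toFun t)) = 0 := by
      have h2 : 0 ≤ dist y.hit z.hit := dist_nonneg
      have h3 : (⨆ t : ℝ≥0, dist (y.toFun t) (z.toFun t)) + dist y.hit z.hit = 0 := h
      linarith
    have h4 : y.toFun = z.toFun := by
      funext t
      have h5 := le_ciSup (bddAbove_dist y z) t
      rw [h1] at h5
      exact dist_le_zero.mp h5
    cases y
    cases z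
    cases h4
    rfl

instance : MeasurableSpace (Path Γ) := borel _

instance : BorelSpace (Path Γ) := ⟨rfl⟩

end Path

/-! ### Equilibria -/

section Equilibrium

variable {d : ℕ} {Γ : Set (Sp d)}

/-- The remaining cost `∫_r^θ L⁺(y_z) dz` of a path. -/
def cost (L : Sp d → ℝ) (y : Path Γ) (r : ℝ≥0) : ℝ≥0∞ :=
  ∫⁻ z in Ioc (r : ℝ) y.hit, ENNReal.ofReal (L (y.pos z))⁺

/-- The law of the initial position `y_0`. -/
abbrev startLaw (Q : ProbabilityMeasure (Path Γ × ℝ≥0)) : Measure (Sp d) :=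
  (Q : Measure (Path Γ × ℝ≥0)).map fun p => p.1.toFun 0

/-- The law of the position `y_β` at the killing time. -/
abbrev killLaw (Q : ProbabilityMeasure (Path Γ × ℝ≥0)) : Measure (Sp d) :=
  (Q : Measure (Path Γ × ℝ≥0)).map fun p => p.1.toFun p.2

/-- `(κ, Q, L)` is an equilibrium capped at `T`, for the initial domain `Γ` and the surface
tension coefficient `γ`. -/
structure IsEquilibrium (Γ : Set (Sp d)) (γ T κ : ℝ)
    (Q : ProbabilityMeasure (Path Γ × ℝ≥0)) (L : Sp d → ℝ) : Prop where
  kappa_pos : 0 < κ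
  ne_zero : ∀ x, L x ≠ 0
  upperSemicontinuous : UpperSemicontinuous L
  /-- `Q` minimizes the expected cost among all laws with the same law of the initial position -/
  optimal : ∀ Q' : ProbabilityMeasure (Path Γ × ℝ≥0), startLaw Q' = startLaw Q →
    ∫⁻ p, cost L p.1 0 ∂(Q : Measure (Path Γ × ℝ≥0)) ≤
      ∫⁻ p, cost L p.1 0 ∂(Q' : Measure (Path Γ × ℝ≥0))
  capped : ∀ᵐ p ∂(Q : Measure (Path Γ × ℝ≥0)), cost L p.1 0 ≤ ENNReal.ofReal T ∧ p.2 ≤ p.1.hit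
  terminal : ∀ᵐ p ∂(Q : Measure (Path Γ × ℝ≥0)),
    p.2 = p.1.hit → p.1.toFun p.1.hit ∈ essBoundary Γ
  /-- the right-hand side of the fixed-point constraint is a convergent integral -/
  locallyIntegrable : LocallyIntegrable L volume
  fixedPoint : ∀ φ : Sp d → ℝ, ContDiff ℝ ∞ φ → HasCompactSupport φ →
    κ * ∫ p, (∫ r in (0 : ℝ)..p.2, φ (p.1.pos r) * (L (p.1.pos r))⁺)
        ∂(Q : Measure (Path Γ × ℝ≥0)) =
      ∫ x, φ x * (1 + γ * L x)
  /-- the expectation of `∫_0^β φ(y_r) L⁻(y_r) dr` converges absolutely and vanishes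
  for each test function `φ` -/
  negPart : ∀ φ : Sp d → ℝ, ContDiff ℝ ∞ φ → HasCompactSupport φ →
    ∫⁻ p, (∫⁻ r in Ioc (0 : ℝ) p.2, ENNReal.ofReal (|φ (p.1.pos r)| * (L (p.1.pos r))⁻))
      ∂(Q : Measure (Path Γ × ℝ≥0)) = 0

/-- `ι(L,t)`: the first time at which the remaining cost is below `t` (`∞` if there is none). -/
def levelTime (L : Sp d → ℝ) (t : ℝ≥0) (y : Path Γ) : ℝ≥0∞ :=
  ⨅ (r : ℝ≥0) (_ : r ≤ y.hit ∧ cost L y r < t), (r : ℝ≥0∞)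

/-- The expected occupation measure of the path on the time interval from `ι(L,t)` to
`max β ι(L,t)`. -/
def occupation (Q : ProbabilityMeasure (Path Γ × ℝ≥0)) (L : Sp d → ℝ) (t : ℝ≥0) :
    Measure (Sp d) :=
  (((Q : Measure (Path Γ × ℝ≥0)).prod (volume : Measure ℝ)).restrict
    {p | levelTime L t p.1.1 ≤ ENNReal.ofReal p.2 ∧ 0 ≤ p.2 ∧ p.2 ≤ p.1.2}).map
      fun p => p.1.1.pos p.2

/-- The cascade aggregate at time `t`. -/
def aggregate (Q : ProbabilityMeasure (Path Γ × ℝ≥0)) (L : Sp d → ℝ) (t : ℝ≥0) : Set (Sp d) :=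
  Γ ∪ (occupation Q L t).support

/-- The arrival time function of the cascade, with values in `[0,∞]`. -/
def arrivalTime (Q : ProbabilityMeasure (Path Γ × ℝ≥0)) (L : Sp d → ℝ) (x : Sp d) : ℝ≥0∞ :=
  ⨅ (t : ℝ≥0) (_ : x ∈ aggregate Q L t), (t : ℝ≥0∞)

/-- The set of points outside the closure of `Γ` which the cascade reaches in finite time. -/
def reached (Q : ProbabilityMeasure (Path Γ × ℝ≥0)) (L : Sp d → ℝ) : Set (Sp d) :=
  {x | arrivalTime Q L x < ⊤} \ closure Γ

/-- The excess energy loss, a finite signed measure as soon as `1 + u` is integrable over the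
reached set. -/
def excess (κ : ℝ) (Q : ProbabilityMeasure (Path Γ × ℝ≥0)) (L : Sp d → ℝ) (u : Sp d → ℝ) :
    SignedMeasure (Sp d) :=
  κ • (((Q : Measure (Path Γ × ℝ≥0)).restrict {p | p.1.hit = 0}).map
      fun p => p.1.toFun 0).toSignedMeasure
    + κ • ((startLaw Q).restrict (reached Q L)).toSignedMeasure
    - κ • ((killLaw Q).restrict (reached Q L)).toSignedMeasure
    - volume.withDensityᵥ ((reached Q L).indicator fun x => 1 + u x)

end Equilibrium

/-! ### Classical data: the cascade equation and its gradient flow -/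

section Flow

variable {d : ℕ}

/-- The open band `{0 < w < t}`. -/
def band (w : Sp d → ℝ) (t : ℝ) : Set (Sp d) := {x | 0 < w x ∧ w x < t}

/-- The direction field `∇w / |∇w|`. -/
def direction (w : Sp d → ℝ) (x : Sp d) : Sp d := ‖gradient w x‖⁻¹ • gradient w x

/-- The integrated form of the cascade equation in `{0 < w < T}` with boundary data `V₀`. The test
functions are the compactly supported Lipschitz functions on the closure of `{0 < w < t}`. -/
def IsWeakSolution (Γ : Set (Sp d)) (γ T : ℝ) (V₀ u w : Sp d → ℝ) : Prop :=
  ∀ t ∈ Ioo 0 T, ∀ φ : Sp d → ℝ,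
    (∃ C : ℝ≥0, LipschitzOnWith C φ (closure (band w t))) →
    (∃ K : Set (Sp d), IsCompact K ∧ ∀ x ∈ closure (band w t), x ∉ K → φ x = 0) →
    ∫ x in band w t,
        (-(φ x * (u x + 1)) +
          inner ℝ (gradient φ x)
            ((1 / ‖gradient w x‖ ^ 2) • gradient w x + (γ / ‖gradient w x‖) • gradient w x)) =
      ∫ x in frontier {x | w x < t} ∩ band w T, φ x * (1 / ‖gradient w x‖ + γ) ∂μHE[d - 1]
        - ∫ x in frontier Γ, φ x * (V₀ x + γ) ∂μHE[d - 1]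

/-- `Y` solves `dY = (∇w/|∇w|)(Y) dr` with `Y 0 = z` on `[0, σ)`, where `σ` is the first time at
which `w (Y r) ≥ T`. The equation is in integrated form; the right-hand side makes sense at almost
every time because `Y r` lies in `{0 < w < T}`. -/
structure IsAscentCurve (w : Sp d → ℝ) (T : ℝ) (z : Sp d) (Y : ℝ → Sp d) (σ : ℝ) : Prop where
  init : Y 0 = z
  pos : 0 < σ
  isLeast : IsLeast {r | 0 ≤ r ∧ T ≤ w (Y r)} σ
  continuousOn : ContinuousOn Y (Icc 0 σ)
  mem_band : ∀ᵐ r : ℝ, r ∈ Ioo 0 σ → Y r ∈ band w T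
  eqn : ∀ r ∈ Icc 0 σ, Y r = z + ∫ s in (0 : ℝ)..r, direction w (Y s)

/-- The first time `τ(t)` at which `w` is at least `t` along the curve `Y`. -/
def passage (w : Sp d → ℝ) (Y : ℝ → Sp d) (t : ℝ) : ℝ := sInf {r | 0 ≤ r ∧ t ≤ w (Y r)}

/-- From each point of `∂Γ ∪ {0 < w < T}` starts exactly one ascent curve, and the map which sends
`(t, z)`, `z ∈ ∂Γ`, to the point where the curve from `z` meets level `t` is continuous on
`[0, T) × ∂Γ`, with a locally Lipschitz inverse on `∂Γ ∪ {0 < w < T}`. -/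
def HasFlow (Γ : Set (Sp d)) (T : ℝ) (w : Sp d → ℝ) : Prop :=
  (∀ z ∈ frontier Γ ∪ band w T,
    (∃ Y σ, IsAscentCurve w T z Y σ) ∧
    ∀ Y Y' σ σ', IsAscentCurve w T z Y σ → IsAscentCurve w T z Y' σ' →
      σ = σ' ∧ EqOn Y Y' (Icc 0 σ)) ∧
  ∃ (F : ℝ × Sp d → Sp d) (G : Sp d → ℝ × Sp d),
    ContinuousOn F (Ico 0 T ×ˢ frontier Γ) ∧
    MapsTo F (Ico 0 T ×ˢ frontier Γ) (frontier Γ ∪ band w T) ∧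
    MapsTo G (frontier Γ ∪ band w T) (Ico 0 T ×ˢ frontier Γ) ∧
    InvOn G F (Ico 0 T ×ˢ frontier Γ) (frontier Γ ∪ band w T) ∧
    LocallyLipschitzOn (frontier Γ ∪ band w T) G ∧
    ∀ t ∈ Ico 0 T, ∀ z ∈ frontier Γ, ∀ Y σ, IsAscentCurve w T z Y σ →
      Y (passage w Y t) = F (t, z)

end Flow

end Cascade

end

/-! The mass of the equilibrium runs down the gradient flow of `w`. Put e = ∇w/|∇w|. By (iv) the
ascent curves of e issuing from ∂Γ fill the band {0 < w < T}, so a point of the band is described by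
its level and by its foot in ∂Γ. Every path of `Q` follows one of these curves backwards, towards
the foot. With the running cost L = |∇w| in the band, the cost of a descent along a curve is the
loss of level; the remaining cost of a path is therefore the level of its position. No competitor is
cheaper, because a path of speed at most one loses level at rate at most |∇w|. The occupation
measure after ι(t) is the part of the total occupation in {w < t}, so that levels are arrival times
as soon as the total occupation has a positive density in the band. The fixed-point constraint
prescribes this density: with L = -1/γ off the closed band it asks that κ times the occupation
measure be (1/|∇w| + γ) dx in the band.

The weak equation (iii) tells which starting and killing laws produce this density. It says that the
field (1/|∇w| + γ) e has divergence -(1 + u) in the band and flux density V₀ + γ through ∂Γ. Read in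
the direction of descent, 1 + u is the net mass put onto the flow lines. So mass starts with density
(1 + u)⁺, is killed with density (1 + u)⁻, and what arrives at ∂Γ has the law (V₀ + γ) dℋ. The
balance is closed by a measure N ≥ 0 of mass starting at level T. It is the excess energy loss,
which is thereby nonnegative and carried by {w = T}.

Starts and deaths have to be paired on each flow line so that death lies below birth. Let π be the
foot map. Testing (iii) with h ∘ π, h ≥ 0, kills the gradient term, because π is constant along the
flow, and leaves a nonnegative flux through {w = t}. Hence on every flow tube the mass started below
level t is at most the mass killed below t (`integral_comp_foot_le`). This is the stochastic order
under which the quantile coupling `exists_monotone_coupling` is ordered. Testing with (t - w) h ∘ π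
yields a second identity (`integral_comp_foot_mul_speed`), which determines how often each level is
crossed (`lintegral_levels`) and so the occupation density (`lintegral_occupation`).

Two facts from geometric measure theory support this. The surface of ∂Γ = ∂_*Γ has to be finite
(`hausdorffMeasure_essBoundary_lt_top`), so that the boundary flux is a finite measure and ∂Γ is
Lebesgue null. And the unreached set {w ≥ T} must not touch ∂Γ
(`disjoint_frontier_closure_unreached`): otherwise a path might pass from level T into Γ for free,
and min(w, T) would not be continuous. At a contact point Γ, the band and the unreached set meet.
Points where all three have positive upper density are ℋ^{d-1}-null
(`hausdorffMeasure_triple_essBoundary`). Where the band has density zero, (iii) forces the integral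
of |1 + u| over small balls to be of order r^{d-1}, which is again possible only on a null set. So
near a contact point the boundary of {w ≥ T} is null, hence of zero perimeter
(`exists_totalVar_le_hausdorffMeasure`), which contradicts the relative isoperimetric inequality.
All of this rests on mollification, Vitali coverings and a De Giorgi iteration; no rectifiability of
the reduced boundary is needed. -/

namespace Cascade

variable {d : ℕ}

/-! ### Divergence of compactly supported vector fields -/

/-- Admissible test fields for the total variation in `U`. -/
structure IsTestField (U : Set (Sp d)) (φ : Sp d → Sp d) : Prop where
  contDiff : ContDiff ℝ 1 φ
  compact : HasCompactSupport φ
  subset : tsupport φ ⊆ U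
  norm_le : ∀ x, ‖φ x‖ ≤ 1

lemma continuous_divergence {φ : Sp d → Sp d} (h : ContDiff ℝ 1 φ) :
    Continuous (divergence φ) := by
  unfold divergence
  have := h.continuous_fderiv one_ne_zero
  fun_prop

lemma divergence_eq_zero_of_notMem_tsupport {φ : Sp d → Sp d} {x : Sp d} (hx : x ∉ tsupport φ) :
    divergence φ x = 0 := by
  have h : φ =ᶠ[𝓝 x] fun _ => 0 := by
    filter_upwards [(isClosed_tsupport φ).isOpen_compl.mem_nhds hx] with y hy
    exact image_eq_zero_of_notMem_tsupport hy
  simp [divergence, h.fderiv_eq]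

lemma tsupport_divergence_subset (φ : Sp d → Sp d) : tsupport (divergence φ) ⊆ tsupport φ :=
  closure_minimal (fun x hx => by
    by_contra h
    exact hx (divergence_eq_zero_of_notMem_tsupport h)) (isClosed_tsupport φ)

lemma hasCompactSupport_divergence {φ : Sp d → Sp d} (h : HasCompactSupport φ) :
    HasCompactSupport (divergence φ) :=
  h.of_isClosed_subset (isClosed_tsupport _) (tsupport_divergence_subset φ)

lemma integrable_divergence {φ : Sp d → Sp d} (h : ContDiff ℝ 1 φ) (hc : HasCompactSupport φ) :
    Integrable (divergence φ) :=
  (continuous_divergence h).integrable_of_hasCompactSupport (hasCompactSupport_divergence hc)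

lemma sum_coord_smul (v : Sp d) : ∑ i, v i • EuclideanSpace.single i (1 : ℝ) = v := by
  ext j
  simp [Finset.sum_apply, Pi.single_apply]

lemma divergence_add {φ ψ : Sp d → Sp d} (h : ContDiff ℝ 1 φ) (h' : ContDiff ℝ 1 ψ) (x : Sp d) :
    divergence (fun y => φ y + ψ y) x = divergence φ x + divergence ψ x := by
  simp only [divergence]
  rw [fderiv_fun_add (h.differentiable one_ne_zero x) (h'.differentiable one_ne_zero x)]
  simp [Finset.sum_add_distrib]

lemma divergence_neg (φ : Sp d → Sp d) (x : Sp d) :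
    divergence (fun y => -φ y) x = -divergence φ x := by
  simp only [divergence]
  rw [fderiv_fun_neg]
  simp

lemma divergence_sum {ι : Type*} (s : Finset ι) {φ : ι → Sp d → Sp d}
    (h : ∀ i ∈ s, ContDiff ℝ 1 (φ i)) (x : Sp d) :
    divergence (fun y => ∑ i ∈ s, φ i y) x = ∑ i ∈ s, divergence (φ i) x := by
  simp only [divergence]
  rw [fderiv_fun_sum fun i hi => (h i hi).differentiable one_ne_zero x, Finset.sum_comm]
  simp

lemma divergence_smul {η : Sp d → ℝ} {φ : Sp d → Sp d} (h : ContDiff ℝ 1 η)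
    (h' : ContDiff ℝ 1 φ) (x : Sp d) :
    divergence (fun y => η y • φ y) x = η x * divergence φ x + fderiv ℝ η x (φ x) := by
  simp only [divergence]
  rw [fderiv_fun_smul (h.differentiable one_ne_zero x) (h'.differentiable one_ne_zero x)]
  conv_rhs => rw [← sum_coord_smul (φ x), map_sum]
  simp [Finset.sum_add_distrib, Finset.mul_sum, mul_comm]

lemma divergence_comp_add {φ : Sp d → Sp d} (a x : Sp d) :
    divergence (fun y => φ (y + a)) x = divergence φ (x + a) := by
  simp [divergence, fderiv_comp_add_right]

/-- Integration by parts. -/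
lemma integral_mul_divergence {g : Sp d → ℝ} {φ : Sp d → Sp d} (hg : ContDiff ℝ 1 g)
    (h : ContDiff ℝ 1 φ) (hc : HasCompactSupport φ) :
    ∫ x, g x * divergence φ x = -∫ x, fderiv ℝ g x (φ x) := by
  have hcomp : ∀ i : Fin d, ContDiff ℝ 1 fun x => φ x i := fun i => by fun_prop
  have hsupp : ∀ i : Fin d, HasCompactSupport fun x => φ x i := fun i =>
    hc.comp_left (g := fun v : Sp d => v i) (by simp)
  have hder : ∀ (i : Fin d) x, fderiv ℝ φ x (EuclideanSpace.single i 1) i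
      = fderiv ℝ (fun x => φ x i) x (EuclideanSpace.single i 1) := by
    intro i x
    have h1 := ((EuclideanSpace.proj (𝕜 := ℝ) i : Sp d →L[ℝ] ℝ).hasFDerivAt.comp x
      (h.differentiable one_ne_zero x).hasFDerivAt).fderiv
    have h2 : (⇑(EuclideanSpace.proj (𝕜 := ℝ) i : Sp d →L[ℝ] ℝ) ∘ φ) = fun x => φ x i := rfl
    rw [h2] at h1
    rw [h1]
    rfl
  have hgc := hg.continuous
  have hg' := hg.continuous_fderiv one_ne_zero
  have I1 : ∀ i : Fin d, Integrable fun x =>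
      g x * fderiv ℝ (fun x => φ x i) x (EuclideanSpace.single i 1) := by
    intro i
    have := (hcomp i).continuous_fderiv one_ne_zero
    refine Continuous.integrable_of_hasCompactSupport (by fun_prop) ?_
    exact HasCompactSupport.mul_left
      (((hsupp i).fderiv ℝ).comp_left (g := fun L : Sp d →L[ℝ] ℝ => L (EuclideanSpace.single i 1)) rfl)
  have I2 : ∀ i : Fin d, Integrable fun x =>
      fderiv ℝ g x (EuclideanSpace.single i 1) * φ x i := by
    intro i
    have := (hcomp i).continuous
    exact Continuous.integrable_of_hasCompactSupport (by fun_prop) (hsupp i).mul_left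
  have I3 : ∀ i : Fin d, Integrable fun x => g x * φ x i := by
    intro i
    have := (hcomp i).continuous
    exact Continuous.integrable_of_hasCompactSupport (by fun_prop) (hsupp i).mul_left
  calc ∫ x, g x * divergence φ x
      = ∫ x, ∑ i, g x * fderiv ℝ (fun x => φ x i) x (EuclideanSpace.single i 1) := by
        simp only [divergence, Finset.mul_sum, hder]
    _ = ∑ i, ∫ x, g x * fderiv ℝ (fun x => φ x i) x (EuclideanSpace.single i 1) :=
        integral_finsetSum _ fun i _ => I1 i
    _ = ∑ i, -∫ x, fderiv ℝ g x (EuclideanSpace.single i 1) * φ x i := by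
        refine Finset.sum_congr rfl fun i _ => ?_
        exact integral_mul_fderiv_eq_neg_fderiv_mul_of_integrable (I2 i) (I1 i) (I3 i)
          (fun x _ => hg.differentiable one_ne_zero x)
          (fun x _ => (hcomp i).differentiable one_ne_zero x)
    _ = -∫ x, ∑ i, fderiv ℝ g x (EuclideanSpace.single i 1) * φ x i := by
        rw [integral_finsetSum _ fun i _ => I2 i, Finset.sum_neg_distrib]
    _ = -∫ x, fderiv ℝ g x (φ x) := by
        congr 2
        funext x
        conv_rhs => rw [← sum_coord_smul (φ x), map_sum]
        simp [mul_comm]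

lemma integral_divergence_eq_zero {φ : Sp d → Sp d} (h : ContDiff ℝ 1 φ)
    (hc : HasCompactSupport φ) : ∫ x, divergence φ x = 0 := by
  have := integral_mul_divergence (g := fun _ => (1 : ℝ)) contDiff_const h hc
  simpa using this

/-! ### Total variation on open sets -/

/-- The total variation of `f` in `U`. -/
noncomputable def totalVar (f : Sp d → ℝ) (U : Set (Sp d)) : ℝ≥0∞ :=
  ⨆ (φ : Sp d → Sp d) (_ : IsTestField U φ), ENNReal.ofReal (∫ x, f x * divergence φ x)

lemma le_totalVar (f : Sp d → ℝ) {U : Set (Sp d)} {φ : Sp d → Sp d} (h : IsTestField U φ) :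
    ENNReal.ofReal (∫ x, f x * divergence φ x) ≤ totalVar f U :=
  le_iSup₂ (f := fun φ (_ : IsTestField U φ) => ENNReal.ofReal (∫ x, f x * divergence φ x)) φ h

lemma integral_le_totalVar (f : Sp d → ℝ) {U : Set (Sp d)} {φ : Sp d → Sp d}
    (h : IsTestField U φ) (hf : totalVar f U ≠ ⊤) :
    ∫ x, f x * divergence φ x ≤ (totalVar f U).toReal :=
  (ENNReal.ofReal_le_iff_le_toReal hf).mp (le_totalVar f h)

lemma IsTestField.mono {U V : Set (Sp d)} {φ : Sp d → Sp d} (h : IsTestField U φ) (hUV : U ⊆ V) :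
    IsTestField V φ := ⟨h.1, h.2, h.3.trans hUV, h.4⟩

lemma IsTestField.neg {U : Set (Sp d)} {φ : Sp d → Sp d} (h : IsTestField U φ) :
    IsTestField U fun x => -φ x where
  contDiff := h.contDiff.neg
  compact := h.compact.comp_left (g := fun v => -v) neg_zero
  subset := (closure_mono (fun x hx => by
    simpa [Function.mem_support] using hx)).trans h.subset
  norm_le x := by simpa using h.norm_le x

lemma isTestField_zero (U : Set (Sp d)) : IsTestField U fun _ => (0 : Sp d) :=
  ⟨contDiff_const, HasCompactSupport.zero, by simp [tsupport], by simp⟩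

lemma totalVar_mono (f : Sp d → ℝ) {U V : Set (Sp d)} (h : U ⊆ V) : totalVar f U ≤ totalVar f V :=
  iSup₂_le fun _ hφ => le_totalVar f (hφ.mono h)

lemma totalVar_neg (f : Sp d → ℝ) (U : Set (Sp d)) : totalVar (fun x => -f x) U = totalVar f U := by
  have key : ∀ f : Sp d → ℝ, totalVar (fun x => -f x) U ≤ totalVar f U := by
    intro f
    refine iSup₂_le fun φ hφ => ?_
    have h2 : ∀ x, -f x * divergence φ x = f x * divergence (fun x => -φ x) x := fun x => by
      rw [divergence_neg]; ring
    simp_rw [h2]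
    exact le_totalVar f hφ.neg
  refine le_antisymm (key f) ?_
  simpa using key fun x => -f x

/-- The class of functions for which the total variation is considered here. -/
structure IsBddMeas (f : Sp d → ℝ) : Prop where
  meas : AEStronglyMeasurable f volume
  bdd : ∃ C, ∀ x, |f x| ≤ C

lemma IsBddMeas.integrable_mul {f : Sp d → ℝ} (hf : IsBddMeas f) {g : Sp d → ℝ}
    (hg : Integrable g) : Integrable fun x => f x * g x := by
  obtain ⟨C, hC⟩ := hf.bdd
  exact hg.bdd_mul hf.meas (ae_of_all _ hC)

lemma IsBddMeas.locallyIntegrable {f : Sp d → ℝ} (hf : IsBddMeas f) :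
    LocallyIntegrable f volume := by
  obtain ⟨C, hC⟩ := hf.bdd
  exact (locallyIntegrable_const C).mono hf.meas (ae_of_all _ fun x =>
    (hC x).trans (le_abs_self C))

lemma isBddMeas_indicator {E : Set (Sp d)} (hE : NullMeasurableSet E volume) :
    IsBddMeas (E.indicator fun _ => (1 : ℝ)) where
  meas := (aestronglyMeasurable_const (b := (1:ℝ))).indicator₀ hE
  bdd := ⟨1, fun x => by by_cases h : x ∈ E <;> simp [h]⟩

lemma IsBddMeas.sub {f g : Sp d → ℝ} (hf : IsBddMeas f) (hg : IsBddMeas g) :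
    IsBddMeas fun x => f x - g x := by
  obtain ⟨C, hC⟩ := hf.bdd
  obtain ⟨D, hD⟩ := hg.bdd
  exact ⟨hf.meas.sub hg.meas, C + D, fun x => (abs_sub _ _).trans (add_le_add (hC x) (hD x))⟩

lemma totalVar_const_sub {f : Sp d → ℝ} (hf : IsBddMeas f) (c : ℝ) (U : Set (Sp d)) :
    totalVar (fun x => c - f x) U = totalVar f U := by
  rw [← totalVar_neg f]
  unfold totalVar
  refine iSup_congr fun φ => iSup_congr fun hφ => congrArg ENNReal.ofReal ?_
  have h1 := integrable_divergence hφ.contDiff hφ.compact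
  simp only [sub_mul, neg_mul]
  rw [integral_sub (h1.const_mul c) (hf.integrable_mul h1), integral_const_mul,
    integral_divergence_eq_zero hφ.contDiff hφ.compact, integral_neg]
  ring

lemma totalVar_congr {f g : Sp d → ℝ} {U : Set (Sp d)} (h : ∀ᵐ x, x ∈ U → f x = g x) :
    totalVar f U = totalVar g U := by
  unfold totalVar
  refine iSup_congr fun φ => iSup_congr fun hφ => congrArg ENNReal.ofReal (integral_congr_ae ?_)
  filter_upwards [h] with x hx
  by_cases hxU : x ∈ tsupport φ
  · rw [hx (hφ.subset hxU)]
  · rw [divergence_eq_zero_of_notMem_tsupport hxU]; simp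

/-- At each point at most one summand is nonzero, since the supports lie in disjoint sets; this
preserves the bound by one. -/
lemma IsTestField.sum {ι : Type*} {s : Finset ι} {U : ι → Set (Sp d)} {φ : ι → Sp d → Sp d}
    {V : Set (Sp d)} (h : ∀ i ∈ s, IsTestField (U i) (φ i))
    (hd : (s : Set ι).PairwiseDisjoint U) (hV : ∀ i ∈ s, U i ⊆ V) :
    IsTestField V fun x => ∑ i ∈ s, φ i x := by
  have hK : IsCompact (⋃ i ∈ s, tsupport (φ i)) :=
    s.finite_toSet.isCompact_biUnion fun i hi => (h i hi).compact
  have hz : ∀ x, (∑ i ∈ s, φ i x) ≠ 0 → x ∈ ⋃ i ∈ s, tsupport (φ i) := by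
    intro x hx
    obtain ⟨i, hi, hne⟩ := Finset.exists_ne_zero_of_sum_ne_zero hx
    exact mem_biUnion hi (subset_closure hne)
  have hsub : tsupport (fun x => ∑ i ∈ s, φ i x) ⊆ ⋃ i ∈ s, tsupport (φ i) :=
    closure_minimal hz hK.isClosed
  refine ⟨ContDiff.sum fun i hi => (h i hi).contDiff,
    hK.of_isClosed_subset (isClosed_tsupport _) hsub,
    hsub.trans (iUnion₂_subset fun i hi => (h i hi).subset.trans (hV i hi)), fun x => ?_⟩
  by_cases hx : ∃ i ∈ s, x ∈ U i
  · obtain ⟨i, hi, hxi⟩ := hx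
    rw [Finset.sum_eq_single_of_mem i hi]
    · exact (h i hi).norm_le x
    · intro j hj hji
      by_contra hne
      exact (hd hj hi hji).le_bot ⟨(h j hj).subset (subset_closure hne), hxi⟩
  · rw [Finset.sum_eq_zero]
    · simp
    · intro i hi
      by_contra hne
      exact hx ⟨i, hi, (h i hi).subset (subset_closure hne)⟩

/-- A test field realizing the total variation up to `ε`. -/
lemma exists_testField {f : Sp d → ℝ} {U : Set (Sp d)} (h : totalVar f U ≠ ⊤) {ε : ℝ}
    (hε : 0 < ε) : ∃ φ, IsTestField U φ ∧
      (totalVar f U).toReal - ε ≤ ∫ x, f x * divergence φ x := by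
  by_cases h0 : (totalVar f U).toReal - ε ≤ 0
  · exact ⟨_, isTestField_zero _, h0.trans (by simp [divergence])⟩
  · push Not at h0
    have hlt : ENNReal.ofReal ((totalVar f U).toReal - ε) < totalVar f U := by
      rw [ENNReal.ofReal_lt_iff_lt_toReal h0.le h]
      linarith
    obtain ⟨φ, hφ, h2⟩ : ∃ φ, ∃ _ : IsTestField U φ, _ < _ := by
      simpa only [totalVar, lt_iSup_iff] using hlt
    exact ⟨φ, hφ, ((ENNReal.ofReal_lt_ofReal_iff_of_nonneg h0.le).mp h2).le⟩

/-- The total variation is superadditive on disjoint sets. -/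
lemma sum_totalVar_le {f : Sp d → ℝ} (hf : IsBddMeas f) {ι : Type*} {s : Finset ι}
    {U : ι → Set (Sp d)} {V : Set (Sp d)} (hd : (s : Set ι).PairwiseDisjoint U)
    (hV : ∀ i ∈ s, U i ⊆ V) : ∑ i ∈ s, totalVar f (U i) ≤ totalVar f V := by
  classical
  by_cases htop : totalVar f V = ⊤
  · simp [htop]
  have hfin : ∀ i ∈ s, totalVar f (U i) ≠ ⊤ := fun i hi =>
    ((totalVar_mono f (hV i hi)).trans_lt (lt_top_iff_ne_top.mpr htop)).ne
  refine ENNReal.le_of_forall_pos_le_add fun ε hε _ => ?_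
  set δ : ℝ := ε / (s.card + 1) with hδ
  have hδ0 : 0 < δ := by positivity
  have hex : ∀ i ∈ s, ∃ φ, IsTestField (U i) φ ∧
      (totalVar f (U i)).toReal - δ ≤ ∫ x, f x * divergence φ x := by
    exact fun i hi => exists_testField (hfin i hi) hδ0
  choose! φ hφ hle using hex
  have htest := IsTestField.sum hφ hd hV
  have h1 := integral_le_totalVar f htest htop
  have h2 : ∫ x, f x * divergence (fun x => ∑ i ∈ s, φ i x) x
      = ∑ i ∈ s, ∫ x, f x * divergence (φ i) x := by
    rw [← integral_finsetSum]
    · simp_rw [divergence_sum s fun i hi => (hφ i hi).contDiff, Finset.mul_sum]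
    · exact fun i hi => hf.integrable_mul
        (integrable_divergence (hφ i hi).contDiff (hφ i hi).compact)
  rw [h2] at h1
  have h3 : ∑ i ∈ s, (totalVar f (U i)).toReal - ε ≤ (totalVar f V).toReal := by
    refine le_trans ?_ h1
    refine le_trans ?_ (Finset.sum_le_sum hle)
    rw [Finset.sum_sub_distrib, Finset.sum_const, nsmul_eq_mul]
    have : (s.card : ℝ) * δ ≤ ε := by
      rw [hδ, mul_div_assoc', div_le_iff₀ (by positivity)]
      nlinarith [ε.2]
    linarith
  rw [← ENNReal.ofReal_toReal htop, ← Finset.sum_congr rfl fun i hi =>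
    ENNReal.ofReal_toReal (hfin i hi), ← ENNReal.ofReal_sum_of_nonneg fun _ _ => ENNReal.toReal_nonneg,
    ← ENNReal.ofReal_coe_nnreal, ← ENNReal.ofReal_add ENNReal.toReal_nonneg ε.coe_nonneg]
  exact ENNReal.ofReal_le_ofReal (by linarith)

lemma totalVar_indicator_univ {E : Set (Sp d)} (hE : NullMeasurableSet E volume) :
    totalVar (E.indicator fun _ => (1 : ℝ)) univ = perimeter E := by
  have key : ∀ φ : Sp d → Sp d, ∫ x, E.indicator (fun _ => (1 : ℝ)) x * divergence φ x
      = ∫ x in E, divergence φ x := by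
    intro φ
    rw [← integral_indicator₀ hE]
    congr 1
    funext x
    by_cases hx : x ∈ E <;> simp [hx]
  unfold totalVar perimeter
  refine le_antisymm (iSup₂_le fun φ hφ => ?_) (iSup₂_le fun φ hφ => ?_)
  · rw [key]
    exact le_iSup₂ (f := fun (φ : Sp d → Sp d)
      (_ : ContDiff ℝ 1 φ ∧ HasCompactSupport φ ∧ ∀ x, ‖φ x‖ ≤ 1) =>
      ENNReal.ofReal (∫ x in E, divergence φ x)) φ ⟨hφ.1, hφ.2, hφ.4⟩
  · rw [← key]
    exact le_totalVar _ ⟨hφ.1, hφ.2.1, subset_univ _, hφ.2.2⟩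

end Cascade

namespace Cascade

variable {d : ℕ}

/-! ### Mollification -/

/-- An open set carries smooth compactly supported cutoff functions increasing to one. -/
lemma exists_cutoff_seq {O : Set (Sp d)} (hO : IsOpen O) :
    ∃ χ : ℕ → Sp d → ℝ, (∀ k, ContDiff ℝ ∞ (χ k)) ∧ (∀ k, HasCompactSupport (χ k)) ∧
      (∀ k, tsupport (χ k) ⊆ O) ∧ (∀ k x, χ k x ∈ Icc (0 : ℝ) 1) ∧
      ∀ x ∈ O, ∀ᶠ k in atTop, χ k x = 1 := by
  obtain ⟨f, hfs, hfc, hf0⟩ := hO.exists_contDiff_support_eq (n := (⊤ : ℕ∞))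
  have hb : ∀ k : ℕ, ∃ b : ContDiffBump (0 : Sp d), b.rIn = (k : ℝ) + 1 := fun k =>
    ⟨⟨(k : ℝ) + 1, (k : ℝ) + 2, by positivity, by linarith⟩, rfl⟩
  choose b hb using hb
  -- The first factor vanishes where f < 1/k and so keeps the support away from the complement of O
  -- = {f ≠ 0}; it equals one where f ≥ 2/k. The bump, equal to one on the ball of radius k + 1,
  -- makes the support compact.
  set χ : ℕ → Sp d → ℝ := fun k x => Real.smoothTransition (k * f x - 1) * b k x with hχ
  have hcl : ∀ k : ℕ, tsupport (χ k) ⊆ {x | 1 ≤ k * f x} ∩ tsupport (b k) := by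
    intro k
    refine closure_minimal (fun x hx => ⟨?_, ?_⟩) (IsClosed.inter ?_ (isClosed_tsupport _))
    · by_contra hlt
      exact hx (by simp [hχ, Real.smoothTransition.zero_of_nonpos (x := k * f x - 1)
        (by simp only [mem_ofPred_eq] at hlt; linarith)])
    · exact subset_closure fun h0 => hx (by simp [hχ, h0])
    · exact isClosed_le continuous_const (continuous_const.mul hfc.continuous)
  refine ⟨χ, fun k => ?_, fun k => ?_, fun k => ?_, fun k x => ⟨?_, ?_⟩, fun x hx => ?_⟩
  · exact (Real.smoothTransition.contDiff.comp ((contDiff_const.mul hfc).sub contDiff_const)).mul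
      (b k).contDiff
  · exact (b k).hasCompactSupport.of_isClosed_subset (isClosed_tsupport _)
      ((hcl k).trans inter_subset_right)
  · intro x hx
    have h1 := (hcl k hx).1
    rw [← hfs, Function.mem_support]
    intro h0
    simp only [mem_ofPred_eq, h0] at h1
    norm_num at h1
  · exact mul_nonneg (Real.smoothTransition.nonneg _) (b k).nonneg
  · exact mul_le_one₀ (Real.smoothTransition.le_one _) (b k).nonneg (b k).le_one
  · have hfx : 0 < f x := by
      have h1 : f x ≠ 0 := by rwa [← Function.mem_support, hfs]
      exact lt_of_le_of_ne (hf0 (mem_range_self x)).1 h1.symm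
    obtain ⟨k₁, hk₁⟩ := exists_nat_ge (2 / f x)
    obtain ⟨k₂, hk₂⟩ := exists_nat_ge ‖x‖
    filter_upwards [eventually_ge_atTop k₁, eventually_ge_atTop k₂] with k h1 h2
    have h1' : (2 : ℝ) / f x ≤ k := hk₁.trans (by exact_mod_cast h1)
    have h2' : ‖x‖ ≤ k := hk₂.trans (by exact_mod_cast h2)
    have h3 : b k x = 1 := (b k).one_of_mem_closedBall (by
      rw [hb, mem_closedBall_zero_iff]; linarith)
    rw [div_le_iff₀ hfx] at h1'
    simp only [hχ, h3, mul_one]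
    exact Real.smoothTransition.one_of_one_le (by linarith)

lemma fderiv_apply_eq_inner (v : Sp d → ℝ) (x y : Sp d) (h : DifferentiableAt ℝ v x) :
    fderiv ℝ v x y = inner ℝ (gradient v x) y := by
  rw [h.hasGradientAt.hasFDerivAt.fderiv]
  simp

lemma norm_gradient_eq (v : Sp d → ℝ) (x : Sp d) : ‖gradient v x‖ = ‖fderiv ℝ v x‖ := by
  simp [gradient]

/-- The total variation of a smooth function is the integral of the norm of its derivative. -/
lemma lintegral_fderiv_le {v : Sp d → ℝ} (hv : ContDiff ℝ ∞ v) {O : Set (Sp d)} (hO : IsOpen O) :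
    ∫⁻ x in O, ‖fderiv ℝ v x‖ₑ ≤ totalVar v O := by
  obtain ⟨χ, hχ1, hχ2, hχ3, hχ4, hχ5⟩ := exists_cutoff_seq hO
  have hgrad : ContDiff ℝ 1 (gradient v) := by
    have : ContDiff ℝ 1 (fderiv ℝ v) := hv.fderiv_right (by norm_cast)
    exact (InnerProductSpace.toDual ℝ (Sp d)).symm.contDiff.comp this
  set δ : ℕ → ℝ := fun k => 1 / ((k : ℝ) + 1) with hδ
  have hδ0 : ∀ k, 0 < δ k := fun k => by positivity
  set D : ℕ → Sp d → ℝ := fun k x => √(‖gradient v x‖ ^ 2 + δ k ^ 2) with hD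
  have hpos : ∀ k x, 0 < ‖gradient v x‖ ^ 2 + δ k ^ 2 := fun k x => by
    have := hδ0 k; positivity
  have hD0 : ∀ k x, 0 < D k x := fun k x => Real.sqrt_pos.mpr (hpos k x)
  have hDc : ∀ k, ContDiff ℝ 1 (D k) := fun k =>
    ((hgrad.norm_sq ℝ).add contDiff_const).sqrt fun x => (hpos k x).ne'
  have hDn : ∀ k x, ‖gradient v x‖ ≤ D k x := fun k x => by
    refine Real.le_sqrt_of_sq_le ?_
    have := hδ0 k; nlinarith
  -- The optimal field -∇v/|∇v| is singular at critical points. Replacing |∇v| by √(|∇v|² + δ²) and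
  -- cutting off by χ gives admissible C¹ fields; the loss disappears in the limit by Fatou's lemma.
  set ψ : ℕ → Sp d → Sp d := fun k x => (-(χ k x) * (D k x)⁻¹) • gradient v x with hψ
  have hsub : ∀ k, tsupport (ψ k) ⊆ tsupport (χ k) := fun k =>
    closure_mono fun x hx h0 => hx (by simp [hψ, h0])
  have htest : ∀ k, IsTestField O (ψ k) := by
    intro k
    refine ⟨?_, (hχ2 k).of_isClosed_subset (isClosed_tsupport _) (hsub k), (hsub k).trans (hχ3 k),
      fun x => ?_⟩
    · exact (((hχ1 k).of_le (by norm_cast)).neg.mul ((hDc k).inv fun x => (hD0 k x).ne')).smul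
        hgrad
    · rw [hψ, norm_smul, norm_mul, norm_neg, norm_inv, Real.norm_of_nonneg (hD0 k x).le,
        Real.norm_of_nonneg (hχ4 k x).1, mul_assoc, inv_mul_eq_div]
      exact mul_le_one₀ (hχ4 k x).2 (by have := hD0 k x; positivity)
        (div_le_one_of_le₀ (hDn k x) (hD0 k x).le)
  have hle : ∀ k, ∫⁻ x in O, ENNReal.ofReal (χ k x * (D k x)⁻¹ * ‖gradient v x‖ ^ 2)
      ≤ totalVar v O := by
    intro k
    refine le_trans ?_ (le_totalVar v (htest k))
    rw [integral_mul_divergence (hv.of_le (by norm_cast)) (htest k).contDiff (htest k).compact,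
      ← integral_neg]
    have h1 : ∀ x, -(fderiv ℝ v x) (ψ k x) = χ k x * (D k x)⁻¹ * ‖gradient v x‖ ^ 2 := by
      intro x
      rw [fderiv_apply_eq_inner v x _ (hv.differentiable (by simp) x), hψ, inner_smul_right,
        real_inner_self_eq_norm_sq]
      ring
    simp_rw [h1]
    rw [ofReal_integral_eq_lintegral_ofReal]
    · exact setLIntegral_le_lintegral _ _
    · refine Continuous.integrable_of_hasCompactSupport ?_ ?_
      · exact ((hχ1 k).continuous.mul ((hDc k).continuous.inv₀ fun x => (hD0 k x).ne')).mul
          (hgrad.continuous.norm.pow 2)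
      · exact ((hχ2 k).mul_right).mul_right
    · exact ae_of_all _ fun x => by
        have := hD0 k x; have := (hχ4 k x).1; positivity
  have hlim : ∀ x ∈ O, Tendsto (fun k => ENNReal.ofReal (χ k x * (D k x)⁻¹ * ‖gradient v x‖ ^ 2))
      atTop (𝓝 ‖fderiv ℝ v x‖ₑ) := by
    intro x hx
    have h1 : Tendsto (fun k => χ k x) atTop (𝓝 1) :=
      tendsto_const_nhds.congr' (by filter_upwards [hχ5 x hx] with k hk using hk.symm)
    have h2 : Tendsto (fun k => D k x) atTop (𝓝 ‖gradient v x‖) := by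
      have h3 : Tendsto (fun k => ‖gradient v x‖ ^ 2 + δ k ^ 2) atTop (𝓝 (‖gradient v x‖ ^ 2 + 0 ^ 2)) :=
        tendsto_const_nhds.add (tendsto_one_div_add_atTop_nhds_zero_nat.pow 2)
      have h4 := (Real.continuous_sqrt.tendsto _).comp h3
      simpa [Function.comp_def, Real.sqrt_sq (norm_nonneg _)] using h4
    rw [← ofReal_norm, ← norm_gradient_eq]
    refine (ENNReal.continuous_ofReal.tendsto _).comp ?_
    by_cases h0 : ‖gradient v x‖ = 0
    · simp [h0]
    · have h3 := (h1.mul (h2.inv₀ h0)).mul_const (‖gradient v x‖ ^ 2)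
      convert h3 using 2
      field_simp
  calc ∫⁻ x in O, ‖fderiv ℝ v x‖ₑ
      = ∫⁻ x in O, liminf (fun k => ENNReal.ofReal (χ k x * (D k x)⁻¹ * ‖gradient v x‖ ^ 2)) atTop :=
        setLIntegral_congr_fun hO.measurableSet fun x hx => (hlim x hx).liminf_eq.symm
    _ ≤ liminf (fun k => ∫⁻ x in O, ENNReal.ofReal (χ k x * (D k x)⁻¹ * ‖gradient v x‖ ^ 2)) atTop := by
        refine lintegral_liminf_le fun k => ?_
        refine ENNReal.measurable_ofReal.comp (Continuous.measurable ?_)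
        exact ((hχ1 k).continuous.mul ((hDc k).continuous.inv₀ fun x => (hD0 k x).ne')).mul
          (hgrad.continuous.norm.pow 2)
    _ ≤ totalVar v O := by
        refine (liminf_le_liminf (Eventually.of_forall hle)).trans ?_
        simp

/-- The convolution is moved onto the field by Fubini: it becomes an average over |y| < `b.rOut` of
integrals of f against the divergence of translates of ψ, and each translate is a test field in the
thickened set. -/
lemma integral_convolution_mul_divergence_le {f : Sp d → ℝ} (hf : IsBddMeas f)
    (b : ContDiffBump (0 : Sp d)) {O : Set (Sp d)} {ψ : Sp d → Sp d} (hψ : IsTestField O ψ)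
    (hfin : totalVar f (Metric.thickening b.rOut O) ≠ ⊤) :
    ∫ x, (convolution (b.normed volume) f (ContinuousLinearMap.lsmul ℝ ℝ) volume x) * divergence ψ x
      ≤ (totalVar f (Metric.thickening b.rOut O)).toReal := by
  obtain ⟨C, hC⟩ := hf.bdd
  have hdiv := integrable_divergence hψ.contDiff hψ.compact
  have hρ : Integrable (b.normed volume) := b.integrable_normed
  have hint : Integrable (fun p : Sp d × Sp d =>
      b.normed volume p.2 * f (p.1 - p.2) * divergence ψ p.1) (volume.prod volume) := by
    have h1 : Integrable (fun p : Sp d × Sp d => divergence ψ p.1 * b.normed volume p.2)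
        (volume.prod volume) := hdiv.mul_prod hρ
    have h2 : AEStronglyMeasurable (fun p : Sp d × Sp d => f (p.1 - p.2)) (volume.prod volume) :=
      hf.meas.comp_quasiMeasurePreserving (quasiMeasurePreserving_sub _ _)
    have h3 := h1.bdd_mul (c := C) h2 (ae_of_all _ fun p => hC _)
    refine h3.congr (ae_of_all _ fun p => ?_)
    simp only
    ring
  have h1 : ∀ x, (convolution (b.normed volume) f (ContinuousLinearMap.lsmul ℝ ℝ) volume x)
      * divergence ψ x = ∫ y, b.normed volume y * f (x - y) * divergence ψ x := by
    intro x
    rw [integral_mul_const]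
    rfl
  simp_rw [h1]
  rw [integral_integral_swap hint]
  have h2 : ∀ y, ∫ x, b.normed volume y * f (x - y) * divergence ψ x
      ≤ b.normed volume y * (totalVar f (Metric.thickening b.rOut O)).toReal := by
    intro y
    simp_rw [mul_assoc]
    rw [integral_const_mul]
    by_cases hy : y ∈ Metric.ball (0 : Sp d) b.rOut
    · refine mul_le_mul_of_nonneg_left ?_ (b.nonneg_normed y)
      have h3 : ∫ x, f (x - y) * divergence ψ x
          = ∫ x, f x * divergence (fun z => ψ (z + y)) x := by
        rw [← integral_add_right_eq_self _ y]
        simp [divergence_comp_add]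
      rw [h3]
      refine integral_le_totalVar f ⟨hψ.contDiff.comp (contDiff_id.add contDiff_const), ?_, ?_,
        fun x => hψ.norm_le _⟩ hfin
      · exact hψ.compact.comp_homeomorph (Homeomorph.addRight y)
      · have h4 : tsupport (fun z => ψ (z + y)) = (Homeomorph.addRight y) ⁻¹' tsupport ψ :=
          tsupport_comp_eq_preimage ψ (Homeomorph.addRight y)
        rw [h4]
        intro x hx
        refine Metric.mem_thickening_iff.mpr ⟨x + y, hψ.subset hx, ?_⟩
        simpa using hy
    · have h0 : b.normed volume y = 0 := by
        rw [← Function.notMem_support, b.support_normed_eq]; exact hy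
      simp [h0]
  calc ∫ y, ∫ x, b.normed volume y * f (x - y) * divergence ψ x
      ≤ ∫ y, b.normed volume y * (totalVar f (Metric.thickening b.rOut O)).toReal :=
        integral_mono hint.swap.integral_prod_left (hρ.mul_const _) h2
    _ = _ := by rw [integral_mul_const, b.integral_normed, one_mul]

/-- Smooth approximations with control of the total variation. -/
lemma exists_mollification {f : Sp d → ℝ} (hf : IsBddMeas f) :
    ∃ v : ℕ → Sp d → ℝ, (∀ n, ContDiff ℝ ∞ (v n)) ∧
      (∀ a b, (∀ x, f x ∈ Icc a b) → ∀ n x, v n x ∈ Icc a b) ∧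
      (∀ᵐ x, Tendsto (fun n => v n x) atTop (𝓝 (f x))) ∧
      ∀ n, ∀ O : Set (Sp d), IsOpen O →
        ∫⁻ x in O, ‖fderiv ℝ (v n) x‖ₑ ≤ totalVar f (Metric.thickening (1 / ((n : ℝ) + 1)) O) := by
  have hb : ∀ n : ℕ, ∃ b : ContDiffBump (0 : Sp d), b.rOut = 1 / ((n : ℝ) + 1) ∧
      b.rIn = 1 / ((n : ℝ) + 1) / 2 := fun n =>
    ⟨⟨1 / ((n : ℝ) + 1) / 2, 1 / ((n : ℝ) + 1), by positivity, half_lt_self (by positivity)⟩, rfl, rfl⟩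
  choose b hb1 hb2 using hb
  have hsm : ∀ n, ContDiff ℝ ∞ (convolution ((b n).normed volume) f
      (ContinuousLinearMap.lsmul ℝ ℝ) volume) := fun n =>
    (b n).hasCompactSupport_normed.contDiff_convolution_left _ (b n).contDiff_normed
      hf.locallyIntegrable
  refine ⟨fun n => convolution ((b n).normed volume) f (ContinuousLinearMap.lsmul ℝ ℝ) volume,
    hsm, ?_, ?_, ?_⟩
  · intro a c hac n x
    have hρ : Integrable ((b n).normed volume) := (b n).integrable_normed
    have hconv : convolution ((b n).normed volume) f (ContinuousLinearMap.lsmul ℝ ℝ) volume x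
      = ∫ y, (b n).normed volume y * f (x - y) := rfl
    have hfx : AEStronglyMeasurable (fun y => f (x - y)) volume :=
      hf.meas.comp_quasiMeasurePreserving (quasiMeasurePreserving_sub_left volume x)
    obtain ⟨C, hC⟩ := hf.bdd
    have hint : Integrable fun y => (b n).normed volume y * f (x - y) := by
      refine (hρ.bdd_mul hfx (ae_of_all _ fun y => hC _)).congr (ae_of_all _ fun y => ?_)
      exact mul_comm _ _
    have hI := (b n).integral_normed (μ := volume)
    beta_reduce
    rw [hconv]
    constructor
    · calc a = ∫ y, (b n).normed volume y * a := by rw [integral_mul_const, hI, one_mul]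
        _ ≤ _ := integral_mono (hρ.mul_const a) hint fun y =>
          mul_le_mul_of_nonneg_left (hac _).1 ((b n).nonneg_normed y)
    · calc _ ≤ ∫ y, (b n).normed volume y * c := integral_mono hint (hρ.mul_const c) fun y =>
            mul_le_mul_of_nonneg_left (hac _).2 ((b n).nonneg_normed y)
        _ = c := by rw [integral_mul_const, hI, one_mul]
  · refine ContDiffBump.ae_convolution_tendsto_right_of_locallyIntegrable (K := 2) ?_ ?_
      hf.locallyIntegrable
    · simp only [hb1]
      exact tendsto_one_div_add_atTop_nhds_zero_nat
    · exact Eventually.of_forall fun n => by rw [hb1, hb2]; linarith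
  · intro n O hO
    by_cases hfin : totalVar f (Metric.thickening (1 / ((n : ℝ) + 1)) O) = ⊤
    · rw [hfin]; exact le_top
    refine (lintegral_fderiv_le (hsm n) hO).trans (iSup₂_le fun ψ hψ => ?_)
    rw [← hb1] at hfin ⊢
    exact ENNReal.ofReal_le_of_le_toReal (integral_convolution_mul_divergence_le hf (b n) hψ hfin)

end Cascade

namespace Cascade

variable {d : ℕ}

/-! ### A covering lemma for Hausdorff measures -/

/-- Vitali's covering lemma selects disjoint balls whose fivefold enlargements cover Z; these have
diameter at most 10 r, whence the factor 10^s. `R` marks the radii at which the set function to be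
summed is large; such radii exist below every δ, so the covers are arbitrarily fine. -/
lemma hausdorffMeasure_le_of_disjoint_balls {Z : Set (Sp d)} {s : ℝ} (hs : 0 ≤ s)
    {R : Sp d → ℝ → Prop} {M : ℝ≥0∞}
    (hR : ∀ δ > 0, ∀ z ∈ Z, ∃ r, 0 < r ∧ r < δ ∧ R z r)
    (hM : ∃ δ₀ > 0, ∀ F : Finset (Sp d × ℝ),
      (∀ p ∈ F, p.1 ∈ Z ∧ 0 < p.2 ∧ p.2 < δ₀ ∧ R p.1 p.2) →
      (F : Set (Sp d × ℝ)).PairwiseDisjoint (fun p => Metric.closedBall p.1 p.2) →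
      ∑ p ∈ F, ENNReal.ofReal p.2 ^ s ≤ M) :
    μH[s] Z ≤ 10 ^ s * M := by
  obtain ⟨δ₀, hδ₀, hM⟩ := hM
  set δ : ℕ → ℝ := fun n => min δ₀ (1 / ((n : ℝ) + 1)) with hδ
  have hδpos : ∀ n, 0 < δ n := fun n => lt_min hδ₀ (by positivity)
  set T : ℕ → Set (Sp d × ℝ) := fun n => {p | p.1 ∈ Z ∧ 0 < p.2 ∧ p.2 < δ n ∧ R p.1 p.2} with hT
  have hV : ∀ n, ∃ u ⊆ T n, (u.PairwiseDisjoint fun p => Metric.closedBall p.1 p.2) ∧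
      ∀ a ∈ T n, ∃ b ∈ u, Metric.closedBall a.1 a.2 ⊆ Metric.closedBall b.1 (5 * b.2) := fun n =>
    Vitali.exists_disjoint_subfamily_covering_enlargement_closedBall (T n) (fun p => p.1)
      (fun p => p.2) (δ n) (fun a ha => ha.2.2.1.le) 5 (by norm_num)
  choose u huT hud huc using hV
  have hcount : ∀ n, Countable (u n) := fun n =>
    ((hud n).countable_of_nonempty_interior fun p hp => by
      rw [interior_closedBall _ (huT n hp).2.1.ne']
      exact Metric.nonempty_ball.mpr (huT n hp).2.1).to_subtype
  have hdiam : ∀ (p : Sp d × ℝ), Metric.ediam (Metric.closedBall p.1 (5 * p.2))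
      ≤ 10 * ENNReal.ofReal p.2 := by
    intro p
    refine Metric.ediam_le fun x hx y hy => ?_
    rw [edist_dist, show (10 : ℝ≥0∞) = ENNReal.ofReal 10 by norm_num,
      ← ENNReal.ofReal_mul (by norm_num)]
    refine ENNReal.ofReal_le_ofReal ((dist_triangle_right x y p.1).trans ?_)
    have := Metric.mem_closedBall.mp hx
    have := Metric.mem_closedBall.mp hy
    linarith
  have h1 := Measure.hausdorffMeasure_le_liminf_tsum (ι := fun n => u n) s Z (l := atTop)
    (fun n => 10 * ENNReal.ofReal (δ n)) (by
      have h2 : Tendsto δ atTop (𝓝 0) := squeeze_zero (fun n => (hδpos n).le)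
        (fun n => min_le_right _ _) tendsto_one_div_add_atTop_nhds_zero_nat
      have h3 := ENNReal.Tendsto.const_mul (a := 10)
        ((ENNReal.continuous_ofReal.tendsto 0).comp h2) (Or.inr (by norm_num))
      simpa using h3)
    (fun n p => Metric.closedBall p.1.1 (5 * p.1.2))
    (Eventually.of_forall fun n p => (hdiam p.1).trans (by
      gcongr
      exact (huT n p.2).2.2.1.le))
    (Eventually.of_forall fun n z hz => by
      obtain ⟨r, hr0, hrδ, hr⟩ := hR (δ n) (hδpos n) z hz
      obtain ⟨b, hb, hsub⟩ := huc n (z, r) ⟨hz, hr0, hrδ, hr⟩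
      exact mem_iUnion.mpr ⟨⟨b, hb⟩, hsub (Metric.mem_closedBall_self hr0.le)⟩)
  refine h1.trans ?_
  have h2 : ∀ n, ∑' p : u n, Metric.ediam (Metric.closedBall p.1.1 (5 * p.1.2)) ^ s
      ≤ 10 ^ s * M := by
    intro n
    calc ∑' p : u n, Metric.ediam (Metric.closedBall p.1.1 (5 * p.1.2)) ^ s
        ≤ ∑' p : u n, 10 ^ s * ENNReal.ofReal p.1.2 ^ s := by
          refine ENNReal.tsum_le_tsum fun p => ?_
          rw [← ENNReal.mul_rpow_of_nonneg _ _ hs]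
          exact ENNReal.rpow_le_rpow (hdiam p.1) hs
      _ = 10 ^ s * ∑' p : u n, ENNReal.ofReal p.1.2 ^ s := ENNReal.tsum_mul_left
      _ ≤ 10 ^ s * M := by
          gcongr
          rw [ENNReal.tsum_eq_iSup_sum]
          refine iSup_le fun F => ?_
          classical
          have h3 := hM (F.map (Function.Embedding.subtype _)) ?_ ?_
          · rwa [Finset.sum_map] at h3
          · intro p hp
            obtain ⟨q, -, rfl⟩ := Finset.mem_map.mp hp
            have h4 := huT n q.2
            exact ⟨h4.1, h4.2.1, h4.2.2.1.trans_le (min_le_left _ _), h4.2.2.2⟩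
          · refine (hud n).subset fun p hp => ?_
            obtain ⟨q, -, rfl⟩ := Finset.mem_map.mp (Finset.mem_coe.mp hp)
            exact q.2
  refine (liminf_le_liminf (Eventually.of_forall h2)).trans ?_
  simp

/-! ### Poincaré inequality -/

/-- The Jacobian of the dilation is bounded below by 2^{-d} only because t stays away from zero. For
this reason differences of values are compared below through midpoints, never along a whole segment.
-/
lemma lintegral_comp_affine_le {g : Sp d → ℝ≥0∞} (hg : Measurable g) (a : Sp d) {t : ℝ}
    (ht : 1 / 2 ≤ t) : ∫⁻ y, g (a + t • y) ≤ 2 ^ d * ∫⁻ y, g y := by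
  have ht0 : 0 < t := by linarith
  have h1 : ∫⁻ y, g (a + t • y) = ∫⁻ y, g (a + y) ∂(Measure.map (fun x => t • x) volume) := by
    exact (lintegral_map (hg.comp (measurable_const_add a)) (measurable_const_smul t)).symm
  rw [h1, Measure.map_addHaar_smul volume ht0.ne', lintegral_smul_measure,
    lintegral_add_left_eq_self]
  rw [smul_eq_mul]
  gcongr
  rw [finrank_euclideanSpace_fin, abs_of_nonneg (by positivity), ← inv_pow,
    ENNReal.ofReal_pow (by positivity)]
  gcongr
  rw [show (2 : ℝ≥0∞) = ENNReal.ofReal 2 by norm_num]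
  refine ENNReal.ofReal_le_ofReal ?_
  rw [inv_le_comm₀ ht0 (by norm_num)]
  linarith

lemma enorm_sub_midpoint_le {v : Sp d → ℝ} (hv : ContDiff ℝ ∞ v) (x y : Sp d) :
    ‖v y - v ((1 / 2 : ℝ) • (x + y))‖ₑ
      ≤ ∫⁻ t in Ioc (1 / 2 : ℝ) 1, ‖fderiv ℝ v (x + t • (y - x))‖ₑ * ‖y - x‖ₑ := by
  have hd : ∀ t : ℝ, HasDerivAt (fun t : ℝ => v (x + t • (y - x)))
      (fderiv ℝ v (x + t • (y - x)) (y - x)) t := by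
    intro t
    have h1 : HasDerivAt (fun t : ℝ => x + t • (y - x)) (y - x) t := by
      simpa using ((hasDerivAt_id t).smul_const (y - x)).const_add x
    exact (hv.differentiable (by simp) _).hasFDerivAt.comp_hasDerivAt t h1
  have hc : Continuous fun t : ℝ => fderiv ℝ v (x + t • (y - x)) (y - x) := by
    have := hv.continuous_fderiv (by simp)
    fun_prop
  have h2 := intervalIntegral.integral_eq_sub_of_hasDerivAt (a := 1 / 2) (b := 1)
    (fun t _ => hd t) (hc.intervalIntegrable _ _)
  have h3 : x + (1 : ℝ) • (y - x) = y := by simp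
  have h4 : x + (1 / 2 : ℝ) • (y - x) = (1 / 2 : ℝ) • (x + y) := by module
  rw [h3, h4, intervalIntegral.integral_of_le (by norm_num)] at h2
  rw [← h2]
  refine (enorm_integral_le_lintegral_enorm _).trans (lintegral_mono fun t => ?_)
  exact ContinuousLinearMap.le_opENorm _ _

/-- The difference of two values is split at the midpoint. For fixed x the half of the segment next
to y is integrated in y, with the substitution x + t (y - x), t ≥ 1/2, which stays in the convex
ball. The other half is the same integral with x and y exchanged. -/
lemma lintegral_enorm_sub_le {v : Sp d → ℝ} (hv : ContDiff ℝ ∞ v) (z : Sp d) (r : ℝ) :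
    ∫⁻ p : Sp d × Sp d, ‖v p.1 - v p.2‖ₑ ∂((volume.restrict (Metric.ball z r)).prod
        (volume.restrict (Metric.ball z r)))
      ≤ 2 * (volume (Metric.ball z r) * (2 ^ d * ENNReal.ofReal (2 * r)
        * ∫⁻ x in Metric.ball z r, ‖fderiv ℝ v x‖ₑ)) := by
  set B := Metric.ball z r with hB
  set μ := (volume : Measure (Sp d)).restrict B with hμ
  set G : Sp d → ℝ≥0∞ := B.indicator fun x => ‖fderiv ℝ v x‖ₑ with hG
  have hvc := hv.continuous
  have hdc := hv.continuous_fderiv (by simp)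
  have hGm : Measurable G := (hdc.enorm.measurable).indicator Metric.isOpen_ball.measurableSet
  have hGint : ∫⁻ x, G x = ∫⁻ x in B, ‖fderiv ℝ v x‖ₑ :=
    lintegral_indicator Metric.isOpen_ball.measurableSet _
  set K : Sp d → Sp d → ℝ≥0∞ := fun x y => ‖v y - v ((1 / 2 : ℝ) • (x + y))‖ₑ with hK
  have hKm : Measurable (fun p : Sp d × Sp d => K p.1 p.2) := by
    refine Continuous.measurable ?_
    fun_prop
  have hKint : ∫⁻ x, ∫⁻ y, K x y ∂μ ∂μ ≤ volume B * (2 ^ d * ENNReal.ofReal (2 * r) * ∫⁻ x, G x) := by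
    have hx : ∀ x ∈ B, ∫⁻ y, K x y ∂μ ≤ 2 ^ d * ENNReal.ofReal (2 * r) * ∫⁻ x, G x := by
      intro x hx
      have h1 : ∀ y ∈ B, K x y ≤ ∫⁻ t in Ioc (1 / 2 : ℝ) 1, G (x + t • (y - x)) * ENNReal.ofReal (2 * r) := by
        intro y hy
        refine (enorm_sub_midpoint_le hv x y).trans (setLIntegral_mono' measurableSet_Ioc fun t ht => ?_)
        have hm : x + t • (y - x) ∈ B := by
          have := (convex_ball z r) hx hy (a := 1 - t) (b := t) (by linarith [ht.2])
            (by linarith [ht.1]) (by ring)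
          convert this using 1
          module
        rw [hG, indicator_of_mem hm]
        gcongr
        rw [← ofReal_norm]
        refine ENNReal.ofReal_le_ofReal ?_
        have h2 := dist_triangle_right y x z
        rw [dist_eq_norm] at h2
        have := Metric.mem_ball.mp hx
        have := Metric.mem_ball.mp hy
        linarith
      calc ∫⁻ y, K x y ∂μ
          ≤ ∫⁻ y, ∫⁻ t in Ioc (1 / 2 : ℝ) 1, G (x + t • (y - x)) * ENNReal.ofReal (2 * r) :=
            (setLIntegral_mono' Metric.isOpen_ball.measurableSet h1).trans
              (setLIntegral_le_lintegral _ _)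
        _ = ∫⁻ t in Ioc (1 / 2 : ℝ) 1, ∫⁻ y, G (x + t • (y - x)) * ENNReal.ofReal (2 * r) := by
            refine lintegral_lintegral_swap (Measurable.aemeasurable ?_)
            refine (hGm.comp (Continuous.measurable ?_)).mul_const _
            fun_prop
        _ ≤ ∫⁻ t in Ioc (1 / 2 : ℝ) 1, 2 ^ d * ENNReal.ofReal (2 * r) * ∫⁻ x, G x := by
            refine setLIntegral_mono' measurableSet_Ioc fun t ht => ?_
            rw [lintegral_mul_const' _ _ ENNReal.ofReal_ne_top]
            have h3 : ∀ y, x + t • (y - x) = (x - t • x) + t • y := fun y => by module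
            simp_rw [h3]
            calc _ ≤ (2 ^ d * ∫⁻ y, G y) * ENNReal.ofReal (2 * r) := by
                  gcongr
                  exact lintegral_comp_affine_le hGm _ ht.1.le
              _ = _ := by ring
        _ ≤ 2 ^ d * ENNReal.ofReal (2 * r) * ∫⁻ x, G x := by
            rw [setLIntegral_const, Real.volume_Ioc]
            refine mul_le_of_le_one_right' ?_
            rw [ENNReal.ofReal_le_one]
            norm_num
    calc ∫⁻ x, ∫⁻ y, K x y ∂μ ∂μ
        ≤ ∫⁻ _, (2 ^ d * ENNReal.ofReal (2 * r) * ∫⁻ x, G x) ∂μ :=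
          setLIntegral_mono' Metric.isOpen_ball.measurableSet hx
      _ = _ := by
          generalize 2 ^ d * ENNReal.ofReal (2 * r) * ∫⁻ x, G x = c
          rw [lintegral_const, hμ, Measure.restrict_apply_univ, mul_comm]
  have hKm2 : Measurable (fun p : Sp d × Sp d => K p.2 p.1) := hKm.comp measurable_swap
  calc ∫⁻ p : Sp d × Sp d, ‖v p.1 - v p.2‖ₑ ∂(μ.prod μ)
      ≤ ∫⁻ p : Sp d × Sp d, (K p.2 p.1 + K p.1 p.2) ∂(μ.prod μ) := by
        refine lintegral_mono fun p => ?_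
        have h5 : v p.1 - v p.2 = (v p.1 - v ((1 / 2 : ℝ) • (p.2 + p.1)))
            - (v p.2 - v ((1 / 2 : ℝ) • (p.1 + p.2))) := by
          rw [add_comm p.2 p.1]; ring
        simp only [h5]
        exact enorm_sub_le
    _ = ∫⁻ x, ∫⁻ y, K y x ∂μ ∂μ + ∫⁻ x, ∫⁻ y, K x y ∂μ ∂μ := by
        rw [lintegral_add_left hKm2, lintegral_prod _ hKm2.aemeasurable,
          lintegral_prod _ hKm.aemeasurable]
    _ = ∫⁻ x, ∫⁻ y, K x y ∂μ ∂μ + ∫⁻ x, ∫⁻ y, K x y ∂μ ∂μ := by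
        rw [lintegral_lintegral_swap hKm2.aemeasurable]
    _ ≤ _ := by
        rw [← two_mul, ← hGint]
        gcongr

/-- Relative isoperimetric inequality in balls. -/
lemma volume_mul_volume_le_totalVar {E : Set (Sp d)} (hE : NullMeasurableSet E volume) (z : Sp d)
    {s r : ℝ} (hsr : s < r) :
    volume (Metric.ball z s ∩ E) * volume (Metric.ball z s \ E)
      ≤ 2 * (volume (Metric.ball z s) * (2 ^ d * ENNReal.ofReal (2 * s)
        * totalVar (E.indicator fun _ => (1 : ℝ)) (Metric.ball z r))) := by
  set f : Sp d → ℝ := E.indicator fun _ => (1 : ℝ) with hf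
  obtain ⟨v, hv1, -, hv3, hv4⟩ := exists_mollification (isBddMeas_indicator hE)
  set μ := (volume : Measure (Sp d)).restrict (Metric.ball z s) with hμ
  have hae : ∀ᵐ p : Sp d × Sp d ∂(μ.prod μ),
      Tendsto (fun n => ‖v n p.1 - v n p.2‖ₑ) atTop (𝓝 ‖f p.1 - f p.2‖ₑ) := by
    have h1 : ∀ᵐ x ∂μ, Tendsto (fun n => v n x) atTop (𝓝 (f x)) := ae_restrict_of_ae hv3
    filter_upwards [Measure.quasiMeasurePreserving_fst.ae h1,
      Measure.quasiMeasurePreserving_snd.ae h1] with p h2 h3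
    exact (h2.sub h3).enorm
  have hlow : volume (Metric.ball z s ∩ E) * volume (Metric.ball z s \ E)
      ≤ ∫⁻ p : Sp d × Sp d, ‖f p.1 - f p.2‖ₑ ∂(μ.prod μ) := by
    have h1 : μ.prod μ (E ×ˢ Eᶜ) = volume (Metric.ball z s ∩ E) * volume (Metric.ball z s \ E) := by
      rw [Measure.prod_prod, hμ, Measure.restrict_apply' measurableSet_ball,
        Measure.restrict_apply' measurableSet_ball, inter_comm, inter_comm Eᶜ, sdiff_eq]
    rw [← h1, ← setLIntegral_one]
    refine le_trans (lintegral_mono_ae ?_) (setLIntegral_le_lintegral (E ×ˢ Eᶜ) _)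
    have hEm : NullMeasurableSet E μ := hE.mono_ac Measure.restrict_le_self.absolutelyContinuous
    have hm : NullMeasurableSet (E ×ˢ Eᶜ) (μ.prod μ) := hEm.prod hEm.compl
    filter_upwards [ae_restrict_mem₀ hm] with p hp
    have h2 : f p.1 = 1 := by simp [hf, hp.1]
    have h3 : f p.2 = 0 := indicator_of_notMem hp.2 _
    simp [h2, h3]
  refine hlow.trans ?_
  -- Fatou's lemma passes from the mollifications to the indicator; the gap between s and r leaves
  -- room for the mollification radius.
  calc ∫⁻ p : Sp d × Sp d, ‖f p.1 - f p.2‖ₑ ∂(μ.prod μ)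
      = ∫⁻ p : Sp d × Sp d, liminf (fun n => ‖v n p.1 - v n p.2‖ₑ) atTop ∂(μ.prod μ) :=
        lintegral_congr_ae (hae.mono fun p hp => hp.liminf_eq.symm)
    _ ≤ liminf (fun n => ∫⁻ p : Sp d × Sp d, ‖v n p.1 - v n p.2‖ₑ ∂(μ.prod μ)) atTop := by
        refine lintegral_liminf_le fun n => Continuous.measurable ?_
        have := (hv1 n).continuous
        fun_prop
    _ ≤ liminf (fun _ : ℕ => 2 * (volume (Metric.ball z s) * (2 ^ d * ENNReal.ofReal (2 * s)
        * totalVar f (Metric.ball z r)))) atTop := by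
        refine liminf_le_liminf ?_
        have h1 : ∀ᶠ n : ℕ in atTop, 1 / ((n : ℝ) + 1) < r - s :=
          tendsto_one_div_add_atTop_nhds_zero_nat.eventually (gt_mem_nhds (by linarith))
        filter_upwards [h1] with n hn
        refine (lintegral_enorm_sub_le (hv1 n) z s).trans ?_
        gcongr
        refine (hv4 n _ Metric.isOpen_ball).trans (totalVar_mono f ?_)
        refine (Metric.thickening_ball z _ _).trans (Metric.ball_subset_ball (by linarith))
    _ = _ := by simp

end Cascade

namespace Cascade

variable {d : ℕ}

/-! ### Radial cutoff functions -/

lemma exists_lipschitzWith_smoothTransition : ∃ K : ℝ≥0, LipschitzWith K Real.smoothTransition := by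
  have hc : Continuous (deriv Real.smoothTransition) :=
    (Real.smoothTransition.contDiff (n := 1)).continuous_deriv le_rfl
  have hs : HasCompactSupport (deriv Real.smoothTransition) := by
    refine HasCompactSupport.intro (isCompact_Icc (a := (0:ℝ)) (b := 1)) fun x hx => ?_
    rw [mem_Icc, not_and_or, not_le, not_le] at hx
    rcases hx with h | h
    · have h1 : Real.smoothTransition =ᶠ[𝓝 x] fun _ => 0 := by
        filter_upwards [gt_mem_nhds h] with y hy using Real.smoothTransition.zero_of_nonpos hy.le
      rw [h1.deriv_eq, deriv_const]
    · have h1 : Real.smoothTransition =ᶠ[𝓝 x] fun _ => 1 := by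
        filter_upwards [lt_mem_nhds h] with y hy using Real.smoothTransition.one_of_one_le hy.le
      rw [h1.deriv_eq, deriv_const]
  obtain ⟨C, hC⟩ := hs.exists_bound_of_continuous hc
  refine ⟨C.toNNReal, lipschitzWith_of_nnnorm_deriv_le
    ((Real.smoothTransition.contDiff (n := 1)).differentiable one_ne_zero) fun x => ?_⟩
  rw [← NNReal.coe_le_coe, coe_nnnorm]
  exact (hC x).trans (Real.le_coe_toNNReal C)

/-- A `C¹` cutoff function between two concentric balls. -/
structure IsRadialCutoff (K : ℝ) (z : Sp d) (s' s : ℝ) (η : Sp d → ℝ) : Prop where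
  contDiff : ContDiff ℝ 1 η
  mem_Icc : ∀ x, η x ∈ Icc (0 : ℝ) 1
  eq_one : ∀ x ∈ Metric.closedBall z s', η x = 1
  tsupport_subset : tsupport η ⊆ Metric.closedBall z s
  norm_fderiv_le : ∀ x, ‖fderiv ℝ η x‖ ≤ K / (s - s')

/-- One fixed profile is rescaled, so the same K serves all balls. The singularity of the norm at
the centre is harmless, because the function is constant near it; this uses 0 < s'. -/
lemma exists_radialCutoff (d : ℕ) : ∃ K : ℝ, 0 < K ∧ ∀ (z : Sp d) (s' s : ℝ), 0 < s' → s' < s →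
    ∃ η, IsRadialCutoff K z s' s η := by
  obtain ⟨K, hK⟩ := exists_lipschitzWith_smoothTransition
  refine ⟨K + 1, by positivity, fun z s' s hs' hs => ?_⟩
  have hpos : 0 < s - s' := by linarith
  set η : Sp d → ℝ := fun x => Real.smoothTransition ((s - ‖x - z‖) / (s - s')) with hη
  have h1 : ∀ x, ‖x - z‖ ≤ s' → η x = 1 := fun x hx =>
    Real.smoothTransition.one_of_one_le (by rw [one_le_div hpos]; linarith)
  refine ⟨η, ?_, fun x => ⟨Real.smoothTransition.nonneg _, Real.smoothTransition.le_one _⟩,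
    fun x hx => h1 x (by rwa [Metric.mem_closedBall, dist_eq_norm] at hx), ?_, fun x => ?_⟩
  · rw [contDiff_iff_contDiffAt]
    intro x
    by_cases hx : x = z
    · subst hx
      refine (contDiffAt_const (c := (1 : ℝ))).congr_of_eventuallyEq ?_
      filter_upwards [Metric.ball_mem_nhds x hs'] with y hy
      exact h1 y (by rw [← dist_eq_norm]; exact (Metric.mem_ball.mp hy).le)
    · refine Real.smoothTransition.contDiff.contDiffAt.comp x ?_
      refine ContDiffAt.div_const (contDiffAt_const.sub ?_) _
      exact (contDiffAt_id.sub contDiffAt_const).norm ℝ (sub_ne_zero.mpr hx)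
  · refine closure_minimal (fun x hx => ?_) Metric.isClosed_closedBall
    by_contra hx2
    rw [Metric.mem_closedBall, dist_eq_norm, not_le] at hx2
    exact hx (Real.smoothTransition.zero_of_nonpos
      (div_nonpos_of_nonpos_of_nonneg (by linarith) hpos.le))
  · have h2 : LipschitzWith (K * (1 / (s - s')).toNNReal) η := by
      refine hK.comp (LipschitzWith.of_dist_le_mul fun x y => ?_)
      rw [Real.coe_toNNReal _ (by positivity), Real.dist_eq, ← sub_div, abs_div, abs_of_pos hpos,
        div_mul_eq_mul_div, one_mul]
      gcongr
      rw [show s - ‖x - z‖ - (s - ‖y - z‖) = ‖y - z‖ - ‖x - z‖ by ring]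
      refine (abs_norm_sub_norm_le _ _).trans ?_
      rw [dist_comm, dist_eq_norm]
      simp
    refine (norm_fderiv_le_of_lipschitz ℝ h2).trans ?_
    rw [NNReal.coe_mul, Real.coe_toNNReal _ (by positivity), mul_one_div]
    gcongr
    linarith

namespace IsRadialCutoff

variable {K : ℝ} {z : Sp d} {s' s : ℝ} {η : Sp d → ℝ}

lemma hasCompactSupport (h : IsRadialCutoff K z s' s η) : HasCompactSupport η :=
  (isCompact_closedBall z s).of_isClosed_subset (isClosed_tsupport _) h.tsupport_subset

lemma eq_zero (h : IsRadialCutoff K z s' s η) {x : Sp d} (hx : x ∉ Metric.closedBall z s) :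
    η x = 0 := image_eq_zero_of_notMem_tsupport fun h' => hx (h.tsupport_subset h')

lemma fderiv_eq_zero (h : IsRadialCutoff K z s' s η) {x : Sp d}
    (hx : x ∉ Metric.closedBall z s \ Metric.ball z s') : fderiv ℝ η x = 0 := by
  by_cases hx1 : x ∈ Metric.closedBall z s
  · have hx2 : x ∈ Metric.ball z s' := by
      by_contra h2; exact hx ⟨hx1, h2⟩
    have h1 : η =ᶠ[𝓝 x] fun _ => 1 := by
      filter_upwards [Metric.isOpen_ball.mem_nhds hx2] with y hy using
        h.eq_one y (Metric.ball_subset_closedBall hy)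
    simp [h1.fderiv_eq]
  · have h1 : η =ᶠ[𝓝 x] fun _ => 0 := by
      filter_upwards [Metric.isClosed_closedBall.isOpen_compl.mem_nhds hx1] with y hy using
        h.eq_zero hy
    simp [h1.fderiv_eq]

end IsRadialCutoff

/-! ### Localized isoperimetric inequality -/

/-- Sobolev's inequality with exponents 1 and d/(d-1), applied to η times mollified indicators. The
derivative splits into the perimeter in a slightly larger ball and the mass in the shell where η
varies. Integer powers d - 1 and d replace the fractional exponent, as the iteration below compares
powers. -/
lemma volume_pow_le_of_radialCutoff (hd : 2 ≤ d) {K : ℝ} {E : Set (Sp d)}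
    (hE : NullMeasurableSet E volume) {z : Sp d} {s' s r : ℝ} (hsr : s < r)
    {η : Sp d → ℝ} (hη : IsRadialCutoff K z s' s η) :
    volume (E ∩ Metric.closedBall z s') ^ (d - 1) ≤
      (eLpNormLESNormFDerivOneConst (volume : Measure (Sp d)) ((d : ℝ) / (d - 1)) *
        (totalVar (E.indicator fun _ => (1 : ℝ)) (Metric.ball z r)
        + ENNReal.ofReal (K / (s - s')) * volume (E ∩ Metric.closedBall z s))) ^ d := by
  set f : Sp d → ℝ := E.indicator fun _ => (1 : ℝ) with hf
  have hd1 : (1 : ℝ) < d := by exact_mod_cast hd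
  set p : ℝ≥0 := (d : ℝ≥0) / (d - 1 : ℕ) with hp
  have hd1' : ((d - 1 : ℕ) : ℝ) = (d : ℝ) - 1 := by
    rw [Nat.cast_sub (by omega), Nat.cast_one]
  have hpr : (p : ℝ) = (d : ℝ) / (d - 1) := by
    rw [hp, NNReal.coe_div, NNReal.coe_natCast, NNReal.coe_natCast, hd1']
  have hp0 : (p : ℝ) ≠ 0 := by
    rw [hpr]; exact (div_pos (by linarith) (by linarith)).ne'
  have hconj : (↑(Module.finrank ℝ (Sp d)) : ℝ≥0).HolderConjugate p := by
    rw [finrank_euclideanSpace_fin, NNReal.holderConjugate_iff]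
    refine ⟨by exact_mod_cast hd, ?_⟩
    rw [← NNReal.coe_inj]
    push_cast
    rw [hpr]
    have h1 : (d : ℝ) ≠ 0 := by linarith
    have h2 : (d : ℝ) - 1 ≠ 0 := by linarith
    field_simp
    ring
  obtain ⟨v, hv1, hv2, hv3, hv4⟩ := exists_mollification (isBddMeas_indicator hE)
  have hv01 : ∀ n x, v n x ∈ Icc (0 : ℝ) 1 := hv2 0 1 fun x => by
    by_cases h : x ∈ E <;> simp [h]
  set C := eLpNormLESNormFDerivOneConst (volume : Measure (Sp d)) (p : ℝ) with hC
  have hη1 := hη.contDiff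
  have hηc := hη.contDiff.continuous
  have hη'c := hη.contDiff.continuous_fderiv one_ne_zero
  -- the estimate for the mollified functions
  have hstep : ∀ n : ℕ, 1 / ((n : ℝ) + 1) < r - s → eLpNorm (fun x => η x * v n x) p volume
      ≤ C * (totalVar f (Metric.ball z r) + ∫⁻ x, ‖v n x‖ₑ * ‖fderiv ℝ η x‖ₑ) := by
    intro n hn
    have hu : ContDiff ℝ 1 fun x => η x * v n x := hη1.mul ((hv1 n).of_le (by norm_cast))
    have huc : HasCompactSupport fun x => η x * v n x := hη.hasCompactSupport.mul_right
    refine (eLpNorm_le_eLpNorm_fderiv_one volume hu huc hconj).trans ?_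
    gcongr
    rw [eLpNorm_one_eq_lintegral_enorm]
    -- Small enough that its 1/(n+1)-neighbourhood lies in the ball of radius r, large enough to
    -- contain the support of η.
    set O := Metric.ball z ((r - 1 / ((n : ℝ) + 1))) with hO
    have hηO : ∀ x, x ∉ O → η x = 0 := fun x hx => hη.eq_zero fun h => hx
      (Metric.closedBall_subset_ball (by linarith) h)
    calc ∫⁻ x, ‖fderiv ℝ (fun x => η x * v n x) x‖ₑ
        ≤ ∫⁻ x, (O.indicator (fun x => ‖fderiv ℝ (v n) x‖ₑ) x + ‖v n x‖ₑ * ‖fderiv ℝ η x‖ₑ) := by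
          refine lintegral_mono fun x => ?_
          rw [fderiv_fun_mul (hη1.differentiable one_ne_zero x)
            ((hv1 n).differentiable (by simp) x)]
          refine (enorm_add_le (η x • fderiv ℝ (v n) x) (v n x • fderiv ℝ η x)).trans ?_
          rw [enorm_smul, enorm_smul]
          gcongr
          by_cases hx : x ∈ O
          · rw [indicator_of_mem hx]
            refine mul_le_of_le_one_left' ?_
            rw [← ofReal_norm, Real.norm_of_nonneg (hη.mem_Icc x).1]
            exact ENNReal.ofReal_le_one.mpr (hη.mem_Icc x).2
          · simp [hηO x hx]
      _ = (∫⁻ x in O, ‖fderiv ℝ (v n) x‖ₑ) + ∫⁻ x, ‖v n x‖ₑ * ‖fderiv ℝ η x‖ₑ := by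
          rw [lintegral_add_left, lintegral_indicator measurableSet_ball]
          exact (((hv1 n).continuous_fderiv (by simp)).enorm.measurable).indicator measurableSet_ball
      _ ≤ _ := by
          gcongr
          refine (hv4 n O Metric.isOpen_ball).trans (totalVar_mono f ?_)
          refine (Metric.thickening_ball z _ _).trans (Metric.ball_subset_ball (by linarith))
  have hlim : Tendsto (fun n => ∫⁻ x, ‖v n x‖ₑ * ‖fderiv ℝ η x‖ₑ) atTop
      (𝓝 (∫⁻ x, ‖f x‖ₑ * ‖fderiv ℝ η x‖ₑ)) := by
    refine tendsto_lintegral_of_dominated_convergence (fun x => ‖fderiv ℝ η x‖ₑ) (fun n => ?_)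
      (fun n => ae_of_all _ fun x => ?_) ?_ ?_
    · exact ((hv1 n).continuous.enorm.measurable).mul hη'c.enorm.measurable
    · refine mul_le_of_le_one_left' ?_
      rw [← ofReal_norm, Real.norm_of_nonneg (hv01 n x).1]
      exact ENNReal.ofReal_le_one.mpr (hv01 n x).2
    · exact (hη'c.integrable_of_hasCompactSupport (hη.hasCompactSupport.fderiv ℝ)).2.ne
    · filter_upwards [hv3] with x hx
      exact ENNReal.Tendsto.mul_const hx.enorm (Or.inr enorm_ne_top)
  have hbound : ∫⁻ x, ‖f x‖ₑ * ‖fderiv ℝ η x‖ₑ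
      ≤ ENNReal.ofReal (K / (s - s')) * volume (E ∩ Metric.closedBall z s) := by
    have hm : NullMeasurableSet (E ∩ Metric.closedBall z s) volume :=
      hE.inter Metric.isClosed_closedBall.nullMeasurableSet
    rw [← setLIntegral_const, ← lintegral_indicator₀ hm]
    refine lintegral_mono fun x => ?_
    by_cases hx : x ∈ E ∩ Metric.closedBall z s
    · rw [indicator_of_mem hx, hf, indicator_of_mem hx.1, enorm_one, one_mul, ← ofReal_norm]
      exact ENNReal.ofReal_le_ofReal (hη.norm_fderiv_le x)
    · rw [indicator_of_notMem hx]
      by_cases hxE : x ∈ E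
      · rw [hη.fderiv_eq_zero fun h => hx ⟨hxE, h.1⟩, enorm_zero (E := Sp d →L[ℝ] ℝ), mul_zero]
      · simp [hf, hxE]
  have hmain : eLpNorm (fun x => η x * f x) p volume ≤ C * (totalVar f (Metric.ball z r)
      + ENNReal.ofReal (K / (s - s')) * volume (E ∩ Metric.closedBall z s)) := by
    have h1 := Lp.eLpNorm_lim_le_liminf_eLpNorm (p := p) (μ := volume) (f := fun n x => η x * v n x)
      (fun n => (hηc.mul (hv1 n).continuous).aestronglyMeasurable) (fun x => η x * f x)
      (by filter_upwards [hv3] with x hx using hx.const_mul _)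
    refine h1.trans ?_
    have h2 : ∀ᶠ n : ℕ in atTop, 1 / ((n : ℝ) + 1) < r - s :=
      tendsto_one_div_add_atTop_nhds_zero_nat.eventually (gt_mem_nhds (by linarith))
    have h3 : Tendsto (fun n => C * (totalVar f (Metric.ball z r)
        + ∫⁻ x, ‖v n x‖ₑ * ‖fderiv ℝ η x‖ₑ)) atTop (𝓝 (C * (totalVar f (Metric.ball z r)
        + ∫⁻ x, ‖f x‖ₑ * ‖fderiv ℝ η x‖ₑ))) :=
      ENNReal.Tendsto.const_mul (tendsto_const_nhds.add hlim) (Or.inr ENNReal.coe_ne_top)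
    refine (liminf_le_liminf (h2.mono fun n hn => hstep n hn)).trans ?_
    rw [h3.liminf_eq]
    gcongr
  have hlow : volume (E ∩ Metric.closedBall z s') ^ (1 / (p : ℝ)) ≤
      eLpNorm (fun x => η x * f x) p volume := by
    have hm : NullMeasurableSet (E ∩ Metric.closedBall z s') volume :=
      hE.inter Metric.isClosed_closedBall.nullMeasurableSet
    have h1 := eLpNorm_indicator_const₀ (c := (1 : ℝ)) (p := (p : ℝ≥0∞)) hm
      (by exact_mod_cast hp0) ENNReal.coe_ne_top
    rw [enorm_one, one_mul, ENNReal.coe_toReal] at h1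
    rw [← h1]
    refine eLpNorm_mono fun x => ?_
    by_cases hx : x ∈ E ∩ Metric.closedBall z s'
    · rw [indicator_of_mem hx, hη.eq_one x hx.2, hf, indicator_of_mem hx.1]
      simp
    · rw [indicator_of_notMem hx, norm_zero]
      exact norm_nonneg _
  have hfin := hlow.trans hmain
  rw [← hpr]
  refine le_trans (le_of_eq ?_) (pow_le_pow_left' hfin d)
  rw [← ENNReal.rpow_natCast, ← ENNReal.rpow_natCast, ← ENNReal.rpow_mul]
  congr 1
  rw [hpr, hd1']
  have h1 : (d : ℝ) ≠ 0 := by linarith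
  field_simp

end Cascade

namespace Cascade

variable {d : ℕ}

/-! ### De Giorgi iteration -/

/-- If cutting a set out of balls is never cheap compared to its perimeter and the set has small
density in a ball, then it is negligible in the ball of half the radius. -/
lemma exists_density_threshold (hd : 2 ≤ d) {K : ℝ} (hK0 : 0 < K)
    (hK : ∀ (z : Sp d) (s' s : ℝ), 0 < s' → s' < s → ∃ η, IsRadialCutoff K z s' s η) :
    ∃ γ : ℝ, 0 < γ ∧ ∀ E : Set (Sp d), NullMeasurableSet E volume → ∀ (z : Sp d) (r : ℝ), 0 < r →
      volume (E ∩ Metric.closedBall z r) ≤ ENNReal.ofReal (γ * r ^ d) →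
      (∀ s' s, r / 2 ≤ s' → s' < s → s ≤ r →
        totalVar (E.indicator fun _ => (1 : ℝ)) (Metric.ball z s') ≤
          ENNReal.ofReal (2 * K / (s - s')) * volume (E ∩ Metric.closedBall z s)) →
      volume (E ∩ Metric.closedBall z (r / 2)) = 0 := by
  obtain ⟨n, rfl⟩ : ∃ n, d = n + 1 := ⟨d - 1, by omega⟩
  have hn : n ≠ 0 := by omega
  set C := eLpNormLESNormFDerivOneConst (volume : Measure (Sp (n + 1)))
    (((n + 1 : ℕ) : ℝ) / ((n + 1 : ℕ) - 1)) with hC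
  -- 24 = 8 + 16. With b = 8^{-j}, the hypothesis on the perimeter is used across a gap r b / 4 and
  -- costs 8 K / (r b); the cutoff works across a gap r b / 16 and costs 16 K / (r b). The summand 1
  -- only ensures positivity.
  set C' : ℝ := C * (24 * K) + 1 with hC'
  have hC'0 : 0 < C' := by positivity
  set q : ℝ := (1 / 8) ^ (n + 1) with hq
  have hq0 : 0 < q := by positivity
  have hq1 : q < 1 := pow_lt_one₀ (by norm_num) (by norm_num) (by omega)
  -- Chosen so that C'^{n+1} γ = q^n. Then the bound γ q^j r^{n+1} on the ball of radius (r/2)(1 +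
  -- 8^{-j}) reproduces itself with j + 1 under the isoperimetric step; since q < 1 it tends to zero
  -- while the radii stay above r/2.
  set γ : ℝ := q ^ n / C' ^ (n + 1) with hγ
  have hγ0 : 0 < γ := by positivity
  refine ⟨γ, hγ0, fun E hE z r hr hsmall hcut => ?_⟩
  have hmono : ∀ {a b : ℝ}, a ≤ b → volume (E ∩ Metric.closedBall z a)
      ≤ volume (E ∩ Metric.closedBall z b) := fun h =>
    measure_mono (inter_subset_inter_right _ (Metric.closedBall_subset_closedBall h))
  have hstep : ∀ j : ℕ, volume (E ∩ Metric.closedBall z (r / 2 * (1 + (1 / 8) ^ j)))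
      ≤ ENNReal.ofReal (γ * q ^ j * r ^ (n + 1)) := by
    intro j
    induction j with
    | zero => simpa [show r / 2 * (1 + 1) = r by ring] using hsmall
    | succ j ih =>
      set b : ℝ := (1 / 8) ^ j with hb
      have hb0 : 0 < b := by positivity
      have hb1 : b ≤ 1 := pow_le_one₀ (by norm_num) (by norm_num)
      have hrb : 0 < r * b := by positivity
      obtain ⟨η, hη⟩ := hK z (r / 2 * (1 + b / 8)) (r / 2 * (1 + b / 4)) (by positivity)
        (by nlinarith)
      have h1 := volume_pow_le_of_radialCutoff hd hE
        (show r / 2 * (1 + b / 4) < r / 2 * (1 + b / 2) by nlinarith) hη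
      have h2 := hcut (r / 2 * (1 + b / 2)) (r / 2 * (1 + b)) (by nlinarith) (by nlinarith)
        (by nlinarith)
      have e1 : 2 * K / (r / 2 * (1 + b) - r / 2 * (1 + b / 2)) = 8 * K / (r * b) := by
        rw [show r / 2 * (1 + b) - r / 2 * (1 + b / 2) = r * b / 4 by ring, div_eq_div_iff
          (by positivity) (by positivity)]
        ring
      have e2 : K / (r / 2 * (1 + b / 4) - r / 2 * (1 + b / 8)) = 16 * K / (r * b) := by
        rw [show r / 2 * (1 + b / 4) - r / 2 * (1 + b / 8) = r * b / 16 by ring, div_eq_div_iff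
          (by positivity) (by positivity)]
        ring
      rw [e1] at h2
      rw [e2, ← hC] at h1
      have h3 : (C : ℝ≥0∞) * (totalVar (E.indicator fun _ => (1 : ℝ))
            (Metric.ball z (r / 2 * (1 + b / 2)))
          + ENNReal.ofReal (16 * K / (r * b)) * volume (E ∩ Metric.closedBall z (r / 2 * (1 + b / 4))))
          ≤ ENNReal.ofReal (C' / (r * b) * (γ * q ^ j * r ^ (n + 1))) := by
        calc _ ≤ (C : ℝ≥0∞) * (ENNReal.ofReal (8 * K / (r * b))
              * ENNReal.ofReal (γ * q ^ j * r ^ (n + 1))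
            + ENNReal.ofReal (16 * K / (r * b)) * ENNReal.ofReal (γ * q ^ j * r ^ (n + 1))) := by
              gcongr
              · exact h2.trans (by gcongr)
              · exact (hmono (by nlinarith)).trans ih
          _ = ENNReal.ofReal (C * (24 * K) / (r * b) * (γ * q ^ j * r ^ (n + 1))) := by
              rw [← add_mul, ← ENNReal.ofReal_add (by positivity) (by positivity),
                ← ENNReal.ofReal_mul (by positivity), ← ENNReal.ofReal_coe_nnreal,
                ← ENNReal.ofReal_mul (by positivity)]
              congr 1
              ring
          _ ≤ _ := by
              refine ENNReal.ofReal_le_ofReal ?_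
              gcongr
              rw [hC']
              linarith
      have h4 : (C' / (r * b) * (γ * q ^ j * r ^ (n + 1))) ^ (n + 1)
          = (γ * q ^ (j + 1) * r ^ (n + 1)) ^ n := by
        have h5 : q ^ j = b ^ (n + 1) := by rw [hq, hb, ← pow_mul, ← pow_mul, mul_comm]
        have h6 : C' ^ (n + 1) * γ = q ^ n := by rw [hγ]; field_simp
        rw [h5, pow_succ q j, h5]
        have e3 : C' / (r * b) * (γ * b ^ (n + 1) * r ^ (n + 1)) = C' * γ * b ^ n * r ^ n := by
          rw [div_mul_eq_mul_div, div_eq_iff hrb.ne']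
          ring
        rw [e3]
        calc (C' * γ * b ^ n * r ^ n) ^ (n + 1)
            = (C' ^ (n + 1) * γ) * γ ^ n * (b ^ n * r ^ n) ^ (n + 1) := by ring_nf
          _ = _ := by rw [h6]; ring_nf
      have h5 : volume (E ∩ Metric.closedBall z (r / 2 * (1 + b / 8))) ^ n
          ≤ ENNReal.ofReal (γ * q ^ (j + 1) * r ^ (n + 1)) ^ n := by
        rw [← ENNReal.ofReal_pow (by positivity), ← h4, ENNReal.ofReal_pow (by positivity)]
        rw [Nat.add_sub_cancel] at h1
        exact h1.trans (pow_le_pow_left' h3 _)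
      have h6 := (ENNReal.pow_right_strictMono hn).le_iff_le.mp h5
      rwa [show b / 8 = (1 / 8) ^ (j + 1) by rw [pow_succ]; ring] at h6
  have hlim : Tendsto (fun j : ℕ => ENNReal.ofReal (γ * q ^ j * r ^ (n + 1))) atTop (𝓝 0) := by
    have h1 := ((tendsto_pow_atTop_nhds_zero_of_lt_one hq0.le hq1).const_mul γ).mul_const
      (r ^ (n + 1))
    have h2 := (ENNReal.continuous_ofReal.tendsto _).comp h1
    simpa [Function.comp_def] using h2
  refine le_antisymm (ge_of_tendsto' hlim fun j => (hmono ?_).trans (hstep j)) bot_le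
  have : (0 : ℝ) < (1 / 8) ^ j := by positivity
  nlinarith

/-! ### Densities -/

lemma volume_closedBall_eq (z : Sp d) {r : ℝ} (hr : 0 ≤ r) :
    volume (Metric.closedBall z r) = ENNReal.ofReal (r ^ d) * volume (Metric.ball (0 : Sp d) 1) := by
  rw [Measure.addHaar_closedBall volume z hr, finrank_euclideanSpace_fin]

/-- The volume of the unit ball. -/
noncomputable def ballVol (d : ℕ) : ℝ := volume.real (Metric.ball (0 : Sp d) 1)

lemma ballVol_pos (d : ℕ) : 0 < ballVol d :=
  ENNReal.toReal_pos (Metric.measure_ball_pos _ _ one_pos).ne' measure_ball_lt_top.ne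

lemma volume_closedBall (z : Sp d) {r : ℝ} (hr : 0 ≤ r) :
    volume (Metric.closedBall z r) = ENNReal.ofReal (ballVol d * r ^ d) := by
  rw [volume_closedBall_eq z hr, mul_comm, ENNReal.ofReal_mul (ballVol_pos d).le, ballVol,
    ofReal_measureReal measure_ball_lt_top.ne]

lemma volume_ball (z : Sp d) {r : ℝ} (hr : 0 < r) :
    volume (Metric.ball z r) = ENNReal.ofReal (ballVol d * r ^ d) := by
  rw [Measure.addHaar_ball_of_pos volume z hr, finrank_euclideanSpace_fin, mul_comm,
    ENNReal.ofReal_mul (ballVol_pos d).le, ballVol, ofReal_measureReal measure_ball_lt_top.ne]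

lemma measureReal_closedBall (z : Sp d) {r : ℝ} (hr : 0 ≤ r) :
    volume.real (Metric.closedBall z r) = ballVol d * r ^ d := by
  have := ballVol_pos d
  rw [measureReal_def, volume_closedBall z hr, ENNReal.toReal_ofReal (by positivity)]

lemma measureReal_inter_add_diff {E : Set (Sp d)} (hE : NullMeasurableSet E volume) (z : Sp d)
    {r : ℝ} (hr : 0 ≤ r) : volume.real (Metric.closedBall z r ∩ E)
      + volume.real (Metric.closedBall z r \ E) = ballVol d * r ^ d := by
  rw [← measureReal_closedBall z hr]
  exact measureReal_inter_add_sdiff₀ hE measure_closedBall_lt_top.ne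

/-- Between two radii the volume changes by at most the volume of the shell, and this is continuous.
-/
lemma continuousOn_measureReal_closedBall_inter (E : Set (Sp d)) (z : Sp d) :
    ContinuousOn (fun r => volume.real (Metric.closedBall z r ∩ E)) (Ioi 0) := by
  have key : ∀ r s : ℝ, 0 < r → r ≤ s → |volume.real (Metric.closedBall z s ∩ E)
      - volume.real (Metric.closedBall z r ∩ E)| ≤ |ballVol d * s ^ d - ballVol d * r ^ d| := by
    intro r s hr hrs
    have hsub := Metric.closedBall_subset_closedBall (x := z) hrs
    have h1 : volume.real (Metric.closedBall z r ∩ E) ≤ volume.real (Metric.closedBall z s ∩ E) :=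
      measureReal_mono (inter_subset_inter_left _ hsub)
        (measure_ne_top_of_subset inter_subset_left measure_closedBall_lt_top.ne)
    have h2 : volume.real (Metric.closedBall z s ∩ E) ≤ volume.real (Metric.closedBall z r ∩ E)
        + volume.real (Metric.closedBall z s \ Metric.closedBall z r) := by
      refine (measureReal_mono ?_ ?_).trans (measureReal_union_le _ _)
      · intro x hx
        by_cases h : x ∈ Metric.closedBall z r
        · exact Or.inl ⟨h, hx.2⟩
        · exact Or.inr ⟨hx.1, h⟩
      · exact measure_union_ne_top
          (measure_ne_top_of_subset inter_subset_left measure_closedBall_lt_top.ne)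
          (measure_ne_top_of_subset sdiff_subset measure_closedBall_lt_top.ne)
    rw [measureReal_sdiff hsub Metric.isClosed_closedBall.measurableSet measure_closedBall_lt_top.ne,
      measureReal_closedBall z hr.le, measureReal_closedBall z (hr.le.trans hrs)] at h2
    rw [abs_of_nonneg (by linarith)]
    exact le_trans (by linarith) (le_abs_self _)
  intro r hr
  refine ContinuousAt.continuousWithinAt ?_
  have hc : Tendsto (fun s : ℝ => |ballVol d * s ^ d - ballVol d * r ^ d|) (𝓝 r) (𝓝 0) := by
    have : Continuous fun s : ℝ => |ballVol d * s ^ d - ballVol d * r ^ d| := by fun_prop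
    simpa using this.tendsto r
  rw [ContinuousAt, tendsto_iff_dist_tendsto_zero]
  refine squeeze_zero' (Eventually.of_forall fun _ => dist_nonneg) ?_ hc
  filter_upwards [lt_mem_nhds hr] with s hs
  rw [Real.dist_eq]
  rcases le_total r s with h | h
  · exact key r s hr h
  · rw [abs_sub_comm, abs_sub_comm (ballVol d * s ^ d)]
    exact key s r hs h

/-- Between a scale where a set occupies at least half of a ball and a scale where it occupies at
most half of it, there is a scale where it occupies exactly half of it. -/
lemma exists_half_density {E : Set (Sp d)} {z : Sp d}
    {ρ r₁ r₂ : ℝ} (h₁ : r₁ ∈ Ioo 0 ρ) (h₂ : r₂ ∈ Ioo 0 ρ)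
    (hle : volume.real (Metric.closedBall z r₁ ∩ E) ≤ volume.real (Metric.closedBall z r₁ \ E))
    (hge : volume.real (Metric.closedBall z r₂ \ E) ≤ volume.real (Metric.closedBall z r₂ ∩ E)) :
    ∃ r ∈ Ioo 0 ρ, volume.real (Metric.closedBall z r ∩ E)
      = volume.real (Metric.closedBall z r \ E) := by
  have hsub : Ioo (0 : ℝ) ρ ⊆ Ioi 0 := fun x hx => hx.1
  obtain ⟨r, hr, hr2⟩ := isPreconnected_Ioo.intermediate_value₂ h₁ h₂
    ((continuousOn_measureReal_closedBall_inter E z).mono hsub)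
    ((continuousOn_measureReal_closedBall_inter Eᶜ z).mono hsub) hle hge
  exact ⟨r, hr, hr2⟩

/-- The perimeter has positive upper density at `z`. -/
def HasPosDensity (p : Sp d → ℝ → ℝ≥0∞) (z : Sp d) : Prop :=
  ∃ ε : ℝ, 0 < ε ∧ ∀ ρ > 0, ∃ r, 0 < r ∧ r < ρ ∧ ENNReal.ofReal (ε * r ^ (d - 1)) ≤ p z r

/-- The relative isoperimetric inequality, solved for the perimeter. It is stated for open balls;
spheres are null, so the shares of closed balls may be inserted. -/
lemma totalVar_ball_ge {E : Set (Sp d)} (hd : 1 ≤ d) (hE : NullMeasurableSet E volume) (z : Sp d)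
    {r a : ℝ} (hr : 0 < r) (ha : 0 ≤ a)
    (h1 : a * r ^ d ≤ volume.real (Metric.closedBall z r ∩ E))
    (h2 : a * r ^ d ≤ volume.real (Metric.closedBall z r \ E)) {s : ℝ} (hs : r < s) :
    ENNReal.ofReal (a ^ 2 / (2 ^ (d + 2) * ballVol d) * r ^ (d - 1))
      ≤ totalVar (E.indicator fun _ => (1 : ℝ)) (Metric.ball z s) := by
  by_cases hfin : totalVar (E.indicator fun _ => (1 : ℝ)) (Metric.ball z s) = ⊤
  · simp [hfin]
  have hω := ballVol_pos d
  have hae : (Metric.closedBall z r : Set (Sp d)) =ᵐ[volume] Metric.ball z r := by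
    refine (ae_eq_of_subset_of_measure_ge Metric.ball_subset_closedBall ?_
      measurableSet_ball.nullMeasurableSet measure_closedBall_lt_top.ne).symm
    rw [volume_ball z hr, volume_closedBall z hr.le]
  have key := volume_mul_volume_le_totalVar hE z hs
  rw [← measure_congr (hae.inter (ae_eq_refl E)), ← measure_congr (hae.diff (ae_eq_refl E)),
    volume_ball z hr, ← ENNReal.ofReal_toReal hfin, ← ofReal_measureReal
      (measure_ne_top_of_subset inter_subset_left measure_closedBall_lt_top.ne),
    ← ofReal_measureReal (measure_ne_top_of_subset sdiff_subset measure_closedBall_lt_top.ne),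
    ← ENNReal.ofReal_mul measureReal_nonneg] at key
  have hR : ∀ P : ℝ, 0 ≤ P → 2 * (ENNReal.ofReal (ballVol d * r ^ d) * (2 ^ d *
      ENNReal.ofReal (2 * r) * ENNReal.ofReal P))
      = ENNReal.ofReal (2 * (ballVol d * r ^ d * (2 ^ d * (2 * r) * P))) := by
    intro P hP
    rw [ENNReal.ofReal_mul (q := ballVol d * r ^ d * _) zero_le_two, ENNReal.ofReal_mul (p := ballVol d * r ^ d) (by positivity),
      ENNReal.ofReal_mul (p := 2 ^ d * (2 * r)) (by positivity),
      ENNReal.ofReal_mul (p := 2 ^ d) (by positivity), ENNReal.ofReal_pow zero_le_two,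
      ENNReal.ofReal_ofNat]
  rw [hR _ ENNReal.toReal_nonneg, ENNReal.ofReal_le_ofReal_iff (by positivity)] at key
  set P := (totalVar (E.indicator fun _ => (1 : ℝ)) (Metric.ball z s)).toReal with hP
  refine (ENNReal.ofReal_le_iff_le_toReal hfin).mpr ?_
  rw [← hP]
  have h3 : (a * r ^ d) * (a * r ^ d) ≤ 2 * (ballVol d * r ^ d * (2 ^ d * (2 * r) * P)) :=
    (mul_le_mul h1 h2 (by positivity) measureReal_nonneg).trans key
  have hrd : r ^ d = r ^ (d - 1) * r := by
    rw [← pow_succ]; congr 1; omega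
  rw [div_mul_eq_mul_div, div_le_iff₀ (by positivity)]
  have h4 : (r ^ d * r) * (a ^ 2 * r ^ (d - 1)) ≤ (r ^ d * r) * (P * (2 ^ (d + 2) * ballVol d)) := by
    calc (r ^ d * r) * (a ^ 2 * r ^ (d - 1)) = (a * r ^ d) * (a * (r ^ (d - 1) * r)) := by ring
      _ = (a * r ^ d) * (a * r ^ d) := by rw [← hrd]
      _ ≤ _ := h3
      _ = _ := by ring
  exact le_of_mul_le_mul_left h4 (by positivity)

lemma frequently_of_limsup_pos {E : Set (Sp d)} {z : Sp d}
    (h : 0 < limsup (fun r : ℝ => volume (Metric.closedBall z r ∩ E) / ENNReal.ofReal (r ^ d))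
      (𝓝[>] 0)) :
    ∃ a : ℝ, 0 < a ∧ ∀ ρ > 0, ∃ r ∈ Ioo 0 ρ, a * r ^ d ≤ volume.real (Metric.closedBall z r ∩ E) := by
  obtain ⟨b, hb0, hb⟩ := exists_between h
  have hf := frequently_lt_of_lt_limsup (by isBoundedDefault) hb
  by_cases hbt : b = ⊤
  · exact absurd (hbt ▸ hb) (by simp)
  refine ⟨b.toReal, ENNReal.toReal_pos hb0.ne' hbt, fun ρ hρ => ?_⟩
  obtain ⟨r, h1, h2⟩ := (hf.and_eventually (Ioo_mem_nhdsGT hρ)).exists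
  refine ⟨r, h2, ?_⟩
  have hr : 0 < r ^ d := pow_pos h2.1 d
  rw [ENNReal.lt_div_iff_mul_lt (Or.inl (by simpa using hr)) (Or.inl ENNReal.ofReal_ne_top)] at h1
  have h3 := ENNReal.toReal_mono
    (measure_ne_top_of_subset inter_subset_left measure_closedBall_lt_top.ne) h1.le
  rwa [ENNReal.toReal_mul, ENNReal.toReal_ofReal hr.le] at h3

/-- At a point of the measure theoretic boundary, there are arbitrarily small scales at which both
the set and its complement occupy a fixed proportion of the ball. -/
lemma exists_scale_of_mem_essBoundary {E : Set (Sp d)} (hE : NullMeasurableSet E volume) {z : Sp d}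
    (hz : z ∈ essBoundary E) : ∃ a : ℝ, 0 < a ∧ ∀ ρ > 0, ∃ r ∈ Ioo 0 ρ,
      a * r ^ d ≤ volume.real (Metric.closedBall z r ∩ E) ∧
      a * r ^ d ≤ volume.real (Metric.closedBall z r \ E) := by
  obtain ⟨a, ha, hA⟩ := frequently_of_limsup_pos hz.1
  obtain ⟨b, hb, hB⟩ := frequently_of_limsup_pos (E := Eᶜ) hz.2
  have hω := ballVol_pos d
  -- The sequences of scales for E and for its complement need not coincide. If neither scale serves
  -- both sets, E is below half of one ball and above half of the other, so that some scale in
  -- between gives each exactly half; this is where `ballVol d / 2` enters.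
  refine ⟨min (min a b) (ballVol d / 2), by positivity, fun ρ hρ => ?_⟩
  obtain ⟨r₁, hr₁, h1⟩ := hA ρ hρ
  obtain ⟨r₂, hr₂, h2⟩ := hB ρ hρ
  set c := min (min a b) (ballVol d / 2) with hc
  have hca : c ≤ a := (min_le_left _ _).trans (min_le_left _ _)
  have hcb : c ≤ b := (min_le_left _ _).trans (min_le_right _ _)
  have hcω : c ≤ ballVol d / 2 := min_le_right _ _
  by_cases hex : c * r₁ ^ d ≤ volume.real (Metric.closedBall z r₁ \ E)
  · exact ⟨r₁, hr₁, (mul_le_mul_of_nonneg_right hca (pow_pos hr₁.1 d).le).trans h1, hex⟩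
  by_cases hex2 : c * r₂ ^ d ≤ volume.real (Metric.closedBall z r₂ ∩ E)
  · exact ⟨r₂, hr₂, hex2, (mul_le_mul_of_nonneg_right hcb (pow_pos hr₂.1 d).le).trans h2⟩
  push Not at hex hex2
  have e1 := measureReal_inter_add_diff hE z hr₁.1.le
  have e2 := measureReal_inter_add_diff hE z hr₂.1.le
  have p1 := pow_pos hr₁.1 d
  have p2 := pow_pos hr₂.1 d
  obtain ⟨r, hr, h⟩ := exists_half_density (E := E) hr₂ hr₁ (by nlinarith) (by nlinarith)
  have e := measureReal_inter_add_diff hE z hr.1.le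
  have p := pow_pos hr.1 d
  exact ⟨r, hr, by nlinarith, by nlinarith⟩

/-- The isoperimetric bound at radius r controls the perimeter in any larger ball; reading it at
radius 2 r costs the factor 2^{d-1}. -/
lemma hasPosDensity_of_mem_essBoundary (hd : 1 ≤ d) {E : Set (Sp d)}
    (hE : NullMeasurableSet E volume) {z : Sp d} (hz : z ∈ essBoundary E) :
    HasPosDensity (fun z r => totalVar (E.indicator fun _ => (1 : ℝ)) (Metric.ball z r)) z := by
  obtain ⟨a, ha, h⟩ := exists_scale_of_mem_essBoundary hE hz
  have hω := ballVol_pos d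
  refine ⟨a ^ 2 / (2 ^ (d + 2) * ballVol d) / 2 ^ (d - 1), by positivity, fun ρ hρ => ?_⟩
  obtain ⟨r, hr, h1, h2⟩ := h (ρ / 2) (by positivity)
  refine ⟨2 * r, by linarith [hr.1], by linarith [hr.2], ?_⟩
  refine le_trans (le_of_eq ?_) (totalVar_ball_ge hd hE z hr.1 ha.le h1 h2
    (show r < 2 * r by linarith [hr.1]))
  congr 1
  rw [mul_pow]
  field_simp

end Cascade

namespace Cascade

variable {d : ℕ}

/-! ### The one-dimensional case -/

lemma enorm_sub_le_lintegral_fderiv_one {v : Sp 1 → ℝ} (hv : ContDiff ℝ ∞ v) {z x y : Sp 1} {r : ℝ}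
    (hx : x ∈ Metric.ball z r) (hy : y ∈ Metric.ball z r) :
    ‖v x - v y‖ₑ ≤ ∫⁻ p in Metric.ball z r, ‖fderiv ℝ v p‖ₑ := by
  set e : ℝ → Sp 1 := fun t => WithLp.toLp 2 fun _ => t with he
  have hmp : MeasurePreserving e volume volume :=
    (EuclideanSpace.volume_preserving_symm_measurableEquiv_toLp (Fin 1)).symm.comp
      (volume_preserving_funUnique (Fin 1) ℝ).symm
  have hnorm : ∀ p : Sp 1, ‖p‖ = |p 0| := fun p => by
    rw [EuclideanSpace.norm_eq]; simp [Real.sqrt_sq_eq_abs]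
  have hsurj : ∀ p : Sp 1, e (p 0) = p := fun p => by
    ext i; rw [Subsingleton.elim i 0]
  have hlin : ∀ s t : ℝ, e t = e s + (t - s) • e 1 := fun s t => by
    ext i; simp [he]
  have he1 : ‖e 1‖ = 1 := by rw [hnorm]; simp [he]
  have hder : ∀ t, HasDerivAt (fun t => v (e t)) (fderiv ℝ v (e t) (e 1)) t := by
    intro t
    have h1 : HasDerivAt e (e 1) t := by
      have h2 : HasDerivAt (fun s : ℝ => e 0 + (s - 0) • e 1) ((1 : ℝ) • e 1) t :=
        (((hasDerivAt_id t).sub_const 0).smul_const (e 1)).const_add (e 0)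
      rw [one_smul] at h2
      exact h2.congr_of_eventuallyEq (Eventually.of_forall fun s => hlin 0 s)
    exact (hv.differentiable (by simp) _).hasFDerivAt.comp_hasDerivAt t h1
  have hec : Continuous e := by
    have h2 : e = fun t => e 0 + (t - 0) • e 1 := funext (hlin 0)
    rw [h2]; fun_prop
  have hdc : Continuous fun p => ‖fderiv ℝ v p‖ₑ := (hv.continuous_fderiv (by simp)).enorm
  have hc : Continuous fun t => fderiv ℝ v (e t) (e 1) := by
    have := hv.continuous_fderiv (by simp)
    fun_prop
  have h1 := intervalIntegral.integral_eq_sub_of_hasDerivAt (a := y 0) (b := x 0)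
    (fun t _ => hder t) (hc.intervalIntegrable _ _)
  rw [hsurj, hsurj] at h1
  have hmem : ∀ t, e t ∈ Metric.ball z r ↔ |t - z 0| < r := fun t => by
    rw [Metric.mem_ball, dist_eq_norm, hnorm]; simp [he]
  have hx' : |x 0 - z 0| < r := (hmem _).mp (by rwa [hsurj])
  have hy' : |y 0 - z 0| < r := (hmem _).mp (by rwa [hsurj])
  have hsub : uIoc (y 0) (x 0) ⊆ e ⁻¹' Metric.ball z r := by
    intro t ht
    rw [mem_preimage, hmem, abs_lt]
    rw [abs_lt] at hx' hy'
    rcases mem_uIoc.mp ht with h | h <;> constructor <;> linarith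
  calc ‖v x - v y‖ₑ = ‖∫ t in (y 0)..(x 0), fderiv ℝ v (e t) (e 1)‖ₑ := by rw [h1]
    _ ≤ ∫⁻ t in uIoc (y 0) (x 0), ‖fderiv ℝ v (e t) (e 1)‖ₑ := by
        have h3 : ‖∫ t in (y 0)..(x 0), fderiv ℝ v (e t) (e 1)‖ₑ
            = ‖∫ t in uIoc (y 0) (x 0), fderiv ℝ v (e t) (e 1)‖ₑ := by
          rw [← ofReal_norm, ← ofReal_norm, intervalIntegral.norm_integral_eq_norm_integral_uIoc]
        rw [h3]
        exact enorm_integral_le_lintegral_enorm _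
    _ ≤ ∫⁻ t in e ⁻¹' Metric.ball z r, ‖fderiv ℝ v (e t)‖ₑ := by
        refine (lintegral_mono_set hsub).trans (lintegral_mono fun t => ?_)
        refine (ContinuousLinearMap.le_opENorm _ _).trans (le_of_eq ?_)
        rw [← ofReal_norm (e 1), he1, ENNReal.ofReal_one, mul_one]
    _ = ∫⁻ p in Metric.ball z r, ‖fderiv ℝ v p‖ₑ :=
        hmp.setLIntegral_comp_preimage measurableSet_ball hdc.measurable

/-- In dimension one a jump costs one, whatever the scale: the mollified indicators tend to 1 at
some point of E and to 0 at some point outside, and their variation over the interval dominates the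
difference. -/
lemma one_le_totalVar_ball {E : Set (Sp 1)} (hE : NullMeasurableSet E volume) {z : Sp 1} {r s : ℝ}
    (hrs : r < s) (h1 : volume (Metric.ball z r ∩ E) ≠ 0)
    (h2 : volume (Metric.ball z r \ E) ≠ 0) :
    1 ≤ totalVar (E.indicator fun _ => (1 : ℝ)) (Metric.ball z s) := by
  obtain ⟨v, hv1, -, hv3, hv4⟩ := exists_mollification (isBddMeas_indicator hE)
  obtain ⟨x, hx, hxl⟩ : ∃ x ∈ Metric.ball z r ∩ E, Tendsto (fun n => v n x) atTop
      (𝓝 (E.indicator (fun _ => (1 : ℝ)) x)) :=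
    ((frequently_ae_mem_iff.mpr h1).and_eventually hv3).exists
  obtain ⟨y, hy, hyl⟩ : ∃ y ∈ Metric.ball z r \ E, Tendsto (fun n => v n y) atTop
      (𝓝 (E.indicator (fun _ => (1 : ℝ)) y)) :=
    ((frequently_ae_mem_iff.mpr h2).and_eventually hv3).exists
  rw [indicator_of_mem hx.2] at hxl
  rw [indicator_of_notMem hy.2] at hyl
  have hlim := (hxl.sub hyl).enorm
  rw [sub_zero, enorm_one] at hlim
  have h3 : ∀ᶠ n : ℕ in atTop, 1 / ((n : ℝ) + 1) < s - r :=
    tendsto_one_div_add_atTop_nhds_zero_nat.eventually (gt_mem_nhds (by linarith))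
  refine le_of_tendsto hlim ?_
  filter_upwards [h3] with n hn
  refine (enorm_sub_le_lintegral_fderiv_one (hv1 n) hx.1 hy.1).trans
    ((hv4 n _ Metric.isOpen_ball).trans (totalVar_mono _ ?_))
  exact (Metric.thickening_ball z _ _).trans (Metric.ball_subset_ball (by linarith))

/-! ### The measure theoretic boundary has finite Hausdorff measure -/

lemma ofReal_rpow_natCast {r : ℝ} (hr : 0 ≤ r) (n : ℕ) :
    ENNReal.ofReal r ^ ((n : ℕ) : ℝ) = ENNReal.ofReal (r ^ n) := by
  rw [ENNReal.rpow_natCast, ENNReal.ofReal_pow hr]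

lemma sum_ofReal_rpow {F : Finset (Sp d × ℝ)} (h : ∀ p ∈ F, 0 < p.2) (n : ℕ) :
    ∑ p ∈ F, ENNReal.ofReal p.2 ^ ((n : ℕ) : ℝ) = ENNReal.ofReal (∑ p ∈ F, p.2 ^ n) := by
  rw [ENNReal.ofReal_sum_of_nonneg fun p hp => (pow_pos (h p hp) n).le]
  exact Finset.sum_congr rfl fun p hp => ofReal_rpow_natCast (h p hp).le n

set_option maxHeartbeats 400000 in
/-- Cutting finitely many disjoint balls out of a set of finite perimeter. -/
lemma sum_totalVar_ball_le {K : ℝ} {E : Set (Sp d)} (hE : NullMeasurableSet E volume)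
    (hfin : totalVar (E.indicator fun _ => (1 : ℝ)) univ ≠ ⊤)
    {ψ : Sp d → Sp d} (hψ : IsTestField univ ψ) {M e : ℝ} (hM : ∀ x, |divergence ψ x| ≤ M)
    (hψe : (totalVar (E.indicator fun _ => (1 : ℝ)) univ).toReal - e
      ≤ ∫ x, E.indicator (fun _ => (1 : ℝ)) x * divergence ψ x)
    (F : Finset (Sp d × ℝ)) (hpos : ∀ p ∈ F, 0 < p.2)
    (hdisj : (F : Set (Sp d × ℝ)).PairwiseDisjoint fun p => Metric.closedBall p.1 p.2)
    (σ : Sp d × ℝ → ℝ) (hσ : ∀ p ∈ F, σ p < p.2)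
    (η : Sp d × ℝ → Sp d → ℝ) (hη : ∀ p ∈ F, IsRadialCutoff K p.1 (σ p) p.2 (η p))
    (hcheap : ∀ p ∈ F, K / (p.2 - σ p) * volume.real
      (E ∩ (Metric.closedBall p.1 p.2 \ Metric.ball p.1 (σ p)))
      ≤ 1 / 2 * (totalVar (E.indicator fun _ => (1 : ℝ)) (Metric.ball p.1 (σ p))).toReal) :
    1 / 2 * ∑ p ∈ F, (totalVar (E.indicator fun _ => (1 : ℝ)) (Metric.ball p.1 (σ p))).toReal
      ≤ e + M * ∑ p ∈ F, ballVol d * p.2 ^ d := by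
  set f : Sp d → ℝ := E.indicator fun _ => (1 : ℝ) with hf
  have hfb : IsBddMeas f := isBddMeas_indicator hE
  -- One on the inner balls, zero off the outer ones. The field ψ is split into (1 - H) ψ and H ψ.
  set H : Sp d → ℝ := fun x => ∑ p ∈ F, η p x with hH
  have hHc : ContDiff ℝ 1 H := ContDiff.sum fun p hp => (hη p hp).contDiff
  have hH01 : ∀ x, H x ∈ Icc (0 : ℝ) 1 := by
    intro x
    by_cases hx : ∃ p ∈ F, x ∈ Metric.closedBall p.1 p.2
    · obtain ⟨p, hp, hxp⟩ := hx
      rw [hH]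
      simp only
      rw [Finset.sum_eq_single_of_mem p hp]
      · exact (hη p hp).mem_Icc x
      · intro q hq hqp
        exact (hη q hq).eq_zero fun h => (hdisj hq hp hqp).le_bot ⟨h, hxp⟩
    · rw [hH]
      simp only
      rw [Finset.sum_eq_zero fun p hp => (hη p hp).eq_zero fun h => hx ⟨p, hp, h⟩]
      simp
  have hH1 : ∀ p ∈ F, ∀ x ∈ Metric.ball p.1 (σ p), H x = 1 := by
    intro p hp x hx
    rw [hH]
    simp only
    rw [Finset.sum_eq_single_of_mem p hp]
    · exact (hη p hp).eq_one x (Metric.ball_subset_closedBall hx)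
    · intro q hq hqp
      refine (hη q hq).eq_zero fun h => (hdisj hq hp hqp).le_bot ⟨h, ?_⟩
      exact Metric.closedBall_subset_closedBall (hσ p hp).le (Metric.ball_subset_closedBall hx)
  -- Test fields may be supported in any set, open or not, so the closed complement of the inner
  -- balls is admissible in `totalVar` and disjoint from them.
  set V : Set (Sp d) := (⋃ p ∈ F, Metric.ball p.1 (σ p))ᶜ with hV
  have hVcl : IsClosed V := (isOpen_biUnion fun p _ => Metric.isOpen_ball).isClosed_compl
  -- the part away from the balls
  have htest : IsTestField V fun x => (1 - H x) • ψ x := by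
    have hsub : tsupport (fun x => (1 - H x) • ψ x) ⊆ tsupport ψ :=
      closure_mono fun x hx h0 => hx (by simp [h0])
    refine ⟨(contDiff_const.sub hHc).smul hψ.contDiff,
      hψ.compact.of_isClosed_subset (isClosed_tsupport _) hsub,
      closure_minimal (fun x hx => ?_) hVcl, fun x => ?_⟩
    · intro hxU
      obtain ⟨p, hp, hxp⟩ := mem_iUnion₂.mp hxU
      exact hx (by simp [hH1 p hp x hxp])
    · rw [norm_smul, Real.norm_of_nonneg (by linarith [(hH01 x).2])]
      exact mul_le_one₀ (by linarith [(hH01 x).1]) (norm_nonneg _) (hψ.norm_le x)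
  have hsplit : ∀ x, divergence ψ x = divergence (fun x => (1 - H x) • ψ x) x
      + divergence (fun x => H x • ψ x) x := by
    intro x
    rw [← divergence_add (φ := fun x => (1 - H x) • ψ x) (ψ := fun x => H x • ψ x) htest.contDiff
      (hHc.smul hψ.contDiff)]
    have hψeq : ψ = fun y => (1 - H y) • ψ y + H y • ψ y := by
      funext y
      rw [← add_smul, sub_add_cancel, one_smul]
    conv_lhs => rw [hψeq]
  have hcH : HasCompactSupport fun x => H x • ψ x :=
    hψ.compact.of_isClosed_subset (isClosed_tsupport _)
      (closure_mono fun x hx h0 => hx (by simp only [h0, smul_zero]))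
  have hHψ : ContDiff ℝ 1 fun x => H x • ψ x := hHc.smul hψ.contDiff
  have hint1 : Integrable fun x => f x * divergence (fun x => (1 - H x) • ψ x) x :=
    hfb.integrable_mul (integrable_divergence htest.contDiff htest.compact)
  have hint2 : Integrable fun x => f x * divergence (fun x => H x • ψ x) x :=
    hfb.integrable_mul (integrable_divergence hHψ hcH)
  have hPV : totalVar f V ≠ ⊤ := ((totalVar_mono f (subset_univ V)).trans_lt
    (lt_top_iff_ne_top.mpr hfin)).ne
  have hPb : ∀ p ∈ F, totalVar f (Metric.ball p.1 (σ p)) ≠ ⊤ := fun p _ =>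
    ((totalVar_mono f (subset_univ _)).trans_lt (lt_top_iff_ne_top.mpr hfin)).ne
  -- superadditivity
  have hsuper : (totalVar f V).toReal + ∑ p ∈ F, (totalVar f (Metric.ball p.1 (σ p))).toReal
      ≤ (totalVar f univ).toReal := by
    set U : Option (Sp d × ℝ) → Set (Sp d) := fun o => o.elim V fun p => Metric.ball p.1 (σ p) with hU
    have h1 := sum_totalVar_le hfb (s := F.insertNone) (U := U) (V := univ) ?_ fun _ _ => subset_univ _
    · rw [Finset.sum_insertNone] at h1
      have h2 := ENNReal.toReal_mono hfin h1
      change (totalVar f V + ∑ p ∈ F, totalVar f (Metric.ball p.1 (σ p))).toReal ≤ _ at h2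
      rwa [ENNReal.toReal_add hPV (ENNReal.sum_ne_top.mpr hPb), ENNReal.toReal_sum hPb] at h2
    · have hVd : ∀ p ∈ F, Disjoint V (Metric.ball p.1 (σ p)) := fun p hp =>
        disjoint_left.mpr fun x hx hxp => hx (mem_biUnion hp hxp)
      intro a ha b hb hab
      cases a with
      | none =>
        cases b with
        | none => exact absurd rfl hab
        | some q => exact hVd q (Finset.some_mem_insertNone.mp hb)
      | some p =>
        cases b with
        | none => exact (hVd p (Finset.some_mem_insertNone.mp ha)).symm
        | some q =>
          have hpF := Finset.some_mem_insertNone.mp ha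
          have hqF := Finset.some_mem_insertNone.mp hb
          refine (hdisj hpF hqF fun h => hab (congrArg some h)).mono ?_ ?_
          · exact Metric.ball_subset_closedBall.trans
              (Metric.closedBall_subset_closedBall (hσ p hpF).le)
          · exact Metric.ball_subset_closedBall.trans
              (Metric.closedBall_subset_closedBall (hσ q hqF).le)
  have h1 := integral_le_totalVar f htest hPV
  -- the part in the balls
  have hballs : ∫ x, f x * divergence (fun x => H x • ψ x) x
      ≤ ∑ p ∈ F, (M * (ballVol d * p.2 ^ d) + K / (p.2 - σ p) * volume.real
        (E ∩ (Metric.closedBall p.1 p.2 \ Metric.ball p.1 (σ p)))) := by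
    have hM0 : 0 ≤ M := (abs_nonneg _).trans (hM 0)
    have hAm : ∀ p ∈ F, NullMeasurableSet (E ∩ (Metric.closedBall p.1 p.2 \ Metric.ball p.1 (σ p)))
        volume := fun p _ =>
      hE.inter (measurableSet_closedBall.diff measurableSet_ball).nullMeasurableSet
    have hAfin : ∀ p : Sp d × ℝ, volume (E ∩ (Metric.closedBall p.1 p.2 \ Metric.ball p.1 (σ p))) ≠ ⊤ :=
      fun p => measure_ne_top_of_subset (inter_subset_right.trans sdiff_subset)
        measure_closedBall_lt_top.ne
    have hI1 : ∀ p ∈ F, Integrable (fun x => (Metric.closedBall p.1 p.2).indicator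
        (fun _ => M) x) := fun p _ =>
      (integrable_indicator_iff measurableSet_closedBall).mpr
        (integrableOn_const measure_closedBall_lt_top.ne)
    have hI2 : ∀ p ∈ F, Integrable (fun x => (E ∩ (Metric.closedBall p.1 p.2 \
        Metric.ball p.1 (σ p))).indicator (fun _ => K / (p.2 - σ p)) x) := fun p hp =>
      (integrableOn_const (hAfin p)).integrable_indicator₀ (hAm p hp)
    calc ∫ x, f x * divergence (fun x => H x • ψ x) x
        ≤ ∫ x, ∑ p ∈ F, ((Metric.closedBall p.1 p.2).indicator (fun _ => M) x
          + (E ∩ (Metric.closedBall p.1 p.2 \ Metric.ball p.1 (σ p))).indicator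
            (fun _ => K / (p.2 - σ p)) x) := by
          refine integral_mono hint2 (integrable_finsetSum _ fun p hp => (hI1 p hp).add (hI2 p hp))
            fun x => ?_
          simp only
          rw [divergence_smul hHc hψ.contDiff]
          have hHd : fderiv ℝ H x = ∑ p ∈ F, fderiv ℝ (η p) x :=
            fderiv_fun_sum fun p hp => (hη p hp).contDiff.differentiable one_ne_zero x
          rw [hHd, hH, sum_apply, Finset.sum_mul, ← Finset.sum_add_distrib,
            Finset.mul_sum]
          refine Finset.sum_le_sum fun p hp => ?_
          have hK0 : 0 ≤ K / (p.2 - σ p) := (norm_nonneg _).trans ((hη p hp).norm_fderiv_le x)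
          rw [mul_add]
          refine add_le_add ?_ ?_
          · by_cases hx : x ∈ Metric.closedBall p.1 p.2
            · rw [indicator_of_mem hx]
              refine (le_abs_self _).trans ?_
              rw [abs_mul, abs_mul]
              have ha : |f x| ≤ 1 := by by_cases h : x ∈ E <;> simp [hf, h]
              have hb : |η p x| ≤ 1 := by
                rw [abs_of_nonneg ((hη p hp).mem_Icc x).1]; exact ((hη p hp).mem_Icc x).2
              calc |f x| * (|η p x| * |divergence ψ x|) ≤ 1 * (1 * M) := by
                    gcongr; exact hM x
                _ = M := by ring
            · rw [(hη p hp).eq_zero hx, indicator_of_notMem hx]; simp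
          · by_cases hx : x ∈ E ∩ (Metric.closedBall p.1 p.2 \ Metric.ball p.1 (σ p))
            · rw [indicator_of_mem hx, hf, indicator_of_mem hx.1, one_mul]
              refine (le_abs_self _).trans (((fderiv ℝ (η p) x).le_opNorm _).trans ?_)
              calc ‖fderiv ℝ (η p) x‖ * ‖ψ x‖ ≤ K / (p.2 - σ p) * 1 :=
                    mul_le_mul ((hη p hp).norm_fderiv_le x) (hψ.norm_le x) (norm_nonneg _) hK0
                _ = _ := mul_one _
            · rw [indicator_of_notMem hx]
              by_cases hxE : x ∈ E
              · rw [(hη p hp).fderiv_eq_zero fun h => hx ⟨hxE, h⟩]; simp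
              · simp [hf, hxE]
      _ = _ := by
          rw [integral_finsetSum F (f := fun (p : Sp d × ℝ) x =>
            (Metric.closedBall p.1 p.2).indicator (fun _ => M) x
            + (E ∩ (Metric.closedBall p.1 p.2 \ Metric.ball p.1 (σ p))).indicator
            (fun _ => K / (p.2 - σ p)) x) fun p hp => (hI1 p hp).add (hI2 p hp)]
          refine Finset.sum_congr rfl fun p hp => ?_
          rw [integral_add (hI1 p hp) (hI2 p hp), integral_indicator measurableSet_closedBall,
            integral_indicator₀ (hAm p hp), setIntegral_const, setIntegral_const,
            measureReal_closedBall p.1 (hpos p hp).le, smul_eq_mul, smul_eq_mul]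
          ring
  have h2 : ∫ x, f x * divergence ψ x = (∫ x, f x * divergence (fun x => (1 - H x) • ψ x) x)
      + ∫ x, f x * divergence (fun x => H x • ψ x) x := by
    rw [← integral_add hint1 hint2]
    congr 1
    funext x
    rw [hsplit x]
    ring
  have h3 : ∑ p ∈ F, (M * (ballVol d * p.2 ^ d) + K / (p.2 - σ p) * volume.real
        (E ∩ (Metric.closedBall p.1 p.2 \ Metric.ball p.1 (σ p))))
      ≤ M * ∑ p ∈ F, ballVol d * p.2 ^ d
        + 1 / 2 * ∑ p ∈ F, (totalVar f (Metric.ball p.1 (σ p))).toReal := by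
    rw [Finset.mul_sum, Finset.mul_sum, ← Finset.sum_add_distrib]
    exact Finset.sum_le_sum fun p hp => add_le_add le_rfl (hcheap p hp)
  -- Near-optimality of ψ and superadditivity leave Σ P(inner balls) - e ≤ ∫ f div(H ψ); by the
  -- cheapness of the cuts half of the sum returns on the right and is absorbed.
  linarith

end Cascade

/-! ### Boundary points of low density, and finiteness of the surface -/

namespace Cascade

variable {d : ℕ}

/-- Points at which a set of finite perimeter has small density at all small scales, although its
perimeter has positive density, form a Hausdorff null set. -/
lemma hausdorffMeasure_eq_zero_of_lowDensity (hd : 1 ≤ d) {K γ ε ρ₀ : ℝ} (hK0 : 0 < K)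
    (hK : ∀ (z : Sp d) (s' s : ℝ), 0 < s' → s' < s → ∃ η, IsRadialCutoff K z s' s η)
    {E : Set (Sp d)} (hE : NullMeasurableSet E volume)
    (hγ : ∀ (z : Sp d) (r : ℝ), 0 < r →
      volume (E ∩ Metric.closedBall z r) ≤ ENNReal.ofReal (γ * r ^ d) →
      (∀ s' s, r / 2 ≤ s' → s' < s → s ≤ r →
        totalVar (E.indicator fun _ => (1 : ℝ)) (Metric.ball z s') ≤
          ENNReal.ofReal (2 * K / (s - s')) * volume (E ∩ Metric.closedBall z s)) →
      volume (E ∩ Metric.closedBall z (r / 2)) = 0)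
    (hfin : totalVar (E.indicator fun _ => (1 : ℝ)) univ ≠ ⊤) (hε : 0 < ε) (hρ₀ : 0 < ρ₀)
    {Z : Set (Sp d)}
    (hZ1 : ∀ z ∈ Z, ∀ ρ > 0, ∃ r, 0 < r ∧ r < ρ ∧ ENNReal.ofReal (ε * r ^ (d - 1))
      ≤ totalVar (E.indicator fun _ => (1 : ℝ)) (Metric.ball z r))
    (hZ2 : ∀ z ∈ Z, ∀ r ∈ Ioo 0 ρ₀, volume (E ∩ Metric.closedBall z r) ≤ ENNReal.ofReal (γ * r ^ d)) :
    μH[((d - 1 : ℕ) : ℝ)] Z = 0 := by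
  set f : Sp d → ℝ := E.indicator fun _ => (1 : ℝ) with hf
  have hPfin : ∀ U, totalVar f U ≠ ⊤ := fun U =>
    ((totalVar_mono f (subset_univ U)).trans_lt (lt_top_iff_ne_top.mpr hfin)).ne
  set c : ℝ := ε / 2 ^ (d - 1) with hc
  have hc0 : 0 < c := by positivity
  -- A good radius s comes with an inner radius s' such that the perimeter in the inner ball is of
  -- order s^{d-1} and cutting through the shell costs at most half of that perimeter. The factor
  -- 2^{d-1} in c appears since s ≤ 2 r.
  set R : Sp d → ℝ → Prop := fun z s => ∃ s', 0 < s' ∧ s' < s ∧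
    c * s ^ (d - 1) ≤ (totalVar f (Metric.ball z s')).toReal ∧
    K / (s - s') * volume.real (E ∩ (Metric.closedBall z s \ Metric.ball z s'))
      ≤ 1 / 2 * (totalVar f (Metric.ball z s')).toReal with hR
  have hR1 : ∀ δ > 0, ∀ z ∈ Z, ∃ r, 0 < r ∧ r < δ ∧ R z r := by
    intro δ hδ z hz
    obtain ⟨r, hr0, hr, hr2⟩ := hZ1 z hz (min δ ρ₀ / 2) (by positivity)
    have hrδ : 2 * r < δ := by have := min_le_left δ ρ₀; linarith
    have hrρ : 2 * r < ρ₀ := by have := min_le_right δ ρ₀; linarith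
    have hne : volume (E ∩ Metric.closedBall z (2 * r / 2)) ≠ 0 := by
      intro h0
      have h1 : totalVar f (Metric.ball z r) = totalVar (fun _ => (0 : ℝ)) (Metric.ball z r) := by
        refine totalVar_congr ?_
        have h2 : ∀ᵐ x, x ∉ E ∩ Metric.closedBall z (2 * r / 2) := measure_eq_zero_iff_ae_notMem.mp h0
        filter_upwards [h2] with x hx hxb
        refine indicator_of_notMem (fun hxE => hx ⟨hxE, ?_⟩) _
        rw [mul_div_cancel_left₀ r two_ne_zero]
        exact Metric.ball_subset_closedBall hxb
      have h3 : totalVar (fun _ : Sp d => (0 : ℝ)) (Metric.ball z r) = 0 := by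
        simp [totalVar]
      rw [h1, h3] at hr2
      have : 0 < ε * r ^ (d - 1) := by positivity
      simp only [nonpos_iff_eq_zero, ENNReal.ofReal_eq_zero] at hr2
      linarith
    -- If cutting were expensive for all pairs of radii between r and 2 r, the De Giorgi threshold
    -- would make E null in the ball of radius r, where its perimeter is positive.
    have hex : ∃ s' s, 2 * r / 2 ≤ s' ∧ s' < s ∧ s ≤ 2 * r ∧
        ENNReal.ofReal (2 * K / (s - s')) * volume (E ∩ Metric.closedBall z s)
          < totalVar f (Metric.ball z s') := by
      by_contra hcon
      push Not at hcon
      exact hne (hγ z (2 * r) (by linarith) (hZ2 z hz _ ⟨by linarith, hrρ⟩)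
        fun s' s h1 h2 h3 => hcon s' s h1 h2 h3)
    obtain ⟨s', s, h1, h2, h3, h4⟩ := hex
    rw [mul_div_cancel_left₀ r two_ne_zero] at h1
    refine ⟨s, by linarith, by linarith, s', by linarith, h2, ?_, ?_⟩
    · have h5 := hr2.trans (totalVar_mono f (Metric.ball_subset_ball (x := z) h1))
      have h6 := (ENNReal.ofReal_le_iff_le_toReal (hPfin _)).mp h5
      refine le_trans ?_ h6
      rw [hc, div_mul_eq_mul_div, mul_div_assoc, ← div_pow]
      gcongr
      · linarith
      · linarith
    · have h5 := ENNReal.toReal_mono (hPfin _) h4.le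
      rw [ENNReal.toReal_mul, ENNReal.toReal_ofReal (div_nonneg (by linarith) (by linarith))] at h5
      have h6 : volume.real (E ∩ (Metric.closedBall z s \ Metric.ball z s'))
          ≤ (volume (E ∩ Metric.closedBall z s)).toReal :=
        ENNReal.toReal_mono (measure_ne_top_of_subset inter_subset_right
          measure_closedBall_lt_top.ne) (measure_mono (inter_subset_inter_right _ sdiff_subset))
      have h7 : 0 < K / (s - s') := div_pos hK0 (by linarith)
      have h8 := mul_le_mul_of_nonneg_left h6 h7.le
      rw [mul_div_assoc, mul_assoc] at h5
      linarith
  -- smallness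
  have hsmall : ∀ e : ℝ, 0 < e → μH[((d - 1 : ℕ) : ℝ)] Z
      ≤ 10 ^ ((d - 1 : ℕ) : ℝ) * ENNReal.ofReal (4 / c * e) := by
    intro e he
    obtain ⟨ψ, hψ, hψe⟩ := exists_testField hfin he
    obtain ⟨M, hM⟩ : ∃ M, ∀ x, |divergence ψ x| ≤ M := by
      obtain ⟨M, hM⟩ := (hasCompactSupport_divergence hψ.compact).exists_bound_of_continuous
        (continuous_divergence hψ.contDiff)
      exact ⟨M, hM⟩
    have hM0 : 0 ≤ M := (abs_nonneg _).trans (hM 0)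
    have hb := ballVol_pos d
    -- Below this radius the volume term M |B| is at most (c/4) r^{d-1}. It is absorbed, and c Σ
    -- r^{d-1} ≤ 4 e remains, with e arbitrarily small.
    refine hausdorffMeasure_le_of_disjoint_balls (Nat.cast_nonneg _) hR1
      ⟨c / (4 * (M * ballVol d + 1)), by positivity, fun F hF hdisj => ?_⟩
    have hpos : ∀ p ∈ F, 0 < p.2 := fun p hp => (hF p hp).2.1
    choose! σ hσ0 hσ1 hσ2 hσ3 using fun p (hp : p ∈ F) => (hF p hp).2.2.2
    choose! η hη using fun p (hp : p ∈ F) => hK p.1 (σ p) p.2 (hσ0 p hp) (hσ1 p hp)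
    have h1 := sum_totalVar_ball_le hE hfin hψ hM hψe F hpos hdisj σ hσ1 η hη hσ3
    rw [sum_ofReal_rpow hpos]
    refine ENNReal.ofReal_le_ofReal ?_
    have h2 : c * ∑ p ∈ F, p.2 ^ (d - 1)
        ≤ ∑ p ∈ F, (totalVar f (Metric.ball p.1 (σ p))).toReal := by
      rw [Finset.mul_sum]
      exact Finset.sum_le_sum hσ2
    have h3 : M * ∑ p ∈ F, ballVol d * p.2 ^ d ≤ c / 4 * ∑ p ∈ F, p.2 ^ (d - 1) := by
      rw [Finset.mul_sum, Finset.mul_sum]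
      refine Finset.sum_le_sum fun p hp => ?_
      have h4 : p.2 ^ d = p.2 ^ (d - 1) * p.2 := by
        rw [← pow_succ, Nat.sub_add_cancel hd]
      have h5 : (M * ballVol d) * p.2 ≤ c / 4 := by
        have h6 := (hF p hp).2.2.1.le
        rw [le_div_iff₀ (by positivity)] at h6
        nlinarith [hpos p hp]
      rw [h4]
      have h7 : 0 ≤ p.2 ^ (d - 1) := (pow_pos (hpos p hp) _).le
      calc M * (ballVol d * (p.2 ^ (d - 1) * p.2)) = M * ballVol d * p.2 * p.2 ^ (d - 1) := by ring
        _ ≤ c / 4 * p.2 ^ (d - 1) := mul_le_mul_of_nonneg_right h5 h7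
    have h8 : c * ∑ p ∈ F, p.2 ^ (d - 1) ≤ 4 * e := by linarith
    rw [div_mul_eq_mul_div, le_div_iff₀ hc0]
    linarith
  refine le_antisymm ?_ zero_le
  have hlim : Tendsto (fun e : ℝ => (10 : ℝ≥0∞) ^ ((d - 1 : ℕ) : ℝ) * ENNReal.ofReal (4 / c * e))
      (𝓝[>] 0) (𝓝 (10 ^ ((d - 1 : ℕ) : ℝ) * ENNReal.ofReal (4 / c * 0))) := by
    refine ENNReal.Tendsto.const_mul (ENNReal.tendsto_ofReal ?_) (Or.inr ?_)
    · exact ((continuous_const.mul continuous_id).tendsto (0 : ℝ)).mono_left nhdsWithin_le_nhds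
    · exact ENNReal.rpow_ne_top_of_nonneg (Nat.cast_nonneg _) (by simp)
  rw [mul_zero, ENNReal.ofReal_zero, mul_zero] at hlim
  exact ge_of_tendsto hlim (eventually_nhdsWithin_of_forall fun e he => hsmall e he)

/-- A set of positive perimeter density at a fixed rate has finite Hausdorff measure. -/
lemma hausdorffMeasure_lt_top_of_totalVar_ball_ge {E : Set (Sp d)} (hE : NullMeasurableSet E volume)
    (hfin : totalVar (E.indicator fun _ => (1 : ℝ)) univ ≠ ⊤) {ε : ℝ} (hε : 0 < ε)
    {Z : Set (Sp d)}
    (hZ : ∀ δ > 0, ∀ z ∈ Z, ∃ r, 0 < r ∧ r < δ ∧ ENNReal.ofReal (ε * r ^ (d - 1))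
      ≤ totalVar (E.indicator fun _ => (1 : ℝ)) (Metric.ball z r)) :
    μH[((d - 1 : ℕ) : ℝ)] Z < ⊤ := by
  set f : Sp d → ℝ := E.indicator fun _ => (1 : ℝ) with hf
  refine (hausdorffMeasure_le_of_disjoint_balls (M := ENNReal.ofReal ε⁻¹ * totalVar f univ)
    (Nat.cast_nonneg _) hZ ⟨1, one_pos, fun F hF hdisj => ?_⟩).trans_lt ?_
  · have hpos : ∀ p ∈ F, 0 < p.2 := fun p hp => (hF p hp).2.1
    have h1 := sum_totalVar_le (isBddMeas_indicator hE) (s := F)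
      (U := fun p => Metric.ball p.1 p.2) (V := univ)
      (fun a ha b hb hab => (hdisj ha hb hab).mono Metric.ball_subset_closedBall
        Metric.ball_subset_closedBall) fun _ _ => subset_univ _
    calc ∑ p ∈ F, ENNReal.ofReal p.2 ^ ((d - 1 : ℕ) : ℝ)
        ≤ ∑ p ∈ F, ENNReal.ofReal ε⁻¹ * totalVar f (Metric.ball p.1 p.2) := by
          refine Finset.sum_le_sum fun p hp => ?_
          rw [ofReal_rpow_natCast (hpos p hp).le]
          calc ENNReal.ofReal (p.2 ^ (d - 1))
              = ENNReal.ofReal ε⁻¹ * ENNReal.ofReal (ε * p.2 ^ (d - 1)) := by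
                rw [← ENNReal.ofReal_mul (by positivity)]
                congr 1
                field_simp
            _ ≤ _ := by gcongr; exact (hF p hp).2.2.2
      _ = ENNReal.ofReal ε⁻¹ * ∑ p ∈ F, totalVar f (Metric.ball p.1 p.2) := Finset.mul_sum .. |>.symm
      _ ≤ _ := by gcongr
  · exact ENNReal.mul_lt_top (ENNReal.rpow_lt_top_of_nonneg (Nat.cast_nonneg _) (by simp))
      (ENNReal.mul_lt_top ENNReal.ofReal_lt_top (lt_top_iff_ne_top.mpr hfin))

lemma totalVar_indicator_compl {E : Set (Sp d)} (hE : NullMeasurableSet E volume) (U : Set (Sp d)) :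
    totalVar (Eᶜ.indicator fun _ => (1 : ℝ)) U = totalVar (E.indicator fun _ => (1 : ℝ)) U := by
  rw [← totalVar_const_sub (isBddMeas_indicator hE) 1]
  congr 1
  funext x
  by_cases hx : x ∈ E <;> simp [hx]

/-- In `G`, where E and its complement both keep a fixed share of arbitrarily small balls, the
isoperimetric inequality gives perimeter at a uniform rate, and disjoint balls cannot use more than
the total perimeter. At the other boundary points E or its complement has small density at all small
scales while the perimeter has positive density. Such points are null, because the balls around them
could be cut out of the set with a gain of perimeter. -/
theorem hausdorffMeasure_essBoundary_lt_top (hd : 1 ≤ d) {E : Set (Sp d)}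
    (hE : HasFinitePerimeter E) : μH[((d - 1 : ℕ) : ℝ)] (essBoundary E) < ⊤ := by
  have hEm := hE.1
  have hfin : totalVar (E.indicator fun _ => (1 : ℝ)) univ ≠ ⊤ := by
    rw [totalVar_indicator_univ hE.1]; exact hE.2.ne
  rcases Nat.lt_or_ge 1 d with hd2 | hd1
  · obtain ⟨K, hK0, hK⟩ := exists_radialCutoff d
    obtain ⟨γ₀, hγ₀, hγ⟩ := exists_density_threshold hd2 hK0 hK
    have hb := ballVol_pos d
    -- The bound by half of the unit ball prevents E from being thin at some small scales and its
    -- complement at others: at a scale of equal shares in between, each share would be at least γ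
    -- r^d.
    set γ := min γ₀ (ballVol d / 2) with hγdef
    have hγ0 : 0 < γ := lt_min hγ₀ (by positivity)
    have hγ1 : γ ≤ ballVol d / 2 := min_le_right _ _
    have hthr : ∀ E' : Set (Sp d), NullMeasurableSet E' volume → ∀ (z : Sp d) (r : ℝ), 0 < r →
      volume (E' ∩ Metric.closedBall z r) ≤ ENNReal.ofReal (γ * r ^ d) →
      (∀ s' s, r / 2 ≤ s' → s' < s → s ≤ r →
        totalVar (E'.indicator fun _ => (1 : ℝ)) (Metric.ball z s') ≤
          ENNReal.ofReal (2 * K / (s - s')) * volume (E' ∩ Metric.closedBall z s)) →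
      volume (E' ∩ Metric.closedBall z (r / 2)) = 0 := by
      intro E' hE' z r hr h1 h2
      refine hγ E' hE' z r hr (h1.trans (ENNReal.ofReal_le_ofReal ?_)) h2
      gcongr
      exact min_le_left _ _
    set G : Set (Sp d) := {z | ∀ ρ > 0, ∃ r ∈ Ioo 0 ρ,
      γ * r ^ d ≤ volume.real (Metric.closedBall z r ∩ E) ∧
      γ * r ^ d ≤ volume.real (Metric.closedBall z r \ E)} with hG
    set B : Set (Sp d) → ℕ → Set (Sp d) := fun E' n => {z |
      (∀ ρ > 0, ∃ r, 0 < r ∧ r < ρ ∧ ENNReal.ofReal (1 / ((n : ℝ) + 1) * r ^ (d - 1))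
        ≤ totalVar (E'.indicator fun _ => (1 : ℝ)) (Metric.ball z r)) ∧
      ∀ r ∈ Ioo 0 (1 / ((n : ℝ) + 1)),
        volume (E' ∩ Metric.closedBall z r) ≤ ENNReal.ofReal (γ * r ^ d)} with hB
    have hBnull : ∀ E', NullMeasurableSet E' volume →
        totalVar (E'.indicator fun _ => (1 : ℝ)) univ ≠ ⊤ →
        μH[((d - 1 : ℕ) : ℝ)] (⋃ n, B E' n) = 0 := by
      intro E' hE' hfin'
      refine measure_iUnion_null fun n => ?_
      exact hausdorffMeasure_eq_zero_of_lowDensity hd hK0 hK hE' (hthr E' hE') hfin'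
        (ε := 1 / ((n : ℝ) + 1)) (ρ₀ := 1 / ((n : ℝ) + 1)) (by positivity) (by positivity)
        (fun z hz => hz.1) (fun z hz => hz.2)
    have hGfin : μH[((d - 1 : ℕ) : ℝ)] G < ⊤ := by
      refine hausdorffMeasure_lt_top_of_totalVar_ball_ge hEm hfin
        (ε := γ ^ 2 / (2 ^ (d + 2) * ballVol d) / 2 ^ (d - 1)) (by positivity) fun δ hδ z hz => ?_
      obtain ⟨r, hr, h1, h2⟩ := hz (δ / 2) (by positivity)
      refine ⟨2 * r, by linarith [hr.1], by linarith [hr.2], ?_⟩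
      refine le_trans (le_of_eq ?_) (totalVar_ball_ge hd hEm z hr.1 hγ0.le h1 h2
        (by linarith [hr.1] : r < 2 * r))
      congr 1
      rw [mul_pow]
      field_simp
    have hcov : essBoundary E ⊆ G ∪ ((⋃ n, B E n) ∪ ⋃ n, B Eᶜ n) := by
      intro z hz
      by_cases hzG : z ∈ G
      · exact Or.inl hzG
      right
      obtain ⟨ε, hε, hε2⟩ := hasPosDensity_of_mem_essBoundary hd hEm hz
      rw [hG, mem_ofPred_eq] at hzG
      push Not at hzG
      obtain ⟨ρ, hρ, hρ2⟩ := hzG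
      have key : ∀ E' : Set (Sp d), (∀ U, totalVar (E'.indicator fun _ => (1 : ℝ)) U
          = totalVar (E.indicator fun _ => (1 : ℝ)) U) →
          (∀ r ∈ Ioo 0 ρ, volume.real (E' ∩ Metric.closedBall z r) < γ * r ^ d) →
          z ∈ ⋃ n, B E' n := by
        intro E' htv hlow
        obtain ⟨n, hn⟩ := exists_nat_one_div_lt (lt_min hε hρ)
        refine mem_iUnion.mpr ⟨n, fun ρ' hρ' => ?_, fun r hr => ?_⟩
        · obtain ⟨r, hr0, hr1, hr2⟩ := hε2 ρ' hρ'
          refine ⟨r, hr0, hr1, ?_⟩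
          rw [htv]
          refine le_trans (ENNReal.ofReal_le_ofReal ?_) hr2
          gcongr
          exact hn.le.trans (min_le_left _ _)
        · have := (hlow r ⟨hr.1, hr.2.trans (hn.trans_le (min_le_right _ _))⟩).le
          refine (ENNReal.le_ofReal_iff_toReal_le ?_ ?_).mpr this
          · exact measure_ne_top_of_subset inter_subset_right measure_closedBall_lt_top.ne
          · have := hr.1; positivity
      by_cases hall : ∀ r ∈ Ioo 0 ρ, volume.real (Metric.closedBall z r ∩ E) < γ * r ^ d
      · refine Or.inl (key E (fun _ => rfl) fun r hr => ?_)
        rw [inter_comm]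
        exact hall r hr
      · refine Or.inr (key Eᶜ (totalVar_indicator_compl hEm) fun r hr => ?_)
        push Not at hall
        obtain ⟨r₂, hr₂, h2⟩ := hall
        by_contra hcon
        push Not at hcon
        rw [inter_comm, ← sdiff_eq] at hcon
        have hsum := measureReal_inter_add_diff hEm z hr.1.le
        have hsum2 := measureReal_inter_add_diff hEm z hr₂.1.le
        have h3 : volume.real (Metric.closedBall z r ∩ E) < γ * r ^ d := by
          by_contra h; push Not at h
          exact absurd (hρ2 r hr h) (not_lt.mpr hcon)
        have h4 := hρ2 r₂ hr₂ h2
        have h5 : γ * r ^ d ≤ ballVol d * r ^ d / 2 := by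
          have := mul_le_mul_of_nonneg_right hγ1 (pow_pos hr.1 d).le; linarith
        have h6 : γ * r₂ ^ d ≤ ballVol d * r₂ ^ d / 2 := by
          have := mul_le_mul_of_nonneg_right hγ1 (pow_pos hr₂.1 d).le; linarith
        obtain ⟨t, ht, hteq⟩ := exists_half_density (E := E) (z := z) hr hr₂ (by linarith)
          (by linarith)
        have h7 := measureReal_inter_add_diff hEm z ht.1.le
        have h8 : γ * t ^ d ≤ ballVol d * t ^ d / 2 := by
          have := mul_le_mul_of_nonneg_right hγ1 (pow_pos ht.1 d).le; linarith
        have := hρ2 t ht (by linarith)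
        linarith
    calc μH[((d - 1 : ℕ) : ℝ)] (essBoundary E)
        ≤ μH[((d - 1 : ℕ) : ℝ)] G + (μH[((d - 1 : ℕ) : ℝ)] (⋃ n, B E n)
          + μH[((d - 1 : ℕ) : ℝ)] (⋃ n, B Eᶜ n)) :=
          (measure_mono hcov).trans ((measure_union_le _ _).trans
            (add_le_add le_rfl (measure_union_le _ _)))
      _ < ⊤ := by
          rw [hBnull E hEm hfin, hBnull Eᶜ hEm.compl (by rwa [totalVar_indicator_compl hEm])]
          simpa using hGfin
  · obtain rfl : d = 1 := le_antisymm hd1 hd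
    -- For d = 1 the exponent d - 1 vanishes, so the rate is the constant 1; Sobolev's inequality is
    -- not needed.
    refine hausdorffMeasure_lt_top_of_totalVar_ball_ge hEm hfin one_pos fun δ hδ z hz => ?_
    obtain ⟨a, ha, h⟩ := exists_scale_of_mem_essBoundary hEm hz
    obtain ⟨r, hr, h1, h2⟩ := h (δ / 3) (by positivity)
    have har : 0 < a * r ^ 1 := by have := hr.1; positivity
    have hsub : Metric.closedBall z r ⊆ Metric.ball z (2 * r) :=
      Metric.closedBall_subset_ball (by linarith [hr.1])
    refine ⟨3 * r, by linarith [hr.1], by linarith [hr.2], ?_⟩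
    have h3 := one_le_totalVar_ball hEm (z := z) (by linarith [hr.1] : 2 * r < 3 * r) ?_ ?_
    · simpa using h3
    · intro h0
      have : volume.real (Metric.closedBall z r ∩ E) = 0 := by
        rw [measureReal_def, measure_mono_null (inter_subset_inter_left _ hsub) h0]; rfl
      linarith
    · intro h0
      have : volume.real (Metric.closedBall z r \ E) = 0 := by
        rw [measureReal_def, measure_mono_null (sdiff_subset_sdiff_left hsub) h0]; rfl
      linarith

end Cascade

namespace Cascade

open scoped CompactlySupported

variable {d : ℕ}

/-! ### The total variation measure -/

/-- Weak limits of absolutely continuous measures of bounded mass, as Riesz measures. -/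
lemma exists_measure_ultrafilter_limit (𝒰 : Ultrafilter ℕ) {ρ : ℕ → Sp d → ℝ}
    (hρc : ∀ n, Continuous (ρ n)) (hρ0 : ∀ n x, 0 ≤ ρ n x) {M : ℝ}
    (hρi : ∀ n, Integrable (ρ n)) (hρM : ∀ n, ∫ x, ρ n x ≤ M) :
    ∃ μ : Measure (Sp d), μ univ ≤ ENNReal.ofReal M ∧
      ∀ g : Sp d → ℝ, Continuous g → HasCompactSupport g →
        Tendsto (fun n => ∫ x, g x * ρ n x) 𝒰 (𝓝 (∫ x, g x ∂μ)) := by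
  have hM0 : 0 ≤ M := (integral_nonneg (hρ0 0)).trans (hρM 0)
  have hint : ∀ (g : C_c(Sp d, ℝ)) n, Integrable fun x => g x * ρ n x := by
    intro g n
    refine (g.continuous.mul (hρc n)).integrable_of_hasCompactSupport ?_
    exact g.hasCompactSupport.mul_right
  have hbound : ∀ (g : C_c(Sp d, ℝ)) (C : ℝ), (∀ x, |g x| ≤ C) → ∀ n,
      |∫ x, g x * ρ n x| ≤ C * M := by
    intro g C hC n
    have hC0 : 0 ≤ C := (abs_nonneg _).trans (hC 0)
    calc |∫ x, g x * ρ n x| ≤ ∫ x, |g x * ρ n x| := abs_integral_le_integral_abs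
      _ ≤ ∫ x, C * ρ n x := by
          refine integral_mono (hint g n).abs ((hρi n).const_mul C) fun x => ?_
          simp only
          rw [abs_mul, abs_of_nonneg (hρ0 n x)]
          exact mul_le_mul_of_nonneg_right (hC x) (hρ0 n x)
      _ = C * ∫ x, ρ n x := integral_const_mul _ _
      _ ≤ C * M := mul_le_mul_of_nonneg_left (hρM n) hC0
  -- Along an ultrafilter all bounded sequences converge simultaneously, so no diagonal subsequence
  -- has to be extracted.
  have hlim : ∀ g : C_c(Sp d, ℝ), ∃ l, Tendsto (fun n => ∫ x, g x * ρ n x) 𝒰 (𝓝 l) := by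
    intro g
    obtain ⟨C, hC⟩ := g.hasCompactSupport.exists_bound_of_continuous g.continuous
    have h1 : Filter.map (fun n => ∫ x, g x * ρ n x) (𝒰 : Filter ℕ) ≤ 𝓟 (Icc (-(C * M)) (C * M)) := by
      rw [le_principal_iff, mem_map]
      exact univ_mem' fun n => abs_le.mp (hbound g C hC n)
    obtain ⟨l, -, hl⟩ := (isCompact_Icc (a := -(C * M)) (b := C * M)).ultrafilter_le_nhds
      (𝒰.map fun n => ∫ x, g x * ρ n x) h1
    exact ⟨l, hl⟩
  choose lam hlam using hlim
  let Λ₀ : C_c(Sp d, ℝ) →ₗ[ℝ] ℝ :=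
    { toFun := lam
      map_add' := fun g h => by
        refine tendsto_nhds_unique (hlam (g + h)) (((hlam g).add (hlam h)).congr fun n => ?_)
        rw [← integral_add (hint g n) (hint h n)]
        congr 1
        funext x
        simp [add_mul]
      map_smul' := fun c g => by
        refine tendsto_nhds_unique (hlam (c • g)) (((hlam g).const_mul c).congr fun n => ?_)
        rw [← integral_const_mul]
        congr 1
        funext x
        simp [mul_assoc] }
  have hpos : ∀ g : C_c(Sp d, ℝ), 0 ≤ g → 0 ≤ Λ₀ g := fun g hg =>
    ge_of_tendsto' (hlam g) fun n => integral_nonneg fun x => mul_nonneg (hg x) (hρ0 n x)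
  let Λ : C_c(Sp d, ℝ) →ₚ[ℝ] ℝ := PositiveLinearMap.mk₀ Λ₀ hpos
  refine ⟨RealRMK.rieszMeasure Λ, ?_, fun g hg hgc => ?_⟩
  · have hK : ∀ n : ℕ, RealRMK.rieszMeasure Λ (Metric.closedBall (0 : Sp d) n)
        ≤ ENNReal.ofReal M := by
      intro n
      obtain ⟨χ, h1, -, h3, h4⟩ := exists_continuous_one_zero_of_isCompact
        (isCompact_closedBall (0 : Sp d) (n : ℝ)) (isClosed_empty) (disjoint_empty _)
      let g : C_c(Sp d, ℝ) := ⟨χ, h3⟩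
      have h5 := RealRMK.rieszMeasure_le_of_eq_one Λ (f := g) (fun x => (h4 x).1)
        (isCompact_closedBall (0 : Sp d) (n : ℝ)) (fun x hx => h1 hx)
      refine h5.trans (ENNReal.ofReal_le_ofReal ?_)
      refine le_of_tendsto' (hlam g) fun n => ?_
      have := hbound g 1 (fun x => by
        exact (abs_of_nonneg (h4 x).1).trans_le (h4 x).2) n
      rw [one_mul] at this
      exact (le_abs_self _).trans this
    have hU : (⋃ n : ℕ, Metric.closedBall (0 : Sp d) n) = univ := Metric.iUnion_closedBall_nat 0
    rw [← hU]
    refine le_of_tendsto' (tendsto_measure_iUnion_atTop fun m n hmn => ?_) hK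
    exact Metric.closedBall_subset_closedBall (by exact_mod_cast hmn)
  · have h := hlam ⟨⟨g, hg⟩, hgc⟩
    have h2 := RealRMK.integral_rieszMeasure Λ ⟨⟨g, hg⟩, hgc⟩
    have h3 : Λ ⟨⟨g, hg⟩, hgc⟩ = lam ⟨⟨g, hg⟩, hgc⟩ := rfl
    rw [h3] at h2
    rw [← h2] at h
    exact h

lemma abs_le_of_mem_Icc_neg {f : Sp d → ℝ} {C : ℝ} {v : ℕ → Sp d → ℝ} (hC : ∀ x, |f x| ≤ C)
    (hv2 : ∀ a b, (∀ x, f x ∈ Icc a b) → ∀ n x, v n x ∈ Icc a b) (n : ℕ) (x : Sp d) :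
    |v n x| ≤ C :=
  abs_le.mpr (hv2 (-C) C (fun x => abs_le.mp (hC x)) n x)

/-- Dominated convergence for bounded convergent sequences tested against divergences. -/
lemma tendsto_integral_mul_divergence {f : Sp d → ℝ} {v : ℕ → Sp d → ℝ} {C : ℝ}
    (hvm : ∀ n, AEStronglyMeasurable (v n) volume) (hvC : ∀ n x, |v n x| ≤ C)
    (hlim : ∀ᵐ x, Tendsto (fun n => v n x) atTop (𝓝 (f x)))
    {ψ : Sp d → Sp d} (hψ : ContDiff ℝ 1 ψ) (hψc : HasCompactSupport ψ) :
    Tendsto (fun n => ∫ x, v n x * divergence ψ x) atTop (𝓝 (∫ x, f x * divergence ψ x)) := by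
  have hi := integrable_divergence hψ hψc
  refine tendsto_integral_of_dominated_convergence (fun x => C * |divergence ψ x|)
    (fun n => (hvm n).mul hi.aestronglyMeasurable) (hi.abs.const_mul C) (fun n => ?_) ?_
  · refine Eventually.of_forall fun x => ?_
    rw [Real.norm_eq_abs, abs_mul]
    exact mul_le_mul_of_nonneg_right (hvC n x) (abs_nonneg _)
  · filter_upwards [hlim] with x hx using hx.mul_const _

lemma integrable_norm_fderiv {v : Sp d → ℝ} (hv : ContDiff ℝ ∞ v)
    (h : ∫⁻ x, ‖fderiv ℝ v x‖ₑ ≠ ⊤) : Integrable fun x => ‖fderiv ℝ v x‖ :=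
  ⟨(hv.continuous_fderiv (by simp)).norm.aestronglyMeasurable,
    by rw [hasFiniteIntegral_iff_enorm]; simpa using lt_top_iff_ne_top.mpr h⟩

lemma integral_norm_fderiv_le {v : Sp d → ℝ} (hv : ContDiff ℝ ∞ v) {M : ℝ≥0∞} (hM : M ≠ ⊤)
    (h : ∫⁻ x, ‖fderiv ℝ v x‖ₑ ≤ M) : ∫ x, ‖fderiv ℝ v x‖ ≤ M.toReal := by
  rw [integral_eq_lintegral_of_nonneg_ae (Eventually.of_forall fun x => norm_nonneg _)
    (hv.continuous_fderiv (by simp)).norm.aestronglyMeasurable]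
  refine ENNReal.toReal_mono hM ?_
  simpa only [ofReal_norm] using h

/-- A finite measure which dominates the distributional derivative of a function of bounded
variation, and is not larger than the total variation. -/
lemma exists_totalVar_measure {f : Sp d → ℝ} (hf : IsBddMeas f) (hfin : totalVar f univ ≠ ⊤) :
    ∃ μ : Measure (Sp d), μ univ ≤ totalVar f univ ∧
      ∀ ψ : Sp d → Sp d, ContDiff ℝ 1 ψ → HasCompactSupport ψ →
        ∫ x, f x * divergence ψ x ≤ ∫ x, ‖ψ x‖ ∂μ := by
  obtain ⟨v, hv1, hv2, hv3, hv4⟩ := exists_mollification hf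
  have hb : ∀ n, ∫⁻ x, ‖fderiv ℝ (v n) x‖ₑ ≤ totalVar f univ := fun n => by
    have := hv4 n univ isOpen_univ
    rw [Measure.restrict_univ] at this
    exact this.trans (totalVar_mono f (subset_univ _))
  have hb' := fun n => ne_top_of_le_ne_top hfin (hb n)
  obtain ⟨μ, hμ1, hμ2⟩ := exists_measure_ultrafilter_limit (hyperfilter ℕ)
    (ρ := fun n x => ‖fderiv ℝ (v n) x‖) (fun n => ((hv1 n).continuous_fderiv (by simp)).norm)
    (fun n x => norm_nonneg _) (fun n => integrable_norm_fderiv (hv1 n) (hb' n))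
    (fun n => integral_norm_fderiv_le (hv1 n) hfin (hb n))
  rw [ENNReal.ofReal_toReal hfin] at hμ1
  refine ⟨μ, hμ1, fun ψ hψ hψc => ?_⟩
  obtain ⟨C, hC⟩ := hf.bdd
  have h1 := (tendsto_integral_mul_divergence (fun n => (hv1 n).continuous.aestronglyMeasurable)
    (abs_le_of_mem_Icc_neg hC hv2) hv3 hψ hψc).mono_left Nat.hyperfilter_le_atTop
  refine le_of_tendsto_of_tendsto' h1 (hμ2 (fun x => ‖ψ x‖) hψ.continuous.norm hψc.norm) fun n => ?_
  rw [integral_mul_divergence ((hv1 n).of_le (by simp)) hψ hψc, ← integral_neg]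
  have hcont := (hv1 n).continuous_fderiv (by simp)
  have hψcont := hψ.continuous
  refine integral_mono ?_ ?_ fun x => ?_
  · refine Continuous.integrable_of_hasCompactSupport (by fun_prop) ?_
    refine hψc.mono' ?_
    intro x hx
    refine subset_tsupport _ fun h0 => hx ?_
    simp [h0]
  · refine Continuous.integrable_of_hasCompactSupport (by fun_prop) ?_
    exact hψc.norm.mul_right
  · simp only
    refine (neg_le_abs _).trans (((fderiv ℝ (v n) x).le_opNorm _).trans ?_)
    rw [mul_comm]

/-! ### Two disjoint sets -/

/-- The variation of the difference of the indicators of two disjoint sets is the sum of the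
perimeters. -/
lemma add_totalVar_le_of_disjoint {E₁ E₂ : Set (Sp d)} (h1 : NullMeasurableSet E₁ volume)
    (h2 : NullMeasurableSet E₂ volume) (hd : ∀ᵐ x : Sp d, ¬(x ∈ E₁ ∧ x ∈ E₂))
    (hP₁ : totalVar (E₁.indicator fun _ => (1 : ℝ)) univ ≠ ⊤)
    (hP₂ : totalVar (E₂.indicator fun _ => (1 : ℝ)) univ ≠ ⊤)
    (hfin : totalVar (fun x => E₁.indicator (fun _ => (1 : ℝ)) x
      - E₂.indicator (fun _ => (1 : ℝ)) x) univ ≠ ⊤) :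
    (totalVar (E₁.indicator fun _ => (1 : ℝ)) univ).toReal
        + (totalVar (E₂.indicator fun _ => (1 : ℝ)) univ).toReal
      ≤ (totalVar (fun x => E₁.indicator (fun _ => (1 : ℝ)) x
        - E₂.indicator (fun _ => (1 : ℝ)) x) univ).toReal := by
  set f : Sp d → ℝ := fun x =>
    E₁.indicator (fun _ => (1 : ℝ)) x - E₂.indicator (fun _ => (1 : ℝ)) x with hfdef
  have hf : IsBddMeas f := (isBddMeas_indicator h1).sub (isBddMeas_indicator h2)
  obtain ⟨v, hv1, hv2, hv3, hv4⟩ := exists_mollification hf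
  have hb : ∀ n, ∫⁻ x, ‖fderiv ℝ (v n) x‖ₑ ≤ totalVar f univ := fun n => by
    have := hv4 n univ isOpen_univ
    rw [Measure.restrict_univ] at this
    exact this.trans (totalVar_mono f (subset_univ _))
  have hb' := fun n => ne_top_of_le_ne_top hfin (hb n)
  set δ : ℕ → ℝ := fun n => 1 / ((n : ℝ) + 1) with hδ
  have hδ0 : ∀ n, 0 < δ n := fun n => by positivity
  -- smooth approximations of the positive part
  set h : ℕ → ℝ → ℝ := fun n s => (√(s ^ 2 + δ n ^ 2) + s) / 2 with hh
  have hsq : ∀ n s, 0 < s ^ 2 + δ n ^ 2 := fun n s => by have := hδ0 n; positivity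
  set h' : ℕ → ℝ → ℝ := fun n s => (s / √(s ^ 2 + δ n ^ 2) + 1) / 2 with hh'
  have hder : ∀ n s, HasDerivAt (h n) (h' n s) s := by
    intro n s
    have e1 : HasDerivAt (fun s : ℝ => s ^ 2 + δ n ^ 2) (2 * s) s := by
      simpa using (hasDerivAt_pow 2 s).add_const (δ n ^ 2)
    have e2 := ((e1.sqrt (hsq n s).ne').add (hasDerivAt_id s)).div_const 2
    refine e2.congr_deriv ?_
    rw [hh']
    simp only
    rw [mul_div_mul_left _ _ two_ne_zero]
  have hsqrt_abs : ∀ n s, |s| ≤ √(s ^ 2 + δ n ^ 2) := fun n s =>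
    Real.abs_le_sqrt (by have := sq_nonneg (δ n); linarith)
  have hsqrt_le : ∀ n s, √(s ^ 2 + δ n ^ 2) ≤ |s| + δ n := fun n s => by
    rw [Real.sqrt_le_iff]
    refine ⟨by have := hδ0 n; positivity, ?_⟩
    rw [add_sq, sq_abs]
    have := mul_nonneg (abs_nonneg s) (hδ0 n).le
    nlinarith
  have hh'01 : ∀ n s, h' n s ∈ Icc (0 : ℝ) 1 := by
    intro n s
    have e1 := hsqrt_abs n s
    have e2 : 0 < √(s ^ 2 + δ n ^ 2) := Real.sqrt_pos.mpr (hsq n s)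
    have e3 : |s / √(s ^ 2 + δ n ^ 2)| ≤ 1 := by
      rw [abs_div, abs_of_pos e2, div_le_one e2]; exact e1
    rw [abs_le] at e3
    rw [hh']
    constructor <;> simp only <;> linarith [e3.1, e3.2]
  -- The identity on which the lemma rests: the derivatives of h(v) and of h(-v) share |∇v| without
  -- overlap, so two fields tested against the two functions together gain at most ∫ |∇v|.
  have hh'neg : ∀ n s, h' n s + h' n (-s) = 1 := by
    intro n s
    rw [hh']
    simp only [neg_sq]
    ring
  have hbound : ∀ n s, |s| ≤ 2 → |h n s| ≤ 3 := by
    intro n s hs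
    have e1 := hsqrt_le n s
    have e2 := hsqrt_abs n s
    have e3 : δ n ≤ 1 := by
      rw [hδ]; simp only
      rw [div_le_one (by positivity)]; linarith [(Nat.cast_nonneg n : (0 : ℝ) ≤ n)]
    have e4 := abs_le.mp hs
    rw [hh, abs_le]
    constructor <;> simp only <;> linarith [neg_abs_le s, le_abs_self s]
  have hδlim : Tendsto δ atTop (𝓝 0) := tendsto_one_div_add_atTop_nhds_zero_nat
  have hlim : ∀ (a : ℕ → ℝ) (l : ℝ), Tendsto a atTop (𝓝 l) →
      Tendsto (fun n => h n (a n)) atTop (𝓝 ((|l| + l) / 2)) := by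
    intro a l ha
    have e1 : Tendsto (fun n => √(a n ^ 2 + δ n ^ 2)) atTop (𝓝 (√(l ^ 2 + 0 ^ 2))) :=
      (Real.continuous_sqrt.tendsto _).comp ((ha.pow 2).add (hδlim.pow 2))
    have e2 : √(l ^ 2 + 0 ^ 2) = |l| := by
      rw [← Real.sqrt_sq_eq_abs]; simp
    rw [e2] at e1
    exact (e1.add ha).div_const 2
  have hf1 : ∀ x, |f x| ≤ 2 := fun x => by
    by_cases a : x ∈ E₁ <;> by_cases b : x ∈ E₂ <;> simp [hfdef, a, b]
  have hvb := abs_le_of_mem_Icc_neg hf1 hv2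
  have hhc : ∀ n, ContDiff ℝ 1 (h n) := fun n => by
    have e0 : ∀ s, s ^ 2 + δ n ^ 2 ≠ 0 := fun s => (hsq n s).ne'
    rw [hh]
    exact (((contDiff_id.pow 2).add contDiff_const).sqrt e0 |>.add contDiff_id).div_const 2
  have key : ∀ ψ₁ ψ₂ : Sp d → Sp d, IsTestField univ ψ₁ → IsTestField univ ψ₂ →
      (∫ x, E₁.indicator (fun _ => (1 : ℝ)) x * divergence ψ₁ x)
        + ∫ x, E₂.indicator (fun _ => (1 : ℝ)) x * divergence ψ₂ x ≤ (totalVar f univ).toReal := by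
    intro ψ₁ ψ₂ hψ₁ hψ₂
    have hcv : ∀ n, ContDiff ℝ 1 (v n) := fun n => (hv1 n).of_le (by simp)
    have L1 : Tendsto (fun n => ∫ x, h n (v n x) * divergence ψ₁ x) atTop
        (𝓝 (∫ x, E₁.indicator (fun _ => (1 : ℝ)) x * divergence ψ₁ x)) := by
      refine tendsto_integral_mul_divergence (C := 3) (fun n =>
        ((hhc n).continuous.comp (hv1 n).continuous).aestronglyMeasurable)
        (fun n x => hbound n _ (hvb n x)) ?_ hψ₁.contDiff hψ₁.compact
      filter_upwards [hv3, hd] with x hx hxd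
      have e := hlim _ _ hx
      have e' : (|f x| + f x) / 2 = E₁.indicator (fun _ => (1 : ℝ)) x := by
        simp only [hfdef]
        by_cases a : x ∈ E₁ <;> by_cases b : x ∈ E₂
        · exact absurd ⟨a, b⟩ hxd
        all_goals simp [a, b]
      rwa [e'] at e
    have L2 : Tendsto (fun n => ∫ x, h n (-v n x) * divergence ψ₂ x) atTop
        (𝓝 (∫ x, E₂.indicator (fun _ => (1 : ℝ)) x * divergence ψ₂ x)) := by
      refine tendsto_integral_mul_divergence (C := 3) (fun n =>
        ((hhc n).continuous.comp (hv1 n).continuous.neg).aestronglyMeasurable)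
        (fun n x => hbound n _ ((abs_neg _).trans_le (hvb n x))) ?_ hψ₂.contDiff hψ₂.compact
      filter_upwards [hv3, hd] with x hx hxd
      have e := hlim _ _ hx.neg
      have e' : (|-f x| + -f x) / 2 = E₂.indicator (fun _ => (1 : ℝ)) x := by
        simp only [hfdef]
        by_cases a : x ∈ E₁ <;> by_cases b : x ∈ E₂
        · exact absurd ⟨a, b⟩ hxd
        all_goals simp [a, b]
      rwa [e'] at e
    refine le_of_tendsto' (L1.add L2) fun n => ?_
    have hcont := (hv1 n).continuous_fderiv (by simp)
    have hψ₁c := hψ₁.contDiff.continuous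
    have hψ₂c := hψ₂.contDiff.continuous
    have hvc := (hv1 n).continuous
    have hh'c : Continuous (h' n) := by
      rw [hh']
      simp only
      refine ((continuous_id.div (by fun_prop) fun s => ?_).add continuous_const).div_const 2
      exact (Real.sqrt_pos.mpr (hsq n s)).ne'
    have D1 : ∀ x, fderiv ℝ (fun x => h n (v n x)) x = h' n (v n x) • fderiv ℝ (v n) x := fun x =>
      ((hder n _).comp_hasFDerivAt x ((hcv n).differentiable one_ne_zero x).hasFDerivAt).fderiv
    have D2 : ∀ x, fderiv ℝ (fun x => h n (-v n x)) x = h' n (-v n x) • -fderiv ℝ (v n) x := fun x =>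
      ((hder n _).comp_hasFDerivAt x ((hcv n).differentiable one_ne_zero x).hasFDerivAt.neg).fderiv
    have J1 := integral_mul_divergence (g := fun x => h n (v n x)) ((hhc n).comp (hcv n))
      hψ₁.contDiff hψ₁.compact
    have J2 := integral_mul_divergence (g := fun x => h n (-v n x)) ((hhc n).comp (hcv n).neg)
      hψ₂.contDiff hψ₂.compact
    rw [J1, J2, ← integral_neg, ← integral_neg]
    simp only [D1, D2]
    have I1 : Integrable fun x => -(h' n (v n x) • fderiv ℝ (v n) x) (ψ₁ x) := by
      refine Continuous.integrable_of_hasCompactSupport (by fun_prop) (hψ₁.compact.mono' ?_)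
      intro x hx
      exact subset_tsupport _ fun h0 => hx (by simp [h0])
    have I2 : Integrable fun x => -(h' n (-v n x) • -fderiv ℝ (v n) x) (ψ₂ x) := by
      refine Continuous.integrable_of_hasCompactSupport (by fun_prop) (hψ₂.compact.mono' ?_)
      intro x hx
      exact subset_tsupport _ fun h0 => hx (by simp [h0])
    rw [← integral_add I1 I2]
    refine le_trans (integral_mono (I1.add I2) (integrable_norm_fderiv (hv1 n) (hb' n)) fun x => ?_)
      (integral_norm_fderiv_le (hv1 n) hfin (hb n))
    have e1 := (fderiv ℝ (v n) x).le_opNorm (ψ₁ x)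
    have e2 := (fderiv ℝ (v n) x).le_opNorm (ψ₂ x)
    have e3 : ‖fderiv ℝ (v n) x‖ * ‖ψ₁ x‖ ≤ ‖fderiv ℝ (v n) x‖ :=
      mul_le_of_le_one_right (norm_nonneg _) (hψ₁.norm_le x)
    have e4 : ‖fderiv ℝ (v n) x‖ * ‖ψ₂ x‖ ≤ ‖fderiv ℝ (v n) x‖ :=
      mul_le_of_le_one_right (norm_nonneg _) (hψ₂.norm_le x)
    rw [Real.norm_eq_abs] at e1 e2
    have e5 := mul_le_mul_of_nonneg_left ((neg_le_abs _).trans (e1.trans e3)) (hh'01 n (v n x)).1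
    have e6 := mul_le_mul_of_nonneg_left ((le_abs_self _).trans (e2.trans e4)) (hh'01 n (-v n x)).1
    have e7 := hh'neg n (v n x)
    simp only [smul_apply, neg_apply,
      smul_eq_mul]
    calc _ = h' n (v n x) * -(fderiv ℝ (v n) x) (ψ₁ x)
          + h' n (-v n x) * (fderiv ℝ (v n) x) (ψ₂ x) := by ring
      _ ≤ h' n (v n x) * ‖fderiv ℝ (v n) x‖ + h' n (-v n x) * ‖fderiv ℝ (v n) x‖ := add_le_add e5 e6
      _ = ‖fderiv ℝ (v n) x‖ := by rw [← add_mul, e7, one_mul]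
  refine le_of_forall_pos_le_add fun ε hε => ?_
  obtain ⟨ψ₁, hψ₁, e₁⟩ := exists_testField hP₁ (half_pos hε)
  obtain ⟨ψ₂, hψ₂, e₂⟩ := exists_testField hP₂ (half_pos hε)
  linarith [key ψ₁ ψ₂ hψ₁ hψ₂]

/-- A common nearly optimal field for two disjoint sets. -/
lemma exists_testField_of_disjoint {E₁ E₂ : Set (Sp d)} (h1 : NullMeasurableSet E₁ volume)
    (h2 : NullMeasurableSet E₂ volume) (hd : ∀ᵐ x : Sp d, ¬(x ∈ E₁ ∧ x ∈ E₂))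
    (hP₁ : totalVar (E₁.indicator fun _ => (1 : ℝ)) univ ≠ ⊤)
    (hP₂ : totalVar (E₂.indicator fun _ => (1 : ℝ)) univ ≠ ⊤) {ε : ℝ} (hε : 0 < ε) :
    ∃ ψ : Sp d → Sp d, IsTestField univ ψ ∧
      (totalVar (E₁.indicator fun _ => (1 : ℝ)) univ).toReal - ε
        ≤ ∫ x, E₁.indicator (fun _ => (1 : ℝ)) x * divergence ψ x ∧
      (totalVar (E₂.indicator fun _ => (1 : ℝ)) univ).toReal - ε
        ≤ ∫ x, E₂.indicator (fun _ => (1 : ℝ)) x * divergence (fun y => -ψ y) x := by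
  set f : Sp d → ℝ := fun x =>
    E₁.indicator (fun _ => (1 : ℝ)) x - E₂.indicator (fun _ => (1 : ℝ)) x with hfdef
  have hsplit : ∀ ψ, IsTestField univ ψ → ∫ x, f x * divergence ψ x
      = (∫ x, E₁.indicator (fun _ => (1 : ℝ)) x * divergence ψ x)
        + ∫ x, E₂.indicator (fun _ => (1 : ℝ)) x * divergence (fun y => -ψ y) x := by
    intro ψ hψ
    have hi := integrable_divergence hψ.contDiff hψ.compact
    have hi' := integrable_divergence hψ.neg.contDiff hψ.neg.compact
    rw [← integral_add ((isBddMeas_indicator h1).integrable_mul hi)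
      ((isBddMeas_indicator h2).integrable_mul hi')]
    congr 1
    funext x
    rw [divergence_neg, hfdef]
    ring
  have hfin : totalVar f univ ≠ ⊤ := by
    refine ne_top_of_le_ne_top (ENNReal.add_ne_top.mpr ⟨hP₁, hP₂⟩) (iSup₂_le fun ψ hψ => ?_)
    rw [hsplit ψ hψ]
    exact ENNReal.ofReal_add_le.trans (add_le_add (le_totalVar _ hψ) (le_totalVar _ hψ.neg))
  obtain ⟨ψ, hψ, e⟩ := exists_testField hfin hε
  have e1 := add_totalVar_le_of_disjoint h1 h2 hd hP₁ hP₂ hfin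
  have e2 := integral_le_totalVar _ hψ hP₁
  have e3 := integral_le_totalVar _ hψ.neg hP₂
  rw [hsplit ψ hψ] at e
  exact ⟨ψ, hψ, by linarith, by linarith⟩

end Cascade

namespace Cascade

variable {d : ℕ}

/-! ### Triple points -/

/-- Z is split according to the rate of density. A piece is enclosed in an open set of small
μ-measure; disjoint balls inside it with μ(B) ≥ ε r^{d-1} have a small sum of r^{d-1}, and Vitali's
covering finishes. -/
lemma hausdorffMeasure_eq_zero_of_hasPosDensity {μ : Measure (Sp d)} [IsFiniteMeasure μ]
    {Z : Set (Sp d)} (hμ : μ Z = 0)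
    (h : ∀ z ∈ Z, HasPosDensity (fun z r => μ (Metric.ball z r)) z) :
    μH[((d - 1 : ℕ) : ℝ)] Z = 0 := by
  set Zn : ℕ → Set (Sp d) := fun n => {z ∈ Z | ∀ ρ > 0, ∃ r, 0 < r ∧ r < ρ ∧
    ENNReal.ofReal (1 / ((n : ℝ) + 1) * r ^ (d - 1)) ≤ μ (Metric.ball z r)} with hZn
  have hcov : Z ⊆ ⋃ n, Zn n := by
    intro z hz
    obtain ⟨ε, hε, hε2⟩ := h z hz
    obtain ⟨n, hn⟩ := exists_nat_one_div_lt hε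
    refine mem_iUnion.mpr ⟨n, hz, fun ρ hρ => ?_⟩
    obtain ⟨r, hr0, hr1, hr2⟩ := hε2 ρ hρ
    refine ⟨r, hr0, hr1, le_trans (ENNReal.ofReal_le_ofReal ?_) hr2⟩
    gcongr
  refine measure_mono_null hcov (measure_iUnion_null fun n => ?_)
  have hε : (0 : ℝ) < 1 / ((n : ℝ) + 1) := by positivity
  set ε : ℝ := 1 / ((n : ℝ) + 1) with hεdef
  have hsmall : ∀ e : ℝ≥0, 0 < e → μH[((d - 1 : ℕ) : ℝ)] (Zn n)
      ≤ 10 ^ ((d - 1 : ℕ) : ℝ) * (ENNReal.ofReal ε⁻¹ * e) := by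
    intro e he
    have h0 : μ (Zn n) < e := by
      rw [measure_mono_null (fun z hz => hz.1) hμ]; exact_mod_cast he
    obtain ⟨O, hO1, hO2, hO3⟩ := (Zn n).exists_isOpen_lt_of_lt (μ := μ) _ h0
    refine hausdorffMeasure_le_of_disjoint_balls (Nat.cast_nonneg _)
      (R := fun z r => Metric.ball z r ⊆ O ∧ ENNReal.ofReal (ε * r ^ (d - 1)) ≤ μ (Metric.ball z r))
      (fun δ hδ z hz => ?_) ⟨1, one_pos, fun F hF hdisj => ?_⟩
    · obtain ⟨ρ, hρ, hρO⟩ := Metric.isOpen_iff.mp hO2 z (hO1 hz)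
      obtain ⟨r, hr0, hr1, hr2⟩ := hz.2 (min δ ρ) (lt_min hδ hρ)
      exact ⟨r, hr0, hr1.trans_le (min_le_left _ _),
        (Metric.ball_subset_ball (hr1.le.trans (min_le_right _ _))).trans hρO, hr2⟩
    · have hpos : ∀ p ∈ F, 0 < p.2 := fun p hp => (hF p hp).2.1
      calc ∑ p ∈ F, ENNReal.ofReal p.2 ^ ((d - 1 : ℕ) : ℝ)
          ≤ ∑ p ∈ F, ENNReal.ofReal ε⁻¹ * μ (Metric.ball p.1 p.2) := by
            refine Finset.sum_le_sum fun p hp => ?_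
            rw [ofReal_rpow_natCast (hpos p hp).le]
            calc ENNReal.ofReal (p.2 ^ (d - 1))
                = ENNReal.ofReal ε⁻¹ * ENNReal.ofReal (ε * p.2 ^ (d - 1)) := by
                  rw [← ENNReal.ofReal_mul (by positivity)]
                  congr 1
                  field_simp
              _ ≤ _ := by gcongr; exact (hF p hp).2.2.2.2
        _ = ENNReal.ofReal ε⁻¹ * ∑ p ∈ F, μ (Metric.ball p.1 p.2) := Finset.mul_sum .. |>.symm
        _ = ENNReal.ofReal ε⁻¹ * μ (⋃ p ∈ F, Metric.ball p.1 p.2) := by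
            rw [measure_biUnion_finset (fun a ha b hb hab => (hdisj ha hb hab).mono
              Metric.ball_subset_closedBall Metric.ball_subset_closedBall)
              fun _ _ => measurableSet_ball]
        _ ≤ _ := by
            gcongr
            exact (measure_mono (iUnion₂_subset fun p hp => (hF p hp).2.2.2.1)).trans hO3.le
  have hlim : Tendsto (fun e : ℝ≥0 => (10 : ℝ≥0∞) ^ ((d - 1 : ℕ) : ℝ) * (ENNReal.ofReal ε⁻¹ * e))
      (𝓝[>] 0) (𝓝 (10 ^ ((d - 1 : ℕ) : ℝ) * (ENNReal.ofReal ε⁻¹ * (0 : ℝ≥0)))) := by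
    refine ENNReal.Tendsto.const_mul (ENNReal.Tendsto.const_mul ?_ (Or.inr ENNReal.ofReal_ne_top))
      (Or.inr ?_)
    · exact (ENNReal.continuous_coe.tendsto 0).mono_left nhdsWithin_le_nhds
    · exact ENNReal.rpow_ne_top_of_nonneg (Nat.cast_nonneg _) (by simp)
  rw [ENNReal.coe_zero, mul_zero, mul_zero] at hlim
  exact le_antisymm (ge_of_tendsto hlim (eventually_nhdsWithin_of_forall hsmall)) zero_le

/-- Two nearly optimal sequences of fields become aligned almost everywhere. -/
lemma ae_tendsto_norm_add {f : Sp d → ℝ} (hf : IsBddMeas f) {μ : Measure (Sp d)}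
    [IsFiniteMeasure μ] (hμ : ∀ ψ : Sp d → Sp d, ContDiff ℝ 1 ψ → HasCompactSupport ψ →
      ∫ x, f x * divergence ψ x ≤ ∫ x, ‖ψ x‖ ∂μ)
    {a b : ℕ → Sp d → Sp d} (ha : ∀ n, IsTestField univ (a n)) (hb : ∀ n, IsTestField univ (b n))
    (ha' : ∀ n, μ.real univ - (1 / 2) ^ n ≤ ∫ x, f x * divergence (a n) x)
    (hb' : ∀ n, μ.real univ - (1 / 2) ^ n ≤ ∫ x, f x * divergence (b n) x) :
    ∀ᵐ x ∂μ, Tendsto (fun n => ‖a n x + b n x‖) atTop (𝓝 2) := by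
  have hle : ∀ n x, ‖a n x + b n x‖ ≤ 2 := fun n x =>
    (norm_add_le _ _).trans (by linarith [(ha n).norm_le x, (hb n).norm_le x])
  have hcont : ∀ n, Continuous fun x => ‖a n x + b n x‖ := fun n =>
    ((ha n).contDiff.continuous.add (hb n).contDiff.continuous).norm
  have hwc : ∀ n, Continuous fun x => 2 - ‖a n x + b n x‖ := fun n => continuous_const.sub (hcont n)
  have hcomp : ∀ n, HasCompactSupport fun x => a n x + b n x := fun n =>
    (ha n).compact.add (hb n).compact
  have hint : ∀ n, Integrable (fun x => ‖a n x + b n x‖) μ := fun n =>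
    (hcont n).integrable_of_hasCompactSupport (hcomp n).norm
  -- The sum of two nearly optimal fields is nearly twice optimal, while its divergence integral is
  -- at most ∫ |a + b| dμ. The defects 2 · 2^{-n} are summable, which gives almost everywhere
  -- convergence of the whole sequence.
  have hI : ∀ n, ∫ x, (2 - ‖a n x + b n x‖) ∂μ ≤ 2 * (1 / 2) ^ n := by
    intro n
    rw [integral_sub (integrable_const _) (hint n), integral_const, smul_eq_mul]
    have h1 := hμ _ ((ha n).contDiff.add (hb n).contDiff) (hcomp n)
    have h2 : ∫ x, f x * divergence (fun x => a n x + b n x) x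
        = (∫ x, f x * divergence (a n) x) + ∫ x, f x * divergence (b n) x := by
      rw [← integral_add (hf.integrable_mul (integrable_divergence (ha n).contDiff (ha n).compact))
        (hf.integrable_mul (integrable_divergence (hb n).contDiff (hb n).compact))]
      congr 1
      funext x
      rw [divergence_add (ha n).contDiff (hb n).contDiff]
      ring
    rw [h2] at h1
    linarith [ha' n, hb' n]
  have hL : ∀ n, ∫⁻ x, ENNReal.ofReal (2 - ‖a n x + b n x‖) ∂μ
      ≤ ENNReal.ofReal (2 * (1 / 2) ^ n) := by
    intro n
    have hi : Integrable (fun x => 2 - ‖a n x + b n x‖) μ := (integrable_const _).sub (hint n)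
    rw [← ofReal_integral_eq_lintegral_ofReal hi
      (Eventually.of_forall fun x => by simpa using hle n x)]
    exact ENNReal.ofReal_le_ofReal (hI n)
  have hsum : ∫⁻ x, ∑' n, ENNReal.ofReal (2 - ‖a n x + b n x‖) ∂μ ≠ ⊤ := by
    rw [lintegral_tsum fun n => ((hwc n).measurable.ennreal_ofReal).aemeasurable]
    refine ne_top_of_le_ne_top ?_ (ENNReal.tsum_le_tsum hL)
    have hs : Summable fun n : ℕ => 2 * (1 / 2 : ℝ) ^ n := summable_geometric_two.mul_left 2
    rw [← ENNReal.ofReal_tsum_of_nonneg (fun n => by positivity) hs]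
    exact ENNReal.ofReal_ne_top
  have hae := ae_lt_top (Measurable.tsum fun n =>
    (hwc n).measurable.ennreal_ofReal) hsum
  filter_upwards [hae] with x hx
  have h1 := ENNReal.tendsto_atTop_zero_of_tsum_ne_top hx.ne
  have h2 := (ENNReal.tendsto_toReal ENNReal.zero_ne_top).comp h1
  have h3 : Tendsto (fun n => 2 - ‖a n x + b n x‖) atTop (𝓝 0) := by
    refine h2.congr fun n => ?_
    simp only [Function.comp_apply]
    rw [ENNReal.toReal_ofReal (by linarith [hle n x])]
  have h4 := h3.const_sub 2
  simpa using h4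

/-- By the parallelogram law two vectors of the unit ball whose sum has norm near 2 are close to
each other. The hypotheses thus give a ≈ b ≈ c ≈ -a, whereas a has norm near one. -/
lemma not_three_aligned {a b c : Sp d} (ha : ‖a‖ ≤ 1) (hb : ‖b‖ ≤ 1) (hc : ‖c‖ ≤ 1)
    (h1 : 1.99 < ‖a + b‖) (h2 : 1.99 < ‖-a + c‖) (h3 : 1.99 < ‖-b + -c‖) : False := by
  have key : ∀ p q : Sp d, ‖p‖ ≤ 1 → ‖q‖ ≤ 1 → 1.99 < ‖p + q‖ → ‖p - q‖ ≤ 0.2 := by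
    intro p q hp hq hpq
    have h := parallelogram_law_with_norm ℝ p q
    have := norm_nonneg p
    have := norm_nonneg q
    have := norm_nonneg (p - q)
    nlinarith
  have e1 := key a b ha hb h1
  have e2 := key (-a) c (by rwa [norm_neg]) hc h2
  have e3 := key (-b) (-c) (by rwa [norm_neg]) (by rwa [norm_neg]) h3
  have h5 : a + a = (a - b) - (-b - -c) - (-a - c) := by abel
  have h6 : a + b = (a + a) - (a - b) := by abel
  have e5 : ‖a + a‖ ≤ 0.6 := by
    rw [h5]
    refine (norm_sub_le _ _).trans ((add_le_add (norm_sub_le _ _) le_rfl).trans ?_)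
    linarith
  have e6 : ‖a + b‖ ≤ 0.8 := by
    rw [h6]
    refine (norm_sub_le _ _).trans ?_
    linarith
  linarith

lemma totalVar_le_measure {f : Sp d → ℝ} {μ : Measure (Sp d)} [IsFiniteMeasure μ]
    (hμ : ∀ ψ : Sp d → Sp d, ContDiff ℝ 1 ψ → HasCompactSupport ψ →
      ∫ x, f x * divergence ψ x ≤ ∫ x, ‖ψ x‖ ∂μ) {U : Set (Sp d)} (hU : MeasurableSet U) :
    totalVar f U ≤ μ U := by
  refine iSup₂_le fun ψ hψ => ?_
  rw [← ENNReal.ofReal_toReal (measure_ne_top μ U)]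
  refine ENNReal.ofReal_le_ofReal ((hμ ψ hψ.contDiff hψ.compact).trans ?_)
  rw [← measureReal_def, ← integral_indicator_one hU]
  refine integral_mono (hψ.contDiff.continuous.norm.integrable_of_hasCompactSupport hψ.compact.norm)
    ((integrable_const 1).indicator hU) fun x => ?_
  by_cases hx : x ∈ U
  · simpa [hx] using hψ.norm_le x
  · have : ψ x = 0 := by
      by_contra h0
      exact hx (hψ.subset (subset_tsupport _ h0))
    simp [hx, this]

/-- For disjoint sets some field is nearly optimal for one while its negative is nearly optimal for
the other, as if it were the common normal. Three such fields, one per pair, must agree almost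
everywhere with respect to each perimeter measure, up to sign. At a triple point this would ask for
three directions with a = b, c = -a and b = c. No blow-up or reduced boundary enters. -/
theorem hausdorffMeasure_triple_essBoundary (hd : 1 ≤ d) {E₁ E₂ E₃ : Set (Sp d)}
    (h1 : HasFinitePerimeter E₁) (h2 : HasFinitePerimeter E₂) (h3 : HasFinitePerimeter E₃)
    (h12 : ∀ᵐ x : Sp d, ¬(x ∈ E₁ ∧ x ∈ E₂)) (h13 : ∀ᵐ x : Sp d, ¬(x ∈ E₁ ∧ x ∈ E₃))
    (h23 : ∀ᵐ x : Sp d, ¬(x ∈ E₂ ∧ x ∈ E₃)) :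
    μH[((d - 1 : ℕ) : ℝ)] (essBoundary E₁ ∩ essBoundary E₂ ∩ essBoundary E₃) = 0 := by
  have hfin : ∀ {E : Set (Sp d)}, HasFinitePerimeter E →
      totalVar (E.indicator fun _ => (1 : ℝ)) univ ≠ ⊤ := fun hE => by
    rw [totalVar_indicator_univ hE.1]; exact hE.2.ne
  -- Exceptional sets are null for the perimeter measures only. They are Hausdorff null as well,
  -- because a perimeter measure has positive density at every point of the essential boundary.
  have hmeas : ∀ E : Set (Sp d), HasFinitePerimeter E → ∃ μ : Measure (Sp d), IsFiniteMeasure μ ∧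
      (∀ ψ : Sp d → Sp d, ContDiff ℝ 1 ψ → HasCompactSupport ψ →
        ∫ x, E.indicator (fun _ => (1 : ℝ)) x * divergence ψ x ≤ ∫ x, ‖ψ x‖ ∂μ) ∧
      (totalVar (E.indicator fun _ => (1 : ℝ)) univ).toReal = μ.real univ ∧
      ∀ Z, Z ⊆ essBoundary E → μ Z = 0 → μH[((d - 1 : ℕ) : ℝ)] Z = 0 := by
    intro E hE
    obtain ⟨μ, hμ1, hμ2⟩ := exists_totalVar_measure (isBddMeas_indicator hE.1) (hfin hE)
    have hf : IsFiniteMeasure μ := ⟨hμ1.trans_lt (lt_top_iff_ne_top.mpr (hfin hE))⟩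
    refine ⟨μ, hf, hμ2, ?_, fun Z hZ hμZ => ?_⟩
    · rw [measureReal_def, le_antisymm hμ1 (totalVar_le_measure hμ2 MeasurableSet.univ)]
    · refine hausdorffMeasure_eq_zero_of_hasPosDensity hμZ fun z hz => ?_
      obtain ⟨ε, hε, hε2⟩ := hasPosDensity_of_mem_essBoundary hd hE.1 (hZ hz)
      refine ⟨ε, hε, fun ρ hρ => ?_⟩
      obtain ⟨r, hr0, hr1, hr2⟩ := hε2 ρ hρ
      exact ⟨r, hr0, hr1, hr2.trans (totalVar_le_measure hμ2 measurableSet_ball)⟩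
  obtain ⟨μ₁, _, hμ₁, e₁, hZ₁⟩ := hmeas E₁ h1
  obtain ⟨μ₂, _, hμ₂, e₂, hZ₂⟩ := hmeas E₂ h2
  obtain ⟨μ₃, _, hμ₃, e₃, hZ₃⟩ := hmeas E₃ h3
  have hpow : ∀ n : ℕ, (0 : ℝ) < (1 / 2) ^ n := fun n => by positivity
  choose a ha ha1 ha2 using fun n => exists_testField_of_disjoint h1.1 h2.1 h12 (hfin h1) (hfin h2)
    (hpow n)
  choose b hb hb1 hb3 using fun n => exists_testField_of_disjoint h1.1 h3.1 h13 (hfin h1) (hfin h3)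
    (hpow n)
  choose c hc hc2 hc3 using fun n => exists_testField_of_disjoint h2.1 h3.1 h23 (hfin h2) (hfin h3)
    (hpow n)
  rw [e₁] at ha1 hb1
  rw [e₂] at ha2 hc2
  rw [e₃] at hb3 hc3
  have t1 := ae_tendsto_norm_add (isBddMeas_indicator h1.1) hμ₁ ha hb ha1 hb1
  have t2 := ae_tendsto_norm_add (isBddMeas_indicator h2.1) hμ₂ (fun n => (ha n).neg) hc ha2 hc2
  have t3 := ae_tendsto_norm_add (isBddMeas_indicator h3.1) hμ₃ (fun n => (hb n).neg)
    (fun n => (hc n).neg) hb3 hc3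
  set Z := essBoundary E₁ ∩ essBoundary E₂ ∩ essBoundary E₃ with hZ
  have n1 := hZ₁ (Z ∩ {x | ¬Tendsto (fun n => ‖a n x + b n x‖) atTop (𝓝 2)})
    (fun x hx => hx.1.1.1) (measure_mono_null inter_subset_right t1)
  have n2 := hZ₂ (Z ∩ {x | ¬Tendsto (fun n => ‖-a n x + c n x‖) atTop (𝓝 2)})
    (fun x hx => hx.1.1.2) (measure_mono_null inter_subset_right t2)
  have n3 := hZ₃ (Z ∩ {x | ¬Tendsto (fun n => ‖-b n x + -c n x‖) atTop (𝓝 2)})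
    (fun x hx => hx.1.2) (measure_mono_null inter_subset_right t3)
  refine measure_mono_null ?_ (measure_union_null n1 (measure_union_null n2 n3))
  intro x hx
  by_contra hcon
  simp only [mem_union, mem_inter_iff, mem_ofPred_eq, hx, true_and, not_or, not_not] at hcon
  obtain ⟨q1, q2, q3⟩ := hcon
  have hlt : (1.99 : ℝ) < 2 := by norm_num
  obtain ⟨n, ⟨r1, r2⟩, r3⟩ := ((q1.eventually (lt_mem_nhds hlt)).and
    (q2.eventually (lt_mem_nhds hlt)) |>.and (q3.eventually (lt_mem_nhds hlt))).exists
  exact not_three_aligned ((ha n).norm_le x) ((hb n).norm_le x) ((hc n).norm_le x) r1 r2 r3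

end Cascade

namespace Cascade

variable {d : ℕ}

/-! ### The perimeter is bounded by the Hausdorff measure of the topological boundary -/

/-- A nearly optimal cover by sets is replaced by balls centred in them, with radii strictly above
the diameters. The strict inequality makes the balls open neighbourhoods even of single points, and
the total loss is kept below ε/2; compactness leaves finitely many. Using the diameter as radius
loses only a constant elsewhere. -/
lemma exists_ball_cover {K : Set (Sp d)} (hK : IsCompact K) (k : ℕ)
    (hfin : μH[(k : ℝ)] K ≠ ⊤) {δ ε : ℝ} (hδ : 0 < δ) (hε : 0 < ε) :
    ∃ F : Finset (Sp d × ℝ), (∀ p ∈ F, 0 < p.2 ∧ p.2 < δ) ∧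
      K ⊆ ⋃ p ∈ F, Metric.ball p.1 p.2 ∧
      ∑ p ∈ F, p.2 ^ k ≤ (μH[(k : ℝ)] K).toReal + ε := by
  classical
  have h1 : ⨅ (t : ℕ → Set (Sp d)) (_ : K ⊆ ⋃ n, t n)
      (_ : ∀ n, Metric.ediam (t n) ≤ ENNReal.ofReal (δ / 2)),
        ∑' n, ⨆ _ : (t n).Nonempty, Metric.ediam (t n) ^ (k : ℝ)
      < μH[(k : ℝ)] K + ENNReal.ofReal (ε / 2) := by
    refine lt_of_le_of_lt ?_ (ENNReal.lt_add_right hfin (by simpa using hε))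
    rw [Measure.hausdorffMeasure_apply]
    exact le_iSup₂ (f := fun (r : ℝ≥0∞) (_ : 0 < r) => ⨅ (t : ℕ → Set (Sp d)) (_ : K ⊆ ⋃ n, t n)
      (_ : ∀ n, Metric.ediam (t n) ≤ r),
        ∑' n, ⨆ _ : (t n).Nonempty, Metric.ediam (t n) ^ (k : ℝ)) _ (by simpa using hδ)
  simp only [iInf_lt_iff] at h1
  obtain ⟨t, hcov, hdiam, hsum⟩ := h1
  set D : ℕ → ℝ := fun n => (Metric.ediam (t n)).toReal with hD
  have hDtop : ∀ n, Metric.ediam (t n) ≠ ⊤ := fun n =>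
    ne_top_of_le_ne_top ENNReal.ofReal_ne_top (hdiam n)
  have hDδ : ∀ n, D n ≤ δ / 2 := fun n => ENNReal.toReal_le_of_le_ofReal (by positivity) (hdiam n)
  have hD0 : ∀ n, 0 ≤ D n := fun n => ENNReal.toReal_nonneg
  have hr : ∀ n, ∃ r, D n < r ∧ r < δ ∧ r ^ k < D n ^ k + ε / 2 * (1 / 2 / 2 ^ n) := by
    intro n
    have hc : ContinuousAt (fun r : ℝ => r ^ k) (D n) := (continuous_pow k).continuousAt
    have e1 : ∀ᶠ r in 𝓝 (D n), r ^ k < D n ^ k + ε / 2 * (1 / 2 / 2 ^ n) :=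
      hc.eventually (gt_mem_nhds (by simp only; have : 0 < ε / 2 * (1 / 2 / 2 ^ n) := by positivity
                                     linarith))
    have e2 : ∀ᶠ r in 𝓝 (D n), r < δ := gt_mem_nhds (by linarith [hDδ n])
    obtain ⟨r, ⟨h1, h2⟩, h3⟩ := (((e1.and e2).filter_mono nhdsWithin_le_nhds).and
      (self_mem_nhdsWithin (a := D n) (s := Ioi (D n)))).exists
    exact ⟨r, h3, h2, h1⟩
  choose r hr1 hr2 hr3 using hr
  have hx : ∀ n, ∃ x, (t n).Nonempty → x ∈ t n := fun n => by
    by_cases h : (t n).Nonempty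
    · exact ⟨h.some, fun _ => h.some_mem⟩
    · exact ⟨0, fun h' => absurd h' h⟩
  choose x hx using hx
  have hsub : ∀ n, t n ⊆ Metric.ball (x n) (r n) := by
    intro n y hy
    have h2 := Metric.edist_le_ediam_of_mem hy (hx n ⟨y, hy⟩)
    rw [Metric.mem_ball]
    refine lt_of_le_of_lt ?_ (hr1 n)
    rw [dist_edist]
    exact ENNReal.toReal_mono (hDtop n) h2
  obtain ⟨J₀, hJ₀⟩ := hK.elim_finite_subcover (fun n : {n // (t n).Nonempty} =>
    Metric.ball (x n) (r n)) (fun _ => Metric.isOpen_ball) (fun y hy => by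
      obtain ⟨n, hn⟩ := mem_iUnion.mp (hcov hy)
      exact mem_iUnion.mpr ⟨⟨n, y, hn⟩, hsub n hn⟩)
  obtain ⟨J, hJne, hJ⟩ : ∃ J : Finset ℕ, (∀ n ∈ J, (t n).Nonempty) ∧
      K ⊆ ⋃ n ∈ J, Metric.ball (x n) (r n) := by
    refine ⟨J₀.image Subtype.val, fun n hn => ?_, fun y hy => ?_⟩
    · obtain ⟨m, -, rfl⟩ := Finset.mem_image.mp hn
      exact m.2
    · obtain ⟨n, hn, hyn⟩ := mem_iUnion₂.mp (hJ₀ hy)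
      exact mem_iUnion₂.mpr ⟨n.1, Finset.mem_image_of_mem _ hn, hyn⟩
  refine ⟨J.image fun n => (x n, r n), fun p hp => ?_, fun y hy => ?_, ?_⟩
  · obtain ⟨n, -, rfl⟩ := Finset.mem_image.mp hp
    exact ⟨(hD0 n).trans_lt (hr1 n), hr2 n⟩
  · obtain ⟨n, hn, hyn⟩ := mem_iUnion₂.mp (hJ hy)
    exact mem_iUnion₂.mpr ⟨_, Finset.mem_image_of_mem _ hn, hyn⟩
  · have hnn : ∀ n, 0 ≤ r n := fun n => (hD0 n).trans (hr1 n).le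
    have s1 : ∑ p ∈ J.image (fun n => (x n, r n)), p.2 ^ k ≤ ∑ n ∈ J, r n ^ k :=
      Finset.sum_image_le_of_nonneg (g := fun n => (x n, r n)) (f := fun p : Sp d × ℝ => p.2 ^ k)
        fun u hu => by
          obtain ⟨n, -, rfl⟩ := Finset.mem_image.mp hu
          exact pow_nonneg (hnn n) k
    have s2 : ∑ n ∈ J, r n ^ k ≤ ∑ n ∈ J, (D n ^ k + ε / 2 * (1 / 2 / 2 ^ n)) :=
      Finset.sum_le_sum fun n _ => (hr3 n).le
    have s3 : ∑ n ∈ J, ε / 2 * (1 / 2 / 2 ^ n) ≤ ε / 2 := by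
      rw [← Finset.mul_sum]
      have : ∑ n ∈ J, (1 : ℝ) / 2 / 2 ^ n ≤ 1 :=
        (Summable.sum_le_tsum (f := fun n : ℕ => (1 : ℝ) / 2 / 2 ^ n) J
          (fun n _ => by positivity) (summable_geometric_two' 1)).trans_eq (tsum_geometric_two' 1)
      nlinarith
    have s4 : ENNReal.ofReal (∑ n ∈ J, D n ^ k) ≤ ENNReal.ofReal ((μH[(k : ℝ)] K).toReal + ε / 2) := by
      rw [ENNReal.ofReal_add ENNReal.toReal_nonneg (by positivity), ENNReal.ofReal_toReal hfin]
      refine le_trans ?_ hsum.le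
      rw [ENNReal.ofReal_sum_of_nonneg fun n _ => pow_nonneg (hD0 n) k]
      have : ∀ n ∈ J, ENNReal.ofReal (D n ^ k)
          = ⨆ _ : (t n).Nonempty, Metric.ediam (t n) ^ (k : ℝ) := by
        intro n hn
        rw [iSup_pos (hJne n hn), ENNReal.rpow_natCast, ENNReal.ofReal_pow (hD0 n), hD,
          ENNReal.ofReal_toReal (hDtop n)]
      rw [Finset.sum_congr rfl this]
      exact ENNReal.sum_le_tsum _
    have s5 := (ENNReal.ofReal_le_ofReal_iff (by positivity)).mp s4
    rw [Finset.sum_add_distrib] at s2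
    linarith

/-- If φ vanishes near the boundary of E, then 1_E φ is itself a C¹ field with compact support. -/
lemma integral_indicator_mul_divergence_eq_zero {E : Set (Sp d)} {φ : Sp d → Sp d}
    (h : ContDiff ℝ 1 φ) (hc : HasCompactSupport φ) (hE : Disjoint (tsupport φ) (frontier E)) :
    ∫ x, E.indicator (fun _ => (1 : ℝ)) x * divergence φ x = 0 := by
  have hloc : ∀ x, (x ∈ interior E ∧ E.indicator φ =ᶠ[𝓝 x] φ) ∨ (E.indicator φ =ᶠ[𝓝 x] 0 ∧
      (x ∉ E ∨ φ =ᶠ[𝓝 x] 0)) := by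
    intro x
    by_cases h1 : x ∈ interior E
    · left
      refine ⟨h1, ?_⟩
      filter_upwards [isOpen_interior.mem_nhds h1] with y hy
      exact indicator_of_mem (interior_subset hy) _
    · right
      by_cases h2 : x ∈ closure E
      · have h3 : x ∉ tsupport φ := fun h4 => hE.le_bot ⟨h4, h2, h1⟩
        have h4 := notMem_tsupport_iff_eventuallyEq.mp h3
        refine ⟨?_, Or.inr h4⟩
        filter_upwards [h4] with y hy
        by_cases hyE : y ∈ E
        · rw [indicator_of_mem hyE, hy]
        · rw [indicator_of_notMem hyE]; rfl
      · refine ⟨?_, Or.inl fun h => h2 (subset_closure h)⟩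
        filter_upwards [isClosed_closure.isOpen_compl.mem_nhds h2] with y hy
        exact indicator_of_notMem (fun h => hy (subset_closure h)) _
  have hC : ContDiff ℝ 1 (E.indicator φ) := by
    rw [contDiff_iff_contDiffAt]
    intro x
    rcases hloc x with ⟨-, h1⟩ | ⟨h1, -⟩
    · exact h.contDiffAt.congr_of_eventuallyEq h1
    · exact (contDiffAt_const (c := (0 : Sp d))).congr_of_eventuallyEq h1
  have hcs : HasCompactSupport (E.indicator φ) := by
    refine hc.of_isClosed_subset (isClosed_tsupport _) (closure_mono fun x hx h0 => hx ?_)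
    by_cases hxE : x ∈ E
    · rw [indicator_of_mem hxE, h0]
    · rw [indicator_of_notMem hxE]
  rw [← integral_divergence_eq_zero hC hcs]
  congr 1
  funext x
  rcases hloc x with ⟨h0, h1⟩ | ⟨h1, h2 | h2⟩
  · rw [indicator_of_mem (interior_subset h0), one_mul, divergence, divergence, h1.fderiv_eq]
  · rw [indicator_of_notMem h2, zero_mul, divergence, h1.fderiv_eq]
    simp
  · rw [divergence, divergence, h1.fderiv_eq, h2.fderiv_eq]
    simp

/-- Only the part of a test field near ∂E contributes. Cut off to finitely many balls covering ∂E,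
it is bounded by the volumes r^d times M + K/r: the gradient of the cutoff yields r^{d-1}, and so
does the divergence once M r ≤ 1, which explains the choice δ = 1/(M + 1). -/
theorem exists_totalVar_le_hausdorffMeasure (hd : 1 ≤ d) : ∃ C : ℝ, 0 < C ∧
    ∀ E O : Set (Sp d), NullMeasurableSet E volume →
      totalVar (E.indicator fun _ => (1 : ℝ)) O
        ≤ ENNReal.ofReal C * μH[((d - 1 : ℕ) : ℝ)] (frontier E ∩ O) := by
  obtain ⟨K₀, hK₀, hη₀⟩ := exists_radialCutoff d
  obtain ⟨K₁, hK₁⟩ := exists_lipschitzWith_smoothTransition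
  have hb := ballVol_pos d
  set C : ℝ := ballVol d * 2 ^ d * (1 + K₁ * K₀) with hC
  have hC0 : 0 < C := by positivity
  refine ⟨C, hC0, fun E O hE => iSup₂_le fun ψ hψ => ?_⟩
  set s : Set (Sp d) := tsupport ψ ∩ frontier E with hs
  have hsc : IsCompact s := hψ.compact.isCompact.inter_right isClosed_frontier
  have hsO : s ⊆ frontier E ∩ O := fun x hx => ⟨hx.2, hψ.subset hx.1⟩
  refine le_trans ?_ (mul_le_mul_right (measure_mono hsO) _)
  by_cases hfin : μH[((d - 1 : ℕ) : ℝ)] s = ⊤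
  · rw [hfin, ENNReal.mul_top (by simpa using hC0)]
    exact le_top
  rw [← ENNReal.ofReal_toReal hfin, ← ENNReal.ofReal_mul hC0.le]
  refine ENNReal.ofReal_le_ofReal ?_
  set H₀ := (μH[((d - 1 : ℕ) : ℝ)] s).toReal with hH₀
  suffices key : ∀ ε > 0, ∫ x, E.indicator (fun _ => (1 : ℝ)) x * divergence ψ x ≤ C * (H₀ + ε) by
    refine le_of_forall_pos_le_add fun ε hε => ?_
    have := key (ε / C) (by positivity)
    rwa [mul_add, mul_div_cancel₀ ε hC0.ne'] at this
  intro ε hε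
  obtain ⟨M, hM⟩ : ∃ M, ∀ x, |divergence ψ x| ≤ M :=
    (hasCompactSupport_divergence hψ.compact).exists_bound_of_continuous
      (continuous_divergence hψ.contDiff)
  have hM0 : 0 ≤ M := (abs_nonneg _).trans (hM 0)
  obtain ⟨F, hF1, hF2, hF3⟩ := exists_ball_cover hsc (d - 1) hfin (δ := 1 / (M + 1))
    (by positivity) hε
  choose! η hη using fun p (hp : p ∈ F) => hη₀ p.1 p.2 (2 * p.2) (hF1 p hp).1
    (by linarith [(hF1 p hp).1])
  set G : Sp d → ℝ := fun x => ∑ p ∈ F, η p x with hG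
  have hGc : ContDiff ℝ 1 G := ContDiff.sum fun p hp => (hη p hp).contDiff
  -- The balls may overlap, so the sum of cutoffs can exceed one. The smooth transition maps it back
  -- to [0, 1], keeps the value one on the balls and costs its Lipschitz constant in the derivative.
  set H : Sp d → ℝ := fun x => Real.smoothTransition (G x) with hH
  have hHc : ContDiff ℝ 1 H := (Real.smoothTransition.contDiff (n := 1)).comp hGc
  have hH01 : ∀ x, H x ∈ Icc (0 : ℝ) 1 := fun x =>
    ⟨Real.smoothTransition.nonneg _, Real.smoothTransition.le_one _⟩
  have hH1 : ∀ p ∈ F, ∀ x ∈ Metric.ball p.1 p.2, H x = 1 := by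
    intro p hp x hx
    refine Real.smoothTransition.one_of_one_le ?_
    rw [← (hη p hp).eq_one x (Metric.ball_subset_closedBall hx)]
    exact Finset.single_le_sum (f := fun p => η p x) (fun q hq => ((hη q hq).mem_Icc x).1) hp
  have hH0 : ∀ x, (∀ p ∈ F, x ∉ Metric.closedBall p.1 (2 * p.2)) → H x = 0 := by
    intro x hx
    have : G x = 0 := Finset.sum_eq_zero fun p hp => (hη p hp).eq_zero (hx p hp)
    rw [hH]
    simp only
    rw [this]
    exact Real.smoothTransition.zero
  have hHd : ∀ x, ‖fderiv ℝ H x‖ ≤ K₁ * ∑ p ∈ F, ‖fderiv ℝ (η p) x‖ := by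
    intro x
    have e1 : HasFDerivAt G (∑ p ∈ F, fderiv ℝ (η p) x) x :=
      HasFDerivAt.fun_sum fun p hp => ((hη p hp).contDiff.differentiable one_ne_zero x).hasFDerivAt
    have e2 : DifferentiableAt ℝ Real.smoothTransition (G x) :=
      (Real.smoothTransition.contDiff (n := 1)).differentiable one_ne_zero _
    have e3 := (e2.hasDerivAt.comp_hasFDerivAt x e1).fderiv
    have e4 : H = Real.smoothTransition ∘ G := rfl
    rw [e4, e3, norm_smul]
    exact mul_le_mul (norm_deriv_le_of_lipschitz hK₁) (norm_sum_le _ _) (norm_nonneg _) K₁.2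
  have hcH : HasCompactSupport fun x => H x • ψ x :=
    hψ.compact.of_isClosed_subset (isClosed_tsupport _)
      (closure_mono fun x hx h0 => hx (by simp only [h0, smul_zero]))
  have hHψ : ContDiff ℝ 1 fun x => H x • ψ x := hHc.smul hψ.contDiff
  have hHψ' : ContDiff ℝ 1 fun x => (1 - H x) • ψ x := (contDiff_const.sub hHc).smul hψ.contDiff
  have hsub : tsupport (fun x => (1 - H x) • ψ x) ⊆ tsupport ψ :=
    closure_mono fun x hx h0 => hx (by simp only [h0, smul_zero])
  have hcH' : HasCompactSupport fun x => (1 - H x) • ψ x :=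
    hψ.compact.of_isClosed_subset (isClosed_tsupport _) hsub
  have hzero := integral_indicator_mul_divergence_eq_zero (E := E) hHψ' hcH' (by
    refine disjoint_left.mpr fun x hx hxE => ?_
    obtain ⟨p, hp, hxp⟩ := mem_iUnion₂.mp (hF2 ⟨hsub hx, hxE⟩)
    refine (notMem_tsupport_iff_eventuallyEq.mpr ?_) hx
    filter_upwards [Metric.isOpen_ball.mem_nhds hxp] with y hy
    simp [hH1 p hp y hy])
  have hfb := isBddMeas_indicator hE
  have hint1 : Integrable fun x => E.indicator (fun _ => (1 : ℝ)) x
      * divergence (fun x => (1 - H x) • ψ x) x :=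
    hfb.integrable_mul (integrable_divergence hHψ' hcH')
  have hint2 : Integrable fun x => E.indicator (fun _ => (1 : ℝ)) x
      * divergence (fun x => H x • ψ x) x :=
    hfb.integrable_mul (integrable_divergence hHψ hcH)
  have hsplit : ∫ x, E.indicator (fun _ => (1 : ℝ)) x * divergence ψ x
      = ∫ x, E.indicator (fun _ => (1 : ℝ)) x * divergence (fun x => H x • ψ x) x := by
    rw [← zero_add (∫ x, E.indicator (fun _ => (1 : ℝ)) x * divergence (fun x => H x • ψ x) x),
      ← hzero, ← integral_add hint1 hint2]
    congr 1
    funext x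
    rw [← mul_add, ← divergence_add hHψ' hHψ]
    have hψeq : ψ = fun y => (1 - H y) • ψ y + H y • ψ y := by
      funext y
      rw [← add_smul, sub_add_cancel, one_smul]
    conv_lhs => rw [hψeq]
  rw [hsplit]
  have hI : ∀ p ∈ F, Integrable (fun x => (Metric.closedBall p.1 (2 * p.2)).indicator
      (fun _ => M + K₁ * (K₀ / p.2)) x) := fun p _ =>
    (integrable_indicator_iff measurableSet_closedBall).mpr
      (integrableOn_const measure_closedBall_lt_top.ne)
  have hpt : ∀ x, E.indicator (fun _ => (1 : ℝ)) x * divergence (fun x => H x • ψ x) x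
      ≤ ∑ p ∈ F, (Metric.closedBall p.1 (2 * p.2)).indicator (fun _ => M + K₁ * (K₀ / p.2)) x := by
    intro x
    rw [divergence_smul hHc hψ.contDiff]
    have e1 : |H x * divergence ψ x| ≤ ∑ p ∈ F,
        (Metric.closedBall p.1 (2 * p.2)).indicator (fun _ => M) x := by
      by_cases hx : ∃ p ∈ F, x ∈ Metric.closedBall p.1 (2 * p.2)
      · obtain ⟨p, hp, hxp⟩ := hx
        have h1 : (Metric.closedBall p.1 (2 * p.2)).indicator (fun _ => M) x ≤ ∑ p ∈ F,
            (Metric.closedBall p.1 (2 * p.2)).indicator (fun _ => M) x :=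
          Finset.single_le_sum (f := fun p : Sp d × ℝ =>
            (Metric.closedBall p.1 (2 * p.2)).indicator (fun _ => M) x)
            (fun q _ => indicator_nonneg (fun _ _ => hM0) _) hp
        rw [indicator_of_mem hxp] at h1
        refine le_trans ?_ h1
        rw [abs_mul, abs_of_nonneg (hH01 x).1]
        exact (mul_le_of_le_one_left (abs_nonneg _) (hH01 x).2).trans (hM x)
      · push Not at hx
        rw [hH0 x hx, zero_mul, abs_zero]
        exact Finset.sum_nonneg fun q _ => indicator_nonneg (fun _ _ => hM0) _
    have e2 : |fderiv ℝ H x (ψ x)| ≤ ∑ p ∈ F,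
        (Metric.closedBall p.1 (2 * p.2)).indicator (fun _ => K₁ * (K₀ / p.2)) x := by
      have h1 := (fderiv ℝ H x).le_opNorm (ψ x)
      rw [Real.norm_eq_abs] at h1
      refine h1.trans ((mul_le_of_le_one_right (norm_nonneg _) (hψ.norm_le x)).trans
        ((hHd x).trans ?_))
      rw [Finset.mul_sum]
      refine Finset.sum_le_sum fun p hp => ?_
      by_cases hx : x ∈ Metric.closedBall p.1 (2 * p.2)
      · rw [indicator_of_mem hx]
        have h2 := (hη p hp).norm_fderiv_le x
        rw [show 2 * p.2 - p.2 = p.2 by ring] at h2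
        exact mul_le_mul_of_nonneg_left h2 K₁.2
      · rw [indicator_of_notMem hx, (hη p hp).fderiv_eq_zero fun h => hx h.1, norm_zero, mul_zero]
    have e3 : ∑ p ∈ F, (Metric.closedBall p.1 (2 * p.2)).indicator
          (fun _ => M + K₁ * (K₀ / p.2)) x
        = (∑ p ∈ F, (Metric.closedBall p.1 (2 * p.2)).indicator (fun _ => M) x)
          + ∑ p ∈ F, (Metric.closedBall p.1 (2 * p.2)).indicator (fun _ => K₁ * (K₀ / p.2)) x := by
      rw [← Finset.sum_add_distrib]
      refine Finset.sum_congr rfl fun p _ => ?_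
      by_cases hx : x ∈ Metric.closedBall p.1 (2 * p.2) <;> simp [hx]
    rw [e3]
    refine le_trans ?_ (add_le_add e1 e2)
    have e4 : |E.indicator (fun _ => (1 : ℝ)) x| ≤ 1 := by
      by_cases h : x ∈ E <;> simp [h]
    refine (le_abs_self _).trans ?_
    rw [abs_mul]
    exact (mul_le_of_le_one_left (abs_nonneg _) e4).trans (abs_add_le _ _)
  refine (integral_mono hint2 (integrable_finsetSum _ hI) hpt).trans ?_
  rw [integral_finsetSum F hI]
  calc ∑ p ∈ F, ∫ x, (Metric.closedBall p.1 (2 * p.2)).indicator (fun _ => M + K₁ * (K₀ / p.2)) x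
      ≤ ∑ p ∈ F, C * p.2 ^ (d - 1) := by
        refine Finset.sum_le_sum fun p hp => ?_
        obtain ⟨hp0, hp1⟩ := hF1 p hp
        rw [integral_indicator measurableSet_closedBall, setIntegral_const,
          measureReal_closedBall p.1 (by linarith), smul_eq_mul, mul_pow]
        have e1 : p.2 ^ d = p.2 ^ (d - 1) * p.2 := by
          rw [← pow_succ, Nat.sub_add_cancel hd]
        have e2 : M * p.2 ≤ 1 := by
          rw [lt_div_iff₀ (by positivity)] at hp1
          nlinarith
        have e3 : p.2 * (M + K₁ * (K₀ / p.2)) ≤ 1 + K₁ * K₀ := by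
          have : p.2 * (M + K₁ * (K₀ / p.2)) = M * p.2 + K₁ * K₀ := by field_simp
          linarith
        have e4 : 0 ≤ ballVol d * 2 ^ d * p.2 ^ (d - 1) := by positivity
        calc ballVol d * (2 ^ d * p.2 ^ d) * (M + K₁ * (K₀ / p.2))
            = ballVol d * 2 ^ d * p.2 ^ (d - 1) * (p.2 * (M + K₁ * (K₀ / p.2))) := by
              rw [e1]; ring
          _ ≤ ballVol d * 2 ^ d * p.2 ^ (d - 1) * (1 + K₁ * K₀) := by gcongr
          _ = C * p.2 ^ (d - 1) := by rw [hC]; ring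
    _ = C * ∑ p ∈ F, p.2 ^ (d - 1) := (Finset.mul_sum ..).symm
    _ ≤ C * (H₀ + ε) := mul_le_mul_of_nonneg_left hF3 hC0.le

end Cascade

namespace Cascade

variable {d : ℕ}

/-! ### Complements and differences -/

lemma essBoundary_compl (E : Set (Sp d)) : essBoundary Eᶜ = essBoundary E := by
  ext x
  simp only [essBoundary, mem_ofPred_eq, sdiff_eq, compl_compl]
  exact and_comm

lemma HasFinitePerimeter.compl {E : Set (Sp d)} (h : HasFinitePerimeter E) :
    HasFinitePerimeter Eᶜ := by
  refine ⟨h.1.compl, ?_⟩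
  rw [← totalVar_indicator_univ h.1.compl, totalVar_indicator_compl h.1,
    totalVar_indicator_univ h.1]
  exact h.2

lemma HasFinitePerimeter.diff {E F G : Set (Sp d)} (hE : HasFinitePerimeter E)
    (hF : HasFinitePerimeter F) (hG : NullMeasurableSet G volume)
    (h : ∀ᵐ x, G.indicator (fun _ => (1 : ℝ)) x
      = E.indicator (fun _ => (1 : ℝ)) x - F.indicator (fun _ => (1 : ℝ)) x) :
    HasFinitePerimeter G := by
  refine ⟨hG, ?_⟩
  rw [← totalVar_indicator_univ hG, totalVar_congr (h.mono fun x hx _ => hx)]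
  refine lt_of_le_of_lt (iSup₂_le fun ψ hψ => ?_) (ENNReal.add_lt_top.mpr ⟨hE.2, hF.2⟩)
  have hi := integrable_divergence hψ.contDiff hψ.compact
  have hi' := integrable_divergence hψ.neg.contDiff hψ.neg.compact
  have e : ∫ x, (E.indicator (fun _ => (1 : ℝ)) x - F.indicator (fun _ => (1 : ℝ)) x)
      * divergence ψ x = (∫ x, E.indicator (fun _ => (1 : ℝ)) x * divergence ψ x)
        + ∫ x, F.indicator (fun _ => (1 : ℝ)) x * divergence (fun y => -ψ y) x := by
    rw [← integral_add ((isBddMeas_indicator hE.1).integrable_mul hi)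
      ((isBddMeas_indicator hF.1).integrable_mul hi')]
    congr 1
    funext x
    rw [divergence_neg]
    ring
  rw [e, ← totalVar_indicator_univ hE.1, ← totalVar_indicator_univ hF.1]
  exact ENNReal.ofReal_add_le.trans (add_le_add (le_totalVar _ hψ) (le_totalVar _ hψ.neg))

/-- The coverings estimate `μH`, the weak equation is written with `μHE`; the nonzero factor
transfers finiteness and null sets between them. -/
lemma exists_hausdorff_factor (k : ℕ) : ∃ c : ℝ≥0, c ≠ 0 ∧
    (μHE[k] : Measure (Sp d)) = c • μH[(k : ℝ)] :=
  ⟨_, Measure.addHaarScalarFactor_volume_hausdorffMeasure_ne_zero k,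
    Measure.euclideanHausdorffMeasure_def k⟩

/-! ### The standing assumptions -/

/-- The standing assumptions on the classical data. -/
structure ClassicalData (d : ℕ) (γ T : ℝ) (Γ : Set (Sp d)) (V₀ w u : Sp d → ℝ) : Prop where
  one_le : 1 ≤ d
  γ_pos : 0 < γ
  T_pos : 0 < T
  perimeter_ne : perimeter Γ ≠ 0
  measV : Measurable V₀
  measw : Measurable w
  measu : Measurable u
  V_nonneg : ∀ x, 0 ≤ V₀ x
  w_nonneg : ∀ x, 0 ≤ w x
  isOpen_band : IsOpen (band w T)
  contDiffOn : ContDiffOn ℝ 1 w (band w T)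
  continuousOn : ContinuousOn w (closure (band w T))
  zero_set : {x | w x = 0} = closure Γ
  u_int : IntegrableOn u (band w T) volume
  V_bdd : ∃ C : ℝ, ∀ x, V₀ x ≤ C
  grad_lower : ∃ c : ℝ, 0 < c ∧ ∀ x ∈ band w T, c ≤ ‖gradient w x‖
  grad_upper : ∀ R : ℝ, ∃ C : ℝ, ∀ x ∈ band w T, ‖x‖ ≤ R → ‖gradient w x‖ ≤ C
  Γ_per : HasFinitePerimeter Γ
  Γ_bdry : frontier Γ = essBoundary Γ
  per : ∀ t ∈ Ioo 0 T, HasFinitePerimeter {x | w x < t}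
  bdry : ∀ t ∈ Ioo 0 T, frontier {x | w x < t} = essBoundary {x | w x < t}
  null : volume (frontier {x | w x < T}) = 0
  weak : IsWeakSolution Γ γ T V₀ u w
  flow : HasFlow Γ T w

/-- The field whose flux enters the weak form of the cascade equation. -/
noncomputable def fluxField (γ : ℝ) (w : Sp d → ℝ) (x : Sp d) : Sp d :=
  (1 / ‖gradient w x‖ ^ 2) • gradient w x + (γ / ‖gradient w x‖) • gradient w x

lemma band_mono (w : Sp d → ℝ) {s t : ℝ} (h : s ≤ t) : band w s ⊆ band w t :=
  fun _ hx => ⟨hx.1, hx.2.trans_le h⟩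

namespace ClassicalData

variable {γ T : ℝ} {Γ : Set (Sp d)} {V₀ w u : Sp d → ℝ}

section
variable (D : ClassicalData d γ T Γ V₀ w u)
include D

lemma w_eq_zero_iff {x : Sp d} : w x = 0 ↔ x ∈ closure Γ := by
  rw [← D.zero_set]; rfl

lemma w_frontier {z : Sp d} (hz : z ∈ frontier Γ) : w z = 0 :=
  D.w_eq_zero_iff.mpr (frontier_subset_closure hz)

lemma mem_band_iff {x : Sp d} {t : ℝ} : x ∈ band w t ↔ x ∉ closure Γ ∧ w x < t := by
  rw [← D.w_eq_zero_iff]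
  refine and_congr_left fun _ => ⟨fun h => h.ne', fun h => lt_of_le_of_ne (D.w_nonneg x) (Ne.symm h)⟩

lemma measurableSet_band (t : ℝ) : MeasurableSet (band w t) :=
  (measurableSet_lt measurable_const D.measw).inter (measurableSet_lt D.measw measurable_const)

lemma continuousOn_band : ContinuousOn w (band w T) := D.contDiffOn.continuousOn

lemma isOpen_band' {t : ℝ} (ht : t ≤ T) : IsOpen (band w t) := by
  have : band w t = band w T ∩ w ⁻¹' Iio t := by
    ext x
    exact ⟨fun h => ⟨band_mono w ht h, h.2⟩, fun h => ⟨h.1.1, h.2⟩⟩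
  rw [this]
  exact D.continuousOn_band.isOpen_inter_preimage D.isOpen_band isOpen_Iio

lemma hausdorff_frontier_lt_top : μH[((d - 1 : ℕ) : ℝ)] (frontier Γ) < ⊤ := by
  rw [D.Γ_bdry]
  exact hausdorffMeasure_essBoundary_lt_top D.one_le D.Γ_per

lemma surface_frontier_lt_top : (μHE[d - 1] : Measure (Sp d)) (frontier Γ) < ⊤ := by
  obtain ⟨c, -, hc⟩ := exists_hausdorff_factor (d := d) (d - 1)
  rw [hc, Measure.smul_apply]
  exact ENNReal.mul_lt_top ENNReal.coe_lt_top D.hausdorff_frontier_lt_top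

/-- A set of finite (d-1)-dimensional measure cannot have positive d-dimensional measure. -/
lemma volume_frontier : volume (frontier Γ) = 0 := by
  rw [← EuclideanSpace.euclideanHausdorffMeasure_eq_volume]
  have h1 := D.one_le
  rcases Measure.euclideanHausdorffMeasure_zero_or_top (X := Sp d) (by omega : d - 1 < d)
    (frontier Γ) with h | h
  · exact h
  · exact absurd h D.surface_frontier_lt_top.ne

lemma ae_mem_closure_iff : ∀ᵐ x : Sp d, x ∈ closure Γ ↔ x ∈ Γ := by
  filter_upwards [measure_eq_zero_iff_ae_notMem.mp D.volume_frontier] with x hx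
  refine ⟨fun h => ?_, fun h => subset_closure h⟩
  by_contra h2
  exact hx ⟨h, fun h3 => h2 (interior_subset h3)⟩

/-- Up to the null set ∂Γ the indicator of the band is the difference of those of {w < t} and of Γ.
-/
lemma finitePerimeter_band {t : ℝ} (ht : t ∈ Ioo 0 T) : HasFinitePerimeter (band w t) := by
  refine (D.per t ht).diff D.Γ_per (D.measurableSet_band t).nullMeasurableSet ?_
  filter_upwards [D.ae_mem_closure_iff] with x hx
  by_cases h1 : x ∈ Γ
  · have h2 : x ∉ band w t := fun h => (D.mem_band_iff.mp h).1 (hx.mpr h1)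
    have h3 : x ∈ {x | w x < t} := by
      have := D.w_eq_zero_iff.mpr (hx.mpr h1)
      rw [mem_ofPred_eq, this]; exact ht.1
    simp only [indicator_of_mem h1, indicator_of_mem h3, indicator_of_notMem h2]; simp
  · rw [indicator_of_notMem h1, sub_zero]
    have h3 : x ∈ band w t ↔ x ∈ {x | w x < t} := by
      rw [D.mem_band_iff, hx]
      exact ⟨fun h => h.2, fun h => ⟨h1, h⟩⟩
    by_cases h4 : x ∈ band w t
    · rw [indicator_of_mem h4, indicator_of_mem (h3.mp h4)]
    · rw [indicator_of_notMem h4, indicator_of_notMem fun h => h4 (h3.mpr h)]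

/-- The level is known to be continuous only on the closed band, so the ball may still contain
unreached points with arbitrary values; that it does not, for small radii, is proved later. -/
lemma exists_ball_w_lt {z : Sp d} (hz : z ∈ frontier Γ) {t : ℝ} (ht : 0 < t) :
    ∃ ρ > 0, ∀ x ∈ Metric.ball z ρ, x ∈ closure (band w T) → w x < t := by
  by_cases h : z ∈ closure (band w T)
  · have h1 : ∀ᶠ x in 𝓝[closure (band w T)] z, w x < t := by
      refine (D.continuousOn z h).eventually (gt_mem_nhds ?_)
      rw [D.w_frontier hz]; exact ht
    obtain ⟨ρ, hρ, h2⟩ := Metric.mem_nhdsWithin_iff.mp h1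
    exact ⟨ρ, hρ, fun x hx hxb => h2 ⟨hx, hxb⟩⟩
  · obtain ⟨ρ, hρ, h2⟩ := Metric.isOpen_iff.mp isClosed_closure.isOpen_compl z h
    exact ⟨ρ, hρ, fun x hx hxb => absurd hxb (h2 hx)⟩

lemma w_eq_of_mem_frontier {t : ℝ} {x : Sp d}
    (hx : x ∈ frontier {x | w x < t} ∩ band w T) : w x = t := by
  have hc : ContinuousAt w x := D.continuousOn_band.continuousAt (D.isOpen_band.mem_nhds hx.2)
  rcases lt_trichotomy (w x) t with h | h | h
  · exact absurd (mem_interior_iff_mem_nhds.mpr (hc.eventually (gt_mem_nhds h))) hx.1.2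
  · exact h
  · have h1 : ∀ᶠ y in 𝓝 x, t < w y := hc.eventually (lt_mem_nhds h)
    obtain ⟨y, hy1, hy2⟩ := mem_closure_iff_nhds.mp hx.1.1 _ h1
    exact (lt_asymm (show t < w y from hy1) hy2).elim

lemma gradient_ne_zero {x : Sp d} (hx : x ∈ band w T) : gradient w x ≠ 0 := by
  obtain ⟨c, hc, h⟩ := D.grad_lower
  intro h0
  have := h x hx
  rw [h0, norm_zero] at this
  linarith

lemma continuousOn_gradient : ContinuousOn (gradient w) (band w T) := by
  have h := D.contDiffOn.continuousOn_fderiv_of_isOpen D.isOpen_band le_rfl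
  exact (InnerProductSpace.toDual ℝ (Sp d)).symm.continuous.comp_continuousOn h

lemma exists_fluxField_bound : ∃ C : ℝ, 0 < C ∧ ∀ x ∈ band w T, ‖fluxField γ w x‖ ≤ C := by
  obtain ⟨c, hc, h⟩ := D.grad_lower
  have hγ := D.γ_pos
  refine ⟨1 / c + γ, by positivity, fun x hx => ?_⟩
  have h1 : 0 < ‖gradient w x‖ := norm_pos_iff.mpr (D.gradient_ne_zero hx)
  refine (norm_add_le _ _).trans ?_
  rw [norm_smul, norm_smul, Real.norm_of_nonneg (by positivity), Real.norm_of_nonneg (by positivity)]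
  have e1 : 1 / ‖gradient w x‖ ^ 2 * ‖gradient w x‖ = 1 / ‖gradient w x‖ := by field_simp
  have e2 : γ / ‖gradient w x‖ * ‖gradient w x‖ = γ := by field_simp
  rw [e1, e2]
  have := one_div_le_one_div_of_le hc (h x hx)
  linarith

lemma weak_fluxField {t : ℝ} (ht : t ∈ Ioo 0 T) {φ : Sp d → ℝ}
    (hφ : ∃ C : ℝ≥0, LipschitzOnWith C φ (closure (band w t)))
    (hφc : ∃ K : Set (Sp d), IsCompact K ∧ ∀ x ∈ closure (band w t), x ∉ K → φ x = 0) :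
    ∫ x in band w t, (-(φ x * (u x + 1)) + inner ℝ (gradient φ x) (fluxField γ w x)) =
      ∫ x in frontier {x | w x < t} ∩ band w T, φ x * (1 / ‖gradient w x‖ + γ) ∂μHE[d - 1]
        - ∫ x in frontier Γ, φ x * (V₀ x + γ) ∂μHE[d - 1] :=
  D.weak t ht φ hφ hφc

/-- The weak formulation tested with a smooth function supported near a point of `∂Γ`. -/
lemma weak_near_frontier {t : ℝ} (ht : t ∈ Ioo 0 T) {φ : Sp d → ℝ} (hφ : ContDiff ℝ 1 φ)
    (hφc : HasCompactSupport φ) (h0 : ∀ x ∈ closure (band w T), t ≤ w x → φ x = 0) :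
    ∫ x in frontier Γ, φ x * (V₀ x + γ) ∂μHE[d - 1]
      = -∫ x in band w t, (-(φ x * (u x + 1)) + inner ℝ (gradient φ x) (fluxField γ w x)) := by
  obtain ⟨C, hC⟩ := hφ.lipschitzWith_of_hasCompactSupport hφc one_ne_zero
  have h1 := D.weak_fluxField ht (φ := φ) ⟨C, hC.lipschitzOnWith⟩
    ⟨tsupport φ, hφc, fun x _ hx => image_eq_zero_of_notMem_tsupport hx⟩
  have h2 : ∫ x in frontier {x | w x < t} ∩ band w T,
      φ x * (1 / ‖gradient w x‖ + γ) ∂(μHE[d - 1] : Measure (Sp d)) = 0 := by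
    refine integral_eq_zero_of_ae ?_
    filter_upwards [ae_restrict_mem (isClosed_frontier.measurableSet.inter
      (D.measurableSet_band T))] with x hx
    rw [h0 x (subset_closure hx.2) (D.w_eq_of_mem_frontier hx).ge, zero_mul]
    rfl
  rw [h2] at h1
  linarith

end

end ClassicalData

end Cascade

/-! ### The unreached set does not touch the boundary of Γ -/

namespace Cascade

variable {d : ℕ} {γ T : ℝ} {Γ : Set (Sp d)} {V₀ w u : Sp d → ℝ}

/-- The set F, having positive upper density at z, forces the complement of E to have it too. The
only way for z to miss the essential boundary of E is then that E has density zero. -/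
lemma notMem_essBoundary_of_subset_compl {E F : Set (Sp d)} {z : Sp d} (hz : z ∈ essBoundary F)
    (hdisj : Disjoint E F) (hE : z ∉ essBoundary E) :
    Tendsto (fun r : ℝ => volume (Metric.closedBall z r ∩ E) / ENNReal.ofReal (r ^ d))
      (𝓝[>] 0) (𝓝 0) := by
  have h1 : 0 < limsup (fun r : ℝ =>
      volume (Metric.closedBall z r \ E) / ENNReal.ofReal (r ^ d)) (𝓝[>] 0) := by
    refine hz.1.trans_le (limsup_le_limsup (Eventually.of_forall fun r => ?_))
    have h2 : Metric.closedBall z r ∩ F ⊆ Metric.closedBall z r \ E :=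
      fun x hx => ⟨hx.1, fun h => hdisj.le_bot ⟨h, hx.2⟩⟩
    exact ENNReal.div_le_div_right (measure_mono h2) _
  have h2 : limsup (fun r : ℝ =>
      volume (Metric.closedBall z r ∩ E) / ENNReal.ofReal (r ^ d)) (𝓝[>] 0) = 0 := by
    by_contra h
    exact hE ⟨pos_iff_ne_zero.mpr h, h1⟩
  exact tendsto_of_le_liminf_of_limsup_le bot_le h2.le

namespace ClassicalData

variable (D : ClassicalData d γ T Γ V₀ w u)
include D

/-- The weak formulation bounds the surface of `∂Γ` in a ball by the energy nearby. -/
lemma surface_ball_le : ∃ C : ℝ, 0 < C ∧ ∀ z ∈ frontier Γ, ∀ r t : ℝ, 0 < r → t ∈ Ioo 0 T →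
    (∀ x ∈ Metric.ball z (3 * r), x ∈ closure (band w T) → w x < t) →
    (μHE[d - 1] : Measure (Sp d)) (frontier Γ ∩ Metric.ball z r) ≤
      ENNReal.ofReal C * ((∫⁻ x in band w t ∩ Metric.closedBall z (2 * r), ‖u x + 1‖ₑ)
        + ENNReal.ofReal r⁻¹ * volume (Metric.closedBall z (2 * r) ∩ band w t)) := by
  obtain ⟨K, hK, hη⟩ := exists_radialCutoff d
  obtain ⟨X, hX, hXb⟩ := D.exists_fluxField_bound
  have hγ := D.γ_pos
  refine ⟨(1 + K * X) / γ, by positivity, fun z hz r t hr ht hnear => ?_⟩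
  -- The support of η stays in the ball of radius 3 r, where the closed band is below level t; the
  -- surface term on {w = t} drops out.
  obtain ⟨η, hη⟩ := hη z r (2 * r) hr (by linarith)
  have hηc := hη.hasCompactSupport
  have h1 := D.weak_near_frontier ht hη.contDiff hηc (fun x hx hxt => hη.eq_zero fun hxb => by
    have := hnear x (Metric.closedBall_subset_ball (by linarith) hxb) hx
    linarith)
  set ν : Measure (Sp d) := μHE[d - 1] with hν
  have hSm : MeasurableSet (frontier Γ) := isClosed_frontier.measurableSet
  have hfin : IsFiniteMeasure (ν.restrict (frontier Γ)) :=
    ⟨by rw [Measure.restrict_apply_univ]; exact D.surface_frontier_lt_top⟩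
  obtain ⟨B, hB⟩ := D.V_bdd
  have hint : Integrable (fun x => η x * (V₀ x + γ)) (ν.restrict (frontier Γ)) := by
    refine Integrable.of_bound ((hη.contDiff.continuous.measurable.mul
      (D.measV.add_const γ)).aestronglyMeasurable) (B + γ) (Eventually.of_forall fun x => ?_)
    have e0 := hη.mem_Icc x
    have e1 := D.V_nonneg x
    rw [Real.norm_of_nonneg (mul_nonneg e0.1 (by linarith))]
    exact (mul_le_of_le_one_left (by linarith) e0.2).trans (by linarith [hB x])
  -- V₀ may vanish, so the lower bound for the boundary term comes from the surface tension γ alone.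
  have h2 : γ * ν.real (frontier Γ ∩ Metric.ball z r) ≤ ∫ x in frontier Γ, η x * (V₀ x + γ) ∂ν := by
    have e1 : γ * ν.real (frontier Γ ∩ Metric.ball z r)
        = ∫ x in frontier Γ, (Metric.ball z r).indicator (fun _ => γ) x ∂ν := by
      rw [integral_indicator measurableSet_ball, setIntegral_const, smul_eq_mul, mul_comm,
        measureReal_restrict_apply measurableSet_ball, inter_comm]
    rw [e1]
    refine integral_mono ((integrable_const γ).indicator measurableSet_ball) hint fun x => ?_
    by_cases hx : x ∈ Metric.ball z r
    · simp only [indicator_of_mem hx]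
      rw [hη.eq_one x (Metric.ball_subset_closedBall hx), one_mul]
      linarith [D.V_nonneg x]
    · simp only [indicator_of_notMem hx]
      exact mul_nonneg (hη.mem_Icc x).1 (by linarith [D.V_nonneg x])
  have h3 : ENNReal.ofReal (∫ x in frontier Γ, η x * (V₀ x + γ) ∂ν)
      ≤ (∫⁻ x in band w t ∩ Metric.closedBall z (2 * r), ‖u x + 1‖ₑ)
        + ENNReal.ofReal (K * X / r) * volume (Metric.closedBall z (2 * r) ∩ band w t) := by
    rw [h1]
    refine (ENNReal.ofReal_le_ofReal (neg_le_abs _)).trans ?_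
    rw [← Real.norm_eq_abs, ofReal_norm]
    refine (enorm_integral_le_lintegral_enorm _).trans ?_
    have e1 : ∀ x ∈ band w t, ‖-(η x * (u x + 1)) + inner ℝ (gradient η x) (fluxField γ w x)‖ₑ
        ≤ (Metric.closedBall z (2 * r)).indicator
          (fun x => ‖u x + 1‖ₑ + ENNReal.ofReal (K * X / r)) x := by
      intro x hx
      by_cases hxb : x ∈ Metric.closedBall z (2 * r)
      · rw [indicator_of_mem hxb]
        refine (enorm_add_le _ _).trans (add_le_add ?_ ?_)
        · rw [enorm_neg, enorm_mul]
          refine mul_le_of_le_one_left' ?_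
          rw [← ofReal_norm, Real.norm_of_nonneg (hη.mem_Icc x).1]
          exact ENNReal.ofReal_le_one.mpr (hη.mem_Icc x).2
        · rw [← ofReal_norm]
          refine ENNReal.ofReal_le_ofReal ((norm_inner_le_norm _ _).trans ?_)
          rw [norm_gradient_eq]
          have e2 := hη.norm_fderiv_le x
          rw [show 2 * r - r = r by ring] at e2
          calc ‖fderiv ℝ η x‖ * ‖fluxField γ w x‖ ≤ K / r * X :=
                mul_le_mul e2 (hXb x (band_mono w ht.2.le hx)) (norm_nonneg _) (by positivity)
            _ = K * X / r := by ring
      · have e2 : gradient η x = 0 := by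
          rw [← norm_eq_zero, norm_gradient_eq, hη.fderiv_eq_zero fun h => hxb h.1, norm_zero]
        rw [indicator_of_notMem hxb, hη.eq_zero hxb, e2]
        simp
    refine (setLIntegral_mono' (D.measurableSet_band t) e1).trans ?_
    rw [setLIntegral_indicator measurableSet_closedBall, lintegral_add_right _ measurable_const,
      setLIntegral_const, inter_comm (band w t)]
  have h4 : ν (frontier Γ ∩ Metric.ball z r) = ENNReal.ofReal (γ⁻¹) *
      ENNReal.ofReal (γ * ν.real (frontier Γ ∩ Metric.ball z r)) := by
    rw [← ENNReal.ofReal_mul (by positivity), ← mul_assoc, inv_mul_cancel₀ hγ.ne', one_mul,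
      measureReal_def, ENNReal.ofReal_toReal]
    exact measure_ne_top_of_subset inter_subset_left D.surface_frontier_lt_top.ne
  rw [h4]
  refine (mul_le_mul_right ((ENNReal.ofReal_le_ofReal h2).trans h3) _).trans ?_
  rw [mul_add, mul_add]
  refine add_le_add ?_ ?_
  · gcongr
    rw [div_eq_mul_inv]
    exact le_mul_of_one_le_left (by positivity) (by nlinarith [mul_pos hK hX])
  · rw [← mul_assoc, ← mul_assoc, ← ENNReal.ofReal_mul (by positivity),
      ← ENNReal.ofReal_mul (by positivity)]
    refine mul_le_mul_left (ENNReal.ofReal_le_ofReal ?_) _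
    have e : (1 + K * X) / γ * r⁻¹ - γ⁻¹ * (K * X / r) = γ⁻¹ * r⁻¹ := by field_simp; ring
    have : 0 < γ⁻¹ * r⁻¹ := by positivity
    linarith

/-- The boundary of the initial domain has no point in common with the set of points which the
front has not reached. -/
theorem disjoint_frontier_closure_unreached : frontier Γ ∩ closure {x | T ≤ w x} = ∅ := by
  rw [eq_empty_iff_forall_notMem]
  intro z₀ hz₀
  have hd := D.one_le
  have hT := D.T_pos
  set t : ℝ := T / 2 with ht'
  have ht : t ∈ Ioo 0 T := ⟨by positivity, by linarith⟩
  set A : Set (Sp d) := frontier Γ ∩ closure {x | T ≤ w x} with hA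
  have hA1 : ∀ z ∈ A, z ∈ essBoundary Γ := fun z hz => D.Γ_bdry ▸ hz.1
  have hA2 : ∀ z ∈ A, z ∈ essBoundary {x | w x < t}ᶜ := by
    intro z hz
    rw [essBoundary_compl, ← D.bdry t ht, frontier_eq_closure_inter_closure]
    refine ⟨subset_closure ?_, closure_mono ?_ hz.2⟩
    · rw [mem_ofPred_eq, D.w_frontier hz.1]; exact ht.1
    · intro x hx hxt
      have h1 : T ≤ w x := hx
      have h2 : w x < t := hxt
      linarith [ht.2]
  -- Γ, the band and {w ≥ t} are pairwise disjoint, so contact points where the band has positive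
  -- density are triple points.
  have htriple : μH[((d - 1 : ℕ) : ℝ)] (A ∩ essBoundary (band w t)) = 0 := by
    have hsub : A ∩ essBoundary (band w t) ⊆
        essBoundary Γ ∩ essBoundary {x | w x < t}ᶜ ∩ essBoundary (band w t) :=
      fun z hz => ⟨⟨hA1 z hz.1, hA2 z hz.1⟩, hz.2⟩
    refine measure_mono_null hsub
      (hausdorffMeasure_triple_essBoundary hd D.Γ_per (D.per t ht).compl (D.finitePerimeter_band ht)
        ?_ ?_ ?_)
    · refine Eventually.of_forall fun x hx => hx.2 ?_
      rw [mem_ofPred_eq, D.w_eq_zero_iff.mpr (subset_closure hx.1)]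
      exact ht.1
    · exact Eventually.of_forall fun x hx => (D.mem_band_iff.mp hx.2).1 (subset_closure hx.1)
    · exact Eventually.of_forall fun x hx => hx.1 hx.2.2
  obtain ⟨ρ, hρ, hnear⟩ := D.exists_ball_w_lt hz₀.1 ht.1
  -- points with vanishing density of the band
  have hlow : μH[((d - 1 : ℕ) : ℝ)] ((A \ essBoundary (band w t)) ∩ Metric.ball z₀ (ρ / 2)) = 0 := by
    -- At the remaining contact points the band has volume o(r^d). Along suitable radii the surface
    -- of ∂Γ is at least of order r^{d-1}, so in the weak equation the integral of |1 + u| has to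
    -- balance it. Hence μ has positive (d-1)-density at these points, although it does not charge
    -- the Lebesgue null set ∂Γ.
    set μ : Measure (Sp d) := (volume.restrict (band w t ∩ Metric.closedBall z₀ ρ)).withDensity
      fun x => ‖u x + 1‖ₑ with hμ
    have hμfin : IsFiniteMeasure μ := by
      refine isFiniteMeasure_withDensity ?_
      have h1 : IntegrableOn (fun x => u x + 1) (band w t ∩ Metric.closedBall z₀ ρ) := by
        refine (D.u_int.mono_set (inter_subset_left.trans (band_mono w ht.2.le))).add ?_
        exact integrableOn_const (measure_ne_top_of_subset inter_subset_right
          measure_closedBall_lt_top.ne)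
      exact h1.2.ne
    have hμZ : μ ((A \ essBoundary (band w t)) ∩ Metric.ball z₀ (ρ / 2)) = 0 := by
      refine (withDensity_absolutelyContinuous _ _) ?_
      refine Measure.restrict_apply_le _ _ |>.trans_eq (measure_mono_null ?_ D.volume_frontier)
        |>.antisymm zero_le
      exact fun z hz => hz.1.1.1
    refine hausdorffMeasure_eq_zero_of_hasPosDensity hμZ fun z hz => ?_
    obtain ⟨C₁, hC₁, hsurf⟩ := D.surface_ball_le
    obtain ⟨C₂, hC₂, hper⟩ := exists_totalVar_le_hausdorffMeasure hd
    obtain ⟨c, hc0, hc⟩ := exists_hausdorff_factor (d := d) (d - 1)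
    obtain ⟨ε, hε, hε2⟩ := hasPosDensity_of_mem_essBoundary hd D.Γ_per.1 (hA1 z hz.1.1)
    have hdens := notMem_essBoundary_of_subset_compl (hA1 z hz.1.1) (E := band w t)
      (disjoint_left.mpr fun x hx hxΓ => (D.mem_band_iff.mp hx).1 (subset_closure hxΓ)) hz.1.2
    have hc' : (0 : ℝ) < c := by positivity
    set a : ℝ := ε * c / (C₁ * C₂) with ha
    have ha0 : 0 < a := by positivity
    have hb : (0 : ℝ) < a / (2 * 2 ^ d) := by positivity
    obtain ⟨δ, hδ, hδ2⟩ := mem_nhdsGT_iff_exists_Ioo_subset.mp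
      (hdens.eventually (gt_mem_nhds (ENNReal.ofReal_pos.mpr hb)))
    refine ⟨a / 2 / 3 ^ (d - 1), by positivity, fun σ hσ => ?_⟩
    obtain ⟨r, hr0, hr1, hr2⟩ := hε2 (min (min (δ / 2) (σ / 3)) (ρ / 8)) (by
      have : (0 : ℝ) < δ := hδ
      positivity)
    have hrδ : 2 * r < δ := by have := hr1.trans_le ((min_le_left _ _).trans (min_le_left _ _)); linarith
    have hrσ : 3 * r < σ := by have := hr1.trans_le ((min_le_left _ _).trans (min_le_right _ _)); linarith
    have hrρ : r < ρ / 8 := hr1.trans_le (min_le_right _ _)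
    have hzz : dist z z₀ < ρ / 2 := hz.2
    refine ⟨3 * r, by linarith, hrσ, ?_⟩
    have hdr : d = (d - 1) + 1 := (Nat.sub_add_cancel hd).symm
    -- lower bound
    have q1 : ENNReal.ofReal (a * r ^ (d - 1)) ≤
        (∫⁻ x in band w t ∩ Metric.closedBall z (2 * r), ‖u x + 1‖ₑ)
        + ENNReal.ofReal r⁻¹ * volume (Metric.closedBall z (2 * r) ∩ band w t) := by
      have q2 := hsurf z hz.1.1.1 r t hr0 ht fun x hx hxb => hnear x (by
        rw [Metric.mem_ball] at hx ⊢
        linarith [dist_triangle x z z₀]) hxb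
      have q3 := hper Γ (Metric.ball z r) D.Γ_per.1
      rw [hc, Measure.smul_apply, ENNReal.smul_def, smul_eq_mul] at q2
      have q4 := hr2.trans q3
      have q5 : ENNReal.ofReal (a * r ^ (d - 1)) = ENNReal.ofReal (c / (C₁ * C₂)) *
          ENNReal.ofReal (ε * r ^ (d - 1)) := by
        rw [← ENNReal.ofReal_mul (by positivity)]
        congr 1
        rw [ha]; ring
      have q6 : ENNReal.ofReal (c / (C₁ * C₂)) * ENNReal.ofReal C₂ =
          ENNReal.ofReal C₁⁻¹ * (c : ℝ≥0∞) := by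
        rw [← ENNReal.ofReal_mul (by positivity), ← ENNReal.ofReal_coe_nnreal (p := c),
          ← ENNReal.ofReal_mul (by positivity)]
        congr 1
        field_simp
      calc ENNReal.ofReal (a * r ^ (d - 1)) ≤ ENNReal.ofReal (c / (C₁ * C₂)) *
            (ENNReal.ofReal C₂ * μH[((d - 1 : ℕ) : ℝ)] (frontier Γ ∩ Metric.ball z r)) := by
            rw [q5]; exact mul_le_mul_right q4 _
        _ = ENNReal.ofReal C₁⁻¹ * (c * μH[((d - 1 : ℕ) : ℝ)] (frontier Γ ∩ Metric.ball z r)) := by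
            rw [← mul_assoc, q6, mul_assoc]
        _ ≤ _ := mul_le_mul_right q2 _
        _ = _ := by
            rw [← mul_assoc, ← ENNReal.ofReal_mul (by positivity), inv_mul_cancel₀ hC₁.ne',
              ENNReal.ofReal_one, one_mul]
    -- The radius is so small that the volume term is at most half of the lower bound; the other
    -- half is left to |1 + u|.
    have q7 : ENNReal.ofReal r⁻¹ * volume (Metric.closedBall z (2 * r) ∩ band w t)
        ≤ ENNReal.ofReal (a / 2 * r ^ (d - 1)) := by
      have q8 : volume (Metric.closedBall z (2 * r) ∩ band w t) / ENNReal.ofReal ((2 * r) ^ d)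
          ≤ ENNReal.ofReal (a / (2 * 2 ^ d)) :=
        le_of_lt (hδ2 (show 2 * r ∈ Ioo 0 δ from ⟨by linarith, hrδ⟩))
      rw [ENNReal.div_le_iff (by simp; positivity) ENNReal.ofReal_ne_top] at q8
      refine (mul_le_mul_right q8 _).trans (le_of_eq ?_)
      rw [← ENNReal.ofReal_mul (by positivity), ← ENNReal.ofReal_mul (by positivity)]
      congr 1
      rw [mul_pow]
      have : r ^ d = r ^ (d - 1) * r := by rw [← pow_succ, Nat.sub_add_cancel hd]
      rw [this]
      field_simp
    have q9 : ENNReal.ofReal (a / 2 * r ^ (d - 1)) ≤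
        ∫⁻ x in band w t ∩ Metric.closedBall z (2 * r), ‖u x + 1‖ₑ := by
      have q10 := q1.trans (add_le_add le_rfl q7)
      have q11 : ENNReal.ofReal (a * r ^ (d - 1)) = ENNReal.ofReal (a / 2 * r ^ (d - 1))
          + ENNReal.ofReal (a / 2 * r ^ (d - 1)) := by
        rw [← ENNReal.ofReal_add (by positivity) (by positivity)]
        congr 1
        ring
      rw [q11] at q10
      exact (ENNReal.add_le_add_iff_right ENNReal.ofReal_ne_top).mp q10
    have q12 : a / 2 / 3 ^ (d - 1) * (3 * r) ^ (d - 1) = a / 2 * r ^ (d - 1) := by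
      rw [mul_pow]; field_simp
    rw [q12]
    refine q9.trans ?_
    change _ ≤ μ (Metric.ball z (3 * r))
    rw [hμ, withDensity_apply _ measurableSet_ball, Measure.restrict_restrict measurableSet_ball]
    refine lintegral_mono_set fun x hx => ⟨?_, hx.1, ?_⟩
    · exact Metric.closedBall_subset_ball (by linarith) hx.2
    · have := hx.2
      rw [Metric.mem_closedBall] at this ⊢
      linarith [dist_triangle x z z₀]
  -- the frontier of the unreached set
  have hsub : frontier {x | T ≤ w x} ∩ Metric.ball z₀ (ρ / 2) ⊆
      (A ∩ essBoundary (band w t)) ∪ ((A \ essBoundary (band w t)) ∩ Metric.ball z₀ (ρ / 2)) := by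
    intro x hx
    have h1 : x ∉ band w T := by
      intro hxb
      obtain ⟨y, hy1, hy2⟩ := mem_closure_iff.mp hx.1.1 _ D.isOpen_band hxb
      exact absurd hy1.2 (not_lt.mpr hy2)
    have h2 : x ∈ closure (closure Γ ∪ band w T) := by
      have h3 : x ∈ closure {x | T ≤ w x}ᶜ := by
        rw [closure_compl]; exact hx.1.2
      refine closure_mono ?_ h3
      intro y hy
      by_cases hyΓ : y ∈ closure Γ
      · exact Or.inl hyΓ
      · exact Or.inr (D.mem_band_iff.mpr ⟨hyΓ, not_le.mp hy⟩)
    rw [closure_union, closure_closure] at h2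
    have h3 : x ∈ closure Γ := by
      rcases h2 with h2 | h2
      · exact h2
      · by_contra hxΓ
        have h4 := hnear x (Metric.ball_subset_ball (by linarith) hx.2) h2
        exact h1 (D.mem_band_iff.mpr ⟨hxΓ, h4.trans ht.2⟩)
    have h4 : x ∈ A := by
      refine ⟨⟨h3, fun h5 => ?_⟩, hx.1.1⟩
      obtain ⟨y, hy1, hy2⟩ := mem_closure_iff.mp hx.1.1 _ isOpen_interior h5
      have h6 : T ≤ w y := hy2
      rw [D.w_eq_zero_iff.mpr (subset_closure (interior_subset hy1))] at h6
      linarith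
    by_cases h5 : x ∈ essBoundary (band w t)
    · exact Or.inl ⟨h4, h5⟩
    · exact Or.inr ⟨⟨h4, h5⟩, hx.2⟩
  have hUm : NullMeasurableSet {x | T ≤ w x} volume :=
    (measurableSet_le measurable_const D.measw).nullMeasurableSet
  obtain ⟨C₂, hC₂, hper⟩ := exists_totalVar_le_hausdorffMeasure hd
  have hzero : totalVar ({x | T ≤ w x}.indicator fun _ => (1 : ℝ)) (Metric.ball z₀ (ρ / 2)) = 0 := by
    refine le_antisymm ((hper _ _ hUm).trans_eq ?_) zero_le
    rw [measure_mono_null hsub (measure_union_null htriple hlow), mul_zero]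
  have hpoin := volume_mul_volume_le_totalVar hUm z₀ (by linarith : ρ / 4 < ρ / 2)
  rw [hzero] at hpoin
  simp only [mul_zero, nonpos_iff_eq_zero, mul_eq_zero] at hpoin
  -- With zero perimeter either {w ≥ T} or its complement is null in the ball. Both are excluded:
  -- the complement contains Γ, and near the contact point {w ≥ t} is contained in {w ≥ T}; Γ and {w
  -- ≥ t} have that point in their essential boundaries.
  have hpos : ∀ E F : Set (Sp d), NullMeasurableSet E volume → z₀ ∈ essBoundary E →
      (∀ x ∈ Metric.ball z₀ (ρ / 4), x ∈ E → x ∈ F) → volume (Metric.ball z₀ (ρ / 4) ∩ F) ≠ 0 := by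
    intro E F hE hzE hEF h0
    obtain ⟨a, ha, h⟩ := exists_scale_of_mem_essBoundary hE hzE
    obtain ⟨r, hr, h1, -⟩ := h (ρ / 4) (by positivity)
    have h2 : volume.real (Metric.closedBall z₀ r ∩ E) = 0 := by
      rw [measureReal_def, measure_mono_null ?_ h0]
      · rfl
      · intro x hx
        have := Metric.closedBall_subset_ball hr.2 hx.1
        exact ⟨this, hEF x this hx.2⟩
    rw [h2] at h1
    have := mul_pos ha (pow_pos hr.1 d)
    linarith
  rcases hpoin with h | h
  · refine hpos _ _ (D.per t ht).compl.1 (hA2 z₀ hz₀) ?_ h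
    intro x hx hxt
    by_contra hxT
    have h1 : t ≤ w x := not_lt.mp hxt
    have h2 : w x < T := not_le.mp hxT
    have h3 : x ∈ band w T := ⟨ht.1.trans_le h1, h2⟩
    have := hnear x (Metric.ball_subset_ball (by linarith) hx) (subset_closure h3)
    linarith
  · refine hpos Γ {x | T ≤ w x}ᶜ D.Γ_per.1 (hA1 z₀ hz₀) ?_ (by rwa [← Set.sdiff_eq])
    intro x _ hxΓ hxT
    have h6 : T ≤ w x := hxT
    rw [D.w_eq_zero_iff.mpr (subset_closure hxΓ)] at h6
    linarith

end ClassicalData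

end Cascade

namespace Cascade

variable {d : ℕ} {γ T : ℝ} {Γ : Set (Sp d)} {V₀ w u : Sp d → ℝ}

/-! ### A single ascent curve -/

namespace IsAscentCurve

variable {z : Sp d} {Y : ℝ → Sp d} {σ : ℝ}

lemma w_lt (h : IsAscentCurve w T z Y σ) {r : ℝ} (hr : r ∈ Ico 0 σ) : w (Y r) < T := by
  by_contra hcon
  exact absurd (h.isLeast.2 ⟨hr.1, not_lt.mp hcon⟩) (not_le.mpr hr.2)

end IsAscentCurve

lemma norm_direction {x : Sp d} (hx : gradient w x ≠ 0) : ‖direction w x‖ = 1 := by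
  rw [direction, norm_smul, norm_inv, norm_norm, inv_mul_cancel₀ (norm_ne_zero_iff.mpr hx)]

lemma measurable_gradient : Measurable (gradient w) :=
  (InnerProductSpace.toDual ℝ (Sp d)).symm.continuous.measurable.comp (measurable_fderiv ℝ w)

lemma measurable_direction : Measurable (direction w) :=
  measurable_gradient.norm.inv.smul measurable_gradient

namespace ClassicalData

variable (D : ClassicalData d γ T Γ V₀ w u)
include D

lemma hasFDerivAt_w {x : Sp d} (hx : x ∈ band w T) : HasFDerivAt w (fderiv ℝ w x) x :=
  ((D.contDiffOn.differentiableOn one_ne_zero).differentiableAt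
    (D.isOpen_band.mem_nhds hx)).hasFDerivAt

lemma fderiv_w_direction {x : Sp d} (hx : x ∈ band w T) :
    fderiv ℝ w x (direction w x) = ‖gradient w x‖ := by
  rw [fderiv_apply_eq_inner _ _ _ (D.hasFDerivAt_w hx).differentiableAt, direction,
    real_inner_smul_right, real_inner_self_eq_norm_sq]
  have := norm_ne_zero_iff.mpr (D.gradient_ne_zero hx)
  field_simp

lemma continuousOn_direction : ContinuousOn (direction w) (band w T) :=
  (D.continuousOn_gradient.norm.inv₀ fun _ hx => norm_ne_zero_iff.mpr (D.gradient_ne_zero hx)).smul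
    D.continuousOn_gradient

lemma intervalIntegrable_direction {z : Sp d} {Y : ℝ → Sp d} {σ : ℝ}
    (h : IsAscentCurve w T z Y σ) {r s : ℝ} (hr : r ∈ Icc 0 σ) (hs : s ∈ Icc 0 σ) :
    IntervalIntegrable (fun q => direction w (Y q)) volume r s := by
  rw [intervalIntegrable_iff]
  have hsub : uIoc r s ⊆ Icc 0 σ := uIoc_subset_uIcc.trans (uIcc_subset_Icc hr hs)
  have hm : AEMeasurable Y (volume.restrict (uIoc r s)) :=
    (h.continuousOn.mono hsub).aemeasurable measurableSet_uIoc
  have hae : ∀ᵐ q ∂volume.restrict (uIoc r s), ‖direction w (Y q)‖ ≤ 1 := by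
    rw [ae_restrict_iff' measurableSet_uIoc]
    have h0 : ∀ᵐ q : ℝ, q ≠ 0 := Measure.ae_ne volume 0
    have h1 : ∀ᵐ q : ℝ, q ≠ σ := Measure.ae_ne volume σ
    filter_upwards [h.mem_band, h0, h1] with q hq h0 h1 hqm
    have := hsub hqm
    exact (norm_direction (D.gradient_ne_zero (hq ⟨lt_of_le_of_ne this.1 (Ne.symm h0),
      lt_of_le_of_ne this.2 h1⟩))).le
  have : IsFiniteMeasure (volume.restrict (uIoc r s)) :=
    ⟨by rw [Measure.restrict_apply_univ, uIoc]; exact measure_Ioc_lt_top⟩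
  exact Integrable.of_bound (measurable_direction.comp_aemeasurable hm).aestronglyMeasurable 1 hae

lemma curve_sub {z : Sp d} {Y : ℝ → Sp d} {σ : ℝ} (h : IsAscentCurve w T z Y σ)
    {r s : ℝ} (hr : r ∈ Icc 0 σ) (hs : s ∈ Icc 0 σ) :
    Y s - Y r = ∫ q in r..s, direction w (Y q) := by
  have h0 : (0 : ℝ) ∈ Icc 0 σ := ⟨le_rfl, h.pos.le⟩
  rw [h.eqn r hr, h.eqn s hs, add_sub_add_left_eq_sub, intervalIntegral.integral_interval_sub_left
    (D.intervalIntegrable_direction h h0 hs) (D.intervalIntegrable_direction h h0 hr)]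

lemma dist_curve_le {z : Sp d} {Y : ℝ → Sp d} {σ : ℝ} (h : IsAscentCurve w T z Y σ)
    {r s : ℝ} (hr : r ∈ Icc 0 σ) (hs : s ∈ Icc 0 σ) : dist (Y r) (Y s) ≤ |r - s| := by
  have hsub : uIoc s r ⊆ Icc 0 σ := uIoc_subset_uIcc.trans (uIcc_subset_Icc hs hr)
  have hae : ∀ᵐ q, q ∈ uIoc s r → ‖direction w (Y q)‖ ≤ 1 := by
    have h0 : ∀ᵐ q : ℝ, q ≠ 0 := Measure.ae_ne volume 0
    have h1 : ∀ᵐ q : ℝ, q ≠ σ := Measure.ae_ne volume σ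
    filter_upwards [h.mem_band, h0, h1] with q hq h0 h1 hqm
    have := hsub hqm
    exact (norm_direction (D.gradient_ne_zero (hq ⟨lt_of_le_of_ne this.1 (Ne.symm h0),
      lt_of_le_of_ne this.2 h1⟩))).le
  rw [dist_eq_norm, D.curve_sub h hs hr]
  simpa using intervalIntegral.norm_integral_le_of_norm_le_const_ae hae

/-- The curve is in the band at almost every time, thus on a dense set of times; continuity does the
rest. -/
lemma curve_mem_closure {z : Sp d} {Y : ℝ → Sp d} {σ : ℝ} (h : IsAscentCurve w T z Y σ)
    {r : ℝ} (hr : r ∈ Icc 0 σ) : Y r ∈ closure (band w T) := by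
  have h1 : closure (Ioo 0 σ ∩ {q | Y q ∈ band w T}) = Icc 0 σ := by
    refine subset_antisymm ?_ ?_
    · exact (closure_mono inter_subset_left).trans (closure_Ioo h.pos.ne).subset
    · rw [← closure_Ioo h.pos.ne]
      refine closure_minimal ?_ isClosed_closure
      have h2 : Dense {q : ℝ | q ∈ Ioo 0 σ → Y q ∈ band w T} := Measure.dense_of_ae h.mem_band
      intro q hq
      have := h2.open_subset_closure_inter isOpen_Ioo hq
      refine closure_mono ?_ this
      exact fun p hp => ⟨hp.1, hp.2 hp.1⟩
  have h2 : r ∈ closure (Ioo 0 σ ∩ {q | Y q ∈ band w T}) := h1 ▸ hr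
  have h3 : ContinuousWithinAt Y (Ioo 0 σ ∩ {q | Y q ∈ band w T}) r :=
    (h.continuousOn r hr).mono (inter_subset_left.trans Ioo_subset_Icc_self)
  exact h3.mem_closure h2 fun q hq => hq.2

lemma continuousOn_w_curve {z : Sp d} {Y : ℝ → Sp d} {σ : ℝ} (h : IsAscentCurve w T z Y σ) :
    ContinuousOn (fun r => w (Y r)) (Icc 0 σ) :=
  D.continuousOn.comp h.continuousOn fun _ hr => D.curve_mem_closure h hr

lemma hasDerivAt_curve {z : Sp d} {Y : ℝ → Sp d} {σ : ℝ} (h : IsAscentCurve w T z Y σ)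
    {r : ℝ} (hr : r ∈ Ioo 0 σ) (hb : Y r ∈ band w T) : HasDerivAt Y (direction w (Y r)) r := by
  have h0 : (0 : ℝ) ∈ Icc 0 σ := ⟨le_rfl, h.pos.le⟩
  have hr' := Ioo_subset_Icc_self hr
  have hnhds : Icc 0 σ ∈ 𝓝 r := Icc_mem_nhds hr.1 hr.2
  have hYc : ContinuousAt Y r := h.continuousOn.continuousAt hnhds
  have hdc : ContinuousAt (direction w) (Y r) :=
    D.continuousOn_direction.continuousAt (D.isOpen_band.mem_nhds hb)
  have hm : AEStronglyMeasurable (fun q => direction w (Y q)) (volume.restrict (Icc 0 σ)) :=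
    (measurable_direction.comp_aemeasurable
      (h.continuousOn.aemeasurable measurableSet_Icc)).aestronglyMeasurable
  have h1 := intervalIntegral.integral_hasDerivAt_right (D.intervalIntegrable_direction h h0 hr')
    ⟨Icc 0 σ, hnhds, hm⟩ (ContinuousAt.comp (f := Y) hdc hYc)
  refine (h1.const_add z).congr_of_eventuallyEq ?_
  filter_upwards [hnhds] with q hq using h.eqn q hq

lemma hasDerivAt_w_curve {z : Sp d} {Y : ℝ → Sp d} {σ : ℝ} (h : IsAscentCurve w T z Y σ)
    {r : ℝ} (hr : r ∈ Ioo 0 σ) (hb : Y r ∈ band w T) :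
    HasDerivAt (fun r => w (Y r)) ‖gradient w (Y r)‖ r := by
  have := (D.hasFDerivAt_w hb).comp_hasDerivAt r (D.hasDerivAt_curve h hr hb)
  rwa [D.fderiv_w_direction hb] at this

/-- Membership is assumed only at almost every time. From an earlier time in the band the level
increases strictly up to the first exit, where it is positive and, before σ, below T; such a point
still belongs to the band. -/
lemma curve_mem_band {z : Sp d} {Y : ℝ → Sp d} {σ : ℝ} (h : IsAscentCurve w T z Y σ)
    {r : ℝ} (hr : r ∈ Ioo 0 σ) : Y r ∈ band w T := by
  by_contra hcon
  obtain ⟨r₁, hr₁, hb₁⟩ : ∃ r₁ ∈ Ioo 0 r, Y r₁ ∈ band w T := by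
    have h2 : Dense {q : ℝ | q ∈ Ioo 0 σ → Y q ∈ band w T} := Measure.dense_of_ae h.mem_band
    obtain ⟨q, hq1, hq2⟩ := h2.exists_mem_open isOpen_Ioo (nonempty_Ioo.mpr hr.1)
    exact ⟨q, hq2, hq1 ⟨hq2.1, hq2.2.trans hr.2⟩⟩
  have hcl : IsClosed {q | q ∈ Icc r₁ r ∧ Y q ∉ band w T} := by
    have hc : ContinuousOn Y (Icc r₁ r) := h.continuousOn.mono (Icc_subset_Icc hr₁.1.le hr.2.le)
    exact hc.preimage_isClosed_of_isClosed isClosed_Icc D.isOpen_band.isClosed_compl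
  set b := sInf {q | q ∈ Icc r₁ r ∧ Y q ∉ band w T} with hb
  have hne : {q | q ∈ Icc r₁ r ∧ Y q ∉ band w T}.Nonempty := ⟨r, ⟨hr₁.2.le, le_rfl⟩, hcon⟩
  have hbdd : BddBelow {q | q ∈ Icc r₁ r ∧ Y q ∉ band w T} := ⟨r₁, fun q hq => hq.1.1⟩
  have hbm : b ∈ {q | q ∈ Icc r₁ r ∧ Y q ∉ band w T} := hcl.csInf_mem hne hbdd
  have hlt : r₁ < b := by
    refine lt_of_le_of_ne hbm.1.1 fun h0 => hbm.2 ?_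
    rw [← h0]; exact hb₁
  have hin : ∀ q ∈ Ico r₁ b, Y q ∈ band w T := by
    intro q hq
    by_contra hq2
    exact absurd (csInf_le hbdd ⟨⟨hq.1, hq.2.le.trans hbm.1.2⟩, hq2⟩) (not_le.mpr hq.2)
  have hmono : StrictMonoOn (fun r => w (Y r)) (Icc r₁ b) := by
    refine strictMonoOn_of_deriv_pos (convex_Icc _ _)
      ((D.continuousOn_w_curve h).mono (Icc_subset_Icc hr₁.1.le (hbm.1.2.trans hr.2.le))) ?_
    intro q hq
    rw [interior_Icc] at hq
    have hqb := hin q ⟨hq.1.le, hq.2⟩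
    rw [(D.hasDerivAt_w_curve h ⟨hr₁.1.trans hq.1, hq.2.trans_le (hbm.1.2.trans hr.2.le)⟩ hqb).deriv]
    exact norm_pos_iff.mpr (D.gradient_ne_zero hqb)
  have h1 := hmono ⟨le_rfl, hlt.le⟩ ⟨hlt.le, le_rfl⟩ hlt
  have h2 : w (Y b) < T := h.w_lt ⟨(hr₁.1.trans hlt).le, hbm.1.2.trans_lt hr.2⟩
  exact hbm.2 ⟨hb₁.1.trans h1, h2⟩

lemma strictMonoOn_w_curve {z : Sp d} {Y : ℝ → Sp d} {σ : ℝ} (h : IsAscentCurve w T z Y σ) :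
    StrictMonoOn (fun r => w (Y r)) (Icc 0 σ) := by
  refine strictMonoOn_of_deriv_pos (convex_Icc _ _) (D.continuousOn_w_curve h) ?_
  intro q hq
  rw [interior_Icc] at hq
  have hqb := D.curve_mem_band h hq
  rw [(D.hasDerivAt_w_curve h hq hqb).deriv]
  exact norm_pos_iff.mpr (D.gradient_ne_zero hqb)

lemma w_le_of_mem_closure {t : ℝ} (ht : t ≤ T) {x : Sp d} (hx : x ∈ closure (band w t)) : w x ≤ t := by
  have h1 : ContinuousWithinAt w (band w t) x :=
    (D.continuousOn x (closure_mono (band_mono w ht) hx)).mono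
      ((band_mono w ht).trans subset_closure)
  have h2 := h1.mem_closure (t := Iic t) hx fun y hy => hy.2.le
  rwa [isClosed_Iic.closure_eq] at h2

lemma w_curve_end {z : Sp d} {Y : ℝ → Sp d} {σ : ℝ} (h : IsAscentCurve w T z Y σ) :
    w (Y σ) = T :=
  le_antisymm (D.w_le_of_mem_closure le_rfl (D.curve_mem_closure h ⟨h.pos.le, le_rfl⟩)) h.isLeast.1.2

lemma passage_eq {z : Sp d} {Y : ℝ → Sp d} {σ : ℝ} (h : IsAscentCurve w T z Y σ) {r : ℝ}
    (hr : r ∈ Icc 0 σ) : passage w Y (w (Y r)) = r := by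
  refine IsLeast.csInf_eq ⟨⟨hr.1, le_rfl⟩, fun q hq => ?_⟩
  by_contra hlt
  push Not at hlt
  exact absurd (D.strictMonoOn_w_curve h ⟨hq.1, hlt.le.trans hr.2⟩ hr hlt) (not_lt.mpr hq.2)

lemma exists_w_curve_eq {z : Sp d} (hz : z ∈ frontier Γ) {Y : ℝ → Sp d} {σ : ℝ}
    (h : IsAscentCurve w T z Y σ) {t : ℝ} (ht : t ∈ Icc 0 T) : ∃ r ∈ Icc 0 σ, w (Y r) = t := by
  refine intermediate_value_Icc h.pos.le (D.continuousOn_w_curve h) ?_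
  simp only [h.init, D.w_curve_end h, D.w_frontier hz]
  exact ht

end ClassicalData

end Cascade

/-! ### The ascent flow from the boundary of Γ, with its clock and foot map -/

namespace Cascade

variable {d : ℕ} {γ T : ℝ} {Γ : Set (Sp d)} {V₀ w u : Sp d → ℝ}

/-- The ascent flow from `∂Γ`: `Y z` is the curve from `z`, `ρ t z` the time at which it meets
level `t`, and `π x` the starting point of the curve through `x`. -/
structure IsAscentFlow (Γ : Set (Sp d)) (T : ℝ) (w : Sp d → ℝ) (Y : Sp d → ℝ → Sp d)
    (ρ : ℝ → Sp d → ℝ) (π : Sp d → Sp d) : Prop where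
  curve_zero : ∀ z ∈ frontier Γ, Y z 0 = z
  clock_zero : ∀ z ∈ frontier Γ, ρ 0 z = 0
  clock_strictMono : ∀ z ∈ frontier Γ, StrictMonoOn (fun t => ρ t z) (Icc 0 T)
  dist_curve : ∀ z ∈ frontier Γ, ∀ r ∈ Icc 0 (ρ T z), ∀ s ∈ Icc 0 (ρ T z),
    dist (Y z r) (Y z s) ≤ |r - s|
  curve_mem_band : ∀ z ∈ frontier Γ, ∀ r ∈ Ioo 0 (ρ T z), Y z r ∈ band w T
  curve_mem_closure : ∀ z ∈ frontier Γ, ∀ r ∈ Icc 0 (ρ T z), Y z r ∈ closure (band w T)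
  w_curve : ∀ z ∈ frontier Γ, ∀ t ∈ Icc 0 T, w (Y z (ρ t z)) = t
  clock_w : ∀ z ∈ frontier Γ, ∀ r ∈ Icc 0 (ρ T z), ρ (w (Y z r)) z = r
  hasDerivAt_curve : ∀ z ∈ frontier Γ, ∀ r ∈ Ioo 0 (ρ T z),
    HasDerivAt (Y z) (direction w (Y z r)) r
  hasDerivAt_w : ∀ z ∈ frontier Γ, ∀ r ∈ Ioo 0 (ρ T z),
    HasDerivAt (fun r => w (Y z r)) ‖gradient w (Y z r)‖ r
  continuousOn_clock : ContinuousOn (fun p : ℝ × Sp d => ρ p.1 p.2) (Icc 0 T ×ˢ frontier Γ)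
  continuousOn_flow : ContinuousOn (fun p : ℝ × Sp d => Y p.2 (ρ p.1 p.2)) (Icc 0 T ×ˢ frontier Γ)
  foot_mem : ∀ x ∈ frontier Γ ∪ band w T, π x ∈ frontier Γ
  flow_foot : ∀ x ∈ frontier Γ ∪ band w T, Y (π x) (ρ (w x) (π x)) = x
  foot_curve : ∀ z ∈ frontier Γ, ∀ r ∈ Ico 0 (ρ T z), π (Y z r) = z
  locallyLipschitz_level : LocallyLipschitzOn (frontier Γ ∪ band w T) w
  locallyLipschitz_foot : LocallyLipschitzOn (frontier Γ ∪ band w T) π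

/-- The Lipschitz bound in t is uniform in x, so continuity in x is needed only on a dense set of
times. This extends the flow continuously to the end level T, about which the hypotheses on the flow
say nothing. -/
lemma continuousOn_prod_of_lipschitz {X Z : Type*} [PseudoMetricSpace X] [PseudoMetricSpace Z]
    {f : ℝ × X → Z} {I J : Set ℝ} {S : Set X} {K : ℝ≥0} (hIJ : I ⊆ closure J) (hJI : J ⊆ I)
    (hf : ∀ x ∈ S, LipschitzOnWith K (fun t => f (t, x)) I)
    (hc : ∀ t ∈ J, ContinuousOn (fun x => f (t, x)) S) : ContinuousOn f (I ×ˢ S) := by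
  rintro ⟨t, x⟩ ⟨ht, hx⟩
  rw [Metric.continuousWithinAt_iff]
  intro ε hε
  have hK : (0 : ℝ) ≤ K := K.2
  obtain ⟨t', ht', htt'⟩ := Metric.mem_closure_iff.mp (hIJ ht) (ε / (6 * (K + 1))) (by positivity)
  obtain ⟨δ, hδ, h⟩ := Metric.continuousWithinAt_iff.mp (hc t' ht' x hx) (ε / 3) (by positivity)
  refine ⟨min δ (ε / (6 * (K + 1))), by positivity, fun {q} hq hqd => ?_⟩
  obtain ⟨s, y⟩ := q
  have hsI : s ∈ I := hq.1
  have hyS : y ∈ S := hq.2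
  rw [Prod.dist_eq] at hqd
  have h1 : dist s t < ε / (6 * (K + 1)) :=
    (le_max_left _ _).trans_lt (hqd.trans_le (min_le_right _ _))
  have h2 : dist y x < δ := (le_max_right _ _).trans_lt (hqd.trans_le (min_le_left _ _))
  have h3 := (hf y hyS).dist_le_mul s hsI t' (hJI ht')
  have h4 := (hf x hx).dist_le_mul t' (hJI ht') t ht
  have h5 := h hyS h2
  have h6 : dist s t' ≤ ε / (6 * (K + 1)) + ε / (6 * (K + 1)) :=
    (dist_triangle s t t').trans (add_le_add h1.le htt'.le)
  have h7 : (K : ℝ) * (ε / (6 * (K + 1))) < ε / 6 := by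
    rw [mul_div_assoc', div_lt_div_iff₀ (by positivity) (by positivity)]
    nlinarith
  have h8 := mul_le_mul_of_nonneg_left h6 hK
  have h9 : dist t' t ≤ ε / (6 * (K + 1)) := by rw [dist_comm]; exact htt'.le
  have h10 := mul_le_mul_of_nonneg_left h9 hK
  have h11 := dist_triangle4 (f (s, y)) (f (t', y)) (f (t', x)) (f (t, x))
  linarith

namespace ClassicalData

variable (D : ClassicalData d γ T Γ V₀ w u)
include D

/-- The level is the better parameter: the clock has derivative 1/|∇w| in the level, which is
bounded. Clock and position are therefore Lipschitz in the level uniformly in the foot, up to and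
including T. -/
theorem exists_ascentFlow : ∃ Y ρ π, IsAscentFlow Γ T w Y ρ π := by
  classical
  obtain ⟨hcur, F, G, hF, hFm, hGm, hinv, hG, hFY⟩ := D.flow
  have hT := D.T_pos
  have hex : ∀ z : Sp d, ∃ (Y : ℝ → Sp d) (σ : ℝ), z ∈ frontier Γ → IsAscentCurve w T z Y σ := by
    intro z
    by_cases hz : z ∈ frontier Γ
    · obtain ⟨⟨Y, σ, h⟩, -⟩ := hcur z (Or.inl hz)
      exact ⟨Y, σ, fun _ => h⟩
    · exact ⟨fun _ => 0, 0, fun h => absurd h hz⟩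
  choose Y σ hY using hex
  set ρ : ℝ → Sp d → ℝ := fun t z => passage w (Y z) t with hρ
  have hρw : ∀ z ∈ frontier Γ, ∀ r ∈ Icc 0 (σ z), ρ (w (Y z r)) z = r := fun z hz r hr =>
    D.passage_eq (hY z hz) hr
  have hρT : ∀ z ∈ frontier Γ, ρ T z = σ z := by
    intro z hz
    have h1 := hρw z hz (σ z) ⟨(hY z hz).pos.le, le_rfl⟩
    rwa [D.w_curve_end (hY z hz)] at h1
  have hex : ∀ z ∈ frontier Γ, ∀ t ∈ Icc 0 T, ρ t z ∈ Icc 0 (σ z) ∧ w (Y z (ρ t z)) = t := by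
    intro z hz t ht
    obtain ⟨r, hr, hrt⟩ := D.exists_w_curve_eq hz (hY z hz) ht
    have : ρ t z = r := by rw [← hrt]; exact hρw z hz r hr
    rw [this]; exact ⟨hr, hrt⟩
  have hmono : ∀ z ∈ frontier Γ, StrictMonoOn (fun t => ρ t z) (Icc 0 T) := by
    intro z hz s hs t ht hst
    obtain ⟨h1, h2⟩ := hex z hz s hs
    obtain ⟨h3, h4⟩ := hex z hz t ht
    by_contra hcon
    have := (D.strictMonoOn_w_curve (hY z hz)).monotoneOn h3 h1 (not_lt.mp hcon)
    simp only [h2, h4] at this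
    linarith
  have hρ0 : ∀ z ∈ frontier Γ, ρ 0 z = 0 := by
    intro z hz
    have h1 := hρw z hz 0 ⟨le_rfl, (hY z hz).pos.le⟩
    rwa [(hY z hz).init, D.w_frontier hz] at h1
  have hFeq : ∀ t ∈ Ico 0 T, ∀ z ∈ frontier Γ, F (t, z) = Y z (ρ t z) := fun t ht z hz =>
    (hFY t ht z hz (Y z) (σ z) (hY z hz)).symm
  obtain ⟨c, hc, hgrad⟩ := D.grad_lower
  -- the clock is Lipschitz in the level
  have hmemIoo : ∀ z ∈ frontier Γ, ∀ t ∈ Ioo 0 T, ρ t z ∈ Ioo 0 (σ z) := by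
    intro z hz t ht
    refine ⟨?_, ?_⟩
    · rw [← hρ0 z hz]
      exact hmono z hz ⟨le_rfl, hT.le⟩ ⟨ht.1.le, ht.2.le⟩ ht.1
    · rw [← hρT z hz]
      exact hmono z hz ⟨ht.1.le, ht.2.le⟩ ⟨hT.le, le_rfl⟩ ht.2
  have hlip : ∀ z ∈ frontier Γ, LipschitzOnWith ⟨c⁻¹, by positivity⟩ (fun t => ρ t z) (Icc 0 T) := by
    intro z hz
    refine LipschitzOnWith.of_dist_le_mul fun s hs t ht => ?_
    wlog hst : s ≤ t generalizing s t
    · rw [dist_comm, dist_comm s]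
      exact this t ht s hs (not_le.mp hst).le
    obtain ⟨h1, h2⟩ := hex z hz s hs
    obtain ⟨h3, h4⟩ := hex z hz t ht
    have hle : ρ s z ≤ ρ t z := (hmono z hz).monotoneOn hs ht hst
    have h5 := (convex_Icc (0 : ℝ) (σ z)).mul_sub_le_image_sub_of_le_deriv
      (D.continuousOn_w_curve (hY z hz)) (C := c) (fun r hr => by
        rw [interior_Icc] at hr
        exact (D.hasDerivAt_w_curve (hY z hz) hr
          (D.curve_mem_band (hY z hz) hr)).differentiableAt.differentiableWithinAt) (fun r hr => by
        rw [interior_Icc] at hr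
        have hb := D.curve_mem_band (hY z hz) hr
        rw [(D.hasDerivAt_w_curve (hY z hz) hr hb).deriv]
        exact hgrad _ hb) _ h1 _ h3 hle
    simp only [h2, h4] at h5
    rw [Real.dist_eq, Real.dist_eq, abs_of_nonpos (by linarith), abs_of_nonpos (by linarith)]
    change _ ≤ c⁻¹ * _
    rw [inv_mul_eq_div, le_div_iff₀ hc]
    linarith
  have hYlip : ∀ z ∈ frontier Γ, LipschitzOnWith ⟨c⁻¹, by positivity⟩ (fun t => Y z (ρ t z))
      (Icc 0 T) := by
    intro z hz
    refine LipschitzOnWith.of_dist_le_mul fun s hs t ht => ?_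
    refine (D.dist_curve_le (hY z hz) (hex z hz s hs).1 (hex z hz t ht).1).trans ?_
    have := (hlip z hz).dist_le_mul s hs t ht
    rwa [Real.dist_eq] at this
  have hsub1 : Icc 0 T ⊆ closure (Ico 0 T) := (closure_Ico hT.ne).symm.subset
  have hflowc : ∀ t ∈ Ico 0 T, ContinuousOn (fun z => Y z (ρ t z)) (frontier Γ) := by
    intro t ht
    have h1 : ContinuousOn (fun z => F (t, z)) (frontier Γ) :=
      hF.comp (by fun_prop) fun z hz => ⟨ht, hz⟩
    exact h1.congr fun z hz => (hFeq t ht z hz).symm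
  -- integral formula for the clock
  have hder : ∀ z ∈ frontier Γ, ∀ t ∈ Ioo 0 T,
      HasDerivAt (fun t => ρ t z) (‖gradient w (Y z (ρ t z))‖⁻¹) t := by
    intro z hz t ht
    have h1 := hmemIoo z hz t ht
    have h2 := D.hasDerivAt_w_curve (hY z hz) h1 (D.curve_mem_band (hY z hz) h1)
    refine HasDerivAt.of_local_left_inverse (g := fun t => ρ t z) ?_ h2 ?_ ?_
    · exact (hlip z hz).continuousOn.continuousAt (Icc_mem_nhds ht.1 ht.2)
    · exact norm_ne_zero_iff.mpr (D.gradient_ne_zero (D.curve_mem_band (hY z hz) h1))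
    · filter_upwards [Icc_mem_nhds ht.1 ht.2] with s hs using (hex z hz s hs).2
  have hband : ∀ z ∈ frontier Γ, ∀ t ∈ Ioo 0 T, Y z (ρ t z) ∈ band w T := fun z hz t ht =>
    D.curve_mem_band (hY z hz) (hmemIoo z hz t ht)
  have hbd : ∀ z ∈ frontier Γ, ∀ t ∈ Ioo 0 T, ‖‖gradient w (Y z (ρ t z))‖⁻¹‖ ≤ c⁻¹ := by
    intro z hz t ht
    rw [norm_inv, norm_norm]
    exact inv_anti₀ hc (hgrad _ (hband z hz t ht))
  have hmeas : ∀ z ∈ frontier Γ, AEStronglyMeasurable (fun t => ‖gradient w (Y z (ρ t z))‖⁻¹)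
      (volume.restrict (Ioo 0 T)) := by
    intro z hz
    have h1 : AEMeasurable (fun t => Y z (ρ t z)) (volume.restrict (Ioo 0 T)) :=
      ((hYlip z hz).continuousOn.mono Ioo_subset_Icc_self).aemeasurable measurableSet_Ioo
    exact (measurable_gradient.norm.inv.comp_aemeasurable h1).aestronglyMeasurable
  have hclockI : ∀ z ∈ frontier Γ, ∀ t ∈ Icc 0 T,
      ρ t z = ∫ s in Ioo 0 t, ‖gradient w (Y z (ρ s z))‖⁻¹ := by
    intro z hz t ht
    have hsub : Ioo 0 t ⊆ Ioo 0 T := Ioo_subset_Ioo_right ht.2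
    have h1 := intervalIntegral.integral_eq_sub_of_hasDerivAt_of_le ht.1
      ((hlip z hz).continuousOn.mono (Icc_subset_Icc_right ht.2))
      (fun s hs => hder z hz s (hsub hs)) (by
        rw [intervalIntegrable_iff_integrableOn_Ioo_of_le ht.1]
        refine IntegrableOn.of_bound measure_Ioo_lt_top
          ((hmeas z hz).mono_measure (Measure.restrict_mono hsub le_rfl)) c⁻¹ ?_
        filter_upwards [ae_restrict_mem measurableSet_Ioo] with s hs using hbd z hz s (hsub hs))
    rw [hρ0 z hz, sub_zero, intervalIntegral.integral_of_le ht.1, integral_Ioc_eq_integral_Ioo] at h1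
    exact h1.symm
  -- The clock is the integral of 1/|∇w| along the flow; the flow is continuous in the foot at every
  -- level below T and the integrand is bounded, so dominated convergence applies.
  have hclockc : ∀ t ∈ Icc 0 T, ContinuousOn (fun z => ρ t z) (frontier Γ) := by
    intro t ht
    have hsub : Ioo 0 t ⊆ Ioo 0 T := Ioo_subset_Ioo_right ht.2
    have h1 : ContinuousOn (fun z => ∫ s in Ioo 0 t, ‖gradient w (Y z (ρ s z))‖⁻¹) (frontier Γ) := by
      refine continuousOn_of_dominated (bound := fun _ => c⁻¹) (fun z hz => ?_) (fun z hz => ?_) ?_ ?_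
      · exact (hmeas z hz).mono_measure (Measure.restrict_mono hsub le_rfl)
      · filter_upwards [ae_restrict_mem measurableSet_Ioo] with s hs using hbd z hz s (hsub hs)
      · exact integrableOn_const measure_Ioo_lt_top.ne
      · filter_upwards [ae_restrict_mem measurableSet_Ioo] with s hs
        have hs' := hsub hs
        refine ContinuousOn.inv₀ (ContinuousOn.norm (D.continuousOn_gradient.comp
          (hflowc s ⟨hs'.1.le, hs'.2⟩) fun z hz => hband z hz s hs')) fun z hz => ?_
        exact norm_ne_zero_iff.mpr (D.gradient_ne_zero (hband z hz s hs'))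
    exact h1.congr fun z hz => hclockI z hz t ht
  -- the foot point
  have hlevel : ∀ x ∈ frontier Γ ∪ band w T, (G x).1 = w x ∧ (G x).2 ∈ frontier Γ ∧
      Y (G x).2 (ρ (w x) (G x).2) = x := by
    intro x hx
    have h1 := hGm hx
    have h2 : F ((G x).1, (G x).2) = x := hinv.2 hx
    rw [hFeq _ h1.1 _ h1.2] at h2
    have h3 := (hex _ h1.2 _ ⟨h1.1.1, h1.1.2.le⟩).2
    rw [h2] at h3
    exact ⟨h3.symm, h1.2, by rw [h3]; exact h2⟩
  refine ⟨Y, ρ, fun x => (G x).2, ?_⟩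
  refine ⟨fun z hz => (hY z hz).init, hρ0, hmono, ?_, ?_, ?_, fun z hz t ht => (hex z hz t ht).2,
    ?_, ?_, ?_, continuousOn_prod_of_lipschitz subset_closure subset_rfl hlip hclockc,
    continuousOn_prod_of_lipschitz hsub1 Ico_subset_Icc_self hYlip hflowc,
    fun x hx => (hlevel x hx).2.1, fun x hx => (hlevel x hx).2.2, ?_, ?_, ?_⟩
  · intro z hz r hr s hs
    rw [hρT z hz] at hr hs
    exact D.dist_curve_le (hY z hz) hr hs
  · intro z hz r hr
    rw [hρT z hz] at hr
    exact D.curve_mem_band (hY z hz) hr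
  · intro z hz r hr
    rw [hρT z hz] at hr
    exact D.curve_mem_closure (hY z hz) hr
  · intro z hz r hr
    rw [hρT z hz] at hr
    exact hρw z hz r hr
  · intro z hz r hr
    rw [hρT z hz] at hr
    exact D.hasDerivAt_curve (hY z hz) hr (D.curve_mem_band (hY z hz) hr)
  · intro z hz r hr
    rw [hρT z hz] at hr
    exact D.hasDerivAt_w_curve (hY z hz) hr (D.curve_mem_band (hY z hz) hr)
  · intro z hz r hr
    rw [hρT z hz] at hr
    have h1 : w (Y z r) ∈ Ico 0 T := ⟨D.w_nonneg _, (hY z hz).w_lt hr⟩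
    have h2 : G (F (w (Y z r), z)) = (w (Y z r), z) := hinv.1 ⟨h1, hz⟩
    rw [hFeq _ h1 z hz, hρw z hz r ⟨hr.1, hr.2.le⟩] at h2
    exact congrArg Prod.snd h2
  · intro x hx
    obtain ⟨K, t, ht, h⟩ := hG hx
    refine ⟨K, t ∩ (frontier Γ ∪ band w T), inter_mem ht self_mem_nhdsWithin, fun p hp q hq => ?_⟩
    have h1 := h hp.1 hq.1
    rw [← (hlevel p hp.2).1, ← (hlevel q hq.2).1]
    exact (le_max_left _ _).trans h1
  · intro x hx
    obtain ⟨K, t, ht, h⟩ := hG hx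
    exact ⟨K, t, ht, fun p hp q hq => (le_max_right _ _).trans (h hp hq)⟩

end ClassicalData

end Cascade

/-! ### The weak equation tested along flow tubes -/

namespace Cascade

variable {d : ℕ} {γ T : ℝ} {Γ : Set (Sp d)} {V₀ w u : Sp d → ℝ}

/-- A product of locally Lipschitz functions on a closed set is Lipschitz if one of the factors has
compact support. -/
lemma exists_lipschitzOnWith_mul {C K : Set (Sp d)} (hC : IsClosed C) (hK : IsCompact K)
    {g φ : Sp d → ℝ} (hg : LocallyLipschitzOn C g) (hφ : LocallyLipschitzOn C φ)
    (h0 : ∀ x ∈ C, x ∉ K → φ x = 0) : ∃ L : ℝ≥0, LipschitzOnWith L (fun x => g x * φ x) C := by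
  obtain ⟨R, hR⟩ := hK.isBounded.subset_closedBall 0
  -- The margin one separates K from the points outside the larger ball. For such distant pairs the
  -- bounds of the factors suffice; for close pairs both points lie in one compact set.
  have hK2 : IsCompact (C ∩ Metric.closedBall 0 (R + 1)) :=
    (isCompact_closedBall _ _).inter_left hC
  obtain ⟨Lg, hLg⟩ := (hg.mono inter_subset_left).exists_lipschitzOnWith_of_compact hK2
  obtain ⟨Lφ, hLφ⟩ := (hφ.mono inter_subset_left).exists_lipschitzOnWith_of_compact hK2
  obtain ⟨Mg, hMg⟩ := hK2.exists_bound_of_continuousOn (hg.continuousOn.mono inter_subset_left)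
  obtain ⟨Mφ, hMφ⟩ := hK2.exists_bound_of_continuousOn (hφ.continuousOn.mono inter_subset_left)
  set L : ℝ := |Mg| * Lφ + |Mφ| * Lg + |Mg| * |Mφ| with hL
  have hL0 : 0 ≤ L := by positivity
  refine ⟨⟨L, hL0⟩, LipschitzOnWith.of_dist_le_mul fun x hx y hy => ?_⟩
  change dist _ _ ≤ L * dist x y
  have key : ∀ x ∈ C, ∀ y ∈ C, x ∈ K → dist (g x * φ x) (g y * φ y) ≤ L * dist x y := by
    intro x hx y hy hxK
    have hxR : x ∈ Metric.closedBall (0 : Sp d) R := hR hxK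
    have hx2 : x ∈ C ∩ Metric.closedBall 0 (R + 1) :=
      ⟨hx, Metric.closedBall_subset_closedBall (by linarith) hxR⟩
    have b1 : |g x| ≤ |Mg| := (hMg x hx2).trans (le_abs_self _)
    have b2 : |φ x| ≤ |Mφ| := (hMφ x hx2).trans (le_abs_self _)
    by_cases hy2 : y ∈ Metric.closedBall (0 : Sp d) (R + 1)
    · have hy3 : y ∈ C ∩ Metric.closedBall 0 (R + 1) := ⟨hy, hy2⟩
      have b3 : |g y| ≤ |Mg| := (hMg y hy3).trans (le_abs_self _)
      have e1 := hLg.dist_le_mul x hx2 y hy3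
      have e2 := hLφ.dist_le_mul x hx2 y hy3
      rw [Real.dist_eq] at e1 e2
      have e3 : g x * φ x - g y * φ y = g y * (φ x - φ y) + φ x * (g x - g y) := by ring
      rw [Real.dist_eq, e3]
      refine (abs_add_le _ _).trans ?_
      rw [abs_mul, abs_mul]
      have e4 : |g y| * |φ x - φ y| ≤ |Mg| * (Lφ * dist x y) :=
        mul_le_mul b3 e2 (abs_nonneg _) (abs_nonneg _)
      have e5 : |φ x| * |g x - g y| ≤ |Mφ| * (Lg * dist x y) :=
        mul_le_mul b2 e1 (abs_nonneg _) (abs_nonneg _)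
      have e6 : 0 ≤ |Mg| * |Mφ| * dist x y := by positivity
      rw [hL]
      linarith
    · rw [h0 y hy fun h => hy2 (Metric.closedBall_subset_closedBall (by linarith) (hR h)), mul_zero,
        Real.dist_eq, sub_zero, abs_mul]
      have e1 : 1 ≤ dist x y := by
        rw [mem_closedBall_zero_iff] at hxR hy2
        have := norm_sub_norm_le y x
        rw [dist_comm, dist_eq_norm]
        linarith
      have e2 : |g x| * |φ x| ≤ |Mg| * |Mφ| := mul_le_mul b1 b2 (abs_nonneg _) (abs_nonneg _)
      have e3 : |Mg| * |Mφ| ≤ L := by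
        rw [hL]
        have : 0 ≤ |Mg| * Lφ + |Mφ| * Lg := by positivity
        linarith
      calc |g x| * |φ x| ≤ L * 1 := by linarith
        _ ≤ L * dist x y := mul_le_mul_of_nonneg_left e1 hL0
  by_cases hxK : x ∈ K
  · exact key x hx y hy hxK
  by_cases hyK : y ∈ K
  · rw [dist_comm, dist_comm x]
    exact key y hy x hx hyK
  · rw [h0 x hx hxK, h0 y hy hyK]
    simp only [mul_zero, dist_self]
    positivity

lemma inner_gradient (f : Sp d → ℝ) (x v : Sp d) : inner ℝ (gradient f x) v = fderiv ℝ f x v :=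
  InnerProductSpace.toDual_symm_apply

namespace ClassicalData

section
variable (D : ClassicalData d γ T Γ V₀ w u)
include D

lemma closure_band_subset {t : ℝ} (ht : t < T) : closure (band w t) ⊆ frontier Γ ∪ band w T := by
  intro x hx
  have h1 := D.w_le_of_mem_closure ht.le hx
  by_cases hxΓ : x ∈ closure Γ
  · refine Or.inl ⟨hxΓ, fun h2 => ?_⟩
    obtain ⟨y, hy1, hy2⟩ := mem_closure_iff.mp hx _ isOpen_interior h2
    exact (D.mem_band_iff.mp hy2).1 (subset_closure (interior_subset hy1))
  · exact Or.inr (D.mem_band_iff.mpr ⟨hxΓ, h1.trans_lt ht⟩)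

lemma fluxField_eq {x : Sp d} (hx : x ∈ band w T) :
    fluxField γ w x = (1 / ‖gradient w x‖ + γ) • direction w x := by
  have h := norm_ne_zero_iff.mpr (D.gradient_ne_zero hx)
  rw [fluxField, direction, smul_smul, ← add_smul]
  congr 1
  field_simp

end

variable (D : ClassicalData d γ T Γ V₀ w u) {Y : Sp d → ℝ → Sp d} {ρ : ℝ → Sp d → ℝ}
  {π : Sp d → Sp d} (A : IsAscentFlow Γ T w Y ρ π)
include D A

lemma clock_pos {z : Sp d} (hz : z ∈ frontier Γ) : 0 < ρ T z := by
  rw [← A.clock_zero z hz]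
  exact A.clock_strictMono z hz ⟨le_rfl, D.T_pos.le⟩ ⟨D.T_pos.le, le_rfl⟩ D.T_pos

lemma clock_mem_Ioo {z : Sp d} (hz : z ∈ frontier Γ) {t : ℝ} (ht : t ∈ Ioo 0 T) :
    ρ t z ∈ Ioo 0 (ρ T z) := by
  have hT := D.T_pos
  refine ⟨?_, A.clock_strictMono z hz ⟨ht.1.le, ht.2.le⟩ ⟨hT.le, le_rfl⟩ ht.2⟩
  rw [← A.clock_zero z hz]
  exact A.clock_strictMono z hz ⟨le_rfl, hT.le⟩ ⟨ht.1.le, ht.2.le⟩ ht.1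

lemma clock_mem_Icc {z : Sp d} (hz : z ∈ frontier Γ) {t : ℝ} (ht : t ∈ Icc 0 T) :
    ρ t z ∈ Icc 0 (ρ T z) := by
  have hT := D.T_pos
  refine ⟨?_, (A.clock_strictMono z hz).monotoneOn ht ⟨hT.le, le_rfl⟩ ht.2⟩
  rw [← A.clock_zero z hz]
  exact (A.clock_strictMono z hz).monotoneOn ⟨le_rfl, hT.le⟩ ht ht.1

lemma foot_frontier {z : Sp d} (hz : z ∈ frontier Γ) : π z = z := by
  have := A.foot_curve z hz 0 ⟨le_rfl, D.clock_pos A hz⟩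
  rwa [A.curve_zero z hz] at this

/-- The foot does not change along a flow line. No differentiability is required: where it fails,
`fderiv` has the value zero by convention, as the equation demands. -/
lemma fderiv_comp_foot {h : Sp d → ℝ} {x : Sp d} (hx : x ∈ band w T) :
    fderiv ℝ (fun x => h (π x)) x (direction w x) = 0 := by
  by_cases hd : DifferentiableAt ℝ (fun x => h (π x)) x
  · have hz := A.foot_mem x (Or.inr hx)
    have hr := D.clock_mem_Ioo A hz (t := w x) hx
    have hxe := A.flow_foot x (Or.inr hx)
    set r := ρ (w x) (π x) with hrdef
    set z := π x with hzdef
    have h1 := A.hasDerivAt_curve z hz r hr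
    rw [hxe] at h1
    have hd' : HasFDerivAt (fun x => h (π x)) (fderiv ℝ (fun x => h (π x)) x) (Y z r) := by
      rw [hxe]; exact hd.hasFDerivAt
    have h2 := hd'.comp_hasDerivAt r h1
    have h3 : HasDerivAt ((fun x => h (π x)) ∘ Y z) 0 r := by
      refine (hasDerivAt_const r (h z)).congr_of_eventuallyEq ?_
      filter_upwards [Ioo_mem_nhds hr.1 hr.2] with q hq
      simp only [Function.comp_apply]
      rw [A.foot_curve z hz q ⟨hq.1.le, hq.2⟩]
    exact h2.unique h3
  · rw [fderiv_zero_of_not_differentiableAt hd]; rfl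

lemma locallyLipschitzOn_comp_foot {h : Sp d → ℝ} {L : ℝ≥0} (hh : LipschitzWith L h) :
    LocallyLipschitzOn (frontier Γ ∪ band w T) fun x => h (π x) := by
  intro x hx
  obtain ⟨K, t, ht, h1⟩ := A.locallyLipschitz_foot hx
  exact ⟨L * K, t, ht, hh.comp_lipschitzOnWith h1⟩

/-- The part of the closed band below level `t` lying over a compact set is compact. -/
lemma exists_compact_over {t : ℝ} (ht : t ∈ Ioo 0 T) {h : Sp d → ℝ} (hh : HasCompactSupport h) :
    ∃ K : Set (Sp d), IsCompact K ∧ ∀ x ∈ closure (band w t), x ∉ K → h (π x) = 0 := by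
  refine ⟨(fun p : ℝ × Sp d => Y p.2 (ρ p.1 p.2)) '' (Icc 0 t ×ˢ (frontier Γ ∩ tsupport h)),
    (isCompact_Icc.prod (hh.isCompact.inter_left isClosed_frontier)).image_of_continuousOn
      (A.continuousOn_flow.mono (prod_mono (Icc_subset_Icc_right ht.2.le) inter_subset_left)),
    fun x hx hxK => ?_⟩
  by_contra h0
  have hx' := D.closure_band_subset ht.2 hx
  exact hxK ⟨(w x, π x), ⟨⟨D.w_nonneg x, D.w_le_of_mem_closure ht.2.le hx⟩,
    A.foot_mem x hx', subset_tsupport _ h0⟩, A.flow_foot x hx'⟩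

lemma aemeasurable_foot {t : ℝ} (ht : t ≤ T) :
    AEMeasurable π (volume.restrict (band w t)) :=
  (A.locallyLipschitz_foot.continuousOn.mono
    ((band_mono w ht).trans subset_union_right)).aemeasurable (D.measurableSet_band t)

/-- A bounded function of the foot point with compact support is integrable against locally
integrable weights below every level `t < T`. -/
lemma integrableOn_comp_foot_mul {t : ℝ} (ht : t ∈ Ioo 0 T) {h : Sp d → ℝ} (hc : Continuous h)
    (hh : HasCompactSupport h) {f : Sp d → ℝ}
    (hf : ∀ K : Set (Sp d), IsCompact K → IntegrableOn f (band w t ∩ K)) :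
    IntegrableOn (fun x => h (π x) * f x) (band w t) := by
  obtain ⟨K, hK, hK0⟩ := D.exists_compact_over A ht hh
  obtain ⟨C, hC⟩ := hh.exists_bound_of_continuous hc
  have h1 : IntegrableOn (fun x => h (π x) * f x) (band w t ∩ K) := by
    refine (hf K hK).bdd_mul (c := C) ?_ (Eventually.of_forall fun x => hC _)
    exact (hc.measurable.comp_aemeasurable ((D.aemeasurable_foot A ht.2.le).mono_measure
      (Measure.restrict_mono inter_subset_left le_rfl))).aestronglyMeasurable
  refine (h1.of_forall_sdiff_eq_zero (D.measurableSet_band t) fun x hx => ?_)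
  rw [hK0 x (subset_closure hx.1) fun h => hx.2 ⟨hx.1, h⟩, zero_mul]

lemma integrableOn_comp_foot_mul_source {t : ℝ} (ht : t ∈ Ioo 0 T) {h : Sp d → ℝ}
    (hc : Continuous h) (hh : HasCompactSupport h) :
    IntegrableOn (fun x => h (π x) * (1 + u x)) (band w t) :=
  D.integrableOn_comp_foot_mul A ht hc hh fun K hK =>
    (integrableOn_const (measure_ne_top_of_subset inter_subset_right hK.measure_lt_top.ne)).add
      (D.u_int.mono_set (inter_subset_left.trans (band_mono w ht.2.le)))

/-- Mass balance of a flow tube. The flux term vanishes for a function of the foot, and the outflow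
through the front {w = t} is nonnegative, so the net source below t cannot exceed the flux through
∂Γ. -/
theorem integral_comp_foot_le {t : ℝ} (ht : t ∈ Ioo 0 T) {h : Sp d → ℝ} {L : ℝ≥0}
    (hL : LipschitzWith L h) (hh : HasCompactSupport h) (h0 : ∀ x, 0 ≤ h x) :
    ∫ x in band w t, h (π x) * (1 + u x)
      ≤ ∫ x in frontier Γ, h x * (V₀ x + γ) ∂μHE[d - 1] := by
  have hsub := D.closure_band_subset ht.2
  obtain ⟨K, hK, hK0⟩ := D.exists_compact_over A ht hh
  have hlip := (D.locallyLipschitzOn_comp_foot A hL).mono hsub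
  have hone : LocallyLipschitzOn (closure (band w t)) fun _ : Sp d => (1 : ℝ) :=
    (LipschitzWith.const (1 : ℝ)).locallyLipschitz.locallyLipschitzOn
  obtain ⟨C, hC⟩ := exists_lipschitzOnWith_mul isClosed_closure hK hone hlip hK0
  simp only [one_mul] at hC
  have h1 := D.weak_fluxField ht ⟨C, hC⟩ ⟨K, hK, hK0⟩
  have h2 : ∫ x in band w t, (-(h (π x) * (u x + 1))
      + inner ℝ (gradient (fun x => h (π x)) x) (fluxField γ w x))
      = -∫ x in band w t, h (π x) * (1 + u x) := by
    rw [← integral_neg]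
    refine setIntegral_congr_fun (D.measurableSet_band t) fun x hx => ?_
    have hx' := band_mono w ht.2.le hx
    rw [inner_gradient, D.fluxField_eq hx', map_smul, D.fderiv_comp_foot A hx', smul_zero, add_zero,
      add_comm (u x)]
  have h3 : 0 ≤ ∫ x in frontier {x | w x < t} ∩ band w T,
      h (π x) * (1 / ‖gradient w x‖ + γ) ∂(μHE[d - 1] : Measure (Sp d)) := by
    refine integral_nonneg fun x => mul_nonneg (h0 _) ?_
    have := D.γ_pos
    positivity
  have h4 : ∫ x in frontier Γ, h (π x) * (V₀ x + γ) ∂(μHE[d - 1] : Measure (Sp d))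
      = ∫ x in frontier Γ, h x * (V₀ x + γ) ∂μHE[d - 1] :=
    setIntegral_congr_fun isClosed_frontier.measurableSet fun x hx => by
      rw [D.foot_frontier A hx]
  rw [h2, h4] at h1
  linarith

/-- The weight t - w removes the front term and equals t on ∂Γ. Its derivative along the flow is
-|∇w|, which turns the flux (1/|∇w| + γ) into the density 1 + γ |∇w|. -/
theorem integral_comp_foot_mul_speed {t : ℝ} (ht : t ∈ Ioo 0 T) {h : Sp d → ℝ} {L : ℝ≥0}
    (hL : LipschitzWith L h) (hh : HasCompactSupport h) :
    ∫ x in band w t, h (π x) * (1 + γ * ‖gradient w x‖ + (t - w x) * (1 + u x))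
      = t * ∫ x in frontier Γ, h x * (V₀ x + γ) ∂μHE[d - 1] := by
  have hsub := D.closure_band_subset ht.2
  obtain ⟨K, hK, hK0⟩ := D.exists_compact_over A ht hh
  have hlip := (D.locallyLipschitzOn_comp_foot A hL).mono hsub
  have hone : LocallyLipschitzOn (closure (band w t)) fun _ : Sp d => (1 : ℝ) :=
    (LipschitzWith.const (1 : ℝ)).locallyLipschitz.locallyLipschitzOn
  obtain ⟨C', hC'⟩ := exists_lipschitzOnWith_mul isClosed_closure hK hone hlip hK0
  simp only [one_mul] at hC'
  have htw : LocallyLipschitzOn (closure (band w t)) fun x => t - w x := by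
    intro x hx
    obtain ⟨K, s, hs, h1⟩ := A.locallyLipschitz_level (hsub hx)
    refine ⟨K, s, nhdsWithin_mono _ hsub hs, fun p hp q hq => ?_⟩
    rw [edist_sub_left]
    exact h1 hp hq
  obtain ⟨C, hC⟩ := exists_lipschitzOnWith_mul isClosed_closure hK htw hlip hK0
  have h1 := D.weak_fluxField ht (φ := fun x => (t - w x) * h (π x)) ⟨C, hC⟩
    ⟨K, hK, fun x hx hxK => by simp only [hK0 x hx hxK, mul_zero]⟩
  have hopen := D.isOpen_band' ht.2.le
  have h2 : ∫ x in band w t, (-((t - w x) * h (π x) * (u x + 1))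
      + inner ℝ (gradient (fun x => (t - w x) * h (π x)) x) (fluxField γ w x))
      = -∫ x in band w t, h (π x) * (1 + γ * ‖gradient w x‖ + (t - w x) * (1 + u x)) := by
    rw [← integral_neg]
    refine setIntegral_congr_ae (D.measurableSet_band t) ?_
    -- Unlike for h ∘ π alone, the product rule needs genuine differentiability; Rademacher's
    -- theorem provides it almost everywhere.
    filter_upwards [hC'.ae_differentiableWithinAt_of_mem] with x hxd hx
    have hx' := band_mono w ht.2.le hx
    have hd : DifferentiableAt ℝ (fun x => h (π x)) x :=
      (hxd (subset_closure hx)).differentiableAt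
        (mem_of_superset (hopen.mem_nhds hx) subset_closure)
    have hw := (D.hasFDerivAt_w hx').const_sub t
    have hprod : fderiv ℝ (fun x => (t - w x) * h (π x)) x = _ := (hw.mul hd.hasFDerivAt).fderiv
    have hg := norm_ne_zero_iff.mpr (D.gradient_ne_zero hx')
    have e1 : fderiv ℝ (fun x => (t - w x) * h (π x)) x (direction w x)
        = -(h (π x) * ‖gradient w x‖) := by
      rw [hprod]
      simp only [add_apply, smul_apply, neg_apply, smul_eq_mul]
      rw [D.fderiv_comp_foot A hx', D.fderiv_w_direction hx']
      ring
    rw [inner_gradient, D.fluxField_eq hx', map_smul, e1, smul_eq_mul]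
    field_simp
    ring
  have h3 : ∫ x in frontier {x | w x < t} ∩ band w T,
      (t - w x) * h (π x) * (1 / ‖gradient w x‖ + γ) ∂(μHE[d - 1] : Measure (Sp d)) = 0 := by
    refine integral_eq_zero_of_ae ?_
    filter_upwards [ae_restrict_mem (isClosed_frontier.measurableSet.inter
      (D.measurableSet_band T))] with x hx
    rw [D.w_eq_of_mem_frontier hx]
    simp
  have h4 : ∫ x in frontier Γ, (t - w x) * h (π x) * (V₀ x + γ) ∂(μHE[d - 1] : Measure (Sp d))
      = t * ∫ x in frontier Γ, h x * (V₀ x + γ) ∂μHE[d - 1] := by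
    rw [← integral_const_mul]
    refine setIntegral_congr_fun isClosed_frontier.measurableSet fun x hx => ?_
    rw [D.foot_frontier A hx, D.w_frontier hx]
    ring
  rw [h2, h3, h4] at h1
  linarith

end ClassicalData

end Cascade

namespace Cascade

/-! ### Comparison and coupling of measures -/

section Coupling

open ProbabilityTheory

lemma lipschitzWith_coe_thickenedIndicator {X : Type*} [PseudoMetricSpace X] {δ : ℝ} (hδ : 0 < δ)
    (K : Set X) : LipschitzWith (1 * δ.toNNReal⁻¹) fun x => (thickenedIndicator hδ K x : ℝ) :=
  (LipschitzWith.of_edist_le (f := NNReal.toReal) fun _ _ => le_of_eq rfl).comp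
    (lipschitzWith_thickenedIndicator hδ K)

lemma hasCompactSupport_coe_thickenedIndicator {X : Type*} [PseudoMetricSpace X] [ProperSpace X]
    {δ : ℝ} (hδ : 0 < δ) {K : Set X} (hK : IsCompact K) :
    HasCompactSupport fun x => (thickenedIndicator hδ K x : ℝ) := by
  refine HasCompactSupport.intro' (hK.cthickening (r := δ)) Metric.isClosed_cthickening
    fun x hx => ?_
  exact_mod_cast thickenedIndicator_zero hδ K
    fun h2 => hx (Metric.thickening_subset_cthickening _ _ h2)

lemma real_le_of_forall_integral_le {d : ℕ} {μ ν : Measure (Sp d)} [IsFiniteMeasure μ]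
    [IsFiniteMeasure ν]
    (h : ∀ (f : Sp d → ℝ) (L : ℝ≥0), LipschitzWith L f → HasCompactSupport f → (∀ x, 0 ≤ f x) →
      (∀ x, f x ≤ 1) → ∫ x, f x ∂μ ≤ ∫ x, f x ∂ν) {K : Set (Sp d)} (hK : IsCompact K) :
    μ.real K ≤ ν.real K := by
  have hp : ∀ n : ℕ, (0 : ℝ) < 1 / ((n : ℝ) + 1) := fun n => Nat.one_div_pos_of_nat
  have hl : Tendsto (fun n : ℕ => 1 / ((n : ℝ) + 1)) atTop (𝓝 0) := tendsto_one_div_add_atTop_nhds_zero_nat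
  refine le_of_tendsto_of_tendsto'
    (tendsto_integral_thickenedIndicator_of_isClosed μ hK.isClosed hp hl)
    (tendsto_integral_thickenedIndicator_of_isClosed ν hK.isClosed hp hl) fun n => ?_
  exact h _ _ (lipschitzWith_coe_thickenedIndicator (hp n) K)
    (hasCompactSupport_coe_thickenedIndicator (hp n) hK) (fun x => NNReal.coe_nonneg _)
    fun x => by exact_mod_cast thickenedIndicator_le_one (hp n) K x

/-- Finite measures are ordered as soon as their values on nonnegative compactly supported
Lipschitz functions are. -/
theorem measure_le_of_forall_integral_le {d : ℕ} {μ ν : Measure (Sp d)} [IsFiniteMeasure μ]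
    [IsFiniteMeasure ν]
    (h : ∀ (f : Sp d → ℝ) (L : ℝ≥0), LipschitzWith L f → HasCompactSupport f → (∀ x, 0 ≤ f x) →
      (∀ x, f x ≤ 1) → ∫ x, f x ∂μ ≤ ∫ x, f x ∂ν) : μ ≤ ν := by
  refine Measure.le_iff.2 fun A hA => ?_
  rw [hA.measure_eq_iSup_isCompact_of_ne_top (measure_ne_top μ A)]
  refine iSup₂_le fun K hKA => iSup_le fun hK => le_trans ?_ (measure_mono hKA)
  have := real_le_of_forall_integral_le h hK
  exact (ENNReal.toReal_le_toReal (measure_ne_top _ _) (measure_ne_top _ _)).1 this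

/-- The quantile function of a probability measure on the line. -/
noncomputable def quantile (ν : Measure ℝ) (q : ℝ) : ℝ := sInf {x | q ≤ cdf ν x}

/-- Right continuity of the distribution function puts the infimum into the set; 0 < q < 1 makes the
set nonempty and bounded below. -/
lemma quantile_le_iff (ν : Measure ℝ) {q : ℝ} (hq : q ∈ Ioo (0 : ℝ) 1) {x : ℝ} :
    quantile ν q ≤ x ↔ q ≤ cdf ν x := by
  have hne : {x | q ≤ cdf ν x}.Nonempty :=
    (((tendsto_cdf_atTop ν).eventually_const_lt hq.2).exists).imp fun x hx => hx.le
  have hbd : BddBelow {x | q ≤ cdf ν x} := by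
    obtain ⟨a, ha⟩ := ((tendsto_cdf_atBot ν).eventually_lt_const hq.1).exists
    exact ⟨a, fun y hy => le_of_not_gt fun hya =>
      absurd (lt_of_le_of_lt (le_trans hy (monotone_cdf ν hya.le)) ha) (lt_irrefl _)⟩
  refine ⟨fun h => ?_, fun h => csInf_le hbd h⟩
  have hc : Tendsto (cdf ν) (𝓝[>] x) (𝓝 (cdf ν x)) :=
    ((cdf ν).right_continuous x).mono Ioi_subset_Ici_self
  refine ge_of_tendsto hc (eventually_nhdsWithin_of_forall fun y hy => ?_)
  obtain ⟨a, ha, hay⟩ := exists_lt_of_csInf_lt hne (lt_of_le_of_lt h hy)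
  exact le_trans ha (monotone_cdf ν hay.le)

variable {E : Type*} [MeasurableSpace E]

lemma measurable_quantile (κ : Kernel E ℝ) [IsMarkovKernel κ] :
    Measurable fun p : E × Ioo (0 : ℝ) 1 => quantile (κ p.1) p.2 := by
  refine measurable_of_Iic fun x => ?_
  have : (fun p : E × Ioo (0 : ℝ) 1 => quantile (κ p.1) p.2) ⁻¹' Iic x
      = {p | (p.2 : ℝ) ≤ (κ p.1).real (Iic x)} := by
    ext p
    simp only [mem_preimage, mem_Iic, quantile_le_iff _ p.2.2, cdf_eq_real, mem_ofPred_eq]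
  rw [this]
  have h1 : Measurable fun p : E × Ioo (0 : ℝ) 1 => (κ p.1).real (Iic x) :=
    ((κ.measurable_coe measurableSet_Iic).comp measurable_fst).ennreal_toReal
  exact measurableSet_le (by fun_prop) h1

lemma map_quantile (ν : Measure ℝ) [IsProbabilityMeasure ν] (hm : Measurable fun q : Ioo (0 : ℝ) 1 =>
    quantile ν q) :
    (volume.comap (Subtype.val : Ioo (0 : ℝ) 1 → ℝ)).map (fun q : Ioo (0 : ℝ) 1 => quantile ν q) = ν := by
  have hemb := MeasurableEmbedding.subtype_coe (measurableSet_Ioo (a := (0 : ℝ)) (b := 1))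
  have hf : IsFiniteMeasure (volume.comap (Subtype.val : Ioo (0 : ℝ) 1 → ℝ)) := by
    refine ⟨?_⟩
    rw [hemb.comap_apply]
    exact (measure_mono (t := Icc (0 : ℝ) 1) (by rintro _ ⟨x, -, rfl⟩; exact ⟨x.2.1.le, x.2.2.le⟩)).trans_lt
      (by simp)
  refine Measure.ext_of_Iic _ _ fun x => ?_
  rw [Measure.map_apply hm measurableSet_Iic, hemb.comap_apply, ← ofReal_cdf ν x]
  have hset : Subtype.val '' ((fun q : Ioo (0 : ℝ) 1 => quantile ν q) ⁻¹' Iic x)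
      = Ioo 0 1 ∩ Iic (cdf ν x) := by
    ext q
    constructor
    · rintro ⟨q, hq, rfl⟩
      exact ⟨q.2, (quantile_le_iff ν q.2).1 hq⟩
    · rintro ⟨h1, h2⟩
      exact ⟨⟨q, h1⟩, (quantile_le_iff ν h1).2 h2, rfl⟩
  rw [hset]
  apply le_antisymm
  · refine (measure_mono (t := Icc 0 (cdf ν x)) fun q hq => ⟨hq.1.1.le, hq.2⟩).trans ?_
    simp
  · refine le_trans ?_ (measure_mono (s := Ioo 0 (cdf ν x))
      fun q hq => ⟨⟨hq.1, hq.2.trans_le (cdf_le_one ν x)⟩, hq.2.le⟩)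
    simp

/-- Two measures with the same first marginal, one of which is stochastically larger than the other
along the second coordinate, are coupled by a measure under which the second coordinates are
ordered. -/
theorem exists_monotone_coupling {s k : Measure (E × ℝ)} [IsFiniteMeasure s] [IsFiniteMeasure k]
    (hfst : s.fst = k.fst)
    (hle : ∀ B : Set E, MeasurableSet B → ∀ t, s (B ×ˢ Iio t) ≤ k (B ×ˢ Iio t)) :
    ∃ m : Measure (E × ℝ × ℝ), m.map (fun p => (p.1, p.2.1)) = s ∧
      m.map (fun p => (p.1, p.2.2)) = k ∧ ∀ᵐ p ∂m, p.2.2 ≤ p.2.1 := by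
  have hs : s.fst ⊗ₘ s.condKernel = s := s.disintegrate _
  have hk : s.fst ⊗ₘ k.condKernel = k := by rw [hfst]; exact k.disintegrate _
  let lam : Measure (Ioo (0 : ℝ) 1) := volume.comap Subtype.val
  have hlam : SFinite lam := by
    have : SFinite (lam.map Subtype.val) := by
      rw [(MeasurableEmbedding.subtype_coe measurableSet_Ioo).map_comap]; infer_instance
    have hf : IsFiniteMeasure lam := by
      refine ⟨?_⟩
      rw [(MeasurableEmbedding.subtype_coe measurableSet_Ioo).comap_apply]
      exact (measure_mono (t := Icc (0 : ℝ) 1)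
        (by rintro _ ⟨x, -, rfl⟩; exact ⟨x.2.1.le, x.2.2.le⟩)).trans_lt (by simp)
    infer_instance
  have hlaw : ∀ (κ : Kernel E ℝ) [IsMarkovKernel κ] (r : Measure (E × ℝ)),
      s.fst ⊗ₘ κ = r →
      (s.fst.prod lam).map (fun p => (p.1, quantile (κ p.1) p.2)) = r := by
    intro κ _ r hr
    have hm := measurable_quantile κ
    ext A hA
    rw [Measure.map_apply (measurable_fst.prodMk hm) hA,
      Measure.prod_apply ((measurable_fst.prodMk hm) hA), ← hr, Measure.compProd_apply hA]
    refine lintegral_congr fun z => ?_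
    have hmz : Measurable fun q : Ioo (0 : ℝ) 1 => quantile (κ z) q :=
      hm.comp measurable_prodMk_left
    conv_rhs => rw [← map_quantile (κ z) hmz]
    rw [Measure.map_apply hmz (measurable_prodMk_left hA)]
    rfl
  have hms := measurable_quantile s.condKernel
  have hmk := measurable_quantile k.condKernel
  have hmeas : Measurable fun p : E × Ioo (0 : ℝ) 1 =>
      (p.1, quantile (s.condKernel p.1) p.2, quantile (k.condKernel p.1) p.2) :=
    measurable_fst.prodMk (hms.prodMk hmk)
  -- Both conditional laws are sampled with the same uniform variable. Ordered distribution
  -- functions then give ordered quantiles.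
  refine ⟨(s.fst.prod lam).map _, ?_, ?_, (ae_map_iff hmeas.aemeasurable
    (measurableSet_le (by fun_prop) (by fun_prop))).2 ?_⟩
  · rw [Measure.map_map (by fun_prop) hmeas]
    exact hlaw s.condKernel s hs
  · rw [Measure.map_map (by fun_prop) hmeas]
    exact hlaw k.condKernel k hk
  · have h1 : ∀ᵐ z ∂s.fst, ∀ q : ℚ, s.condKernel z (Iio (q : ℝ)) ≤ k.condKernel z (Iio (q : ℝ)) := by
      refine ae_all_iff.2 fun q => ?_
      refine ae_le_of_forall_setLIntegral_le_of_sigmaFinite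
        (s.condKernel.measurable_coe measurableSet_Iio) fun B hB _ => ?_
      rw [← Measure.compProd_apply_prod hB measurableSet_Iio,
        ← Measure.compProd_apply_prod hB measurableSet_Iio, hs, hk]
      exact hle B hB q
    have h2 : ∀ᵐ p ∂s.fst.prod lam,
        ∀ q : ℚ, s.condKernel p.1 (Iio (q : ℝ)) ≤ k.condKernel p.1 (Iio (q : ℝ)) :=
      Measure.quasiMeasurePreserving_fst.ae h1
    filter_upwards [h2] with p hp
    refine le_of_forall_gt_imp_ge_of_dense fun y hy => ?_
    obtain ⟨q, hq1, hq2⟩ := exists_rat_btwn hy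
    refine le_trans ?_ hq2.le
    rw [quantile_le_iff _ p.2.2]
    have h3 := (quantile_le_iff (s.condKernel p.1) p.2.2).1 le_rfl
    rw [cdf_eq_real] at h3 ⊢
    refine h3.trans ((ENNReal.toReal_le_toReal (measure_ne_top _ _) (measure_ne_top _ _)).2 ?_)
    exact (measure_mono (Iic_subset_Iio.2 hq1)).trans ((hp q).trans (measure_mono Iio_subset_Iic_self))

end Coupling

end Cascade

namespace Cascade
variable {d : ℕ} {γ T : ℝ} {Γ : Set (Sp d)} {V₀ w u : Sp d → ℝ}

/-! ### Transport of volume to the boundary of the initial domain -/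

/-- The measure `(V₀ + γ) dℋ` on the boundary of the initial domain. -/
noncomputable def boundaryFlux (γ : ℝ) (Γ : Set (Sp d)) (V₀ : Sp d → ℝ) : Measure (Sp d) :=
  ((μHE[d - 1] : Measure (Sp d)).restrict (frontier Γ)).withDensity
    fun x => ENNReal.ofReal (V₀ x + γ)

/-- The image under `π` of the measure `f⁺ dx` on the band `{0 < w < t}`. -/
noncomputable def transport (w : Sp d → ℝ) (π : Sp d → Sp d) (t : ℝ) (f : Sp d → ℝ) :
    Measure (Sp d) :=
  ((volume.restrict (band w t)).withDensity fun x => ENNReal.ofReal (f x)).map π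

section Transport

variable {π : Sp d → Sp d} (hπ : Measurable π) {t : ℝ} {f : Sp d → ℝ}

include hπ

lemma integral_transport (hf : Measurable f) {h : Sp d → ℝ} (hc : Continuous h) :
    ∫ z, h z ∂transport w π t f = ∫ x in band w t, max (f x) 0 * h (π x) := by
  rw [transport, integral_map hπ.aemeasurable hc.aestronglyMeasurable,
    integral_withDensity_eq_integral_toReal_smul hf.ennreal_ofReal (by simp)]
  exact integral_congr_ae (Eventually.of_forall fun x => by simp [ENNReal.toReal_ofReal'])

lemma transport_apply (hw : MeasurableSet (band w t)) {B : Set (Sp d)} (hB : MeasurableSet B) :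
    transport w π t f B
      = ((volume.withDensity fun x => ENNReal.ofReal (f x)).restrict (π ⁻¹' B)) (band w t) := by
  rw [transport, Measure.map_apply hπ hB, ← restrict_withDensity hw, Measure.restrict_apply (hπ hB),
    Measure.restrict_apply hw, inter_comm]

lemma isFiniteMeasure_transport (hf : IntegrableOn f (band w t)) :
    IsFiniteMeasure (transport w π t f) := by
  refine ⟨?_⟩
  rw [transport, Measure.map_apply hπ MeasurableSet.univ, preimage_univ,
    withDensity_apply _ MeasurableSet.univ, Measure.restrict_univ]
  exact hf.lintegral_lt_top

omit hπ in
/-- A bound on the integrals against the functions `h ∘ π` bounds the total mass. -/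
lemma lintegral_le_of_comp_foot {ν : Measure (Sp d)} {C : ℝ}
    (h : ∀ (h : Sp d → ℝ) (L : ℝ≥0), LipschitzWith L h → HasCompactSupport h → (∀ x, 0 ≤ h x) →
      (∀ x, h x ≤ 1) → Integrable (fun x => h (π x) * max (f x) 0) ν ∧
        ∫ x, h (π x) * max (f x) 0 ∂ν ≤ C) :
    ∫⁻ x, ENNReal.ofReal (f x) ∂ν ≤ ENNReal.ofReal C := by
  have hb : ∀ n : ℕ, ∀ x, π x ∈ Metric.closedBall (0 : Sp d) n →
      (thickenedIndicator one_pos (Metric.closedBall (0 : Sp d) n) (π x) : ℝ) = 1 := by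
    intro n x hx
    exact_mod_cast thickenedIndicator_one one_pos _ hx
  let g : ℕ → Sp d → ℝ≥0∞ := fun n x =>
    ENNReal.ofReal (thickenedIndicator one_pos (Metric.closedBall (0 : Sp d) n) (π x)
      * max (f x) 0)
  have hmon : ∀ x, Tendsto (fun n => g n x) atTop (𝓝 (ENNReal.ofReal (f x))) := by
    intro x
    refine tendsto_const_nhds.congr' ?_
    filter_upwards [eventually_ge_atTop ⌈‖π x‖⌉₊] with n hn
    have hx : π x ∈ Metric.closedBall (0 : Sp d) n := by
      rw [mem_closedBall_zero_iff]
      exact (Nat.le_ceil _).trans (by exact_mod_cast hn)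
    simp only [g]
    rw [hb n x hx, one_mul]
    simp
  have key : ∀ n : ℕ, Integrable (fun x => (thickenedIndicator one_pos (Metric.closedBall (0 : Sp d) n)
      (π x) : ℝ) * max (f x) 0) ν ∧ ∫ x, (thickenedIndicator one_pos
      (Metric.closedBall (0 : Sp d) n) (π x) : ℝ) * max (f x) 0 ∂ν ≤ C := fun n =>
    h _ _ (lipschitzWith_coe_thickenedIndicator one_pos _)
      (hasCompactSupport_coe_thickenedIndicator one_pos (isCompact_closedBall _ _))
      (fun x => NNReal.coe_nonneg _) fun x => by exact_mod_cast thickenedIndicator_le_one one_pos _ x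
  calc ∫⁻ x, ENNReal.ofReal (f x) ∂ν = ∫⁻ x, liminf (fun n => g n x) atTop ∂ν :=
        lintegral_congr fun x => ((hmon x).liminf_eq).symm
    _ ≤ liminf (fun n => ∫⁻ x, g n x ∂ν) atTop :=
        lintegral_liminf_le' fun n => (key n).1.1.aemeasurable.ennreal_ofReal
    _ ≤ ENNReal.ofReal C := by
        refine (liminf_le_liminf (Eventually.of_forall fun n => ?_) :
          _ ≤ liminf (fun _ : ℕ => ENNReal.ofReal C) atTop).trans (by simp)
        rw [← ofReal_integral_eq_lintegral_ofReal (key n).1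
          (Eventually.of_forall fun x => mul_nonneg (NNReal.coe_nonneg _) (le_max_right _ _))]
        exact ENNReal.ofReal_le_ofReal (key n).2

end Transport

namespace ClassicalData

section

variable (D : ClassicalData d γ T Γ V₀ w u)
include D

lemma integrableOn_flux : IntegrableOn (fun x => V₀ x + γ) (frontier Γ) μHE[d - 1] := by
  obtain ⟨C, hC⟩ := D.V_bdd
  refine IntegrableOn.of_bound D.surface_frontier_lt_top
    (D.measV.add_const γ).aestronglyMeasurable (C + γ) (Eventually.of_forall fun x => ?_)
  rw [Real.norm_of_nonneg (add_nonneg (D.V_nonneg x) D.γ_pos.le)]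
  linarith [hC x]

lemma isFiniteMeasure_boundaryFlux : IsFiniteMeasure (boundaryFlux γ Γ V₀) := by
  refine ⟨?_⟩
  rw [boundaryFlux, withDensity_apply _ MeasurableSet.univ, Measure.restrict_univ]
  exact D.integrableOn_flux.lintegral_lt_top

lemma integral_boundaryFlux (h : Sp d → ℝ) :
    ∫ z, h z ∂boundaryFlux γ Γ V₀ = ∫ x in frontier Γ, h x * (V₀ x + γ) ∂μHE[d - 1] := by
  rw [boundaryFlux, integral_withDensity_eq_integral_toReal_smul
    (D.measV.add_const γ).ennreal_ofReal (by simp)]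
  refine integral_congr_ae (Eventually.of_forall fun x => ?_)
  simp only
  rw [ENNReal.toReal_ofReal (add_nonneg (D.V_nonneg x) D.γ_pos.le), smul_eq_mul, mul_comm]

/-- The perimeter of Γ is nonzero and is bounded by a multiple of the surface of ∂Γ, which is thus
positive; the density of the flux is at least γ. -/
lemma boundaryFlux_univ_ne_zero : boundaryFlux γ Γ V₀ univ ≠ 0 := by
  have hm : Measurable fun x => ENNReal.ofReal (V₀ x + γ) :=
    (D.measV.add_const γ).ennreal_ofReal
  rw [boundaryFlux, withDensity_apply _ MeasurableSet.univ, Measure.restrict_univ, Ne,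
    lintegral_eq_zero_iff hm]
  intro h0
  have hz : ((μHE[d - 1] : Measure (Sp d)).restrict (frontier Γ)) univ = 0 := by
    refine measure_mono_null (fun x _ => ?_) (ae_iff.1 h0)
    show ¬ (ENNReal.ofReal (V₀ x + γ) = 0)
    rw [ENNReal.ofReal_eq_zero, not_le]
    linarith [D.V_nonneg x, D.γ_pos]
  obtain ⟨C, -, hC⟩ := exists_totalVar_le_hausdorffMeasure (d := d) D.one_le
  obtain ⟨c, hc, hc2⟩ := exists_hausdorff_factor (d := d) (d - 1)
  have h1 := hC Γ univ D.Γ_per.1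
  rw [totalVar_indicator_univ D.Γ_per.1, inter_univ] at h1
  rw [Measure.restrict_apply_univ, hc2, Measure.smul_apply] at hz
  have hz2 : μH[((d - 1 : ℕ) : ℝ)] (frontier Γ) = 0 := by
    rcases (smul_eq_zero (M := ℝ≥0∞)).1 hz with h | h
    · exact absurd h hc
    · exact h
  rw [hz2, mul_zero] at h1
  exact D.perimeter_ne (le_antisymm h1 bot_le)

lemma frontier_nonempty : (frontier Γ).Nonempty := by
  by_contra h
  refine D.boundaryFlux_univ_ne_zero ?_
  rw [boundaryFlux, not_nonempty_iff_eq_empty.1 h]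
  simp

/-- π is known to be continuous only on ∂Γ together with the band. Redefining it elsewhere makes it
Borel and affects none of the properties of the flow. -/
lemma exists_measurable_ascentFlow : ∃ Y ρ π, IsAscentFlow Γ T w Y ρ π ∧ Measurable π := by
  classical
  obtain ⟨Y, ρ, π, A⟩ := D.exists_ascentFlow
  refine ⟨Y, ρ, (frontier Γ ∪ band w T).piecewise π fun _ => 0, ⟨A.curve_zero, A.clock_zero,
    A.clock_strictMono, A.dist_curve, A.curve_mem_band, A.curve_mem_closure, A.w_curve, A.clock_w,
    A.hasDerivAt_curve, A.hasDerivAt_w, A.continuousOn_clock, A.continuousOn_flow,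
    fun x hx => ?_, fun x hx => ?_, fun z hz r hr => ?_, A.locallyLipschitz_level, ?_⟩,
    (A.locallyLipschitz_foot.continuousOn).measurable_piecewise continuousOn_const
      (isClosed_frontier.measurableSet.union (D.measurableSet_band T))⟩
  · rw [piecewise_eq_of_mem _ _ _ hx]
    exact A.foot_mem x hx
  · rw [piecewise_eq_of_mem _ _ _ hx]
    exact A.flow_foot x hx
  · rw [piecewise_eq_of_mem _ _ _ ?_]
    · exact A.foot_curve z hz r hr
    · rcases hr.1.eq_or_lt with h | h
      · rw [← h, A.curve_zero z hz]
        exact Or.inl hz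
      · exact Or.inr (A.curve_mem_band z hz r ⟨h, hr.2⟩)
  · intro x hx
    obtain ⟨K, t, ht, hK⟩ := A.locallyLipschitz_foot hx
    refine ⟨K, t ∩ (frontier Γ ∪ band w T), Filter.inter_mem ht self_mem_nhdsWithin, ?_⟩
    intro a ha b hb
    rw [piecewise_eq_of_mem _ _ _ ha.2, piecewise_eq_of_mem _ _ _ hb.2]
    exact hK ha.1 hb.1

end

lemma _root_.Cascade.measure_band_le_of_lt (hT : 0 < T) (μ : Measure (Sp d)) {C : ℝ≥0∞}
    (h : ∀ t ∈ Ioo 0 T, μ (band w t) ≤ C) : μ (band w T) ≤ C := by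
  obtain ⟨t, ht1, ht2, ht3⟩ := exists_seq_strictMono_tendsto' hT
  have hU : band w T = ⋃ n, band w (t n) := by
    ext x
    simp only [mem_iUnion]
    constructor
    · intro hx
      obtain ⟨n, hn⟩ := (ht3.eventually_const_lt hx.2).exists
      exact ⟨n, hx.1, hn⟩
    · rintro ⟨n, hn⟩
      exact band_mono w (ht2 n).2.le hn
  rw [hU]
  refine le_of_tendsto' (tendsto_measure_iUnion_atTop fun m n hmn => ?_) fun n => h _ (ht2 n)
  exact band_mono w (ht1.monotone hmn)

variable (D : ClassicalData d γ T Γ V₀ w u) {Y : Sp d → ℝ → Sp d} {ρ : ℝ → Sp d → ℝ}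
  {π : Sp d → Sp d} (A : IsAscentFlow Γ T w Y ρ π)

include D

lemma integrableOn_loss : IntegrableOn (fun x => max (-(1 + u x)) 0) (band w T) := by
  refine D.u_int.abs.mono' (by have := D.measu; fun_prop) (Eventually.of_forall fun x => ?_)
  rw [Real.norm_of_nonneg (le_max_right _ _)]
  exact max_le (by linarith [neg_abs_le (u x)]) (abs_nonneg _)

include A

/-- The source `1 + u` is integrable on the whole band. -/
theorem integrableOn_source : IntegrableOn (fun x => 1 + u x) (band w T) := by
  have hu := D.measu
  -- The loss (1 + u)⁻ is at most |u|, hence integrable. On every tube the gain is bounded by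
  -- boundary flux plus loss, so 1 + u turns out to be integrable although the band might a priori
  -- have infinite volume.
  set C : ℝ := (∫ x in frontier Γ, (V₀ x + γ) ∂μHE[d - 1]) + ∫ x in band w T, max (-(1 + u x)) 0
    with hC
  have key : ∀ t ∈ Ioo 0 T,
      (volume.withDensity fun x => ENNReal.ofReal (1 + u x)) (band w t) ≤ ENNReal.ofReal C := by
    intro t ht
    rw [withDensity_apply _ (D.measurableSet_band t)]
    refine lintegral_le_of_comp_foot (π := π) fun h L hL hh h0 h1 => ?_
    have i1 := D.integrableOn_comp_foot_mul_source A ht hL.continuous hh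
    have e1 : ∀ x, h (π x) * max (1 + u x) 0 = max (h (π x) * (1 + u x)) 0 := fun x => by
      rw [mul_max_of_nonneg _ _ (h0 _), mul_zero]
    have e2 : ∀ x, h (π x) * max (-(1 + u x)) 0 = max (-(h (π x) * (1 + u x))) 0 := fun x => by
      rw [mul_max_of_nonneg _ _ (h0 _), mul_zero, mul_neg]
    have i2 : IntegrableOn (fun x => h (π x) * max (1 + u x) 0) (band w t) := by
      simp only [e1]; exact i1.pos_part
    have i3 : IntegrableOn (fun x => h (π x) * max (-(1 + u x)) 0) (band w t) := by
      simp only [e2]; exact i1.neg_part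
    refine ⟨i2, ?_⟩
    have e3 : ∫ x in band w t, h (π x) * max (1 + u x) 0
        = (∫ x in band w t, h (π x) * (1 + u x))
          + ∫ x in band w t, h (π x) * max (-(1 + u x)) 0 := by
      rw [← integral_add i1 i3]
      refine integral_congr_ae (Eventually.of_forall fun x => ?_)
      simp only
      rw [← mul_add]
      congr 1
      rcases le_total 0 (1 + u x) with h | h
      · rw [max_eq_left h, max_eq_right (by linarith)]; ring
      · rw [max_eq_right h, max_eq_left (by linarith)]; ring
    rw [e3, hC]
    refine add_le_add ((D.integral_comp_foot_le A ht hL hh h0).trans ?_) ?_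
    · refine integral_mono_of_nonneg (Eventually.of_forall fun x => mul_nonneg (h0 x)
        (add_nonneg (D.V_nonneg x) D.γ_pos.le)) D.integrableOn_flux (Eventually.of_forall fun x => ?_)
      exact mul_le_of_le_one_left (add_nonneg (D.V_nonneg x) D.γ_pos.le) (h1 x)
    · refine (integral_mono i3 (D.integrableOn_loss.mono_set (band_mono w ht.2.le)) fun x =>
        mul_le_of_le_one_left (le_max_right _ _) (h1 _)).trans ?_
      exact setIntegral_mono_set D.integrableOn_loss
        (Eventually.of_forall fun x => le_max_right _ _) (band_mono w ht.2.le).eventuallyLE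
  have h1 := measure_band_le_of_lt D.T_pos _ key
  rw [withDensity_apply _ (D.measurableSet_band T)] at h1
  have h2 : IntegrableOn (fun x => max (1 + u x) 0) (band w T) := by
    refine ⟨by fun_prop, ?_⟩
    refine (hasFiniteIntegral_iff_ofReal (f := fun x => max (1 + u x) 0)
      (Eventually.of_forall fun x => le_max_right _ _)).2 ?_
    refine lt_of_le_of_lt (lintegral_mono fun x => ?_) (h1.trans_lt ENNReal.ofReal_lt_top)
    simp
  refine (h2.sub D.integrableOn_loss).congr (Eventually.of_forall fun x => ?_)
  simp only [Pi.sub_apply]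
  rcases le_total 0 (1 + u x) with h | h
  · rw [max_eq_left h, max_eq_right (by linarith)]; ring
  · rw [max_eq_right h, max_eq_left (by linarith)]; ring

lemma integrableOn_time_mul_source {t : ℝ} (ht : t ∈ Ioo 0 T) :
    IntegrableOn (fun x => (t - w x) * (1 + u x)) (band w t) := by
  have h1 := (D.integrableOn_source A).mono_set (band_mono w ht.2.le)
  refine Integrable.bdd_mul (c := t) h1 (by have := D.measw; fun_prop) ?_
  filter_upwards [ae_restrict_mem (D.measurableSet_band t)] with x hx
  rw [Real.norm_eq_abs, abs_le]
  constructor <;> linarith [hx.1, hx.2, ht.1]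

/-- The speed density `1 + γ |∇w|` is integrable on the inner bands. -/
lemma integrableOn_speed {t : ℝ} (ht : t ∈ Ioo 0 T) :
    IntegrableOn (fun x => 1 + γ * ‖gradient w x‖) (band w t) := by
  have hm : Measurable fun x => 1 + γ * ‖gradient w x‖ :=
    (measurable_gradient.norm.const_mul γ).const_add 1
  have hpos : ∀ x, 0 ≤ 1 + γ * ‖gradient w x‖ := fun x =>
    add_nonneg zero_le_one (mul_nonneg D.γ_pos.le (norm_nonneg _))
  have hloc : ∀ K : Set (Sp d), IsCompact K →
      IntegrableOn (fun x => 1 + γ * ‖gradient w x‖) (band w t ∩ K) := by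
    intro K hK
    obtain ⟨R, hR⟩ := hK.isBounded.subset_closedBall 0
    obtain ⟨C, hC⟩ := D.grad_upper R
    refine IntegrableOn.of_bound (measure_lt_top_of_subset inter_subset_right hK.measure_lt_top.ne)
      hm.aestronglyMeasurable (1 + γ * C) ?_
    filter_upwards [ae_restrict_mem ((D.measurableSet_band t).inter hK.measurableSet)] with x hx
    rw [Real.norm_of_nonneg (hpos x)]
    have := hC x (band_mono w ht.2.le hx.1) (by simpa using hR hx.2)
    nlinarith [mul_le_mul_of_nonneg_left this D.γ_pos.le]
  have i0 := D.integrableOn_time_mul_source A ht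
  -- The bound comes from the second tube identity itself, first for compactly supported h, where
  -- local boundedness of |∇w| gives integrability, and then by exhaustion.
  have key : ∫⁻ x in band w t, ENNReal.ofReal (1 + γ * ‖gradient w x‖) ≤ ENNReal.ofReal
      (t * (∫ x in frontier Γ, (V₀ x + γ) ∂μHE[d - 1])
        + ∫ x in band w t, |(t - w x) * (1 + u x)|) := by
    refine lintegral_le_of_comp_foot (π := π) fun h L hL hh h0 h1 => ?_
    simp only [max_eq_left (hpos _)]
    have i1 := D.integrableOn_comp_foot_mul A ht hL.continuous hh hloc
    have i2 : IntegrableOn (fun x => h (π x) * ((t - w x) * (1 + u x))) (band w t) :=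
      D.integrableOn_comp_foot_mul A ht hL.continuous hh fun K _ => i0.mono_set inter_subset_left
    refine ⟨i1, ?_⟩
    have e := D.integral_comp_foot_mul_speed A ht hL hh
    have e2 : (∫ x in band w t, h (π x) * (1 + γ * ‖gradient w x‖))
        + (∫ x in band w t, h (π x) * ((t - w x) * (1 + u x)))
        = t * ∫ x in frontier Γ, h x * (V₀ x + γ) ∂μHE[d - 1] := by
      rw [← e, ← integral_add i1 i2]
      simp only [mul_add]
    have e3 : ∫ x in frontier Γ, h x * (V₀ x + γ) ∂μHE[d - 1]
        ≤ ∫ x in frontier Γ, (V₀ x + γ) ∂μHE[d - 1] := by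
      refine integral_mono_of_nonneg (Eventually.of_forall fun x => mul_nonneg (h0 x)
        (add_nonneg (D.V_nonneg x) D.γ_pos.le)) D.integrableOn_flux (Eventually.of_forall fun x => ?_)
      exact mul_le_of_le_one_left (add_nonneg (D.V_nonneg x) D.γ_pos.le) (h1 x)
    have e4 : - ∫ x in band w t, h (π x) * ((t - w x) * (1 + u x))
        ≤ ∫ x in band w t, |(t - w x) * (1 + u x)| := by
      rw [← integral_neg]
      refine integral_mono i2.neg i0.abs fun x => ?_
      refine (neg_le_abs _).trans ?_
      rw [abs_mul, abs_of_nonneg (h0 _)]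
      exact mul_le_of_le_one_left (abs_nonneg _) (h1 _)
    have e5 := mul_le_mul_of_nonneg_left e3 ht.1.le
    linarith
  refine ⟨hm.aestronglyMeasurable, ?_⟩
  rw [hasFiniteIntegral_iff_ofReal (Eventually.of_forall hpos)]
  exact key.trans_lt ENNReal.ofReal_lt_top

variable (hπ : Measurable π)
include hπ

/-- The mass gained along the flow lines up to level `t` is bounded by the boundary flux and the
mass lost. -/
theorem transport_gain_le {t : ℝ} (ht : t ∈ Ioc 0 T) :
    transport w π t (fun x => 1 + u x)
      ≤ boundaryFlux γ Γ V₀ + transport w π t fun x => -(1 + u x) := by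
  have hu := D.measu
  have key : ∀ t ∈ Ioo 0 T, transport w π t (fun x => 1 + u x)
      ≤ boundaryFlux γ Γ V₀ + transport w π t fun x => -(1 + u x) := by
    intro t ht
    have i1 := (D.integrableOn_source A).mono_set (band_mono w ht.2.le)
    have := D.isFiniteMeasure_boundaryFlux
    have := isFiniteMeasure_transport hπ i1
    have := isFiniteMeasure_transport (f := fun x => -(1 + u x)) hπ i1.neg
    refine measure_le_of_forall_integral_le fun h L hL hh h0 h1 => ?_
    have hc := hL.continuous
    rw [integral_add_measure (hc.integrable_of_hasCompactSupport hh)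
      (hc.integrable_of_hasCompactSupport hh), integral_transport hπ (by fun_prop) hc,
      integral_transport hπ (by fun_prop) hc, D.integral_boundaryFlux]
    refine le_trans (le_of_eq ?_) (add_le_add_left (D.integral_comp_foot_le A ht hL hh h0) _)
    have i2 := D.integrableOn_comp_foot_mul_source A ht hL.continuous hh
    have i3 : IntegrableOn (fun x => max (-(1 + u x)) 0 * h (π x)) (band w t) := by
      refine i2.neg_part.congr (Eventually.of_forall fun x => ?_)
      simp only
      rw [max_mul_of_nonneg _ _ (h0 _), zero_mul]
      congr 1; ring
    rw [← integral_add i2 i3]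
    refine integral_congr_ae (Eventually.of_forall fun x => ?_)
    simp only
    rw [mul_comm (h (π x)), ← add_mul]
    congr 1
    rcases le_total 0 (1 + u x) with h | h
    · rw [max_eq_left h, max_eq_right (by linarith)]; ring
    · rw [max_eq_right h, max_eq_left (by linarith)]; ring
  rcases ht.2.lt_or_eq with h | rfl
  · exact key t ⟨ht.1, h⟩
  -- The weak equation is not available at t = T; both sides are monotone in t and the left one is
  -- an increasing limit.
  · refine Measure.le_iff.2 fun B hB => ?_
    rw [transport_apply hπ (D.measurableSet_band _) hB]
    refine measure_band_le_of_lt D.T_pos _ fun t' ht' => ?_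
    rw [← transport_apply hπ (D.measurableSet_band _) hB]
    refine (key t' ht' B).trans ?_
    rw [Measure.add_apply, Measure.add_apply, transport_apply hπ (D.measurableSet_band _) hB,
      transport_apply hπ (D.measurableSet_band _) hB]
    exact add_le_add le_rfl (measure_mono (band_mono w ht'.2.le))

/-- The balance between the speed density, the boundary flux and the source on each flow tube. -/
theorem transport_speed_add {t : ℝ} (ht : t ∈ Ioo 0 T) :
    transport w π t (fun x => 1 + γ * ‖gradient w x‖)
        + transport w π t (fun x => (t - w x) * (1 + u x))
      = ENNReal.ofReal t • boundaryFlux γ Γ V₀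
        + transport w π t fun x => -((t - w x) * (1 + u x)) := by
  have hu := D.measu
  have hw := D.measw
  have hg : Measurable fun x => ‖gradient w x‖ := measurable_gradient.norm
  have i1 := D.integrableOn_speed A ht
  have i2 := D.integrableOn_time_mul_source A ht
  have := D.isFiniteMeasure_boundaryFlux
  have := isFiniteMeasure_transport hπ i1
  have := isFiniteMeasure_transport hπ i2
  have := isFiniteMeasure_transport (f := fun x => -((t - w x) * (1 + u x))) hπ i2.neg
  have : IsFiniteMeasure (ENNReal.ofReal t • boundaryFlux γ Γ V₀) := by
    constructor
    rw [Measure.smul_apply, smul_eq_mul]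
    exact ENNReal.mul_lt_top ENNReal.ofReal_lt_top (measure_lt_top _ _)
  -- The signed term (t - w)(1 + u) is distributed over the two sides by its positive and negative
  -- parts, so that the identity holds between finite positive measures and can be read set by set.
  have key : ∀ (h : Sp d → ℝ) (L : ℝ≥0), LipschitzWith L h → HasCompactSupport h →
      ∫ z, h z ∂(transport w π t (fun x => 1 + γ * ‖gradient w x‖)
        + transport w π t (fun x => (t - w x) * (1 + u x)))
      = ∫ z, h z ∂(ENNReal.ofReal t • boundaryFlux γ Γ V₀
        + transport w π t fun x => -((t - w x) * (1 + u x))) := by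
    intro h L hL hh
    have hc := hL.continuous
    obtain ⟨M, hM⟩ := hc.bounded_above_of_compact_support hh
    have hb : ∀ f : Sp d → ℝ, IntegrableOn f (band w t) →
        IntegrableOn (fun x => f x * h (π x)) (band w t) := fun f hf =>
      hf.mul_bdd (c := M) (hc.measurable.comp hπ).aestronglyMeasurable
        (Eventually.of_forall fun x => hM _)
    rw [integral_add_measure (hc.integrable_of_hasCompactSupport hh)
      (hc.integrable_of_hasCompactSupport hh), integral_add_measure
      (hc.integrable_of_hasCompactSupport hh) (hc.integrable_of_hasCompactSupport hh),
      integral_transport hπ (by fun_prop) hc, integral_transport hπ (by fun_prop) hc,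
      integral_transport hπ (by fun_prop) hc, integral_smul_measure, D.integral_boundaryFlux,
      ENNReal.toReal_ofReal ht.1.le, smul_eq_mul, ← D.integral_comp_foot_mul_speed A ht hL hh,
      ← integral_add, ← integral_add]
    · refine integral_congr_ae (Eventually.of_forall fun x => ?_)
      simp only
      rw [max_eq_left (add_nonneg zero_le_one (mul_nonneg D.γ_pos.le (norm_nonneg _)))]
      rcases le_total 0 ((t - w x) * (1 + u x)) with h | h
      · rw [max_eq_left h, max_eq_right (by linarith)]; ring
      · rw [max_eq_right h, max_eq_left (by linarith)]; ring
    · refine (hb _ (i1.add i2)).congr (Eventually.of_forall fun x => ?_)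
      simp only [Pi.add_apply]
      ring
    · exact hb _ i2.neg_part
    · exact hb _ i1.pos_part
    · exact hb _ i2.pos_part
  exact le_antisymm
    (measure_le_of_forall_integral_le fun h L hL hh _ _ => (key h L hL hh).le)
    (measure_le_of_forall_integral_le fun h L hL hh _ _ => (key h L hL hh).ge)

end ClassicalData

end Cascade

namespace Cascade
variable {d : ℕ} {γ T : ℝ} {Γ : Set (Sp d)} {V₀ w u : Sp d → ℝ}

/-! ### The transport plan -/

/-- Only thresholds below T are required, as the tube identities are known there alone; in exchange
neither measure may charge [T, ∞). -/
lemma ext_of_Iio_of_lt {μ ν : Measure ℝ} [IsFiniteMeasure μ] {T : ℝ}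
    (h : ∀ t < T, μ (Iio t) = ν (Iio t)) (hμ : μ (Ici T) = 0) (hν : ν (Ici T) = 0) : μ = ν := by
  obtain ⟨t, ht1, ht2, ht3⟩ := exists_seq_strictMono_tendsto T
  have hU : Iio T = ⋃ n, Iio (t n) := by
    ext x
    simp only [mem_iUnion, mem_Iio]
    exact ⟨fun hx => (ht3.eventually_const_lt hx).exists, fun ⟨n, hn⟩ => hn.trans (ht2 n)⟩
  have hT : μ (Iio T) = ν (Iio T) := by
    have h1 : ∀ κ : Measure ℝ, Tendsto (fun n => κ (Iio (t n))) atTop (𝓝 (κ (Iio T))) := fun κ => by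
      rw [hU]
      exact tendsto_measure_iUnion_atTop fun m n hmn => Iio_subset_Iio (ht1.monotone hmn)
    refine tendsto_nhds_unique (h1 μ) ((h1 ν).congr fun n => (h _ (ht2 n)).symm)
  have hall : ∀ b, μ (Iio b) = ν (Iio b) := by
    intro b
    rcases lt_or_ge b T with hb | hb
    · exact h b hb
    · have h1 : ∀ κ : Measure ℝ, κ (Ici T) = 0 → κ (Iio b) = κ (Iio T) := fun κ hκ =>
        le_antisymm (by
          refine (measure_mono (t := Iio T ∪ Ici T) (by simp)).trans ((measure_union_le _ _).trans ?_)
          rw [hκ, add_zero]) (measure_mono (Iio_subset_Iio hb))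
      rw [h1 μ hμ, h1 ν hν, hT]
  refine Measure.ext_of_Ico μ ν fun a b hab => ?_
  rw [← Iio_sdiff_Iio, measure_sdiff (Iio_subset_Iio hab.le) measurableSet_Iio.nullMeasurableSet
    (measure_ne_top _ _), measure_sdiff (Iio_subset_Iio hab.le) measurableSet_Iio.nullMeasurableSet
    (by rw [← hall]; exact measure_ne_top _ _), hall, hall]

lemma ext_of_prod_Iio_of_lt {E : Type*} [MeasurableSpace E] {μ ν : Measure (E × ℝ)}
    [IsFiniteMeasure μ] {T : ℝ}
    (h : ∀ B : Set E, MeasurableSet B → ∀ t < T, μ (B ×ˢ Iio t) = ν (B ×ˢ Iio t))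
    (hμ : μ (univ ×ˢ Ici T) = 0) (hν : ν (univ ×ˢ Ici T) = 0) : μ = ν := by
  refine Measure.ext_prod fun {B C} hB hC => ?_
  have e : ∀ (κ : Measure (E × ℝ)) (C : Set ℝ), MeasurableSet C →
      (κ.restrict (B ×ˢ univ)).map Prod.snd C = κ (B ×ˢ C) := fun κ C hC => by
    rw [Measure.map_apply measurable_snd hC, Measure.restrict_apply (measurable_snd hC)]
    congr 1
    ext x
    simp [and_comm]
  rw [← e μ C hC, ← e ν C hC]
  congr 1
  refine ext_of_Iio_of_lt (T := T) (fun t ht => ?_) ?_ ?_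
  · rw [e _ _ measurableSet_Iio, e _ _ measurableSet_Iio, h B hB t ht]
  · rw [e _ _ measurableSet_Ici]
    exact measure_mono_null (prod_mono_left (subset_univ _)) hμ
  · rw [e _ _ measurableSet_Ici]
    exact measure_mono_null (prod_mono_left (subset_univ _)) hν

/-- The law of (foot, level) under the measure `f⁺ dx` on the band `{0 < w < T}`. -/
noncomputable def levelLaw (w : Sp d → ℝ) (π : Sp d → Sp d) (T : ℝ) (f : Sp d → ℝ) :
    Measure (Sp d × ℝ) :=
  ((volume.restrict (band w T)).withDensity fun x => ENNReal.ofReal (f x)).map fun x => (π x, w x)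

/-- `m` is the joint law of (foot, starting level, killing level): mass starts along the flow lines
with density `(1 + u)⁺ dx` and, at level `T`, according to `N`; it is killed with density
`(1 + u)⁻ dx` and, at level zero, according to the boundary flux. -/
structure IsTransportPlan (Γ : Set (Sp d)) (γ T : ℝ) (V₀ w u : Sp d → ℝ) (π : Sp d → Sp d)
    (N : Measure (Sp d)) (m : Measure (Sp d × ℝ × ℝ)) : Prop where
  start : m.map (fun p => (p.1, p.2.1)) =
    levelLaw w π T (fun x => 1 + u x) + N.map fun z => (z, T)
  kill : m.map (fun p => (p.1, p.2.2)) =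
    levelLaw w π T (fun x => -(1 + u x)) + (boundaryFlux γ Γ V₀).map fun z => (z, 0)
  finite : IsFiniteMeasure m
  finite_top : IsFiniteMeasure N
  mem : ∀ᵐ p ∂m, p.1 ∈ frontier Γ ∧ p.2.1 ∈ Ioc 0 T ∧ p.2.2 ∈ Ico 0 T ∧ p.2.2 ≤ p.2.1

section LevelLaw

variable {π : Sp d → Sp d} (hπ : Measurable π) (hw : Measurable w) {f : Sp d → ℝ}
include hπ hw

lemma levelLaw_apply_prod_Iio (hT : MeasurableSet (band w T)) {B : Set (Sp d)}
    (hB : MeasurableSet B) (t : ℝ) (ht : MeasurableSet (band w (min t T))) :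
    levelLaw w π T f (B ×ˢ Iio t) = transport w π (min t T) f B := by
  rw [levelLaw, Measure.map_apply (hπ.prodMk hw) (hB.prod measurableSet_Iio),
    transport_apply hπ ht hB, ← restrict_withDensity hT,
    Measure.restrict_apply ((hπ.prodMk hw) (hB.prod measurableSet_Iio)),
    Measure.restrict_apply ht]
  congr 1
  ext x
  simp only [band, mem_inter_iff, mem_preimage, mem_prod, mem_Iio, mem_ofPred_eq, lt_min_iff]
  tauto

lemma levelLaw_fst : (levelLaw w π T f).fst = transport w π T f := by
  rw [Measure.fst, levelLaw, Measure.map_map measurable_fst (hπ.prodMk hw)]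
  rfl

lemma ae_levelLaw (hT : MeasurableSet (band w T)) {p : Sp d × ℝ → Prop}
    (hp : MeasurableSet {q | p q}) (h : ∀ x ∈ band w T, p (π x, w x)) :
    ∀ᵐ q ∂levelLaw w π T f, p q := by
  rw [levelLaw, ae_map_iff (hπ.prodMk hw).aemeasurable hp]
  exact (withDensity_absolutelyContinuous _ _).ae_le ((ae_restrict_iff' hT).2 (Eventually.of_forall h))

lemma lintegral_levelLaw (hf : Measurable f) {g : Sp d × ℝ → ℝ≥0∞} (hg : Measurable g) :
    ∫⁻ q, g q ∂levelLaw w π T f = ∫⁻ x in band w T, ENNReal.ofReal (f x) * g (π x, w x) := by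
  rw [levelLaw, lintegral_map hg (hπ.prodMk hw),
    lintegral_withDensity_eq_lintegral_mul _ hf.ennreal_ofReal
      (show Measurable fun x => g (π x, w x) from hg.comp (hπ.prodMk hw))]
  rfl

/-- The truncation of t - level at zero replaces the restriction to {w < t}, so integrals over the
fixed law of levels reproduce the weighted sources at every t. -/
lemma lintegral_levelLaw_sub (hf : Measurable f) (hT : MeasurableSet (band w T)) {B : Set (Sp d)}
    (hB : MeasurableSet B) {t : ℝ} (ht : t ≤ T) (ht2 : MeasurableSet (band w t)) :
    ∫⁻ q, (B ×ˢ univ).indicator (fun q : Sp d × ℝ => ENNReal.ofReal (t - q.2)) q ∂levelLaw w π T f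
      = transport w π t (fun x => (t - w x) * f x) B := by
  have hm : Measurable fun q : Sp d × ℝ => ENNReal.ofReal (t - q.2) := by fun_prop
  rw [lintegral_levelLaw hπ hw hf (hm.indicator (hB.prod MeasurableSet.univ)), transport,
    Measure.map_apply hπ hB, withDensity_apply _ (hπ hB), ← lintegral_indicator (hπ hB),
    ← lintegral_indicator hT, ← lintegral_indicator ht2]
  refine lintegral_congr fun x => ?_
  by_cases hx : x ∈ band w T
  · by_cases hxt : x ∈ band w t
    · rw [indicator_of_mem hx, indicator_of_mem hxt]
      by_cases hB' : π x ∈ B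
      · rw [indicator_of_mem (show (π x, w x) ∈ B ×ˢ univ from ⟨hB', mem_univ _⟩),
          indicator_of_mem (show x ∈ π ⁻¹' B from hB'), ENNReal.ofReal_mul (by linarith [hxt.2]),
          mul_comm]
      · rw [indicator_of_notMem (fun h => hB' h.1), indicator_of_notMem (show x ∉ π ⁻¹' B from hB'),
          mul_zero]
    · rw [indicator_of_mem hx, indicator_of_notMem hxt]
      have : t ≤ w x := le_of_not_gt fun h => hxt ⟨hx.1, h⟩
      rw [indicator]
      split_ifs
      · rw [ENNReal.ofReal_of_nonpos (by linarith : t - w x ≤ 0), mul_zero]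
      · rw [mul_zero]
  · rw [indicator_of_notMem hx, indicator_of_notMem fun h => hx (band_mono w ht h)]

end LevelLaw

namespace ClassicalData

variable (D : ClassicalData d γ T Γ V₀ w u) {Y : Sp d → ℝ → Sp d} {ρ : ℝ → Sp d → ℝ}
  {π : Sp d → Sp d} (A : IsAscentFlow Γ T w Y ρ π) (hπ : Measurable π)

include D A hπ

/-- N is the mass missing in the balance of the whole tubes; it is nonnegative by
`transport_gain_le` at t = T, and adding it at level T equalizes the marginals of the foot. The same
inequality at smaller t is the stochastic order needed for the coupling. -/
theorem exists_transportPlan : ∃ N m, IsTransportPlan Γ γ T V₀ w u π N m := by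
  have hw := D.measw
  have hu := D.measu
  have i1 := D.integrableOn_source A
  have := D.isFiniteMeasure_boundaryFlux
  have := isFiniteMeasure_transport hπ i1
  have := isFiniteMeasure_transport (f := fun x => -(1 + u x)) hπ i1.neg
  have hle := D.transport_gain_le A hπ ⟨D.T_pos, le_rfl⟩
  set N := boundaryFlux γ Γ V₀ + transport w π T (fun x => -(1 + u x))
    - transport w π T (fun x => 1 + u x) with hN
  have hsum : N + transport w π T (fun x => 1 + u x)
      = boundaryFlux γ Γ V₀ + transport w π T (fun x => -(1 + u x)) := Measure.sub_add_cancel_of_le hle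
  have hNf : IsFiniteMeasure N := ⟨by
    refine (le_self_add.trans (congrArg (fun κ : Measure (Sp d) => κ univ) hsum).le).trans_lt ?_
    exact measure_lt_top _ _⟩
  have hTm : Measurable fun z : Sp d => (z, T) := by fun_prop
  have h0m : Measurable fun z : Sp d => (z, (0 : ℝ)) := by fun_prop
  have hfin : ∀ f : Sp d → ℝ, IntegrableOn f (band w T) → IsFiniteMeasure (levelLaw w π T f) := by
    intro f hf
    have := isFiniteMeasure_transport hπ hf
    refine ⟨?_⟩
    rw [← Measure.fst_univ, levelLaw_fst hπ hw]
    exact measure_lt_top _ _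
  have := hfin _ i1
  have := hfin (fun x => -(1 + u x)) i1.neg
  have hNT : ∀ B : Set (Sp d), MeasurableSet B → ∀ t, (N.map fun z => (z, T)) (B ×ˢ Iio t)
      = if T < t then N B else 0 := by
    intro B hB t
    rw [Measure.map_apply hTm (hB.prod measurableSet_Iio)]
    split_ifs with h
    · congr 1; ext z; simp [h]
    · convert measure_empty (μ := N); ext z; simp [h]
  have hν0 : ∀ B : Set (Sp d), MeasurableSet B → ∀ t,
      ((boundaryFlux γ Γ V₀).map fun z => (z, (0 : ℝ))) (B ×ˢ Iio t)
      = if 0 < t then boundaryFlux γ Γ V₀ B else 0 := by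
    intro B hB t
    rw [Measure.map_apply h0m (hB.prod measurableSet_Iio)]
    split_ifs with h
    · congr 1; ext z; simp [h]
    · convert measure_empty (μ := boundaryFlux γ Γ V₀); ext z; simp [h]
  obtain ⟨m, hm1, hm2, hm3⟩ := exists_monotone_coupling
    (s := levelLaw w π T (fun x => 1 + u x) + N.map fun z => (z, T))
    (k := levelLaw w π T (fun x => -(1 + u x)) + (boundaryFlux γ Γ V₀).map fun z => (z, 0)) (by
      have e1 := levelLaw_fst (T := T) (f := fun x => 1 + u x) hπ hw
      have e2 := levelLaw_fst (T := T) (f := fun x => -(1 + u x)) hπ hw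
      rw [Measure.fst] at e1 e2 ⊢
      rw [Measure.fst, Measure.map_add _ _ measurable_fst, Measure.map_add _ _ measurable_fst, e1, e2,
        Measure.map_map measurable_fst hTm, Measure.map_map measurable_fst h0m]
      have e3 : Prod.fst ∘ (fun z : Sp d => (z, T)) = id := rfl
      have e4 : Prod.fst ∘ (fun z : Sp d => (z, (0 : ℝ))) = id := rfl
      rw [e3, e4, Measure.map_id, Measure.map_id, add_comm, hsum, add_comm]) (by
      intro B hB t
      rw [Measure.add_apply, Measure.add_apply, hNT B hB, hν0 B hB,
        levelLaw_apply_prod_Iio hπ hw (D.measurableSet_band T) hB t (D.measurableSet_band _),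
        levelLaw_apply_prod_Iio hπ hw (D.measurableSet_band T) hB t (D.measurableSet_band _)]
      rcases le_or_gt t 0 with h0 | h0
      · have he : band w (min t T) = ∅ := by
          ext x
          simp only [band, mem_ofPred_eq, lt_min_iff, mem_empty_iff_false, iff_false]
          intro h
          linarith [h.1, h.2.1]
        rw [if_neg (by linarith [D.T_pos]), transport_apply hπ (D.measurableSet_band _) hB, he]
        simp
      · rw [if_pos h0]
        split_ifs with h
        · rw [min_eq_right h.le, add_comm, add_comm _ (boundaryFlux γ Γ V₀ B)]
          exact (congrArg (fun κ : Measure (Sp d) => κ B) hsum).le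
        · rw [add_zero, add_comm]
          exact D.transport_gain_le A hπ ⟨lt_min h0 D.T_pos, min_le_right _ _⟩ B)
  have hf1 : Measurable fun p : Sp d × ℝ × ℝ => (p.1, p.2.1) := by fun_prop
  have hf2 : Measurable fun p : Sp d × ℝ × ℝ => (p.1, p.2.2) := by fun_prop
  refine ⟨N, m, hm1, hm2, ⟨?_⟩, hNf, ?_⟩
  · have : m univ = (m.map fun p => (p.1, p.2.1)) univ := by
      rw [Measure.map_apply hf1 MeasurableSet.univ, preimage_univ]
    rw [this, hm1]
    exact measure_lt_top _ _
  · have hS : MeasurableSet (frontier Γ) := isClosed_frontier.measurableSet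
    have k1 : ∀ᵐ q ∂m.map (fun p : Sp d × ℝ × ℝ => (p.1, p.2.2)), q.1 ∈ frontier Γ ∧ q.2 ∈ Ico 0 T := by
      rw [hm2, ae_add_measure_iff]
      refine ⟨ae_levelLaw hπ hw (D.measurableSet_band T)
        ((hS.preimage measurable_fst).inter (measurableSet_Ico.preimage measurable_snd))
        fun x hx => ⟨A.foot_mem x (Or.inr hx), hx.1.le, hx.2⟩, ?_⟩
      refine (ae_map_iff h0m.aemeasurable
        ((hS.preimage measurable_fst).inter (measurableSet_Ico.preimage measurable_snd))).2 ?_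
      have : ∀ᵐ z ∂boundaryFlux γ Γ V₀, z ∈ frontier Γ :=
        (withDensity_absolutelyContinuous _ _).ae_le (ae_restrict_mem hS)
      filter_upwards [this] with z hz
      exact ⟨hz, le_rfl, D.T_pos⟩
    have k2 : ∀ᵐ q ∂m.map (fun p : Sp d × ℝ × ℝ => (p.1, p.2.1)), q.2 ∈ Ioc 0 T := by
      rw [hm1, ae_add_measure_iff]
      refine ⟨ae_levelLaw hπ hw (D.measurableSet_band T) (measurableSet_Ioc.preimage measurable_snd)
        fun x hx => ⟨hx.1, hx.2.le⟩, ?_⟩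
      rw [ae_map_iff hTm.aemeasurable (measurableSet_Ioc.preimage measurable_snd)]
      exact Eventually.of_forall fun z => ⟨D.T_pos, le_rfl⟩
    filter_upwards [ae_of_ae_map hf2.aemeasurable k1, ae_of_ae_map hf1.aemeasurable k2, hm3]
      with p h1 h2 h3
    exact ⟨h1.1, h2, h1.2, h3⟩

/-- Between starting and killing, the levels along the flow lines are visited with density
`(1 + γ |∇w|) dx`. -/
theorem lintegral_levels {N : Measure (Sp d)} {m : Measure (Sp d × ℝ × ℝ)}
    (P : IsTransportPlan Γ γ T V₀ w u π N m) {g : Sp d × ℝ → ℝ≥0∞} (hg : Measurable g) :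
    ∫⁻ p, (∫⁻ τ in Ioo p.2.2 p.2.1, g (p.1, τ)) ∂m
      = ∫⁻ x in band w T, ENNReal.ofReal (1 + γ * ‖gradient w x‖) * g (π x, w x) := by
  have hw := D.measw
  have hu := D.measu
  have hgr : Measurable fun x => ‖gradient w x‖ := measurable_gradient.norm
  have := P.finite
  have := P.finite_top
  have := D.isFiniteMeasure_boundaryFlux
  have hf1 : Measurable fun p : Sp d × ℝ × ℝ => (p.1, p.2.1) := by fun_prop
  have hf2 : Measurable fun p : Sp d × ℝ × ℝ => (p.1, p.2.2) := by fun_prop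
  have hTm : Measurable fun z : Sp d => (z, T) := by fun_prop
  have h0m : Measurable fun z : Sp d => (z, (0 : ℝ)) := by fun_prop
  let J : Set ((Sp d × ℝ × ℝ) × ℝ) := {q | q.1.2.2 < q.2 ∧ q.2 < q.1.2.1}
  have hJ : MeasurableSet J :=
    (measurableSet_lt (f := fun q : (Sp d × ℝ × ℝ) × ℝ => q.1.2.2) (g := fun q => q.2)
      (by fun_prop) (by fun_prop)).inter (measurableSet_lt
      (f := fun q : (Sp d × ℝ × ℝ) × ℝ => q.2) (g := fun q => q.1.2.1) (by fun_prop) (by fun_prop))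
  have hq : Measurable fun q : (Sp d × ℝ × ℝ) × ℝ => (q.1.1, q.2) := by fun_prop
  -- The expected number of passages, recorded by foot and level.
  let Θ : Measure (Sp d × ℝ) := ((m.prod volume).restrict J).map fun q => (q.1.1, q.2)
  have hΘ : ∀ g : Sp d × ℝ → ℝ≥0∞, Measurable g →
      ∫⁻ q, g q ∂Θ = ∫⁻ p, (∫⁻ τ in Ioo p.2.2 p.2.1, g (p.1, τ)) ∂m := by
    intro g hg
    rw [lintegral_map hg hq, ← lintegral_indicator hJ,
      lintegral_prod _ ((show Measurable fun q : (Sp d × ℝ × ℝ) × ℝ => g (q.1.1, q.2) from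
        hg.comp hq).indicator hJ).aemeasurable]
    refine lintegral_congr fun p => ?_
    rw [← lintegral_indicator measurableSet_Ioo]
    rfl
  have hΘB : ∀ B : Set (Sp d), MeasurableSet B → ∀ C : Set ℝ, MeasurableSet C → Θ (B ×ˢ C)
      = ∫⁻ p, (B ×ˢ univ).indicator (fun p => volume (C ∩ Ioo p.2.2 p.2.1)) p ∂m := by
    intro B hB C hC
    rw [← lintegral_indicator_one (hB.prod hC), hΘ _ (measurable_one.indicator (hB.prod hC))]
    refine lintegral_congr fun p => ?_
    by_cases hp : p.1 ∈ B
    · rw [indicator_of_mem (show p ∈ B ×ˢ univ from ⟨hp, mem_univ _⟩),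
        ← Measure.restrict_apply hC, ← lintegral_indicator_one hC]
      refine lintegral_congr fun τ => ?_
      have h1 : ((p.1, τ) ∈ B ×ˢ C) ↔ τ ∈ C := ⟨fun h => h.2, fun h => ⟨hp, h⟩⟩
      by_cases hτ : τ ∈ C
      · rw [indicator_of_mem (h1.2 hτ), indicator_of_mem hτ]; rfl
      · rw [indicator_of_notMem (fun h => hτ (h1.1 h)), indicator_of_notMem hτ]
    · rw [indicator_of_notMem (fun h => hp h.1)]
      simp [indicator, hp, mem_prod]
  have hmain : ∀ B : Set (Sp d), MeasurableSet B → ∀ t ∈ Ioo 0 T,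
      Θ (B ×ˢ Iio t) = transport w π t (fun x => 1 + γ * ‖gradient w x‖) B := by
    intro B hB t ht
    have hB' : MeasurableSet (B ×ˢ (univ : Set ℝ)) := hB.prod MeasurableSet.univ
    have hBm : Measurable ((B ×ˢ univ).indicator fun q : Sp d × ℝ => ENNReal.ofReal (t - q.2)) :=
      Measurable.indicator (by fun_prop) hB'
    have hs : ∫⁻ p, (B ×ˢ univ).indicator (fun p : Sp d × ℝ × ℝ => ENNReal.ofReal (t - p.2.1)) p ∂m
        = transport w π t (fun x => (t - w x) * (1 + u x)) B := by
      have e := lintegral_map (μ := m) hBm hf1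
      rw [P.start, lintegral_add_measure, lintegral_levelLaw_sub hπ hw (by fun_prop)
        (D.measurableSet_band T) hB ht.2.le (D.measurableSet_band t), lintegral_map hBm hTm] at e
      rw [show (∫⁻ a, (B ×ˢ univ).indicator (fun q : Sp d × ℝ => ENNReal.ofReal (t - q.2)) (a, T) ∂N)
        = 0 from ?_, add_zero] at e
      · rw [e]; rfl
      · refine (lintegral_eq_zero_iff (hBm.comp hTm)).2 ?_
        refine Eventually.of_forall fun z => ?_
        simp only [indicator, Pi.zero_apply, Function.comp_apply]
        split_ifs
        · exact ENNReal.ofReal_of_nonpos (by linarith [ht.2])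
        · rfl
    have hk : ∫⁻ p, (B ×ˢ univ).indicator (fun p : Sp d × ℝ × ℝ => ENNReal.ofReal (t - p.2.2)) p ∂m
        = transport w π t (fun x => -((t - w x) * (1 + u x))) B
          + ENNReal.ofReal t * boundaryFlux γ Γ V₀ B := by
      have e := lintegral_map (μ := m) hBm hf2
      rw [P.kill, lintegral_add_measure, lintegral_levelLaw_sub hπ hw (by fun_prop)
        (D.measurableSet_band T) hB ht.2.le (D.measurableSet_band t), lintegral_map hBm h0m] at e
      simp only [mul_neg] at e
      rw [show (∫⁻ a, (B ×ˢ univ).indicator (fun q : Sp d × ℝ => ENNReal.ofReal (t - q.2)) (a, 0)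
        ∂boundaryFlux γ Γ V₀) = ENNReal.ofReal t * boundaryFlux γ Γ V₀ B from ?_] at e
      · rw [e]; rfl
      · rw [← setLIntegral_const, ← lintegral_indicator hB]
        refine lintegral_congr fun z => ?_
        have h1 : ((z, (0 : ℝ)) ∈ B ×ˢ (univ : Set ℝ)) ↔ z ∈ B := ⟨fun h => h.1, fun h => ⟨h, mem_univ _⟩⟩
        by_cases hz : z ∈ B
        · rw [indicator_of_mem (h1.2 hz), indicator_of_mem hz, sub_zero]
        · rw [indicator_of_notMem (fun h => hz (h1.1 h)), indicator_of_notMem hz]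
    -- For death level b ≤ starting level a, the length of (b, a) below t plus (t - a)⁺ is (t - b)⁺.
    -- Integrated over the plan this has the form of the second tube identity, and subtracting a
    -- common finite term gives Θ.
    have hsum : Θ (B ×ˢ Iio t) + transport w π t (fun x => (t - w x) * (1 + u x)) B
        = transport w π t (fun x => -((t - w x) * (1 + u x))) B
          + ENNReal.ofReal t * boundaryFlux γ Γ V₀ B := by
      rw [← hs, ← hk, hΘB B hB _ measurableSet_Iio, ← lintegral_add_right _
        (Measurable.indicator (by fun_prop) (hB.prod MeasurableSet.univ))]
      refine lintegral_congr_ae ?_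
      filter_upwards [P.mem] with p hp
      by_cases hpB : p.1 ∈ B
      · have hp' : p ∈ B ×ˢ (univ : Set (ℝ × ℝ)) := ⟨hpB, mem_univ _⟩
        rw [indicator_of_mem hp', indicator_of_mem hp', indicator_of_mem hp', inter_comm,
          Ioo_inter_Iio, Real.volume_Ioo]
        rcases le_total p.2.1 t with h | h
        · rw [min_eq_left h, ← ENNReal.ofReal_add (by linarith [hp.2.2.2]) (by linarith)]
          congr 1; ring
        · rw [min_eq_right h, ENNReal.ofReal_of_nonpos (by linarith : t - p.2.1 ≤ 0), add_zero]
      · have hp' : p ∉ B ×ˢ (univ : Set (ℝ × ℝ)) := fun h => hpB h.1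
        rw [indicator_of_notMem hp', indicator_of_notMem hp', indicator_of_notMem hp', add_zero]
    have h2 := congrArg (fun κ : Measure (Sp d) => κ B) (D.transport_speed_add A hπ ht)
    simp only [Measure.add_apply, Measure.smul_apply, smul_eq_mul] at h2
    rw [add_comm (Θ _)] at hsum
    rw [add_comm (ENNReal.ofReal t * _), ← hsum, add_comm (transport _ _ _ _ _)] at h2
    have := isFiniteMeasure_transport hπ (D.integrableOn_time_mul_source A ht)
    exact ((ENNReal.add_right_inj (measure_ne_top _ B)).1 h2).symm
  have hΘf : IsFiniteMeasure Θ := by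
    refine ⟨?_⟩
    rw [← univ_prod_univ, hΘB univ MeasurableSet.univ univ MeasurableSet.univ]
    have : ∀ᵐ p ∂m, (univ ×ˢ univ : Set (Sp d × ℝ × ℝ)).indicator
        (fun p => volume (univ ∩ Ioo p.2.2 p.2.1)) p ≤ ENNReal.ofReal T := by
      filter_upwards [P.mem] with p hp
      rw [univ_prod_univ, indicator_univ, univ_inter, Real.volume_Ioo]
      exact ENNReal.ofReal_le_ofReal (by linarith [hp.2.1.2, hp.2.2.1.1])
    refine (lintegral_mono_ae this).trans_lt ?_
    rw [lintegral_const]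
    exact ENNReal.mul_lt_top ENNReal.ofReal_lt_top (measure_lt_top _ _)
  have hEq : Θ = levelLaw w π T fun x => 1 + γ * ‖gradient w x‖ := by
    refine ext_of_prod_Iio_of_lt (T := T) (fun B hB t ht => ?_) ?_ ?_
    · rw [levelLaw_apply_prod_Iio hπ hw (D.measurableSet_band T) hB t (D.measurableSet_band _),
        min_eq_left ht.le]
      rcases le_or_gt t 0 with h0 | h0
      · have he : band w t = ∅ := by
          ext x
          simp only [band, mem_ofPred_eq, mem_empty_iff_false, iff_false]
          intro h
          linarith [h.1, h.2]
        rw [transport_apply hπ (D.measurableSet_band _) hB, he, measure_empty,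
          hΘB B hB _ measurableSet_Iio, lintegral_eq_zero_iff' ?_]
        · filter_upwards [P.mem] with p hp
          rw [indicator]
          split_ifs
          · rw [inter_comm, Ioo_inter_Iio, Ioo_eq_empty, measure_empty]
            · rfl
            · have := min_le_right p.2.1 t
              have := hp.2.2.1.1
              linarith
          · rfl
        · refine (Measurable.indicator ?_ (hB.prod MeasurableSet.univ)).aemeasurable
          simp only [inter_comm (Iio t), Ioo_inter_Iio, Real.volume_Ioo]
          fun_prop
      · exact hmain B hB t ⟨h0, ht⟩
    · rw [hΘB univ MeasurableSet.univ _ measurableSet_Ici, lintegral_eq_zero_iff' ?_]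
      · filter_upwards [P.mem] with p hp
        rw [univ_prod_univ, indicator_univ]
        refine measure_mono_null (t := ∅) (fun τ hτ => ?_) measure_empty
        linarith [hτ.1.out, hτ.2.2, hp.2.1.2]
      · refine (Measurable.indicator ?_ (MeasurableSet.univ.prod MeasurableSet.univ)).aemeasurable
        have : ∀ p : Sp d × ℝ × ℝ, volume (Ici T ∩ Ioo p.2.2 p.2.1)
            = ENNReal.ofReal (p.2.1 - max T p.2.2) := fun p => by
          refine le_antisymm ?_ ?_
          · refine (measure_mono (t := Icc (max T p.2.2) p.2.1) fun τ hτ =>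
              ⟨max_le hτ.1 hτ.2.1.le, hτ.2.2.le⟩).trans (by simp)
          · refine le_trans (by simp) (measure_mono (s := Ioo (max T p.2.2) p.2.1) fun τ hτ =>
              ⟨((le_max_left _ _).trans_lt hτ.1).le, (le_max_right _ _).trans_lt hτ.1, hτ.2⟩)
        simp only [this]
        fun_prop
    · have h1 := ae_levelLaw (T := T) (f := fun x => 1 + γ * ‖gradient w x‖)
        (p := fun q => q.2 < T) hπ hw (D.measurableSet_band T)
        (measurableSet_lt (by fun_prop) (by fun_prop)) fun x hx => hx.2
      have h2 : (univ : Set (Sp d)) ×ˢ Ici T ⊆ {q | ¬ q.2 < T} := fun q hq => not_lt.2 hq.2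
      exact measure_mono_null h2 (ae_iff.1 h1)
  rw [← hΘ g hg, hEq, lintegral_levelLaw hπ hw (by fun_prop) hg]

end ClassicalData

end Cascade

namespace Cascade
variable {d : ℕ} {γ T : ℝ} {Γ : Set (Sp d)} {V₀ w u : Sp d → ℝ}

/-! ### Measurability on the space of paths -/

namespace Path

lemma dist_eq (y z : Path Γ) :
    dist y z = (⨆ t : ℝ≥0, dist (y.toFun t) (z.toFun t)) + dist y.hit z.hit := rfl

lemma dist_apply_le (y z : Path Γ) (t : ℝ≥0) : dist (y.toFun t) (z.toFun t) ≤ dist y z := by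
  rw [dist_eq]
  exact (le_ciSup (bddAbove_dist y z) t).trans (le_add_of_nonneg_right dist_nonneg)

lemma dist_hit_le (y z : Path Γ) : dist y.hit z.hit ≤ dist y z := by
  rw [dist_eq]
  exact le_add_of_nonneg_left (Real.iSup_nonneg fun t => dist_nonneg)

lemma measurable_hit : Measurable (hit : Path Γ → ℝ≥0) :=
  (LipschitzWith.of_dist_le_mul (K := 1) fun y z => by
    simpa using dist_hit_le y z).continuous.measurable

lemma measurable_apply (t : ℝ≥0) : Measurable fun y : Path Γ => y.toFun t :=
  (LipschitzWith.of_dist_le_mul (K := 1) fun y z => by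
    simpa using dist_apply_le y z t).continuous.measurable

lemma measurable_uncurry : Measurable fun p : Path Γ × ℝ≥0 => p.1.toFun p.2 :=
  (measurable_uncurry_of_continuous_of_measurable (u := fun (t : ℝ≥0) (y : Path Γ) => y.toFun t)
    (fun y => y.lipschitz.continuous) measurable_apply).comp measurable_swap

lemma measurable_pos : Measurable fun p : Path Γ × ℝ => p.1.pos p.2 :=
  measurable_uncurry.comp (measurable_fst.prodMk measurable_snd.real_toNNReal)

lemma continuous_pos (y : Path Γ) : Continuous y.pos :=
  y.lipschitz.continuous.comp continuous_real_toNNReal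

lemma hit_mem (y : Path Γ) : y.toFun y.hit ∈ closure Γ :=
  (show hit y ∈ {s | y.toFun s ∈ closure Γ} from
    IsClosed.csInf_mem (isClosed_closure.preimage y.lipschitz.continuous :
      IsClosed {s | y.toFun s ∈ closure Γ}) y.hits (OrderBot.bddBelow _))

lemma notMem_of_lt_hit (y : Path Γ) {t : ℝ≥0} (ht : t < y.hit) : y.toFun t ∉ closure Γ :=
  fun h => absurd (csInf_le (s := {s | y.toFun s ∈ closure Γ}) (OrderBot.bddBelow _) h) (not_le.2 ht)

end Path

/-! ### The flow lines as paths -/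

namespace ClassicalData

variable (D : ClassicalData d γ T Γ V₀ w u) {Y : Sp d → ℝ → Sp d} {ρ : ℝ → Sp d → ℝ}
  {π : Sp d → Sp d} (A : IsAscentFlow Γ T w Y ρ π)

include D A

lemma w_curve_mem {z : Sp d} (hz : z ∈ frontier Γ) {r : ℝ} (hr : r ∈ Icc 0 (ρ T z)) :
    w (Y z r) ∈ Icc 0 T :=
  ⟨D.w_nonneg _, D.w_le_of_mem_closure le_rfl (A.curve_mem_closure z hz r hr)⟩

lemma w_curve_pos {z : Sp d} (hz : z ∈ frontier Γ) {r : ℝ} (hr : r ∈ Ioc 0 (ρ T z)) :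
    0 < w (Y z r) := by
  refine lt_of_le_of_ne (D.w_nonneg _) fun h => ?_
  have h1 := A.clock_w z hz r ⟨hr.1.le, hr.2⟩
  rw [← h, A.clock_zero z hz] at h1
  exact hr.1.ne h1

/-- The flow line traversed backwards and stopped at its foot. The level is positive before the foot
is reached, so the closure of Γ is hit exactly at time ρ a z. -/
lemma exists_path {a : ℝ} (ha : a ∈ Icc 0 T) {z : Sp d} (hz : z ∈ frontier Γ) :
    ∃ y : Path Γ, (y.hit : ℝ) = ρ a z ∧ ∀ r : ℝ≥0, y.toFun r = Y z (max (ρ a z - r) 0) := by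
  have hρ := D.clock_mem_Icc A hz ha
  obtain ⟨R, hR⟩ : ∃ R : ℝ≥0, (R : ℝ) = ρ a z := ⟨⟨_, hρ.1⟩, rfl⟩
  rw [← hR] at hρ ⊢
  have hmem : ∀ r : ℝ≥0, max ((R : ℝ) - r) 0 ∈ Icc 0 (ρ T z) := fun r =>
    ⟨le_max_right _ _, max_le (by linarith [hρ.2, r.2]) (hρ.1.trans hρ.2)⟩
  have hset : {s : ℝ≥0 | Y z (max ((R : ℝ) - s) 0) ∈ closure Γ} = Ici (R : ℝ≥0) := by
    ext s
    rw [mem_ofPred_eq, mem_Ici, ← NNReal.coe_le_coe, ← D.w_eq_zero_iff]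
    constructor
    · intro h
      by_contra hs
      rw [not_le] at hs
      have h2 : 0 < (R : ℝ) - s := by linarith
      refine (D.w_curve_pos A hz ⟨?_, (hmem s).2⟩).ne' h
      rwa [max_eq_left h2.le]
    · intro hs
      rw [max_eq_right (by linarith), A.curve_zero z hz, D.w_eq_zero_iff]
      exact frontier_subset_closure hz
  have hinf : sInf {s : ℝ≥0 | Y z (max ((R : ℝ) - s) 0) ∈ closure Γ} = R := by
    rw [hset, csInf_Ici]
  refine ⟨⟨fun r => Y z (max ((R : ℝ) - r) 0), LipschitzWith.of_dist_le_mul fun r s => ?_,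
    ⟨R, ?_⟩, fun t ht => ?_⟩, ?_, fun r => rfl⟩
  · refine (A.dist_curve z hz _ (hmem r) _ (hmem s)).trans ((abs_max_sub_max_le_abs _ _ _).trans ?_)
    rw [NNReal.coe_one, one_mul, NNReal.dist_eq, abs_sub_comm (r : ℝ)]
    refine le_of_eq ?_
    congr 1; ring
  · have : (R : ℝ≥0) ∈ {s : ℝ≥0 | Y z (max ((R : ℝ) - s) 0) ∈ closure Γ} := by
      rw [hset]; exact self_mem_Ici
    exact this
  · rw [hinf] at ht ⊢
    rw [← NNReal.coe_le_coe] at ht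
    rw [sub_self, max_self, max_eq_right (by linarith)]
  · change ((sInf {s : ℝ≥0 | Y z (max ((R : ℝ) - s) 0) ∈ closure Γ} : ℝ≥0) : ℝ) = _
    rw [hinf]

lemma exists_clock_eq {z : Sp d} (hz : z ∈ frontier Γ) {r : ℝ} (hr : r ∈ Icc 0 (ρ T z)) :
    ∃ b ∈ Icc 0 T, ρ b z = r :=
  ⟨w (Y z r), D.w_curve_mem A hz hr, A.clock_w z hz r hr⟩

/-- The flow lines, run backwards from level `a` to the boundary point `z`, form a measurable family
of paths. -/
theorem exists_flowPath : ∃ P : ℝ × Sp d → Path Γ, Measurable P ∧ ∀ a ∈ Icc 0 T, ∀ z ∈ frontier Γ,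
    ((P (a, z)).hit : ℝ) = ρ a z ∧ ∀ r : ℝ≥0, (P (a, z)).toFun r = Y z (max (ρ a z - r) 0) := by
  classical
  obtain ⟨z₀, hz₀⟩ := D.frontier_nonempty
  set J : Set (ℝ × Sp d) := Icc 0 T ×ˢ frontier Γ with hJ
  have hJm : MeasurableSet J := measurableSet_Icc.prod isClosed_frontier.measurableSet
  choose! Φ hΦ1 hΦ2 using fun (q : J) => D.exists_path A q.2.1 q.2.2
  have hcont : Continuous Φ := by
    rw [continuous_iff_continuousAt]
    intro q
    have hval : Tendsto (Subtype.val : J → ℝ × Sp d) (𝓝 q) (𝓝[J] q.1) :=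
      tendsto_nhdsWithin_of_tendsto_nhds_of_eventually_within _ continuousAt_subtype_val
        (Eventually.of_forall fun q => q.2)
    have hsnd : Tendsto (fun q : J => q.1.2) (𝓝 q) (𝓝[frontier Γ] q.1.2) :=
      tendsto_nhdsWithin_of_tendsto_nhds_of_eventually_within _
        (continuous_snd.comp continuous_subtype_val).continuousAt
        (Eventually.of_forall fun q => q.2.2)
    rw [ContinuousAt, Metric.tendsto_nhds]
    intro ε hε
    have hε4 : 0 < ε / 8 := by linarith
    have c1 := A.continuousOn_clock
    have c2 := A.continuousOn_flow
    have hswap : MapsTo (fun p : Sp d × ℝ => (p.2, p.1)) (frontier Γ ×ˢ Icc 0 T) (Icc 0 T ×ˢ frontier Γ) :=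
      fun p hp => ⟨hp.2, hp.1⟩
    -- The path metric asks for closeness uniformly in time. Compactness of the interval of levels
    -- makes the continuity in the foot uniform in the level; positions at equal times are then
    -- compared through the point of equal level on the other line.
    obtain ⟨v1, hv1, e1⟩ := isCompact_Icc.mem_uniformity_of_prod
      (f := fun (z : Sp d) (b : ℝ) => ρ b z) (s := frontier Γ) (k := Icc 0 T) (q := q.1.2)
      (c1.comp (f := fun p : Sp d × ℝ => (p.2, p.1)) (by fun_prop) hswap) q.2.2
      (Metric.dist_mem_uniformity hε4)
    obtain ⟨v2, hv2, e2⟩ := isCompact_Icc.mem_uniformity_of_prod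
      (f := fun (z : Sp d) (b : ℝ) => Y z (ρ b z)) (s := frontier Γ) (k := Icc 0 T) (q := q.1.2)
      (c2.comp (f := fun p : Sp d × ℝ => (p.2, p.1)) (by fun_prop) hswap) q.2.2
      (Metric.dist_mem_uniformity hε4)
    have c3 : Tendsto (fun p : J => ρ p.1.1 p.1.2) (𝓝 q) (𝓝 (ρ q.1.1 q.1.2)) := (c1 q.1 q.2).tendsto.comp hval
    filter_upwards [hsnd hv1, hsnd hv2, Metric.tendsto_nhds.1 c3 _ hε4] with p h1 h2 h3
    have hd : dist (Φ p).hit (Φ q).hit ≤ ε / 8 := by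
      rw [NNReal.dist_eq, hΦ1, hΦ1]
      exact h3.le
    have hs : ⨆ t : ℝ≥0, dist ((Φ p).toFun t) ((Φ q).toFun t) ≤ ε / 8 + (ε / 8 + ε / 8) := by
      refine ciSup_le fun r => ?_
      rw [hΦ2, hΦ2]
      have m1 := D.clock_mem_Icc A p.2.2 p.2.1
      have m2 := D.clock_mem_Icc A q.2.2 q.2.1
      have hp : max (ρ p.1.1 p.1.2 - r) 0 ∈ Icc 0 (ρ T p.1.2) :=
        ⟨le_max_right _ _, max_le (by linarith [m1.2, r.2]) (m1.1.trans m1.2)⟩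
      have hq : max (ρ q.1.1 q.1.2 - r) 0 ∈ Icc 0 (ρ T q.1.2) :=
        ⟨le_max_right _ _, max_le (by linarith [m2.2, r.2]) (m2.1.trans m2.2)⟩
      obtain ⟨b, hb, hbr⟩ := D.exists_clock_eq A p.2.2 hp
      refine (dist_triangle _ (Y q.1.2 (ρ b q.1.2)) _).trans (add_le_add ?_ ?_)
      · rw [← hbr]
        exact (e2 _ h2 b hb).out.le
      · refine (A.dist_curve _ q.2.2 _ (D.clock_mem_Icc A q.2.2 hb) _ hq).trans ?_
        have k1 : |ρ b p.1.2 - ρ b q.1.2| ≤ ε / 8 := (e1 _ h1 b hb).out.le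
        have k2 : |max (ρ p.1.1 p.1.2 - r) 0 - max (ρ q.1.1 q.1.2 - r) 0| ≤ ε / 8 := by
          refine (abs_max_sub_max_le_abs _ _ _).trans ?_
          rw [sub_sub_sub_cancel_right]
          exact h3.le
        rw [← hbr] at k2
        have := abs_sub_le (ρ b q.1.2) (ρ b p.1.2) (max (ρ q.1.1 q.1.2 - r) 0)
        rw [abs_sub_comm (ρ b q.1.2) (ρ b p.1.2)] at this
        linarith
    rw [Path.dist_eq]
    linarith
  have hz0J : ((0 : ℝ), z₀) ∈ J := ⟨⟨le_rfl, D.T_pos.le⟩, hz₀⟩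
  -- Arguments outside [0, T] × ∂Γ are sent to an arbitrary admissible pair, which makes the family
  -- measurable on the whole product.
  let pr : ℝ × Sp d → J := fun p => ⟨if p ∈ J then p else (0, z₀), by split_ifs with h; exacts [h, hz0J]⟩
  have hpr : Measurable pr := (Measurable.ite hJm measurable_id measurable_const).subtype_mk
  refine ⟨fun p => Φ (pr p), hcont.measurable.comp hpr, fun a ha z hz => ?_⟩
  have hp : (pr (a, z)).1 = (a, z) := if_pos (⟨ha, hz⟩ : (a, z) ∈ J)
  have e1 := hΦ1 (pr (a, z))
  have e2 := hΦ2 (pr (a, z))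
  rw [hp] at e1 e2
  exact ⟨e1, e2⟩

end ClassicalData

end Cascade

namespace Cascade
variable {d : ℕ} {γ T κ : ℝ} {Γ : Set (Sp d)} {V₀ w u : Sp d → ℝ}

/-! ### The law of the paths -/

/-- The path started at level `p.2.1` of the flow line from `p.1`, with the time at which it reaches
level `p.2.2`. -/
noncomputable def flowPair (Ψ : ℝ × Sp d → Path Γ) (p : Sp d × ℝ × ℝ) : Path Γ × ℝ≥0 :=
  (Ψ (p.2.1, p.1), (Ψ (p.2.1, p.1)).hit - (Ψ (p.2.2, p.1)).hit)

/-- `Q` is, up to the factor `κ`, the law of the paths along the flow lines which start and are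
killed according to the transport plan `m`. -/
structure IsFlowLaw (Γ : Set (Sp d)) (γ T : ℝ) (V₀ w u : Sp d → ℝ) (Y : Sp d → ℝ → Sp d)
    (ρ : ℝ → Sp d → ℝ) (π : Sp d → Sp d) (N : Measure (Sp d)) (m : Measure (Sp d × ℝ × ℝ))
    (Ψ : ℝ × Sp d → Path Γ) (κ : ℝ) (Q : ProbabilityMeasure (Path Γ × ℝ≥0)) : Prop where
  measurable_foot : Measurable π
  plan : IsTransportPlan Γ γ T V₀ w u π N m
  measurable_path : Measurable Ψ
  hit_path : ∀ a ∈ Icc 0 T, ∀ z ∈ frontier Γ, ((Ψ (a, z)).hit : ℝ) = ρ a z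
  path_apply : ∀ a ∈ Icc 0 T, ∀ z ∈ frontier Γ, ∀ r : ℝ≥0,
    (Ψ (a, z)).toFun r = Y z (max (ρ a z - r) 0)
  kappa_pos : 0 < κ
  law : ENNReal.ofReal κ • (Q : Measure (Path Γ × ℝ≥0)) = m.map (flowPair Ψ)

lemma measurableSet_alive :
    MeasurableSet {q : (Path Γ × ℝ≥0) × ℝ | 0 ≤ q.2 ∧ q.2 ≤ q.1.2} :=
  (measurableSet_le measurable_const measurable_snd).inter
    (measurableSet_le measurable_snd (by fun_prop))

namespace ClassicalData

variable (D : ClassicalData d γ T Γ V₀ w u) {Y : Sp d → ℝ → Sp d} {ρ : ℝ → Sp d → ℝ}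
  {π : Sp d → Sp d} (A : IsAscentFlow Γ T w Y ρ π)

lemma _root_.Cascade.measurable_flowPair {Ψ : ℝ × Sp d → Path Γ} (hΨ : Measurable Ψ) :
    Measurable (flowPair Ψ) := by
  have h1 : Measurable fun p : Sp d × ℝ × ℝ => Ψ (p.2.1, p.1) := hΨ.comp (by fun_prop)
  have h2 : Measurable fun p : Sp d × ℝ × ℝ => Ψ (p.2.2, p.1) := hΨ.comp (by fun_prop)
  exact h1.prodMk ((Path.measurable_hit.comp h1).sub (Path.measurable_hit.comp h2))

include D

/-- κ is the total mass of the plan; it is positive because the plan kills at level zero with the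
boundary flux. -/
theorem exists_flowLaw : ∃ Y ρ π N m Ψ κ Q, IsAscentFlow Γ T w Y ρ π ∧
    IsFlowLaw Γ γ T V₀ w u Y ρ π N m Ψ κ Q := by
  obtain ⟨Y, ρ, π, A, hπ⟩ := D.exists_measurable_ascentFlow
  obtain ⟨N, m, P⟩ := D.exists_transportPlan A hπ
  obtain ⟨Ψ, hΨ, hΨ2⟩ := D.exists_flowPath A
  have := P.finite
  have hm0 : m univ ≠ 0 := by
    have hf2 : Measurable fun p : Sp d × ℝ × ℝ => (p.1, p.2.2) := by fun_prop
    have h0m : Measurable fun z : Sp d => (z, (0 : ℝ)) := by fun_prop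
    have h1 := congrArg (fun κ : Measure (Sp d × ℝ) => κ univ) P.kill
    simp only [Measure.add_apply] at h1
    rw [Measure.map_apply hf2 MeasurableSet.univ, Measure.map_apply h0m MeasurableSet.univ,
      preimage_univ, preimage_univ] at h1
    rw [h1]
    exact fun h => D.boundaryFlux_univ_ne_zero (add_eq_zero.1 h).2
  have hκ : 0 < (m univ).toReal := ENNReal.toReal_pos hm0 (measure_ne_top _ _)
  have hof : ENNReal.ofReal (m univ).toReal = m univ := ENNReal.ofReal_toReal (measure_ne_top _ _)
  have hpr : IsProbabilityMeasure ((m univ)⁻¹ • m.map (flowPair Ψ)) := by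
    refine ⟨?_⟩
    rw [Measure.smul_apply, Measure.map_apply (measurable_flowPair hΨ) MeasurableSet.univ,
      preimage_univ, smul_eq_mul]
    exact ENNReal.inv_mul_cancel hm0 (measure_ne_top _ _)
  refine ⟨Y, ρ, π, N, m, Ψ, (m univ).toReal, ⟨_, hpr⟩, A, hπ, P, hΨ,
    fun a ha z hz => (hΨ2 a ha z hz).1, fun a ha z hz => (hΨ2 a ha z hz).2, hκ, ?_⟩
  rw [hof]
  change m univ • ((m univ)⁻¹ • m.map (flowPair Ψ)) = _
  rw [smul_smul, ENNReal.mul_inv_cancel hm0 (measure_ne_top _ _), one_smul]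

include A

/-- Change of variables from time to level along a flow line. -/
lemma lintegral_flowLine {z : Sp d} (hz : z ∈ frontier Γ) {a b : ℝ} (ha : a ∈ Icc 0 T)
    (hb : b ∈ Icc 0 T) (f : Sp d → ℝ≥0∞) :
    ∫⁻ r in Ioo 0 (ρ a z - ρ b z), ‖gradient w (Y z (ρ a z - r))‖ₑ * f (Y z (ρ a z - r))
      = ∫⁻ τ in Ioo b a, f (Y z (ρ τ z)) := by
  have ma := D.clock_mem_Icc A hz ha
  have mb := D.clock_mem_Icc A hz hb
  have hq : ∀ r ∈ Ioo 0 (ρ a z - ρ b z), ρ a z - r ∈ Ioo 0 (ρ T z) := fun r hr =>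
    ⟨by linarith [hr.2, mb.1], by linarith [hr.1, ma.2]⟩
  have hmono : ∀ r ∈ Icc 0 T, ∀ s ∈ Icc 0 T, ρ r z < ρ s z ↔ r < s := fun r hr s hs =>
    (A.clock_strictMono z hz).lt_iff_lt hr hs
  have himg : (fun r => w (Y z (ρ a z - r))) '' Ioo 0 (ρ a z - ρ b z) = Ioo b a := by
    ext τ
    constructor
    · rintro ⟨r, hr, rfl⟩
      have h1 := Ioo_subset_Icc_self (hq r hr)
      have h2 := D.w_curve_mem A hz h1
      have h3 := A.clock_w z hz _ h1
      constructor
      · rw [← hmono b hb _ h2, h3]; linarith [hr.2]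
      · rw [← hmono _ h2 a ha, h3]; linarith [hr.1]
    · intro hτ
      have h1 : τ ∈ Icc 0 T := ⟨hb.1.trans hτ.1.le, hτ.2.le.trans ha.2⟩
      refine ⟨ρ a z - ρ τ z, ⟨?_, ?_⟩, ?_⟩
      · linarith [(hmono τ h1 a ha).2 hτ.2]
      · linarith [(hmono b hb τ h1).2 hτ.1]
      · simp only [sub_sub_cancel]
        exact A.w_curve z hz τ h1
  have hinj : InjOn (fun r => w (Y z (ρ a z - r))) (Ioo 0 (ρ a z - ρ b z)) := by
    intro r hr s hs hrs
    have h1 := A.clock_w z hz _ (Ioo_subset_Icc_self (hq r hr))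
    have h2 := A.clock_w z hz _ (Ioo_subset_Icc_self (hq s hs))
    simp only at hrs
    rw [hrs, h2] at h1
    linarith
  have hder : ∀ r ∈ Ioo 0 (ρ a z - ρ b z), HasDerivWithinAt (fun r => w (Y z (ρ a z - r)))
      (-‖gradient w (Y z (ρ a z - r))‖) (Ioo 0 (ρ a z - ρ b z)) r := by
    intro r hr
    have h1 := A.hasDerivAt_w z hz _ (hq r hr)
    have h2 : HasDerivAt (fun r => ρ a z - r) (-1) r := by
      simpa using (hasDerivAt_id r).const_sub (ρ a z)
    have h3 := HasDerivAt.comp r h1 h2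
    rw [mul_neg_one] at h3
    exact h3.hasDerivWithinAt
  rw [← himg, lintegral_image_eq_lintegral_abs_deriv_mul measurableSet_Ioo hder hinj]
  refine setLIntegral_congr_fun measurableSet_Ioo fun r hr => ?_
  rw [abs_neg, abs_of_nonneg (norm_nonneg _), ofReal_norm,
    A.clock_w z hz _ (Ioo_subset_Icc_self (hq r hr))]

variable {N : Measure (Sp d)} {m : Measure (Sp d × ℝ × ℝ)} {Ψ : ℝ × Sp d → Path Γ}
  {Q : ProbabilityMeasure (Path Γ × ℝ≥0)} (F : IsFlowLaw Γ γ T V₀ w u Y ρ π N m Ψ κ Q)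

omit A D in
include F in
lemma lintegral_law {f : Path Γ × ℝ≥0 → ℝ≥0∞} (hf : Measurable f) :
    ENNReal.ofReal κ * ∫⁻ q, f q ∂(Q : Measure (Path Γ × ℝ≥0)) = ∫⁻ p, f (flowPair Ψ p) ∂m := by
  rw [← smul_eq_mul, ← lintegral_smul_measure, F.law, lintegral_map hf
    (measurable_flowPair F.measurable_path)]

omit A D in
include F in
lemma ae_law {p : Path Γ × ℝ≥0 → Prop} (hp : MeasurableSet {q | p q})
    (h : ∀ z ∈ frontier Γ, ∀ a ∈ Icc 0 T, ∀ b ∈ Icc 0 T, b ≤ a → p (flowPair Ψ (z, a, b))) :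
    ∀ᵐ q ∂(Q : Measure (Path Γ × ℝ≥0)), p q := by
  have h1 : ∀ᵐ q ∂m.map (flowPair Ψ), p q := by
    rw [ae_map_iff (measurable_flowPair F.measurable_path).aemeasurable hp]
    filter_upwards [F.plan.mem] with x hx
    exact h x.1 hx.1 x.2.1 (Ioc_subset_Icc_self hx.2.1) x.2.2 (Ico_subset_Icc_self hx.2.2.1) hx.2.2.2
  rw [← F.law] at h1
  rw [ae_iff, Measure.smul_apply, smul_eq_mul, mul_eq_zero] at h1
  exact h1.resolve_left (by simpa using F.kappa_pos)

omit A D in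
include F in
lemma ae_law_prod {p : (Path Γ × ℝ≥0) × ℝ → Prop} (hp : MeasurableSet {q | p q})
    (h : ∀ z ∈ frontier Γ, ∀ a ∈ Icc 0 T, ∀ b ∈ Icc 0 T, b ≤ a →
      ∀ᵐ r : ℝ, p (flowPair Ψ (z, a, b), r)) :
    ∀ᵐ q ∂(Q : Measure (Path Γ × ℝ≥0)).prod (volume : Measure ℝ), p q := by
  rw [Measure.ae_prod_iff_ae_ae hp]
  refine ae_law F ?_ h
  have h1 := measurable_measure_prodMk_left (ν := (volume : Measure ℝ)) hp.compl
  exact h1 (measurableSet_singleton 0)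

include F

omit D A in
lemma flowPair_fst_apply {z : Sp d} (hz : z ∈ frontier Γ) {a : ℝ} (ha : a ∈ Icc 0 T) (b : ℝ)
    {r : ℝ} (hr : r ∈ Icc 0 (ρ a z)) : (flowPair Ψ (z, a, b)).1.pos r = Y z (ρ a z - r) := by
  rw [flowPair, Path.pos, F.path_apply a ha z hz, Real.coe_toNNReal _ hr.1,
    max_eq_left (by linarith [hr.2])]

omit D in
lemma flowPair_snd {z : Sp d} (hz : z ∈ frontier Γ) {a b : ℝ} (ha : a ∈ Icc 0 T)
    (hb : b ∈ Icc 0 T) (hba : b ≤ a) : ((flowPair Ψ (z, a, b)).2 : ℝ) = ρ a z - ρ b z := by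
  have h := (A.clock_strictMono z hz).monotoneOn hb ha hba
  rw [flowPair, NNReal.coe_sub, F.hit_path a ha z hz, F.hit_path b hb z hz]
  rw [← NNReal.coe_le_coe, F.hit_path a ha z hz, F.hit_path b hb z hz]
  exact h

/-- The expected occupation density of the paths before they are killed. -/
theorem lintegral_occupation {f : Sp d → ℝ≥0∞} (hf : Measurable f) :
    ENNReal.ofReal κ * ∫⁻ q, (∫⁻ r in Icc (0 : ℝ) q.2, f (q.1.pos r))
        ∂(Q : Measure (Path Γ × ℝ≥0))
      = ∫⁻ x in band w T, ENNReal.ofReal (1 / ‖gradient w x‖ + γ) * f x := by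
  have hg : Measurable fun x => ‖gradient w x‖ₑ := measurable_gradient.enorm
  have hJ := measurableSet_alive (Γ := Γ)
  have hm1 : Measurable fun q : Path Γ × ℝ≥0 => ∫⁻ r in Icc (0 : ℝ) q.2, f (q.1.pos r) := by
    have h1 : Measurable ({q : (Path Γ × ℝ≥0) × ℝ | 0 ≤ q.2 ∧ q.2 ≤ q.1.2}.indicator
        fun q => f (q.1.1.pos q.2)) :=
      (hf.comp (Path.measurable_pos.comp
        ((measurable_fst.comp measurable_fst).prodMk measurable_snd))).indicator hJ
    convert h1.lintegral_prod_right' (ν := (volume : Measure ℝ)) using 2 with q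
    rw [← lintegral_indicator measurableSet_Icc]
    rfl
  -- The point at level τ over the foot z is the start of the path Ψ(τ, z), which expresses it as a
  -- measurable function of foot and level. Division by |∇w| is the change of variables from time to
  -- level.
  have hG : Measurable fun q : Sp d × ℝ => f ((Ψ (q.2, q.1)).toFun 0)
      / ‖gradient w ((Ψ (q.2, q.1)).toFun 0)‖ₑ := by
    have h1 : Measurable fun q : Sp d × ℝ => (Ψ (q.2, q.1)).toFun 0 :=
      (Path.measurable_apply 0).comp (F.measurable_path.comp measurable_swap)
    exact (hf.comp h1).div (hg.comp h1)
  rw [lintegral_law F hm1]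
  trans ∫⁻ p, (∫⁻ τ in Ioo p.2.2 p.2.1, f ((Ψ (τ, p.1)).toFun 0)
      / ‖gradient w ((Ψ (τ, p.1)).toFun 0)‖ₑ) ∂m
  · refine lintegral_congr_ae ?_
    filter_upwards [F.plan.mem] with p ⟨hz, ha, hb, hba⟩
    obtain ⟨z, a, b⟩ := p
    have ha' := Ioc_subset_Icc_self ha
    have hb' := Ico_subset_Icc_self hb
    simp only at hz ha hb hba ha' hb' ⊢
    have ma := D.clock_mem_Icc A hz ha'
    have mb := D.clock_mem_Icc A hz hb'
    rw [flowPair_snd A F hz ha' hb' hba, setLIntegral_congr Ioo_ae_eq_Icc.symm]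
    trans ∫⁻ τ in Ioo b a, f (Y z (ρ τ z)) / ‖gradient w (Y z (ρ τ z))‖ₑ
    · rw [← D.lintegral_flowLine A hz ha' hb' fun x => f x / ‖gradient w x‖ₑ]
      refine setLIntegral_congr_fun measurableSet_Ioo fun r hr => ?_
      rw [flowPair_fst_apply F hz ha' b ⟨hr.1.le, by linarith [hr.2, mb.1]⟩,
        ENNReal.mul_div_cancel]
      · simpa using D.gradient_ne_zero (A.curve_mem_band z hz _
          ⟨by linarith [hr.2, mb.1], by linarith [hr.1, ma.2]⟩)
      · exact enorm_ne_top
    · refine setLIntegral_congr_fun measurableSet_Ioo fun τ hτ => ?_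
      have hτ' : τ ∈ Icc 0 T := ⟨hb.1.trans hτ.1.le, hτ.2.le.trans ha.2⟩
      rw [F.path_apply τ hτ' z hz, NNReal.coe_zero, sub_zero,
        max_eq_left (D.clock_mem_Icc A hz hτ').1]
  rw [D.lintegral_levels A F.measurable_foot F.plan hG]
  refine setLIntegral_congr_fun (D.measurableSet_band T) fun x hx => ?_
  have hπx := A.foot_mem x (Or.inr hx)
  have hwx : w x ∈ Icc 0 T := ⟨hx.1.le, hx.2.le⟩
  have hg0 : 0 < ‖gradient w x‖ := norm_pos_iff.2 (D.gradient_ne_zero hx)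
  simp only
  rw [F.path_apply _ hwx _ hπx, NNReal.coe_zero, sub_zero,
    max_eq_left (D.clock_mem_Icc A hπx hwx).1, A.flow_foot x (Or.inr hx), ← ofReal_norm,
    ENNReal.div_eq_inv_mul, ← mul_assoc, ← ENNReal.ofReal_inv_of_pos hg0, ← ENNReal.ofReal_mul
    (add_nonneg zero_le_one (mul_nonneg D.γ_pos.le hg0.le))]
  congr 2
  field_simp

end ClassicalData

end Cascade

namespace Cascade
variable {d : ℕ} {γ T κ : ℝ} {Γ : Set (Sp d)} {V₀ w u L : Sp d → ℝ}

/-! ### The running cost -/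

/-- The running cost: the speed of `w` in the band, a large constant on the boundary of the band, and
`-1/γ` elsewhere. -/
structure IsCostField (γ T : ℝ) (w L : Sp d → ℝ) : Prop where
  on_band : ∀ x ∈ band w T, L x = ‖gradient w x‖
  pos : ∀ x ∈ closure (band w T), 0 < L x
  off : ∀ x ∉ closure (band w T), L x = -(1 / γ)
  upperSemicontinuous : UpperSemicontinuous L
  locallyIntegrable : LocallyIntegrable L volume

lemma IsCostField.measurable (hL : IsCostField γ T w L) : Measurable L :=
  hL.upperSemicontinuous.measurable

namespace ClassicalData

variable (D : ClassicalData d γ T Γ V₀ w u) {Y : Sp d → ℝ → Sp d} {ρ : ℝ → Sp d → ℝ}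
  {π : Sp d → Sp d} (A : IsAscentFlow Γ T w Y ρ π)

include D

/-- The values -1/γ off the closed band annihilate 1 + γ L there. The rest of the closed band is
null and its values only have to be positive, locally bounded and large enough for upper
semicontinuity; the local upper bounds on |∇w| allow this. -/
theorem exists_costField : ∃ L, IsCostField γ T w L := by
  classical
  have hγ := D.γ_pos
  have hγ' : 0 < 1 / γ := by positivity
  choose c hc using fun n : ℕ => D.grad_upper (n : ℝ)
  let C : ℕ → ℝ := fun n => 1 + ∑ i ∈ Finset.range (n + 1), |c i|
  have hC1 : ∀ n, 1 ≤ C n := fun n => le_add_of_nonneg_right (Finset.sum_nonneg fun i _ => abs_nonneg _)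
  have hCm : Monotone C := fun m n hmn => add_le_add_right
    (Finset.sum_le_sum_of_subset_of_nonneg (Finset.range_mono (by lia)) fun i _ _ => abs_nonneg _) _
  have hCb : ∀ n : ℕ, ∀ x ∈ band w T, ‖x‖ ≤ n → ‖gradient w x‖ ≤ C n := fun n x hx hn => by
    have h1 := Finset.single_le_sum (f := fun i => |c i|) (fun i _ => abs_nonneg _)
      (Finset.mem_range.2 (Nat.lt_succ_self n))
    linarith [hc n x hx hn, le_abs_self (c n)]
  -- Points of norm below ⌊‖x‖⌋ + 1 form a neighbourhood of x on which L is at most C (⌊‖x‖⌋ + 2),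
  -- hence the shift by two.
  let M : Sp d → ℝ := fun x => C (⌊‖x‖⌋₊ + 2)
  let L : Sp d → ℝ := fun x => if x ∈ band w T then ‖gradient w x‖ else
    if x ∈ closure (band w T) then M x else -(1 / γ)
  have hLb : ∀ x ∈ band w T, L x = ‖gradient w x‖ := fun x hx => if_pos hx
  have hLo : ∀ x ∉ closure (band w T), L x = -(1 / γ) := fun x hx => by
    simp only [L]
    rw [if_neg fun h => hx (subset_closure h), if_neg hx]
  have hLc : ∀ x ∈ closure (band w T), x ∉ band w T → L x = M x := fun x hx hx2 => by
    simp only [L]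
    rw [if_neg hx2, if_pos hx]
  have hle : ∀ n : ℕ, ∀ x : Sp d, ‖x‖ < n → L x ≤ C (n + 1) := by
    intro n x hx
    by_cases h1 : x ∈ band w T
    · rw [hLb x h1]
      exact (hCb n x h1 hx.le).trans (hCm (by lia))
    · by_cases h2 : x ∈ closure (band w T)
      · rw [hLc x h2 h1]
        refine hCm ?_
        have := (Nat.floor_lt (norm_nonneg x)).2 hx
        lia
      · rw [hLo x h2]
        linarith [hC1 (n + 1)]
  have hge : ∀ x, -(1 / γ) ≤ L x := by
    intro x
    by_cases h1 : x ∈ band w T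
    · rw [hLb x h1]; linarith [norm_nonneg (gradient w x)]
    · by_cases h2 : x ∈ closure (band w T)
      · rw [hLc x h2 h1]; linarith [hC1 (⌊‖x‖⌋₊ + 2)]
      · rw [hLo x h2]
  have husc : UpperSemicontinuous L := by
    intro x
    by_cases h1 : x ∈ band w T
    · have hcont : ContinuousAt L x :=
        ((D.continuousOn_gradient.norm).continuousAt (D.isOpen_band.mem_nhds h1)).congr
          (by filter_upwards [D.isOpen_band.mem_nhds h1] with y hy using (hLb y hy).symm)
      exact hcont.upperSemicontinuousAt
    · by_cases h2 : x ∈ closure (band w T)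
      · intro b hb
        have hx : ‖x‖ < (⌊‖x‖⌋₊ + 1 : ℕ) := by exact_mod_cast Nat.lt_floor_add_one ‖x‖
        filter_upwards [(isOpen_lt continuous_norm continuous_const).mem_nhds hx] with y hy
        refine (hle _ y hy).trans_lt ?_
        rw [hLc x h2 h1] at hb
        exact hb
      · have hcont : ContinuousAt L x := (continuousAt_const (y := -(1 / γ))).congr (by
          filter_upwards [isClosed_closure.isOpen_compl.mem_nhds h2] with y hy using (hLo y hy).symm)
        exact hcont.upperSemicontinuousAt
  refine ⟨L, hLb, fun x hx => ?_, hLo, husc, ?_⟩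
  · by_cases h1 : x ∈ band w T
    · rw [hLb x h1]
      exact norm_pos_iff.2 (D.gradient_ne_zero h1)
    · rw [hLc x hx h1]
      linarith [hC1 (⌊‖x‖⌋₊ + 2)]
  · intro x
    obtain ⟨n, hn⟩ := exists_nat_gt (‖x‖ + 1)
    refine ⟨Metric.ball x 1, Metric.ball_mem_nhds x one_pos, ?_⟩
    refine IntegrableOn.of_bound measure_ball_lt_top husc.measurable.aestronglyMeasurable
      (C (n + 1) + 1 / γ) ?_
    filter_upwards [ae_restrict_mem measurableSet_ball] with y hy
    have h1 : ‖y‖ < n := by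
      have := norm_le_norm_add_norm_sub' y x
      rw [mem_ball_iff_norm] at hy
      linarith
    rw [Real.norm_eq_abs, abs_le]
    constructor
    · linarith [hge y, hC1 (n + 1)]
    · linarith [hle n y h1]

variable (hL : IsCostField γ T w L)
include A hL

omit A D in
lemma _root_.Cascade.IsCostField.ofReal_posPart {x : Sp d} (hx : x ∈ band w T) : ENNReal.ofReal (L x)⁺ = ‖gradient w x‖ₑ := by
  rw [hL.on_band x hx, posPart_eq_self.2 (norm_nonneg _), ofReal_norm]

variable {N : Measure (Sp d)} {m : Measure (Sp d × ℝ × ℝ)} {Ψ : ℝ × Sp d → Path Γ}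
  {Q : ProbabilityMeasure (Path Γ × ℝ≥0)} (F : IsFlowLaw Γ γ T V₀ w u Y ρ π N m Ψ κ Q)
include F

/-- The remaining cost along a flow line is the level. -/
lemma cost_flowPair {z : Sp d} (hz : z ∈ frontier Γ) {a : ℝ} (ha : a ∈ Icc 0 T) (b : ℝ) {r : ℝ≥0}
    (hr : (r : ℝ) ≤ ρ a z) :
    cost L (flowPair Ψ (z, a, b)).1 r = ENNReal.ofReal (w (Y z (ρ a z - r))) := by
  have ma := D.clock_mem_Icc A hz ha
  have hr0 : ρ a z - r ∈ Icc 0 (ρ T z) := ⟨by linarith, by linarith [r.2, ma.2]⟩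
  have hc := A.clock_w z hz _ hr0
  have hw := D.w_curve_mem A hz hr0
  have e := D.lintegral_flowLine A hz hw ⟨le_rfl, D.T_pos.le⟩ fun _ => 1
  rw [setLIntegral_one, Real.volume_Ioo, sub_zero] at e
  rw [← e, A.clock_zero z hz, hc, sub_zero, cost]
  have hh : ((flowPair Ψ (z, a, b)).1.hit : ℝ) = ρ a z := F.hit_path a ha z hz
  rw [hh, setLIntegral_congr Ioo_ae_eq_Ioc.symm, ← lintegral_indicator measurableSet_Ioo,
    ← lintegral_indicator measurableSet_Ioo, ← lintegral_add_right_eq_self _ (r : ℝ)]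
  refine lintegral_congr fun s => ?_
  have hiff : s + r ∈ Ioo (r : ℝ) (ρ a z) ↔ s ∈ Ioo 0 (ρ a z - r) := by
    simp only [mem_Ioo]
    constructor <;> rintro ⟨h1, h2⟩ <;> constructor <;> linarith
  by_cases hs : s ∈ Ioo 0 (ρ a z - r)
  · rw [indicator_of_mem (hiff.2 hs), indicator_of_mem hs, mul_one,
      flowPair_fst_apply F hz ha b ⟨by linarith [hs.1, r.2], by linarith [hs.2]⟩,
      show ρ a z - (s + r) = ρ a z - r - s by ring]
    exact hL.ofReal_posPart (A.curve_mem_band z hz _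
      ⟨by linarith [hs.2], by linarith [hs.1, hr0.2]⟩)
  · rw [indicator_of_notMem (fun h => hs (hiff.1 h)), indicator_of_notMem hs]

omit D A F in
lemma measurable_cost : Measurable fun p : Path Γ × ℝ≥0 => cost L p.1 p.2 := by
  have hJ : MeasurableSet {q : (Path Γ × ℝ≥0) × ℝ | (q.1.2 : ℝ) < q.2 ∧ q.2 ≤ q.1.1.hit} :=
    (measurableSet_lt (f := fun q : (Path Γ × ℝ≥0) × ℝ => (q.1.2 : ℝ)) (by fun_prop)
      measurable_snd).inter (measurableSet_le measurable_snd
      (show Measurable fun q : (Path Γ × ℝ≥0) × ℝ => (q.1.1.hit : ℝ) from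
        measurable_coe_nnreal_real.comp (Path.measurable_hit.comp
        (measurable_fst.comp measurable_fst))))
  have h1 : Measurable ({q : (Path Γ × ℝ≥0) × ℝ | (q.1.2 : ℝ) < q.2 ∧ q.2 ≤ q.1.1.hit}.indicator
      fun q => ENNReal.ofReal (L (q.1.1.pos q.2))⁺) := by
    refine Measurable.indicator ?_ hJ
    refine ENNReal.measurable_ofReal.comp (Measurable.max (hL.measurable.comp
      (Path.measurable_pos.comp ((measurable_fst.comp measurable_fst).prodMk measurable_snd)))
      measurable_const)
  convert h1.lintegral_prod_right' (ν := (volume : Measure ℝ)) using 2 with q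
  rw [cost, ← lintegral_indicator measurableSet_Ioc]
  rfl

lemma ae_capped : ∀ᵐ p ∂(Q : Measure (Path Γ × ℝ≥0)),
    cost L p.1 0 ≤ ENNReal.ofReal T ∧ p.2 ≤ p.1.hit := by
  have m1 : MeasurableSet {p : Path Γ × ℝ≥0 | cost L p.1 0 ≤ ENNReal.ofReal T} :=
    measurableSet_le ((measurable_cost hL).comp (measurable_fst.prodMk measurable_const))
      measurable_const
  have m2 : MeasurableSet {p : Path Γ × ℝ≥0 | p.2 ≤ p.1.hit} :=
    measurableSet_le measurable_snd (Path.measurable_hit.comp measurable_fst)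
  refine ae_law F (m1.inter m2) fun z hz a ha b hb hba => ⟨?_, tsub_le_self⟩
  have ma := D.clock_mem_Icc A hz ha
  rw [D.cost_flowPair A hL F hz ha b (by simpa using ma.1)]
  refine ENNReal.ofReal_le_ofReal ?_
  rw [NNReal.coe_zero, sub_zero, A.w_curve z hz a ha]
  exact ha.2

omit hL in
lemma ae_terminal : ∀ᵐ p ∂(Q : Measure (Path Γ × ℝ≥0)),
    p.2 = p.1.hit → p.1.toFun p.1.hit ∈ essBoundary Γ := by
  rw [← D.Γ_bdry]
  have hm : Measurable fun p : Path Γ × ℝ≥0 => p.1.toFun p.1.hit :=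
    Path.measurable_uncurry.comp (measurable_fst.prodMk (Path.measurable_hit.comp measurable_fst))
  have h : ∀ᵐ p ∂(Q : Measure (Path Γ × ℝ≥0)), p.1.toFun p.1.hit ∈ frontier Γ := by
    refine ae_law F (hm isClosed_frontier.measurableSet) fun z hz a ha b hb hba => ?_
    rw [flowPair, F.path_apply a ha z hz, F.hit_path a ha z hz, sub_self, max_self,
      A.curve_zero z hz]
    exact hz
  filter_upwards [h] with p hp _ using hp

lemma lintegral_negPart {φ : Sp d → ℝ} (hφ : Measurable φ) :
    ∫⁻ p, (∫⁻ r in Ioc (0 : ℝ) p.2, ENNReal.ofReal (|φ (p.1.pos r)| * (L (p.1.pos r))⁻))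
      ∂(Q : Measure (Path Γ × ℝ≥0)) = 0 := by
  have hf : Measurable fun x => ENNReal.ofReal (|φ x| * (L x)⁻) :=
    ENNReal.measurable_ofReal.comp ((hφ.norm).mul ((hL.measurable.neg).max measurable_const))
  have h := D.lintegral_occupation A F hf
  have h2 : ∫⁻ x in band w T, ENNReal.ofReal (1 / ‖gradient w x‖ + γ)
      * ENNReal.ofReal (|φ x| * (L x)⁻) = 0 := by
    rw [← lintegral_zero (μ := volume.restrict (band w T))]
    refine setLIntegral_congr_fun (D.measurableSet_band T) fun x hx => ?_
    rw [hL.on_band x hx, negPart_eq_zero.2 (norm_nonneg _), mul_zero, ENNReal.ofReal_zero, mul_zero]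
  rw [h2, mul_eq_zero] at h
  rw [← h.resolve_left (by simpa using F.kappa_pos)]
  exact lintegral_congr fun q => setLIntegral_congr Ioc_ae_eq_Icc

end ClassicalData

end Cascade

namespace Cascade
variable {d : ℕ} {γ T κ : ℝ} {Γ : Set (Sp d)} {V₀ w u L : Sp d → ℝ}

/-! ### Occupation measures -/

/-- The expected occupation measure of the paths before they are killed. -/
noncomputable def flowOccupation (Q : ProbabilityMeasure (Path Γ × ℝ≥0)) : Measure (Sp d) :=
  (((Q : Measure (Path Γ × ℝ≥0)).prod (volume : Measure ℝ)).restrict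
    {q | 0 ≤ q.2 ∧ q.2 ≤ q.1.2}).map fun q => q.1.1.pos q.2

lemma measurable_pos_fst : Measurable fun q : (Path Γ × ℝ≥0) × ℝ => q.1.1.pos q.2 :=
  Path.measurable_pos.comp ((measurable_fst.comp measurable_fst).prodMk measurable_snd)

lemma lintegral_flowOccupation (Q : ProbabilityMeasure (Path Γ × ℝ≥0)) {f : Sp d → ℝ≥0∞}
    (hf : Measurable f) : ∫⁻ x, f x ∂flowOccupation Q
      = ∫⁻ q, (∫⁻ r in Icc (0 : ℝ) q.2, f (q.1.pos r)) ∂(Q : Measure (Path Γ × ℝ≥0)) := by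
  rw [flowOccupation, lintegral_map hf measurable_pos_fst, ← lintegral_indicator measurableSet_alive,
    lintegral_prod _ ((show Measurable fun q : (Path Γ × ℝ≥0) × ℝ => f (q.1.1.pos q.2) from
      hf.comp measurable_pos_fst).indicator measurableSet_alive).aemeasurable]
  refine lintegral_congr fun q => ?_
  rw [← lintegral_indicator measurableSet_Icc]
  rfl

namespace ClassicalData

variable (D : ClassicalData d γ T Γ V₀ w u) {Y : Sp d → ℝ → Sp d} {ρ : ℝ → Sp d → ℝ}
  {π : Sp d → Sp d} (A : IsAscentFlow Γ T w Y ρ π)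
  {N : Measure (Sp d)} {m : Measure (Sp d × ℝ × ℝ)} {Ψ : ℝ × Sp d → Path Γ}
  {Q : ProbabilityMeasure (Path Γ × ℝ≥0)} (F : IsFlowLaw Γ γ T V₀ w u Y ρ π N m Ψ κ Q)

omit A F in
include D in
/-- The closure of the band exceeds the band by a null set. -/
lemma ae_mem_closure_band_iff : ∀ᵐ x : Sp d, x ∈ closure (band w T) ↔ x ∈ band w T := by
  have h1 : ∀ᵐ x : Sp d, x ∉ frontier {x | w x < T} := measure_eq_zero_iff_ae_notMem.1 D.null
  have h2 : ∀ᵐ x : Sp d, x ∉ frontier Γ := measure_eq_zero_iff_ae_notMem.1 D.volume_frontier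
  filter_upwards [h1, h2] with x hx1 hx2
  refine ⟨fun h => ?_, fun h => subset_closure h⟩
  by_contra hb
  have hwT : ¬ w x < T ∨ x ∈ closure Γ := by
    by_contra hc
    push Not at hc
    exact hb (D.mem_band_iff.2 ⟨hc.2, hc.1⟩)
  rcases hwT with hw | hw
  · exact hx1 ⟨closure_mono (fun y hy => hy.2) h, fun hi =>
      hw (show x ∈ {x | w x < T} from interior_subset hi)⟩
  · have hi : x ∈ interior Γ := by
      by_contra hi
      exact hx2 ⟨hw, hi⟩
    obtain ⟨y, hy1, hy2⟩ := mem_closure_iff.1 h _ isOpen_interior hi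
    exact (D.mem_band_iff.1 hy2).1 (subset_closure (interior_subset hy1))

include D A F

theorem smul_flowOccupation : ENNReal.ofReal κ • flowOccupation Q
    = (volume.restrict (band w T)).withDensity
        fun x => ENNReal.ofReal (1 / ‖gradient w x‖ + γ) := by
  have hg : Measurable fun x => ‖gradient w x‖ := measurable_gradient.norm
  refine Measure.ext_of_lintegral _ fun f hf => ?_
  rw [lintegral_smul_measure, smul_eq_mul, lintegral_flowOccupation Q hf,
    D.lintegral_occupation A F hf, lintegral_withDensity_eq_lintegral_mul _ (by fun_prop) hf]
  rfl

/-- In the band (1/|∇w| + γ) L = 1 + γ L since L = |∇w|; elsewhere 1 + γ L vanishes almost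
everywhere. -/
theorem fixedPoint (hL : IsCostField γ T w L) {φ : Sp d → ℝ} (hφ : Continuous φ)
    (hφs : HasCompactSupport φ) :
    κ * ∫ p, (∫ r in (0 : ℝ)..p.2, φ (p.1.pos r) * (L (p.1.pos r))⁺)
        ∂(Q : Measure (Path Γ × ℝ≥0)) = ∫ x, φ x * (1 + γ * L x) := by
  have hg : Measurable fun x => ‖gradient w x‖ := measurable_gradient.norm
  have hLm := hL.measurable
  set ψ : Sp d → ℝ := fun x => φ x * (L x)⁺ with hψ
  have hψm : Measurable ψ := hφ.measurable.mul (hLm.max measurable_const)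
  have hκ : ENNReal.ofReal κ ≠ 0 := by simpa using F.kappa_pos
  have hdens : ∀ x ∈ band w T, (ENNReal.ofReal (1 / ‖gradient w x‖ + γ)).toReal • ψ x
      = φ x * (1 + γ * L x) := by
    intro x hx
    have hg0 : 0 < ‖gradient w x‖ := norm_pos_iff.2 (D.gradient_ne_zero hx)
    have hγ := D.γ_pos
    simp only [hψ]
    rw [ENNReal.toReal_ofReal (by positivity), hL.on_band x hx, posPart_eq_self.2 hg0.le,
      smul_eq_mul]
    field_simp
  have hint : Integrable ψ (flowOccupation Q) := by
    have h1 : Integrable ψ (ENNReal.ofReal κ • flowOccupation Q) := by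
      rw [D.smul_flowOccupation A F, integrable_withDensity_iff_integrable_smul' (by fun_prop)
        (by simp)]
      refine IntegrableOn.congr_fun ?_ (fun x hx => (hdens x hx).symm) (D.measurableSet_band T)
      obtain ⟨R, hR⟩ := hφs.isBounded.subset_closedBall 0
      refine Integrable.integrableOn ?_
      have hli : LocallyIntegrable (fun x => 1 + γ * L x) volume :=
        (locallyIntegrable_const 1).add (hL.locallyIntegrable.smul γ)
      exact (hli.integrable_smul_left_of_hasCompactSupport hφ hφs)
    exact (integrable_smul_measure hκ ENNReal.ofReal_ne_top).1 h1
  have e1 : ∫ p, (∫ r in (0 : ℝ)..p.2, ψ (p.1.pos r)) ∂(Q : Measure (Path Γ × ℝ≥0))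
      = ∫ x, ψ x ∂flowOccupation Q := by
    have h1 := (integrable_map_measure hψm.aestronglyMeasurable measurable_pos_fst.aemeasurable).1 hint
    rw [flowOccupation, integral_map measurable_pos_fst.aemeasurable hψm.aestronglyMeasurable,
      ← integral_indicator measurableSet_alive, integral_prod]
    · refine integral_congr_ae (Eventually.of_forall fun p => ?_)
      simp only
      rw [intervalIntegral.integral_of_le (NNReal.coe_nonneg p.2), ← integral_Icc_eq_integral_Ioc,
        ← integral_indicator measurableSet_Icc]
      rfl
    · exact (integrable_indicator_iff measurableSet_alive).2 h1
  have e2 : κ * ∫ x, ψ x ∂flowOccupation Q = ∫ x in band w T, φ x * (1 + γ * L x) := by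
    have h1 := integral_smul_measure (μ := flowOccupation Q) ψ (ENNReal.ofReal κ)
    rw [D.smul_flowOccupation A F, integral_withDensity_eq_integral_toReal_smul (by fun_prop)
      (by simp), ENNReal.toReal_ofReal F.kappa_pos.le, smul_eq_mul] at h1
    rw [← h1]
    exact setIntegral_congr_fun (D.measurableSet_band T) fun x hx => hdens x hx
  rw [e1, e2]
  refine setIntegral_eq_integral_of_ae_compl_eq_zero ?_
  filter_upwards [D.ae_mem_closure_band_iff] with x hx hxb
  rw [hL.off x (fun h => hxb (hx.1 h))]
  have := D.γ_pos
  field_simp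
  ring

omit D A F in
/-- The remaining cost is lower semicontinuous from the right in time. -/
lemma _root_.Cascade.le_cost_of_forall_gt {y : Path Γ} {r : ℝ≥0} {t : ℝ≥0∞}
    (h : ∀ s > r, cost L y s ≤ t) : cost L y r ≤ t := by
  obtain ⟨s, hs1, hs2, hs3⟩ := exists_seq_strictAnti_tendsto r
  have hU : Ioc (r : ℝ) y.hit = ⋃ n, Ioc (s n : ℝ) y.hit := by
    ext q
    simp only [mem_iUnion, mem_Ioc]
    constructor
    · rintro ⟨h1, h2⟩
      have h3 : Tendsto (fun n => (s n : ℝ)) atTop (𝓝 r) := NNReal.tendsto_coe.2 hs3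
      exact ((h3.eventually_lt_const h1).exists).imp fun n hn => ⟨hn, h2⟩
    · rintro ⟨n, h1, h2⟩
      exact ⟨lt_trans (by exact_mod_cast hs2 n) h1, h2⟩
  have hmeas : ∀ r : ℝ, (volume.withDensity fun z => ENNReal.ofReal (L (y.pos z))⁺) (Ioc r y.hit)
      = ∫⁻ z in Ioc r y.hit, ENNReal.ofReal (L (y.pos z))⁺ := fun r =>
    withDensity_apply _ measurableSet_Ioc
  rw [cost, ← hmeas, hU]
  refine le_of_tendsto' (tendsto_measure_iUnion_atTop fun m n hmn =>
    Ioc_subset_Ioc_left (by exact_mod_cast hs1.antitone hmn)) fun n => ?_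
  rw [Function.comp_apply, hmeas]
  exact h _ (hs2 n)

omit D A F in
lemma _root_.Cascade.antitone_cost (y : Path Γ) : Antitone (cost L y) := fun r s hrs =>
  lintegral_mono_set (Ioc_subset_Ioc_left (by exact_mod_cast hrs))

omit D A F in
-- Costs below t at all later times give in the limit only cost ≤ t at r; the case of equality is
-- excluded by hypothesis and occurs at almost no time along the flow.
lemma _root_.Cascade.levelTime_le_iff {y : Path Γ} {r t : ℝ≥0} (hr : r ≤ y.hit)
    (ht : cost L y r ≠ t) : levelTime L t y ≤ r ↔ cost L y r < t := by
  refine ⟨fun h => lt_of_le_of_ne (le_cost_of_forall_gt fun s hs => ?_) ht, fun h =>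
    iInf₂_le r ⟨hr, h⟩⟩
  have h2 : levelTime L t y < s := lt_of_le_of_lt h (by exact_mod_cast hs)
  rw [levelTime, iInf_lt_iff] at h2
  obtain ⟨q, hq⟩ := h2
  rw [iInf_lt_iff] at hq
  obtain ⟨⟨-, hq1⟩, hq2⟩ := hq
  exact (antitone_cost y (le_of_lt (by exact_mod_cast hq2))).trans hq1.le

variable (hL : IsCostField γ T w L)
include hL

/-- Along almost every path the remaining cost is the level. -/
lemma ae_cost_eq (t : ℝ≥0) : ∀ᵐ q ∂(Q : Measure (Path Γ × ℝ≥0)).prod (volume : Measure ℝ),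
    0 ≤ q.2 ∧ q.2 ≤ q.1.2 → q.2 ≤ q.1.1.hit ∧
      cost L q.1.1 q.2.toNNReal = ENNReal.ofReal (w (q.1.1.pos q.2)) ∧
      ENNReal.ofReal (w (q.1.1.pos q.2)) ≠ t := by
  have hmw : Measurable fun q : (Path Γ × ℝ≥0) × ℝ => ENNReal.ofReal (w (q.1.1.pos q.2)) :=
    (D.measw.comp measurable_pos_fst).ennreal_ofReal
  have m1 : MeasurableSet {q : (Path Γ × ℝ≥0) × ℝ | q.2 ≤ q.1.1.hit} :=
    measurableSet_le measurable_snd (measurable_coe_nnreal_real.comp (Path.measurable_hit.comp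
      (measurable_fst.comp measurable_fst)))
  have m2 : MeasurableSet {q : (Path Γ × ℝ≥0) × ℝ |
      cost L q.1.1 q.2.toNNReal = ENNReal.ofReal (w (q.1.1.pos q.2))} :=
    measurableSet_eq_fun ((measurable_cost hL).comp
      ((measurable_fst.comp measurable_fst).prodMk measurable_snd.real_toNNReal)) hmw
  have m3 : MeasurableSet {q : (Path Γ × ℝ≥0) × ℝ | ENNReal.ofReal (w (q.1.1.pos q.2)) ≠ t} :=
    (hmw (measurableSet_singleton (t : ℝ≥0∞))).compl
  have hm := (measurableSet_alive (Γ := Γ)).compl.union (m1.inter (m2.inter m3))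
  refine ae_law_prod F (hm.congr (by ext q; simp [imp_iff_not_or])) fun z hz a ha b hb hba => ?_
  have mb := D.clock_mem_Icc A hz hb
  have ma := D.clock_mem_Icc A hz ha
  -- The level is strictly monotone along a flow line, so level t is met at one time at most.
  have hnull : ∀ᵐ r : ℝ, r ≠ ρ a z - ρ (t : ℝ) z := by
    rw [ae_iff]; simp
  filter_upwards [hnull] with r hr ⟨h0, h1⟩
  rw [flowPair_snd A F hz ha hb hba] at h1
  have h2 : r ≤ ρ a z := by linarith [mb.1]
  have hmem : ρ a z - r ∈ Icc 0 (ρ T z) := ⟨by linarith, by linarith [ma.2]⟩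
  refine ⟨?_, ?_, ?_⟩
  · rw [show ((flowPair Ψ (z, a, b)).1.hit : ℝ) = ρ a z from F.hit_path a ha z hz]
    exact h2
  · rw [D.cost_flowPair A hL F hz ha b (by rwa [Real.coe_toNNReal _ h0]),
      flowPair_fst_apply F hz ha b ⟨h0, h2⟩, Real.coe_toNNReal _ h0]
  · rw [flowPair_fst_apply F hz ha b ⟨h0, h2⟩]
    intro h
    have h3 : w (Y z (ρ a z - r)) = t := by
      have := congrArg ENNReal.toReal h
      rwa [ENNReal.toReal_ofReal (D.w_nonneg _)] at this
    have h4 := A.clock_w z hz _ hmem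
    rw [h3] at h4
    exact hr (by linarith)

/-- The remaining cost is the level, so being past ι(t) amounts to being below level t, up to a null
set of times. -/
theorem occupation_eq (t : ℝ≥0) :
    occupation Q L t = (flowOccupation Q).restrict {x | ENNReal.ofReal (w x) < t} := by
  have hms : MeasurableSet {x | ENNReal.ofReal (w x) < t} :=
    measurableSet_lt D.measw.ennreal_ofReal measurable_const
  rw [flowOccupation, Measure.restrict_map measurable_pos_fst hms, Measure.restrict_restrict
    (measurable_pos_fst hms), occupation]
  congr 1
  refine Measure.restrict_congr_set ?_
  filter_upwards [D.ae_cost_eq A F hL t] with q hq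
  refine propext ⟨fun h => ⟨?_, h.2⟩, fun h => ⟨?_, h.2⟩⟩
  · obtain ⟨h1, h2, h3⟩ := hq h.2
    have h4 : q.2.toNNReal ≤ q.1.1.hit := by
      rw [← NNReal.coe_le_coe, Real.coe_toNNReal _ h.2.1]; exact h1
    show ENNReal.ofReal (w (q.1.1.pos q.2)) < t
    rw [← h2]
    exact (levelTime_le_iff h4 (by rw [h2]; exact h3)).1 h.1
  · obtain ⟨h1, h2, h3⟩ := hq h.2
    have h4 : q.2.toNNReal ≤ q.1.1.hit := by
      rw [← NNReal.coe_le_coe, Real.coe_toNNReal _ h.2.1]; exact h1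
    refine (levelTime_le_iff h4 (by rw [h2]; exact h3)).2 ?_
    rw [h2]
    exact h.1

end ClassicalData

end Cascade

namespace Cascade
variable {d : ℕ} {γ T κ : ℝ} {Γ : Set (Sp d)} {V₀ w u L : Sp d → ℝ}

/-! ### Aggregates and arrival times -/

lemma arrivalTime_le {Q : ProbabilityMeasure (Path Γ × ℝ≥0)} {x : Sp d} {t : ℝ≥0}
    (h : x ∈ aggregate Q L t) : arrivalTime Q L x ≤ t :=
  iInf₂_le (f := fun (t : ℝ≥0) (_ : x ∈ aggregate Q L t) => (t : ℝ≥0∞)) t h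

namespace ClassicalData

variable (D : ClassicalData d γ T Γ V₀ w u) {Y : Sp d → ℝ → Sp d} {ρ : ℝ → Sp d → ℝ}
  {π : Sp d → Sp d} (A : IsAscentFlow Γ T w Y ρ π)
  {N : Measure (Sp d)} {m : Measure (Sp d × ℝ × ℝ)} {Ψ : ℝ × Sp d → Path Γ}
  {Q : ProbabilityMeasure (Path Γ × ℝ≥0)} (F : IsFlowLaw Γ γ T V₀ w u Y ρ π N m Ψ κ Q)
  (hL : IsCostField γ T w L)

section

include D

lemma isOpen_band_min (t : ℝ) : IsOpen (band w (min t T)) := D.isOpen_band' (min_le_right _ _)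

/-- Clear inside Γ and in the band; at points of ∂Γ this is the absence of contact with the
unreached set. -/
lemma isOpen_lt_level : IsOpen {x | w x < T} := by
  rw [isOpen_iff_mem_nhds]
  intro x hx
  by_cases h0 : x ∈ closure Γ
  · by_cases hi : x ∈ interior Γ
    · filter_upwards [isOpen_interior.mem_nhds hi] with y hy
      show w y < T
      rw [D.w_eq_zero_iff.2 (subset_closure (interior_subset hy))]
      exact D.T_pos
    · have h1 : x ∉ closure {x | T ≤ w x} := fun h => by
        have : x ∈ frontier Γ ∩ closure {x | T ≤ w x} := ⟨⟨h0, hi⟩, h⟩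
        rw [D.disjoint_frontier_closure_unreached] at this
        exact this
      filter_upwards [isClosed_closure.isOpen_compl.mem_nhds h1] with y hy
      exact not_le.1 fun h => hy (subset_closure h)
  · filter_upwards [D.isOpen_band.mem_nhds (D.mem_band_iff.2 ⟨h0, hx⟩)] with y hy using hy.2

/-- A point is in the closure of the inner band as soon as its level is smaller. -/
lemma mem_closure_band_of_lt {x : Sp d} (hx : x ∈ closure (band w T)) {t : ℝ} (ht : w x < t) :
    x ∈ closure (band w (min t T)) := by
  rcases lt_or_ge t T with htT | htT
  · rw [min_eq_left htT.le]
    have h1 := D.continuousOn x hx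
    have h2 : ∀ᶠ y in 𝓝[band w T] x, w y < t :=
      (h1.mono_left (nhdsWithin_mono _ subset_closure)).eventually_lt_const ht
    rw [mem_closure_iff_frequently]
    rw [mem_closure_iff_clusterPt, ClusterPt, ← nhdsWithin] at hx
    rw [eventually_nhdsWithin_iff] at h2
    refine ((frequently_mem_iff_neBot.2 hx).and_eventually h2).mono fun y hy => ⟨hy.1.1, hy.2 hy.1⟩
  · rwa [min_eq_right htT]

lemma mem_closure_lt_level {x : Sp d} (hx : x ∈ closure {x | w x < T}) :
    x ∈ closure Γ ∨ x ∈ closure (band w T) := by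
  have : {x | w x < T} ⊆ closure Γ ∪ band w T := fun y hy => by
    by_cases h : y ∈ closure Γ
    · exact Or.inl h
    · exact Or.inr (D.mem_band_iff.2 ⟨h, hy⟩)
  have h2 := closure_mono this hx
  rwa [closure_union, closure_closure] at h2

end

section

include D A in
lemma frontier_subset_closure_band : frontier Γ ⊆ closure (band w T) := fun z hz => by
  have h := A.curve_mem_closure z hz 0 ⟨le_rfl, (D.clock_pos A hz).le⟩
  rwa [A.curve_zero z hz] at h

include D A F hL

/-- The occupation has a strictly positive density on the open set {0 < w < min(t, T)} and no mass
elsewhere. -/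
theorem support_occupation (t : ℝ≥0) :
    (occupation Q L t).support = closure (band w (min t T)) := by
  have hκ : ENNReal.ofReal κ ≠ 0 := by simpa using F.kappa_pos
  have hms : MeasurableSet {x | ENNReal.ofReal (w x) < t} :=
    measurableSet_lt D.measw.ennreal_ofReal measurable_const
  have hset : ∀ x, x ∈ band w T → (ENNReal.ofReal (w x) < t ↔ x ∈ band w (min t T)) := fun x hx => by
    rw [ENNReal.ofReal_lt_coe_iff (D.w_nonneg x)]
    exact ⟨fun h => ⟨hx.1, lt_min h hx.2⟩, fun h => h.2.trans_le (min_le_left _ _)⟩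
  have hocc : ∀ U, MeasurableSet U → ENNReal.ofReal κ * occupation Q L t U
      = ∫⁻ x in U ∩ band w (min t T), ENNReal.ofReal (1 / ‖gradient w x‖ + γ) := by
    intro U hU
    rw [D.occupation_eq A F hL, Measure.restrict_apply hU, ← smul_eq_mul, ← Measure.smul_apply,
      D.smul_flowOccupation A F, withDensity_apply _ (hU.inter hms),
      Measure.restrict_restrict (hU.inter hms)]
    congr 2
    ext x
    constructor
    · rintro ⟨⟨h1, h2⟩, h3⟩
      exact ⟨h1, (hset x h3).1 h2⟩
    · rintro ⟨h1, h2⟩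
      have h3 := band_mono w (min_le_right (t : ℝ) T) h2
      exact ⟨⟨h1, (hset x h3).2 h2⟩, h3⟩
  apply Subset.antisymm
  · refine Measure.support_subset_of_isClosed isClosed_closure ?_
    have h := hocc (closure (band w (min t T)))ᶜ isClosed_closure.measurableSet.compl
    rw [show (closure (band w (min t T)))ᶜ ∩ band w (min t T) = ∅ from
      eq_empty_of_forall_notMem fun x hx => hx.1 (subset_closure hx.2)] at h
    rw [Measure.restrict_empty, lintegral_zero_measure, mul_eq_zero] at h
    exact h.resolve_left hκ
  · intro x hx
    rw [Measure.mem_support_iff_forall]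
    intro U hU
    obtain ⟨O, hOU, hO, hxO⟩ := mem_nhds_iff.1 hU
    refine lt_of_lt_of_le ?_ (measure_mono hOU)
    rw [pos_iff_ne_zero]
    intro h0
    have h := hocc O hO.measurableSet
    have hmeas : Measurable fun x => ENNReal.ofReal (1 / ‖gradient w x‖ + γ) := by
      have hg : Measurable fun x => ‖gradient w x‖ := measurable_gradient.norm
      fun_prop
    rw [h0, mul_zero, eq_comm, lintegral_eq_zero_iff hmeas] at h
    have hpos : volume (O ∩ band w (min t T)) = 0 := by
      rw [← Measure.restrict_apply_univ]
      refine measure_mono_null (fun x _ => ?_) (ae_iff.1 h)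
      show ¬ (ENNReal.ofReal (1 / ‖gradient w x‖ + γ) = 0)
      rw [ENNReal.ofReal_eq_zero, not_le]
      have := D.γ_pos
      positivity
    have hopen := hO.inter (D.isOpen_band_min t)
    exact (hopen.measure_pos volume (mem_closure_iff.1 hx O hO hxO)).ne' hpos

lemma mem_aggregate_iff {x : Sp d} {t : ℝ≥0} :
    x ∈ aggregate Q L t ↔ x ∈ Γ ∨ x ∈ closure (band w (min t T)) := by
  rw [aggregate, D.support_occupation A F hL]
  rfl

lemma le_arrivalTime (x : Sp d) : ENNReal.ofReal (w x) ≤ arrivalTime Q L x := by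
  refine le_iInf₂ fun t ht => ?_
  rcases (D.mem_aggregate_iff A F hL).1 ht with h | h
  · rw [D.w_eq_zero_iff.2 (subset_closure h), ENNReal.ofReal_zero]
    exact bot_le
  · rw [← ENNReal.ofReal_coe_nnreal]
    exact ENNReal.ofReal_le_ofReal ((D.w_le_of_mem_closure (min_le_right _ _) h).trans (min_le_left _ _))

/-- The arrival time is the level. -/
theorem arrivalTime_eq {x : Sp d} (hx : x ∈ closure Γ ∨ x ∈ closure (band w T)) :
    arrivalTime Q L x = ENNReal.ofReal (w x) := by
  refine le_antisymm ?_ (D.le_arrivalTime A F hL x)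
  by_cases hΓ : x ∈ Γ
  · have h0 : x ∈ aggregate Q L 0 := (D.mem_aggregate_iff A F hL).2 (Or.inl hΓ)
    exact (show arrivalTime Q L x ≤ ((0 : ℝ≥0) : ℝ≥0∞) from arrivalTime_le h0).trans (by simp)
  · have hxb : x ∈ closure (band w T) := by
      rcases hx with h | h
      · have hf : x ∈ frontier Γ := ⟨h, fun hi => hΓ (interior_subset hi)⟩
        exact D.frontier_subset_closure_band A hf
      · exact h
    -- The point need not belong to the aggregate at its own level, for instance when the inner band
    -- is empty at t = 0; it belongs to all later ones.
    refine ENNReal.le_of_forall_pos_le_add fun ε hε _ => ?_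
    have ht : w x < ((w x).toNNReal + ε : ℝ≥0) := by
      rw [NNReal.coe_add, Real.coe_toNNReal _ (D.w_nonneg x)]
      linarith [NNReal.coe_pos.2 hε]
    have h1 : x ∈ aggregate Q L ((w x).toNNReal + ε) :=
      (D.mem_aggregate_iff A F hL).2 (Or.inr (D.mem_closure_band_of_lt hxb ht))
    have h2 : arrivalTime Q L x ≤ (((w x).toNNReal + ε : ℝ≥0) : ℝ≥0∞) := arrivalTime_le h1
    rwa [ENNReal.coe_add] at h2

lemma arrivalTime_lt_top_iff {x : Sp d} :
    arrivalTime Q L x < ⊤ ↔ x ∈ closure Γ ∨ x ∈ closure (band w T) := by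
  refine ⟨fun h => ?_, fun h => ?_⟩
  · rw [arrivalTime, iInf_lt_iff] at h
    obtain ⟨t, ht⟩ := h
    rw [iInf_lt_iff] at ht
    obtain ⟨ht, -⟩ := ht
    exact ((D.mem_aggregate_iff A F hL).1 ht).imp (fun h => subset_closure h)
      fun h => closure_mono (band_mono w (min_le_right _ _)) h
  · rw [D.arrivalTime_eq A F hL h]
    exact ENNReal.ofReal_lt_top

lemma reached_eq : reached Q L = closure (band w T) \ closure Γ := by
  ext x
  simp only [reached, Set.mem_sdiff, mem_ofPred_eq, D.arrivalTime_lt_top_iff A F hL]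
  tauto

lemma measurableSet_reached : MeasurableSet (reached Q L) := by
  rw [D.reached_eq A F hL]
  exact isClosed_closure.measurableSet.diff isClosed_closure.measurableSet

lemma reached_ae_eq_band : reached Q L =ᵐ[volume] band w T := by
  rw [D.reached_eq A F hL]
  filter_upwards [D.ae_mem_closure_band_iff] with x hx
  refine propext ⟨fun h => hx.1 h.1, fun h => ⟨subset_closure h, (D.mem_band_iff.1 h).1⟩⟩

lemma mem_reached_iff {x : Sp d} :
    x ∈ reached Q L ↔ x ∈ closure (band w T) ∧ x ∉ closure Γ := by
  rw [D.reached_eq A F hL]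
  rfl

lemma arrivalTime_le_iff {x : Sp d} {t : ℝ} (ht : t ∈ Ioo 0 T) :
    arrivalTime Q L x ≤ ENNReal.ofReal t ↔ w x ≤ t := by
  refine ⟨fun h => ?_, fun h => ?_⟩
  · exact (ENNReal.ofReal_le_ofReal_iff ht.1.le).1 ((D.le_arrivalTime A F hL x).trans h)
  · rw [D.arrivalTime_eq A F hL]
    · exact ENNReal.ofReal_le_ofReal h
    · by_cases h0 : x ∈ closure Γ
      · exact Or.inl h0
      · exact Or.inr (subset_closure (D.mem_band_iff.2 ⟨h0, h.trans_lt ht.2⟩))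

end

end ClassicalData

end Cascade

namespace Cascade
variable {d : ℕ} {γ T κ : ℝ} {Γ : Set (Sp d)} {V₀ w u L : Sp d → ℝ}

/-! ### Optimality of the flow lines -/

lemma Path.dist_pos_le (y : Path Γ) (r s : ℝ) : dist (y.pos r) (y.pos s) ≤ |r - s| := by
  refine (y.lipschitz.dist_le_mul _ _).trans ?_
  rw [NNReal.coe_one, one_mul, NNReal.dist_eq, Real.coe_toNNReal', Real.coe_toNNReal']
  exact abs_max_sub_max_le_abs _ _ _

namespace ClassicalData

variable (D : ClassicalData d γ T Γ V₀ w u) {Y : Sp d → ℝ → Sp d} {ρ : ℝ → Sp d → ℝ}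
  {π : Sp d → Sp d} (A : IsAscentFlow Γ T w Y ρ π)
  {N : Measure (Sp d)} {m : Measure (Sp d × ℝ × ℝ)} {Ψ : ℝ × Sp d → Path Γ}
  {Q : ProbabilityMeasure (Path Γ × ℝ≥0)} (F : IsFlowLaw Γ γ T V₀ w u Y ρ π N m Ψ κ Q)
  (hL : IsCostField γ T w L)

include D

/-- Nothing is known about w in the unreached set beyond w ≥ T, hence the truncation. The function
is continuous on each of the three closed sets Γ̄, closed band and {w ≥ T}; the last one is closed
thanks to the absence of contact. -/
lemma continuous_min_level : Continuous fun x => min (w x) T := by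
  have h1 : ContinuousOn (fun x => min (w x) T) (closure Γ) := by
    refine continuousOn_const.congr (f := fun _ => (0 : ℝ)) fun x hx => ?_
    simp only
    rw [D.w_eq_zero_iff.2 hx, min_eq_left D.T_pos.le]
  have h2 : ContinuousOn (fun x => min (w x) T) (closure (band w T)) :=
    continuous_min.comp_continuousOn (D.continuousOn.prodMk continuousOn_const)
  have h3 : ContinuousOn (fun x => min (w x) T) {x | T ≤ w x} :=
    continuousOn_const.congr (f := fun _ => T) fun x hx => min_eq_right hx
  have hc : IsClosed {x | T ≤ w x} := by
    convert D.isOpen_lt_level.isClosed_compl using 1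
    ext x
    simp
  rw [← continuousOn_univ]
  refine ((h1.union_of_isClosed h2 isClosed_closure isClosed_closure).union_of_isClosed h3
    (isClosed_closure.union isClosed_closure) hc).mono fun x _ => ?_
  by_cases hx : x ∈ closure Γ
  · exact Or.inl (Or.inl hx)
  · rcases lt_or_ge (w x) T with h | h
    · exact Or.inl (Or.inr (subset_closure (D.mem_band_iff.2 ⟨hx, h⟩)))
    · exact Or.inr h

/-- Along a path in the band the level decreases at most by the integral of the speed. -/
lemma level_sub_le_integral (y : Path Γ) {p q s t : ℝ} (hst : s ≤ t) (hs : s ∈ Ioo p q)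
    (ht : t ∈ Ioo p q) (hb : ∀ r ∈ Ioo p q, y.pos r ∈ band w T) :
    w (y.pos s) - w (y.pos t) ≤ ∫ r in s..t, ‖gradient w (y.pos r)‖ := by
  have hsub : Icc s t ⊆ Ioo p q := fun r hr => ⟨hs.1.trans_le hr.1, hr.2.trans_lt ht.2⟩
  have hgc : ContinuousOn (fun r => ‖gradient w (y.pos r)‖) (Ioo p q) :=
    (D.continuousOn_gradient.comp y.continuous_pos.continuousOn hb).norm
  have hwc : ContinuousOn (fun r => w (y.pos r)) (Ioo p q) :=
    D.contDiffOn.continuousOn.comp y.continuous_pos.continuousOn hb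
  have hii : ∀ r ∈ Icc s t, IntervalIntegrable (fun r => ‖gradient w (y.pos r)‖) volume s r :=
    fun r hr => (hgc.mono ((uIcc_of_le hr.1).subset.trans
      ((Icc_subset_Icc_right hr.2).trans hsub))).intervalIntegrable
  have hder : ∀ r ∈ Icc s t, HasDerivAt (fun r => ∫ x in s..r, ‖gradient w (y.pos x)‖)
      ‖gradient w (y.pos r)‖ r := fun r hr =>
    intervalIntegral.integral_hasDerivAt_right (hii r hr)
      (hgc.stronglyMeasurableAtFilter isOpen_Ioo _ (hsub hr))
      (hgc.continuousAt (isOpen_Ioo.mem_nhds (hsub hr)))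
  -- A path is merely Lipschitz and w along it need not be differentiable; an estimate of the right
  -- slopes at every time is enough.
  refine image_le_of_liminf_slope_right_le_deriv_boundary (a := s) (b := t)
    (f := fun r => w (y.pos s) - w (y.pos r))
    (B := fun r => ∫ x in s..r, ‖gradient w (y.pos x)‖)
    (B' := fun r => ‖gradient w (y.pos r)‖) (continuousOn_const.sub (hwc.mono hsub)) (by simp)
    (fun r hr => (hder r hr).continuousAt.continuousWithinAt)
    (fun r hr => (hder r (Ico_subset_Icc_self hr)).hasDerivWithinAt) (fun r hr c hc => ?_)
    ⟨hst, le_rfl⟩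
  have hr' := hsub (Ico_subset_Icc_self hr)
  have hfd := D.hasFDerivAt_w (hb r hr')
  have hε : 0 < (c - ‖gradient w (y.pos r)‖) / 2 := by linarith
  have h1 := (hasFDerivAt_iff_isLittleO_nhds_zero.1 hfd).def hε
  have h2 : Tendsto (fun q => y.pos q - y.pos r) (𝓝[>] r) (𝓝 0) := by
    have := ((y.continuous_pos.tendsto r).sub_const (y.pos r)).mono_left
      (nhdsWithin_le_nhds (s := Ioi r))
    rwa [sub_self] at this
  refine (Filter.Eventually.and (h2.eventually h1) self_mem_nhdsWithin).frequently.mono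
    fun q ⟨hq, hqr⟩ => ?_
  have hqr' : 0 < q - r := sub_pos.2 hqr
  rw [slope_def_field, div_lt_iff₀ hqr']
  rw [add_sub_cancel, Real.norm_eq_abs] at hq
  have h3 : ‖y.pos q - y.pos r‖ ≤ q - r := by
    rw [← dist_eq_norm, ← abs_of_pos hqr']
    exact y.dist_pos_le q r
  have h4 : |fderiv ℝ w (y.pos r) (y.pos q - y.pos r)| ≤ ‖gradient w (y.pos r)‖ * ‖y.pos q - y.pos r‖ := by
    rw [← inner_gradient]
    exact abs_real_inner_le_norm _ _
  have h5 := (abs_le.1 hq).1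
  have h6 := (abs_le.1 h4).1
  have h7 : ‖gradient w (y.pos r)‖ * ‖y.pos q - y.pos r‖ ≤ ‖gradient w (y.pos r)‖ * (q - r) :=
    mul_le_mul_of_nonneg_left h3 (norm_nonneg _)
  have h8 : (c - ‖gradient w (y.pos r)‖) / 2 * ‖y.pos q - y.pos r‖
      ≤ (c - ‖gradient w (y.pos r)‖) / 2 * (q - r) := mul_le_mul_of_nonneg_left h3 hε.le
  have h9 : 0 < (c - ‖gradient w (y.pos r)‖) / 2 * (q - r) := mul_pos hε hqr'
  nlinarith

include hL

/-- Every path pays at least the level of its starting point. -/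
theorem min_level_le_cost (y : Path Γ) :
    ENNReal.ofReal (min (w (y.pos 0)) T) ≤ cost L y 0 := by
  set f : ℝ → ℝ := fun r => min (w (y.pos r)) T with hf
  have hfc : Continuous f := D.continuous_min_level.comp y.continuous_pos
  obtain ⟨θ, hθ⟩ : ∃ θ : ℝ, (y.hit : ℝ) = θ := ⟨_, rfl⟩
  have hθ0 : 0 ≤ θ := hθ ▸ NNReal.coe_nonneg _
  have hfθ : f θ = 0 := by
    simp only [hf, ← hθ, Path.pos, Real.toNNReal_coe]
    rw [D.w_eq_zero_iff.2 y.hit_mem, min_eq_left D.T_pos.le]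
  rcases le_or_gt (f 0) 0 with h0 | h0
  · rw [ENNReal.ofReal_of_nonpos h0]; exact bot_le
  -- p is the last time at which the truncated level is at least its initial value. Afterwards,
  -- until the hitting time, the level is positive and below T, so the path is in the band and pays
  -- for its whole descent. Whatever happens before p, excursions into the unreached set included,
  -- has nonnegative cost and is dropped.
  have hcompact : IsCompact (Icc 0 θ ∩ {r | f 0 ≤ f r}) :=
    isCompact_Icc.inter_right (isClosed_le continuous_const hfc)
  obtain ⟨p, ⟨hp1, hp2⟩, hpmax⟩ := hcompact.exists_isGreatest ⟨0, ⟨le_rfl, hθ0⟩, le_refl (f 0)⟩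
  have hpθ : p < θ := lt_of_le_of_ne hp1.2 fun h => by
    rw [mem_ofPred_eq, h, hfθ] at hp2
    linarith
  have hb : ∀ r ∈ Ioo p θ, y.pos r ∈ band w T := by
    intro r hr
    have hr0 : 0 ≤ r := hp1.1.trans hr.1.le
    rw [D.mem_band_iff]
    constructor
    · refine y.notMem_of_lt_hit ?_
      rw [← NNReal.coe_lt_coe, Real.coe_toNNReal _ hr0, hθ]
      exact hr.2
    · have h1 : f r < f 0 := by
        by_contra h
        exact absurd (hpmax ⟨⟨hr0, hr.2.le⟩, not_lt.1 h⟩) (not_le.2 hr.1)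
      have h2 : f r < T := h1.trans_le (min_le_right _ _)
      exact (min_lt_iff.1 h2).resolve_right (lt_irrefl _)
  have key : ∀ s ∈ Ioo p θ, ∀ t ∈ Ioo p θ, s ≤ t → ENNReal.ofReal (f s - f t) ≤ cost L y 0 := by
    intro s hs t ht hst
    have h1 := D.level_sub_le_integral y hst hs ht hb
    have hgc : ContinuousOn (fun r => ‖gradient w (y.pos r)‖) (Ioo p θ) :=
      (D.continuousOn_gradient.comp y.continuous_pos.continuousOn hb).norm
    have hii : IntervalIntegrable (fun r => ‖gradient w (y.pos r)‖) volume s t :=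
      (hgc.mono ((uIcc_of_le hst).subset.trans
        fun r hr => ⟨hs.1.trans_le hr.1, hr.2.trans_lt ht.2⟩)).intervalIntegrable
    have e : ∀ r ∈ Ioo p θ, f r = w (y.pos r) := fun r hr => min_eq_left (hb r hr).2.le
    rw [e s hs, e t ht]
    refine (ENNReal.ofReal_le_ofReal h1).trans ?_
    rw [intervalIntegral.integral_of_le hst, ofReal_integral_eq_lintegral_ofReal
      ((intervalIntegrable_iff_integrableOn_Ioc_of_le hst).1 hii)
      (Eventually.of_forall fun r => norm_nonneg _)]
    refine le_trans (le_of_eq ?_) (lintegral_mono_set (s := Ioc s t) fun r hr =>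
      ⟨(by simpa using lt_of_le_of_lt hp1.1 (hs.1.trans hr.1)), hθ ▸ hr.2.trans ht.2.le⟩)
    refine setLIntegral_congr_fun measurableSet_Ioc fun r hr => ?_
    rw [hL.ofReal_posPart (hb r ⟨hs.1.trans hr.1, hr.2.trans_lt ht.2⟩), ofReal_norm]
  have key2 : ∀ s ∈ Ioo p θ, ENNReal.ofReal (f s) ≤ cost L y 0 := by
    intro s hs
    have h1 : Tendsto (fun t => ENNReal.ofReal (f s - f t)) (𝓝[<] θ) (𝓝 (ENNReal.ofReal (f s))) := by
      refine ENNReal.tendsto_ofReal ?_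
      have := (hfc.tendsto θ).const_sub (f s)
      rw [hfθ, sub_zero] at this
      exact this.mono_left nhdsWithin_le_nhds
    refine le_of_tendsto h1 ?_
    filter_upwards [Ioo_mem_nhdsLT hs.2] with t ht
    exact key s hs t ⟨hs.1.trans ht.1, ht.2⟩ ht.1.le
  have h2 : Tendsto (fun s => ENNReal.ofReal (f s)) (𝓝[>] p) (𝓝 (ENNReal.ofReal (f p))) :=
    ENNReal.tendsto_ofReal ((hfc.tendsto p).mono_left nhdsWithin_le_nhds)
  refine (ENNReal.ofReal_le_ofReal hp2).trans (le_of_tendsto h2 ?_)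
  filter_upwards [Ioo_mem_nhdsGT hpθ] with s hs using key2 s hs

include A F

/-- Calibration: the expected initial level depends only on the law of y_0. It bounds the cost of
every competitor from below and is the cost of the flow lines. -/
theorem optimal (Q' : ProbabilityMeasure (Path Γ × ℝ≥0)) (h : startLaw Q' = startLaw Q) :
    ∫⁻ p, cost L p.1 0 ∂(Q : Measure (Path Γ × ℝ≥0)) ≤
      ∫⁻ p, cost L p.1 0 ∂(Q' : Measure (Path Γ × ℝ≥0)) := by
  have hm0 : Measurable fun p : Path Γ × ℝ≥0 => p.1.toFun 0 :=
    (Path.measurable_apply 0).comp measurable_fst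
  have hw : Measurable fun x => ENNReal.ofReal (min (w x) T) :=
    (D.measw.min measurable_const).ennreal_ofReal
  have e : ∀ R : ProbabilityMeasure (Path Γ × ℝ≥0),
      ∫⁻ p, ENNReal.ofReal (min (w (p.1.toFun 0)) T) ∂(R : Measure (Path Γ × ℝ≥0))
        = ∫⁻ x, ENNReal.ofReal (min (w x) T) ∂startLaw R := fun R => (lintegral_map hw hm0).symm
  calc ∫⁻ p, cost L p.1 0 ∂(Q : Measure (Path Γ × ℝ≥0))
      = ∫⁻ p, ENNReal.ofReal (min (w (p.1.toFun 0)) T) ∂(Q : Measure (Path Γ × ℝ≥0)) := by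
        refine lintegral_congr_ae (ae_law F (measurableSet_eq_fun ((measurable_cost hL).comp
          (measurable_fst.prodMk measurable_const)) (hw.comp hm0)) fun z hz a ha b hb hba => ?_)
        have ma := D.clock_mem_Icc A hz ha
        show cost L (flowPair Ψ (z, a, b)).1 0
          = ENNReal.ofReal (min (w ((flowPair Ψ (z, a, b)).1.toFun 0)) T)
        rw [D.cost_flowPair A hL F hz ha b (by simpa using ma.1), flowPair,
          F.path_apply a ha z hz, NNReal.coe_zero, sub_zero, max_eq_left ma.1,
          A.w_curve z hz a ha, min_eq_left ha.2]
    _ = ∫⁻ p, ENNReal.ofReal (min (w (p.1.toFun 0)) T) ∂(Q' : Measure (Path Γ × ℝ≥0)) := by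
        rw [e, e, h]
    _ ≤ _ := lintegral_mono fun p => by
        have := D.min_level_le_cost hL p.1
        rwa [Path.pos, Real.toNNReal_zero] at this

end ClassicalData

end Cascade

namespace Cascade
variable {d : ℕ} {γ T κ : ℝ} {Γ : Set (Sp d)} {V₀ w u L : Sp d → ℝ}

/-! ### The excess energy loss -/

namespace ClassicalData

variable (D : ClassicalData d γ T Γ V₀ w u) {Y : Sp d → ℝ → Sp d} {ρ : ℝ → Sp d → ℝ}
  {π : Sp d → Sp d} (A : IsAscentFlow Γ T w Y ρ π)
  {N : Measure (Sp d)} {m : Measure (Sp d × ℝ × ℝ)} {Ψ : ℝ × Sp d → Path Γ}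
  {Q : ProbabilityMeasure (Path Γ × ℝ≥0)} (F : IsFlowLaw Γ γ T V₀ w u Y ρ π N m Ψ κ Q)
  (hL : IsCostField γ T w L)

section

include F

lemma measurable_start : Measurable fun q : Sp d × ℝ => (Ψ (q.2, q.1)).toFun 0 :=
  (Path.measurable_apply 0).comp (F.measurable_path.comp measurable_swap)

lemma ae_foot_top : ∀ᵐ z ∂N, z ∈ frontier Γ := by
  have hf1 : Measurable fun p : Sp d × ℝ × ℝ => (p.1, p.2.1) := by fun_prop
  have hTm : Measurable fun z : Sp d => (z, T) := by fun_prop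
  have hS : MeasurableSet {q : Sp d × ℝ | q.1 ∈ frontier Γ} :=
    isClosed_frontier.measurableSet.preimage measurable_fst
  have h : ∀ᵐ q ∂m.map (fun p : Sp d × ℝ × ℝ => (p.1, p.2.1)), q.1 ∈ frontier Γ := by
    rw [ae_map_iff hf1.aemeasurable hS]
    filter_upwards [F.plan.mem] with p hp using hp.1
  rw [F.plan.start, ae_add_measure_iff] at h
  exact ae_of_ae_map hTm.aemeasurable h.2

include D A

lemma start_apply {z : Sp d} (hz : z ∈ frontier Γ) {a : ℝ} (ha : a ∈ Icc 0 T) :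
    (Ψ (a, z)).toFun 0 = Y z (ρ a z) := by
  rw [F.path_apply a ha z hz, NNReal.coe_zero, sub_zero, max_eq_left (D.clock_mem_Icc A hz ha).1]

lemma start_foot {x : Sp d} (hx : x ∈ band w T) : (Ψ (w x, π x)).toFun 0 = x := by
  rw [D.start_apply A F (A.foot_mem x (Or.inr hx)) ⟨hx.1.le, hx.2.le⟩, A.flow_foot x (Or.inr hx)]

/-- The path at level w x over the foot of x starts at x, so the law of (foot, level) is carried
back to the original density on the band. -/
lemma map_levelLaw (f : Sp d → ℝ) : (levelLaw w π T f).map (fun q => (Ψ (q.2, q.1)).toFun 0)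
    = (volume.restrict (band w T)).withDensity fun x => ENNReal.ofReal (f x) := by
  rw [levelLaw, Measure.map_map (measurable_start F) (F.measurable_foot.prodMk D.measw)]
  conv_rhs => rw [← Measure.map_id (μ := (volume.restrict (band w T)).withDensity
    fun x => ENNReal.ofReal (f x))]
  refine Measure.map_congr ((withDensity_absolutelyContinuous _ _).ae_le ?_)
  filter_upwards [ae_restrict_mem (D.measurableSet_band T)] with x hx
  exact D.start_foot A F hx

theorem smul_startLaw : ENNReal.ofReal κ • startLaw Q
    = (volume.restrict (band w T)).withDensity (fun x => ENNReal.ofReal (1 + u x))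
      + N.map fun z => (Ψ (T, z)).toFun 0 := by
  have hm0 : Measurable fun p : Path Γ × ℝ≥0 => p.1.toFun 0 :=
    (Path.measurable_apply 0).comp measurable_fst
  have hH := measurable_start F
  have hTm : Measurable fun z : Sp d => (z, T) := by fun_prop
  rw [startLaw, ← Measure.map_smul, F.law, Measure.map_map hm0 (measurable_flowPair F.measurable_path)]
  have e := congrArg (Measure.map fun q : Sp d × ℝ => (Ψ (q.2, q.1)).toFun 0) F.plan.start
  rw [Measure.map_map hH (by fun_prop), Measure.map_add _ _ hH, D.map_levelLaw A F,
    Measure.map_map hH hTm] at e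
  exact e

/-- At its killing time a path sits where the path from the killing level over the same foot would
start. One map from (foot, level) to points thus serves starts and deaths. -/
theorem smul_killLaw : ENNReal.ofReal κ • killLaw Q
    = (volume.restrict (band w T)).withDensity (fun x => ENNReal.ofReal (-(1 + u x)))
      + boundaryFlux γ Γ V₀ := by
  have hH := measurable_start F
  have h0m : Measurable fun z : Sp d => (z, (0 : ℝ)) := by fun_prop
  rw [killLaw, ← Measure.map_smul, F.law, Measure.map_map Path.measurable_uncurry
    (measurable_flowPair F.measurable_path)]
  have e := congrArg (Measure.map fun q : Sp d × ℝ => (Ψ (q.2, q.1)).toFun 0) F.plan.kill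
  rw [Measure.map_map hH (by fun_prop), Measure.map_add _ _ hH, D.map_levelLaw A F,
    Measure.map_map hH h0m] at e
  have e2 : (boundaryFlux γ Γ V₀).map ((fun q : Sp d × ℝ => (Ψ (q.2, q.1)).toFun 0) ∘
      fun z => (z, 0)) = boundaryFlux γ Γ V₀ := by
    conv_rhs => rw [← Measure.map_id (μ := boundaryFlux γ Γ V₀)]
    refine Measure.map_congr ((withDensity_absolutelyContinuous _ _).ae_le ?_)
    filter_upwards [ae_restrict_mem isClosed_frontier.measurableSet] with z hz
    rw [Function.comp_apply, D.start_apply A F hz ⟨le_rfl, D.T_pos.le⟩, A.clock_zero z hz,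
      A.curve_zero z hz]
    rfl
  rw [← e2, ← e]
  refine Measure.map_congr ?_
  filter_upwards [F.plan.mem] with p ⟨hz, ha, hb, hba⟩
  have ha' := Ioc_subset_Icc_self ha
  have hb' := Ico_subset_Icc_self hb
  obtain ⟨z, a, b⟩ := p
  simp only [Function.comp_apply]
  rw [D.start_apply A F hz hb', flowPair, F.path_apply a ha' z hz]
  have h := flowPair_snd A F hz ha' hb' hba
  rw [flowPair] at h
  simp only at h ⊢
  rw [h, sub_sub_cancel, max_eq_left (D.clock_mem_Icc A hz hb').1]

/-- The paths which are never killed arrive at the boundary of the initial domain with the law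
prescribed by the boundary flux. -/
theorem smul_map_terminal : ENNReal.ofReal κ •
    ((Q : Measure (Path Γ × ℝ≥0)).restrict {p | p.2 = p.1.hit}).map (fun p => p.1.toFun p.1.hit)
      = boundaryFlux γ Γ V₀ := by
  have hfp := measurable_flowPair F.measurable_path
  have hms : MeasurableSet {p : Path Γ × ℝ≥0 | p.2 = p.1.hit} :=
    measurableSet_eq_fun measurable_snd (Path.measurable_hit.comp measurable_fst)
  have hmt : Measurable fun p : Path Γ × ℝ≥0 => p.1.toFun p.1.hit :=
    Path.measurable_uncurry.comp (measurable_fst.prodMk (Path.measurable_hit.comp measurable_fst))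
  have hf2 : Measurable fun p : Sp d × ℝ × ℝ => (p.1, p.2.2) := by fun_prop
  have h0m : Measurable fun z : Sp d => (z, (0 : ℝ)) := by fun_prop
  have h0s : MeasurableSet {q : Sp d × ℝ | q.2 = 0} :=
    measurable_snd (measurableSet_singleton (0 : ℝ))
  rw [← Measure.map_smul, ← Measure.restrict_smul, F.law]
  ext B hB
  -- β = θ means that the killing level is zero. Deaths inside the band have positive level, so only
  -- the boundary flux is left.
  have e := congrArg (fun μ : Measure (Sp d × ℝ) => μ ({q | q.2 = 0} ∩ Prod.fst ⁻¹' B)) F.plan.kill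
  rw [Measure.map_apply hf2 (h0s.inter (measurable_fst hB)), Measure.add_apply,
    Measure.map_apply h0m (h0s.inter (measurable_fst hB))] at e
  have e0 : levelLaw w π T (fun x => -(1 + u x)) ({q | q.2 = 0} ∩ Prod.fst ⁻¹' B) = 0 := by
    have h1 := ae_levelLaw (T := T) (f := fun x => -(1 + u x)) (p := fun q => q.2 ≠ 0)
      F.measurable_foot D.measw (D.measurableSet_band T) h0s.compl fun x hx => hx.1.ne'
    have h2 : {q : Sp d × ℝ | q.2 = 0} ∩ Prod.fst ⁻¹' B ⊆ {q | ¬ q.2 ≠ 0} :=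
      fun q hq => not_not.2 hq.1
    exact measure_mono_null h2 (ae_iff.1 h1)
  rw [e0, zero_add] at e
  have e1 : (fun z : Sp d => (z, (0 : ℝ))) ⁻¹' ({q | q.2 = 0} ∩ Prod.fst ⁻¹' B) = B := by
    ext z
    exact ⟨fun h => h.2, fun h => ⟨rfl, h⟩⟩
  rw [e1] at e
  rw [← e, Measure.map_apply hmt hB, Measure.restrict_apply (hmt hB),
    Measure.map_apply hfp ((hmt hB).inter hms)]
  refine measure_congr ?_
  filter_upwards [F.plan.mem] with p ⟨hz, ha, hb, hba⟩
  have ha' := Ioc_subset_Icc_self ha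
  have hb' := Ico_subset_Icc_self hb
  obtain ⟨z, a, b⟩ := p
  have h1 : (flowPair Ψ (z, a, b)).1.toFun (flowPair Ψ (z, a, b)).1.hit = z := by
    rw [flowPair, F.path_apply a ha' z hz, F.hit_path a ha' z hz, sub_self, max_self,
      A.curve_zero z hz]
  have h2 : (flowPair Ψ (z, a, b)).2 = (flowPair Ψ (z, a, b)).1.hit ↔ b = 0 := by
    rw [← NNReal.coe_inj, flowPair_snd A F hz ha' hb' hba,
      show ((flowPair Ψ (z, a, b)).1.hit : ℝ) = ρ a z from F.hit_path a ha' z hz, sub_eq_self]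
    conv_lhs => rw [← A.clock_zero z hz]
    exact (A.clock_strictMono z hz).injOn.eq_iff hb' ⟨le_rfl, D.T_pos.le⟩
  refine propext ⟨fun h => ⟨h2.1 h.2, ?_⟩, fun h => ⟨?_, h2.2 h.1⟩⟩
  · have h3 : (flowPair Ψ (z, a, b)).1.toFun (flowPair Ψ (z, a, b)).1.hit ∈ B := h.1
    rwa [h1] at h3
  · show (flowPair Ψ (z, a, b)).1.toFun (flowPair Ψ (z, a, b)).1.hit ∈ B
    rw [h1]
    exact h.2

/-- All starting levels are positive, so the first term of the excess vanishes. -/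
lemma measure_hit_eq_zero : (Q : Measure (Path Γ × ℝ≥0)) {p | p.1.hit = 0} = 0 := by
  have hms : MeasurableSet {p : Path Γ × ℝ≥0 | p.1.hit = 0} :=
    (Path.measurable_hit.comp measurable_fst) (measurableSet_singleton 0)
  have e := congrArg (fun μ : Measure (Path Γ × ℝ≥0) => μ {p | p.1.hit = 0}) F.law
  rw [Measure.map_apply (measurable_flowPair F.measurable_path) hms, Measure.smul_apply,
    smul_eq_mul] at e
  have h : ∀ᵐ p ∂m, ¬ p ∈ flowPair Ψ ⁻¹' {p | p.1.hit = 0} := by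
    filter_upwards [F.plan.mem] with p ⟨hz, ha, _, _⟩ h
    obtain ⟨z, a, b⟩ := p
    have h1 := F.hit_path a (Ioc_subset_Icc_self ha) z hz
    have h2 : (Ψ (a, z)).hit = 0 := h
    rw [h2, NNReal.coe_zero, ← A.clock_zero z hz] at h1
    exact ha.1.ne ((A.clock_strictMono z hz).injOn ⟨le_rfl, D.T_pos.le⟩
      (Ioc_subset_Icc_self ha) h1)
  rw [measure_eq_zero_iff_ae_notMem.2 h, mul_eq_zero] at e
  exact e.resolve_left (by simpa using F.kappa_pos)

lemma ae_start_top : ∀ᵐ z ∂N, w ((Ψ (T, z)).toFun 0) = T ∧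
    (Ψ (T, z)).toFun 0 ∈ closure (band w T) := by
  filter_upwards [ae_foot_top F] with z hz
  have hT : T ∈ Icc 0 T := ⟨D.T_pos.le, le_rfl⟩
  rw [D.start_apply A F hz hT]
  exact ⟨A.w_curve z hz T hT, A.curve_mem_closure z hz _ (D.clock_mem_Icc A hz hT)⟩

include hL

/-- The excess is the law of the arrival points at the top level. -/
theorem excess_apply {B : Set (Sp d)} (hB : MeasurableSet B) :
    excess κ Q L u B = N.real ((fun z => (Ψ (T, z)).toFun 0) ⁻¹' B) := by
  have hR := D.measurableSet_reached A F hL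
  have hu := D.measu
  have := F.plan.finite_top
  have := D.isFiniteMeasure_boundaryFlux
  have iu := D.integrableOn_source A
  have hTm : Measurable fun z : Sp d => (Ψ (T, z)).toFun 0 :=
    (measurable_start F).comp (show Measurable fun z : Sp d => (z, T) by fun_prop)
  have hbR : band w T ⊆ reached Q L := fun x hx => by
    rw [D.mem_reached_iff A F hL]
    exact ⟨subset_closure hx, (D.mem_band_iff.1 hx).1⟩
  have hdens : ∀ f : Sp d → ℝ, Measurable f → ((volume.restrict (band w T)).withDensity
      fun x => ENNReal.ofReal (f x)) (B ∩ reached Q L) = ENNReal.ofReal 0 +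
        ∫⁻ x in B ∩ band w T, ENNReal.ofReal (f x) := by
    intro f hf
    rw [withDensity_apply _ (hB.inter hR), Measure.restrict_restrict (hB.inter hR), inter_assoc,
      inter_eq_self_of_subset_right hbR, ENNReal.ofReal_zero, zero_add]
  have hreal : ∀ f : Sp d → ℝ, Measurable f → (∫⁻ x in B ∩ band w T, ENNReal.ofReal (f x)).toReal
      = ∫ x in B ∩ band w T, max (f x) 0 := by
    intro f hf
    have hm : Measurable fun x => max (f x) 0 := hf.max measurable_const
    rw [integral_eq_lintegral_of_nonneg_ae (f := fun x => max (f x) 0)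
      (Eventually.of_forall fun x => le_max_right _ _) hm.aestronglyMeasurable]
    simp
  have hfin : ∀ f : Sp d → ℝ, IntegrableOn f (band w T) →
      ∫⁻ x in B ∩ band w T, ENNReal.ofReal (f x) ≠ ⊤ := fun f hf =>
    (hf.mono_set inter_subset_right).lintegral_lt_top.ne
  -- The mass started at level T lies entirely in the reached set, since T > 0 and flow lines end in
  -- the closed band.
  have e1 : κ * (startLaw Q).real (B ∩ reached Q L) = (∫ x in B ∩ band w T, max (1 + u x) 0)
      + N.real ((fun z => (Ψ (T, z)).toFun 0) ⁻¹' B) := by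
    have h := congrArg (fun μ : Measure (Sp d) => (μ (B ∩ reached Q L)).toReal) (D.smul_startLaw A F)
    simp only [Measure.smul_apply, Measure.add_apply, smul_eq_mul, ENNReal.toReal_mul] at h
    rw [ENNReal.toReal_ofReal F.kappa_pos.le, hdens _ (by fun_prop), ENNReal.ofReal_zero, zero_add,
      ENNReal.toReal_add (hfin _ iu) (by
        rw [Measure.map_apply hTm (hB.inter hR)]; exact measure_ne_top _ _),
      hreal _ (by fun_prop), Measure.map_apply hTm (hB.inter hR)] at h
    rw [measureReal_def, h, measureReal_def]
    congr 2
    refine measure_congr ?_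
    filter_upwards [D.ae_start_top A F] with z hz
    refine propext ⟨fun h => h.1, fun h => ⟨h, ?_⟩⟩
    show (Ψ (T, z)).toFun 0 ∈ reached Q L
    rw [D.mem_reached_iff A F hL, ← D.w_eq_zero_iff, hz.1]
    exact ⟨hz.2, D.T_pos.ne'⟩
  have e2 : κ * (killLaw Q).real (B ∩ reached Q L) = ∫ x in B ∩ band w T, max (-(1 + u x)) 0 := by
    have h := congrArg (fun μ : Measure (Sp d) => (μ (B ∩ reached Q L)).toReal) (D.smul_killLaw A F)
    simp only [Measure.smul_apply, Measure.add_apply, smul_eq_mul, ENNReal.toReal_mul] at h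
    -- Deaths on ∂Γ are not counted, because the reached set leaves out the closure of Γ. What
    -- remains is (1 + u)⁺ - (1 + u)⁻ - (1 + u) = 0 plus the mass from N.
    have h0 : boundaryFlux γ Γ V₀ (B ∩ reached Q L) = 0 := by
      refine (withDensity_absolutelyContinuous _ _) ?_
      rw [Measure.restrict_apply (hB.inter hR)]
      convert measure_empty (μ := (μHE[d - 1] : Measure (Sp d)))
      refine eq_empty_of_forall_notMem fun x hx => ?_
      exact ((D.mem_reached_iff A F hL).1 hx.1.2).2 (frontier_subset_closure hx.2)
    rw [ENNReal.toReal_ofReal F.kappa_pos.le, hdens _ (by fun_prop), ENNReal.ofReal_zero, zero_add,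
      h0, add_zero, hreal _ (by fun_prop)] at h
    exact h
  have e3 : ∫ x in B, (reached Q L).indicator (fun x => 1 + u x) x
      = ∫ x in B ∩ band w T, (1 + u x) := by
    rw [setIntegral_indicator hR]
    exact setIntegral_congr_set ((ae_eq_refl B).inter (D.reached_ae_eq_band A F hL))
  have hint : Integrable ((reached Q L).indicator fun x => 1 + u x) volume :=
    (integrable_indicator_iff hR).2 (iu.congr_set_ae (D.reached_ae_eq_band A F hL))
  rw [excess]
  simp only [sub_apply, add_apply, smul_apply, smul_eq_mul]
  rw [Measure.toSignedMeasure_apply_measurable hB, Measure.toSignedMeasure_apply_measurable hB,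
    Measure.toSignedMeasure_apply_measurable hB, withDensityᵥ_apply hint hB,
    Measure.restrict_eq_zero.2 (D.measure_hit_eq_zero A F), Measure.map_zero,
    measureReal_restrict_apply hB, measureReal_restrict_apply hB, e1, e2, e3, measureReal_zero_apply]
  have h4 : ∫ x in B ∩ band w T, (1 + u x) = (∫ x in B ∩ band w T, max (1 + u x) 0)
      - ∫ x in B ∩ band w T, max (-(1 + u x)) 0 := by
    have i := iu.mono_set (inter_subset_right (s := B))
    rw [← integral_sub i.pos_part i.neg_part]
    refine integral_congr_ae (Eventually.of_forall fun x => ?_)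
    simp only
    rcases le_total 0 (1 + u x) with h | h
    · rw [max_eq_left h, max_eq_right (by linarith)]; ring
    · rw [max_eq_right h, max_eq_left (by linarith)]; ring
  rw [h4]
  ring

theorem excess_nonneg : 0 ≤ excess κ Q L u := by
  rw [VectorMeasure.le_iff]
  intro B hB
  rw [D.excess_apply A F hL hB]
  exact measureReal_nonneg

theorem excess_sublevel {t : ℝ} (ht : t ∈ Ioo 0 T) :
    MeasurableSet {x | arrivalTime Q L x ≤ ENNReal.ofReal t} ∧
      excess κ Q L u {x | arrivalTime Q L x ≤ ENNReal.ofReal t} = 0 := by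
  have hset : {x | arrivalTime Q L x ≤ ENNReal.ofReal t} = {x | w x ≤ t} := by
    ext x
    exact D.arrivalTime_le_iff A F hL ht
  have hm : MeasurableSet {x | w x ≤ t} := measurableSet_le D.measw measurable_const
  rw [hset]
  refine ⟨hm, ?_⟩
  rw [D.excess_apply A F hL hm, measureReal_def]
  have h0 : N ((fun z => (Ψ (T, z)).toFun 0) ⁻¹' {x | w x ≤ t}) = 0 := by
    rw [measure_eq_zero_iff_ae_notMem]
    filter_upwards [D.ae_start_top A F] with z hz h
    have h1 : w ((Ψ (T, z)).toFun 0) ≤ t := h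
    rw [hz.1] at h1
    linarith [ht.2]
  rw [h0, ENNReal.toReal_zero]

end

include D in
/-- The conclusion for classical data. -/
theorem exists_equilibrium : ∃ (κ : ℝ) (Q : ProbabilityMeasure (Path Γ × ℝ≥0)) (L : Sp d → ℝ),
      IsEquilibrium Γ γ T κ Q L ∧
      (∀ x ∈ closure {x | w x < T}, arrivalTime Q L x = ENNReal.ofReal (w x)) ∧
      IntegrableOn (fun x => 1 + u x) (reached Q L) volume ∧
      0 ≤ excess κ Q L u ∧
      (∀ t ∈ Set.Ioo 0 T,
        MeasurableSet {x | arrivalTime Q L x ≤ ENNReal.ofReal t} ∧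
        excess κ Q L u {x | arrivalTime Q L x ≤ ENNReal.ofReal t} = 0) ∧
      ENNReal.ofReal κ •
          ((Q : Measure (Path Γ × ℝ≥0)).restrict {p | p.2 = p.1.hit}).map
            (fun p => p.1.toFun p.1.hit) =
        ((μHE[d - 1] : Measure (Sp d)).restrict (frontier Γ)).withDensity
          (fun x => ENNReal.ofReal (V₀ x + γ)) := by
  obtain ⟨L, hL⟩ := D.exists_costField
  obtain ⟨Y, ρ, π, N, m, Ψ, κ, Q, A, F⟩ := D.exists_flowLaw
  refine ⟨κ, Q, L, ⟨F.kappa_pos, fun x => ?_, hL.upperSemicontinuous, D.optimal A F hL,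
    D.ae_capped A hL F, D.ae_terminal A F, hL.locallyIntegrable,
    fun φ hφ hφs => D.fixedPoint A F hL hφ.continuous hφs,
    fun φ hφ _ => D.lintegral_negPart A hL F hφ.continuous.measurable⟩,
    fun x hx => D.arrivalTime_eq A F hL (D.mem_closure_lt_level hx),
    (D.integrableOn_source A).congr_set_ae (D.reached_ae_eq_band A F hL),
    D.excess_nonneg A F hL, fun t ht => D.excess_sublevel A F hL ht, D.smul_map_terminal A F⟩
  by_cases hx : x ∈ closure (band w T)
  · exact (hL.pos x hx).ne'
  · rw [hL.off x hx]
    have := D.γ_pos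
    exact (neg_neg_of_pos (by positivity)).ne

end ClassicalData

end Cascade

theorem proposition2p1 (d : ℕ) (hd : 1 ≤ d) (γ T : ℝ) (hγ : 0 < γ) (hT : 0 < T)
    (Γ : Set (Cascade.Sp d)) (hΓ : Cascade.perimeter Γ ≠ 0)
    (V₀ w u : Cascade.Sp d → ℝ)
    (hV₀_meas : Measurable V₀) (hw_meas : Measurable w) (hu_meas : Measurable u)
    (hV₀_nonneg : ∀ x, 0 ≤ V₀ x) (hw_nonneg : ∀ x, 0 ≤ w x)
    -- (i)
    (h_open : IsOpen (Cascade.band w T))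
    (h_C1 : ContDiffOn ℝ 1 w (Cascade.band w T))
    (h_cont : ContinuousOn w (closure (Cascade.band w T)))
    (h_zero : {x | w x = 0} = closure Γ)
    (hu_int : IntegrableOn u (Cascade.band w T) volume)
    (hV₀_bdd : ∃ C : ℝ, ∀ x, V₀ x ≤ C)
    (h_grad_lower : ∃ c : ℝ, 0 < c ∧ ∀ x ∈ Cascade.band w T, c ≤ ‖gradient w x‖)
    (h_grad_upper : ∀ R : ℝ, ∃ C : ℝ, ∀ x ∈ Cascade.band w T, ‖x‖ ≤ R → ‖gradient w x‖ ≤ C)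
    -- (ii)
    (hΓ_per : Cascade.HasFinitePerimeter Γ)
    (hΓ_bdry : frontier Γ = Cascade.essBoundary Γ)
    (h_per : ∀ t ∈ Set.Ioo 0 T, Cascade.HasFinitePerimeter {x | w x < t})
    (h_bdry : ∀ t ∈ Set.Ioo 0 T,
      frontier {x | w x < t} = Cascade.essBoundary {x | w x < t})
    (h_null : volume (frontier {x | w x < T}) = 0)
    -- (iii)
    (h_weak : Cascade.IsWeakSolution Γ γ T V₀ u w)
    -- (iv)
    (h_flow : Cascade.HasFlow Γ T w) :
    ∃ (κ : ℝ) (Q : ProbabilityMeasure (Cascade.Path Γ × ℝ≥0)) (L : Cascade.Sp d → ℝ),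
      Cascade.IsEquilibrium Γ γ T κ Q L ∧
      -- (1)
      (∀ x ∈ closure {x | w x < T}, Cascade.arrivalTime Q L x = ENNReal.ofReal (w x)) ∧
      -- (2)
      IntegrableOn (fun x => 1 + u x) (Cascade.reached Q L) volume ∧
      0 ≤ Cascade.excess κ Q L u ∧
      (∀ t ∈ Set.Ioo 0 T,
        MeasurableSet {x | Cascade.arrivalTime Q L x ≤ ENNReal.ofReal t} ∧
        Cascade.excess κ Q L u {x | Cascade.arrivalTime Q L x ≤ ENNReal.ofReal t} = 0) ∧
      -- (3)
      ENNReal.ofReal κ •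
          ((Q : Measure (Cascade.Path Γ × ℝ≥0)).restrict {p | p.2 = p.1.hit}).map
            (fun p => p.1.toFun p.1.hit) =
        ((μHE[d - 1] : Measure (Cascade.Sp d)).restrict (frontier Γ)).withDensity
          (fun x => ENNReal.ofReal (V₀ x + γ)) := by
  exact Cascade.ClassicalData.exists_equilibrium
    ⟨hd, hγ, hT, hΓ, hV₀_meas, hw_meas, hu_meas, hV₀_nonneg, hw_nonneg, h_open, h_C1, h_cont, h_zero,
      hu_int, hV₀_bdd, h_grad_lower, h_grad_upper, hΓ_per, hΓ_bdry, h_per, h_bdry, h_null, h_weak,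
      h_flow⟩
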